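/- **Theorem 5.8.** Write $Q=[0,1]^2$. For a twice continuously differentiable $f:Q\to\mathbb R$ let $\lambda_f(x)$ be the smaller eigenvalue of the Hessian $Hf(x)$, let $V_f(x)$ be a corresponding unit eigenvector, and let $$\mathcal L(f)=\{x\in Q:\ \lambda_f(x)<0,\ \langle\nabla f(x),v\rangle=0 \text{ for some eigenvector } v \text{ of } Hf(x) \text{ for } \lambda_f(x)\}$$ be the filament of $f$. $\mathrm{Haus}$ is the Hausdorff distance for the Euclidean metric (with $\mathrm{Haus}(A,\emptyset)=\infty$ for $A\ne\emptyset$ and $\mathrm{Haus}(\emptyset,\emptyset)=0$). *Model.* For each $n$ one observes $\mathbb D_n=\{(X_i,Y_i):i\le n\}$, $Y_i=f^*(X_i)+\varepsilon_i$, where the $\varepsilon_i$ are i.i.d. sub-Gaussian with mean $0$, variance $\sigma_0^2$ and a law that does not depend on $n$; $\mathrm P_0$ is the underlying probability. Let $\mathbb G$ be a distribution function on $Q$ with positive continuous density. Either the $X_i\in Q$ are fixed (they may depend on $n$) and $\sup_{x\in Q}|\mathbb G_n(x)-\mathbb G(x)|=o(1/(J_1J_2))$ for their empirical distribution function $\mathbb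 G_n$, or the $X_i$ are i.i.d. with distribution $\mathbb G$ and independent of the errors. *Prior and posterior.* Let $q_1,q_2\ge\alpha$ be fixed integers. For each $n$ and $k=1,2$ let $0=t_{k,0}<\dots<t_{k,N_k+1}=1$ be knots such that the ratio of the largest to the smallest of the spacings $t_{k,\ell+1}-t_{k,\ell}$, $0\le\ell\le N_k$, is bounded uniformly in $n$; let $J_k=q_k+N_k$ and let $b(x)=(B_{j_1}(x_1)B_{j_2}(x_2))_{j_k\le J_k}$ be the tensor products of the normalised B-splines of orders $q_1,q_2$ with these knots ($0$ and $1$ being repeated $q_k$ times). Let $B$ be the matrix with rows $b(X_i)^T$. The prior is $f=b^T\theta$, $\theta\mid\sigma^2\sim N(\theta_0,\sigma^2\Lambda_0)$, where $\theta_0$ has entries bounded uniformly in $n$ and $c_1I\le\Lambda_0\le c_2I$ with constants $0<c_1\le c_2<\infty$. The (empirical Bayes) posterior $\Pi(\cdot\mid\mathbb D_n)$ is the law of $f=b^T\theta$ for $$\theta\sim N\big((B^TB+\Lambda_0^{-1})^{-1}(B^TY+\Lambda_0^{-1}\theta_0),\ \hat\sigma_n^2(B^TB+\Lambda_0^{-1})^{-1}\big),\qquad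 \hat\sigma_n^2=n^{-1}(Y-B\theta_0)^T(B\Lambda_0B^T+I_n)^{-1}(Y-B\theta_0),$$ and $\tilde f=b^T(B^TB+\Lambda_0^{-1})^{-1}(B^TY+\Lambda_0^{-1}\theta_0)$ is the posterior mean. Put $\mathcal L=\mathcal L(f)$ for $f$ drawn from the posterior, $\tilde{\mathcal L}=\mathcal L(\tilde f)$, $\mathcal L^*=\mathcal L(f^*)$, $\lambda^*=\lambda_{f^*}$, $V^*=V_{f^*}$. *Assumptions.* There are $\delta,\eta,a^*,C_{\mathcal G}>0$ such that the following hold, where $\mathcal L^*\oplus\delta$ is the open $\delta$-neighbourhood of $\mathcal L^*$ and the sign of $V^*$ is chosen continuously on $(\mathcal L^*\oplus\delta)\cap Q$. For the integral curves $\Upsilon^*_{x_0}$, i.e. the solutions of $\frac{d}{dt}\Upsilon^*_{x_0}=V^*(\Upsilon^*_{x_0})$, $\Upsilon^*_{x_0}(0)=x_0$, let $\mathcal G=\{\Upsilon^*_{x_0}(t):x_0\in\mathcal L^*,|t|\le a^*\}$. It is assumed that $\mathcal G\subset Q$ and that for each $x_0\in\mathcal G$ there is $t^*_{x_0}\in[-a^*,a^*]$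 such that $\Upsilon^*_{x_0}$ is defined in $Q$ on $[t^*_{x_0}-a^*,t^*_{x_0}+a^*]$ and $t^*_{x_0}$ is the unique minimiser of $|t|$ among the $t$ in this interval with $\Upsilon^*_{x_0}(t)\in\mathcal L^*$. - (A1) $f^*$ belongs to the Hölder space $\mathcal H^\alpha(Q)$, $\alpha\ge4$. - (A2) For $x\in(\mathcal L^*\oplus\delta)\cap Q$, $Hf^*(x)$ has two distinct eigenvalues and $\lambda^*(x)\le-\eta$. - (A3) For $x\in(\mathcal L^*\oplus\delta)\cap Q$, $|\langle\nabla\langle\nabla f^*(x),V^*(x)\rangle,V^*(x)\rangle|\ge\eta$. - (A4) $\mathcal L^*$ is compact and $\mathcal L^*=\{\Upsilon^*_{x_0}(t^*_{x_0}):x_0\in\mathcal G\}$. - (A5) For all $x_0\in\mathcal G$ and all $u\ne s$ in $(t^*_{x_0}-a^*,t^*_{x_0}+a^*)$, $\big\|\frac{\Upsilon^*_{x_0}(u)-\Upsilon^*_{x_0}(s)}{u-s}\big\|\ge C_{\mathcal G}$. - (Nondegeneracy) There is no $x\in Q$ at which $\lambda^*(x)=0$ and $\langle\nabla f^*(x),v\rangle=0$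 for some eigenvector $v$ of $Hf^*(x)$ for the eigenvalue $\lambda^*(x)$. *Conclusion.* If $J_1\asymp J_2\asymp(n/\log n)^{1/(2(\alpha+1))}$, then for every sequence $M_n\to\infty$ $$\Pi\big(\mathrm{Haus}(\mathcal L,\mathcal L^*)>M_n(n/\log n)^{\frac{2-\alpha}{2(\alpha+1)}}\mid\mathbb D_n\big)\xrightarrow{\mathrm P_0}0,$$ $$\Pi\big(\mathrm{Haus}(\mathcal L,\tilde{\mathcal L})>M_n(n/\log n)^{\frac{2-\alpha}{2(\alpha+1)}}\mid\mathbb D_n\big)\xrightarrow{\mathrm P_0}0,$$ and there is a constant $C>0$ with $$\mathrm P_0\big(\mathrm{Haus}(\tilde{\mathcal L},\mathcal L^*)\le C\,(n/\log n)^{\frac{2-\alpha}{2(\alpha+1)}}\big)\to1 .$$ -/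

import Mathlib

open Filter MeasureTheory ProbabilityTheory Set
open scoped Topology ENNReal NNReal Asymptotics

noncomputable section

namespace FilamentPosterior

/-! ### Functions on the unit square: derivatives, Hölder classes, filaments -/

/-- The plane with its Euclidean norm. -/
abbrev Plane := EuclideanSpace ℝ (Fin 2)

/-- The closed unit square. -/
def unitSquare : Set Plane := {x | ∀ i, x i ∈ Icc (0 : ℝ) 1}

/-- The partial derivative in the `i`-th coordinate of a function on the unit square
(one-sided at the boundary; values outside the square are irrelevant). -/
def pderiv (i : Fin 2) (f : Plane → ℝ) : Plane → ℝ :=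
  fun x => fderivWithin ℝ f unitSquare x (EuclideanSpace.single i 1)

/-- The mixed partial derivative of order `(r₁, r₂)`. -/
def mixedDeriv (r₁ r₂ : ℕ) (f : Plane → ℝ) : Plane → ℝ :=
  (pderiv 0)^[r₁] ((pderiv 1)^[r₂] f)

/-- The largest integer strictly smaller than `α` (for `α > 0`). -/
def strictFloor (α : ℝ) : ℕ := ⌈α⌉₊ - 1

/-- Membership in the Hölder space of order `α > 0` on the unit square: with `m` the largest
integer strictly smaller than `α`, all partial derivatives of order at most `m` exist, are
continuous and bounded, and those of order `m` are Hölder continuous with exponent `α - m`. -/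
def IsHolder (α : ℝ) (f : Plane → ℝ) : Prop :=
  ContDiffOn ℝ (strictFloor α) f unitSquare ∧
  ∃ C : ℝ,
    (∀ r₁ r₂ : ℕ, r₁ + r₂ ≤ strictFloor α → ∀ x ∈ unitSquare, |mixedDeriv r₁ r₂ f x| ≤ C) ∧
    (∀ r₁ r₂ : ℕ, r₁ + r₂ = strictFloor α → ∀ x ∈ unitSquare, ∀ y ∈ unitSquare,
      |mixedDeriv r₁ r₂ f x - mixedDeriv r₁ r₂ f y| ≤ C * ‖x - y‖ ^ (α - strictFloor α))

/-- The gradient. -/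
def grad (f : Plane → ℝ) (x : Plane) : Plane := !₂[pderiv 0 f x, pderiv 1 f x]

/-- The Hessian matrix. -/
def hess (f : Plane → ℝ) (x : Plane) : Matrix (Fin 2) (Fin 2) ℝ :=
  Matrix.of fun i j => pderiv i (pderiv j f) x

/-- The quantity `√((f₁₁ - f₂₂)² + 4 f₁₂²)`: the difference of the two Hessian eigenvalues. -/
def eigGap (f : Plane → ℝ) (x : Plane) : ℝ :=
  √((hess f x 0 0 - hess f x 1 1) ^ 2 + 4 * hess f x 0 1 ^ 2)

/-- The smaller eigenvalue of the Hessian. -/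
def lamMin (f : Plane → ℝ) (x : Plane) : ℝ :=
  (hess f x 0 0 + hess f x 1 1 - eigGap f x) / 2

/-- `v` is an eigenvector of the Hessian of `f` at `x` for the smaller eigenvalue. -/
def IsMinEigenvector (f : Plane → ℝ) (x v : Plane) : Prop :=
  v ≠ 0 ∧ ∀ i, ∑ j, hess f x i j * v j = lamMin f x * v i

/-- The filament (ridge) of `f`. The condition does not depend on sign or length of `v`. -/
def filament (f : Plane → ℝ) : Set Plane :=
  {x | x ∈ unitSquare ∧ lamMin f x < 0 ∧ ∃ v, IsMinEigenvector f x v ∧ inner ℝ (grad f x) v = 0}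

/-- The part of the open `δ`-neighbourhood of the filament that lies in the unit square. -/
def filamentNhd (f : Plane → ℝ) (δ : ℝ) : Set Plane :=
  Metric.thickening δ (filament f) ∩ unitSquare

/-! ### Integral curves, hitting times and the assumptions on the true function -/

/-- `V` selects at each point of the square a unit eigenvector for the smaller eigenvalue of the
Hessian, the sign being chosen continuously on the set `D`. -/
structure IsEigenfield (f : Plane → ℝ) (D : Set Plane) (V : Plane → Plane) : Prop where
  eigenvector : ∀ x ∈ unitSquare, IsMinEigenvector f x (V x)
  norm_one : ∀ x ∈ unitSquare, ‖V x‖ = 1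
  continuousOn : ContinuousOn V D

/-- `γ` solves `dγ/dt = V(γ)`, `γ(0) = x₀` on the interval `I`, inside the unit square. -/
def IsIntegralCurveFrom (V : Plane → Plane) (x₀ : Plane) (γ : ℝ → Plane) (I : Set ℝ) : Prop :=
  γ 0 = x₀ ∧ ∀ t ∈ I, γ t ∈ unitSquare ∧ HasDerivWithinAt γ (V (γ t)) I t

/-- `t₀` is the unique minimiser of `|t|` among the times `t ∈ I` with `γ t` on the filament. -/
def IsUniqueHittingTime (f : Plane → ℝ) (γ : ℝ → Plane) (I : Set ℝ) (t₀ : ℝ) : Prop :=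
  t₀ ∈ I ∧ γ t₀ ∈ filament f ∧ ∀ t ∈ I, γ t ∈ filament f → t ≠ t₀ → |t₀| < |t|

/-- The set of starting points: all points reached from the filament within time `a` along the
integral curves, in either direction. -/
def startSet (f : Plane → ℝ) (Υ : Plane → ℝ → Plane) (a : ℝ) : Set Plane :=
  {x | ∃ x₀ ∈ filament f, ∃ t ∈ Icc (-a) a, x = Υ x₀ t}

/-- `Υ x₀` is the integral curve through `x₀` and `T x₀` its hitting time, for all starting points
`x₀`; the number `a > 0` is so small that the starting points lie in the unit square and the
hitting times are unique. The curve through `x₀` is considered for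
`T x₀ - a ≤ t ≤ T x₀ + a`. -/
structure IsCurveSystem (f : Plane → ℝ) (V : Plane → Plane) (a : ℝ)
    (Υ : Plane → ℝ → Plane) (T : Plane → ℝ) : Prop where
  pos : 0 < a
  curve_filament : ∀ x₀ ∈ filament f, IsIntegralCurveFrom V x₀ (Υ x₀) (Icc (-a) a)
  subset : startSet f Υ a ⊆ unitSquare
  abs_le : ∀ x₀ ∈ startSet f Υ a, |T x₀| ≤ a
  curve : ∀ x₀ ∈ startSet f Υ a,
    IsIntegralCurveFrom V x₀ (Υ x₀) (Icc (T x₀ - a) (T x₀ + a))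
  hitting : ∀ x₀ ∈ startSet f Υ a,
    IsUniqueHittingTime f (Υ x₀) (Icc (T x₀ - a) (T x₀ + a)) (T x₀)

/-- Near the filament the Hessian has two distinct eigenvalues, the smaller one at most
`-η`. -/
def HasSeparatedEigenvalues (f : Plane → ℝ) (δ η : ℝ) : Prop :=
  ∀ x ∈ filamentNhd f δ, 0 < eigGap f x ∧ lamMin f x ≤ -η

/-- The inequality `|⟨∇⟨∇f, V⟩, V⟩| ≥ η` holds near the filament. -/
def IsTransversal (f : Plane → ℝ) (V : Plane → Plane) (δ η : ℝ) : Prop :=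
  ∀ x ∈ filamentNhd f δ,
    η ≤ |inner ℝ (grad (fun y => inner ℝ (grad f y) (V y)) x) (V x)|

/-- The filament is compact and consists of the hitting points. -/
def IsCompactHittingSet (f : Plane → ℝ) (a : ℝ) (Υ : Plane → ℝ → Plane) (T : Plane → ℝ) : Prop :=
  IsCompact (filament f) ∧ filament f = {x | ∃ x₀ ∈ startSet f Υ a, x = Υ x₀ (T x₀)}

/-- The difference quotients of the integral curves are bounded away from zero. -/
def HasChordBound (f : Plane → ℝ) (a : ℝ) (Υ : Plane → ℝ → Plane) (T : Plane → ℝ) : Prop :=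
  ∃ C : ℝ, 0 < C ∧ ∀ x₀ ∈ startSet f Υ a,
    ∀ u ∈ Ioo (T x₀ - a) (T x₀ + a), ∀ s ∈ Ioo (T x₀ - a) (T x₀ + a), u ≠ s →
      C ≤ ‖(u - s)⁻¹ • (Υ x₀ u - Υ x₀ s)‖

/-- Nondegeneracy: at no point of the square do the smaller eigenvalue of the Hessian and the
derivative of `f` along a corresponding eigenvector vanish simultaneously. -/
def IsNondegenerate (f : Plane → ℝ) : Prop :=
  ∀ x ∈ unitSquare, ∀ v, IsMinEigenvector f x v → inner ℝ (grad f x) v = 0 → lamMin f x ≠ 0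

/-! ### Tensor product B-splines -/

/-- `t 0 < t 1 < … < t (N + 1)` are knots of `[0,1]` with `N` interior knots, and the ratio of
the largest to the smallest spacing is at most `C`. -/
structure IsKnots (N : ℕ) (t : ℕ → ℝ) (C : ℝ) : Prop where
  first : t 0 = 0
  last : t (N + 1) = 1
  lt_succ : ∀ l ≤ N, t l < t (l + 1)
  quasiUniform : ∀ l ≤ N, ∀ m ≤ N, t (l + 1) - t l ≤ C * (t (m + 1) - t m)

/-- The extended knot sequence for order `q`: the end points `0` and `1` are repeated `q` times. -/
def extKnots (q N : ℕ) (t : ℕ → ℝ) (m : ℕ) : ℝ := t (min (m - (q - 1)) (N + 1))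

/-- The normalised B-spline of degree `k` (order `k + 1`) with support `[τ j, τ (j + k + 1)]`, by
the Cox–de Boor recursion; terms with vanishing denominator are zero (as division by zero is).
Order one splines are right-continuous, except that the last one includes the end point `1`. -/
def bsplineDeg (τ : ℕ → ℝ) : ℕ → ℕ → ℝ → ℝ
  | 0, j, x => by
      classical
      exact if (τ j ≤ x ∧ x < τ (j + 1)) ∨ (x = 1 ∧ τ j < 1 ∧ τ (j + 1) = 1) then 1 else 0
  | k + 1, j, x =>
      (x - τ j) / (τ (j + k + 1) - τ j) * bsplineDeg τ k j x +
      (τ (j + k + 2) - x) / (τ (j + k + 2) - τ (j + 1)) * bsplineDeg τ k (j + 1) x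

/-- The `j`-th (counted from `0`) of the `q + N` B-splines of order `q`. -/
def bspline (q N : ℕ) (t : ℕ → ℝ) (j : ℕ) : ℝ → ℝ := bsplineDeg (extKnots q N t) (q - 1) j

/-- Data of a tensor product B-spline basis: orders, numbers of interior knots, and knots in the
two coordinates. -/
structure SplineSpace where
  q : Fin 2 → ℕ
  N : Fin 2 → ℕ
  t : Fin 2 → ℕ → ℝ

/-- The number `J_k = q_k + N_k` of basis functions in coordinate `k`. -/
def SplineSpace.J (S : SplineSpace) (k : Fin 2) : ℕ := S.q k + S.N k

/-- Index set of the `J₁ J₂` tensor product B-splines. -/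
abbrev SplineSpace.Idx (S : SplineSpace) : Type := Fin (S.J 0) × Fin (S.J 1)

/-- The tensor product basis functions. -/
def SplineSpace.basis (S : SplineSpace) (j : S.Idx) (x : Plane) : ℝ :=
  bspline (S.q 0) (S.N 0) (S.t 0) j.1 (x 0) * bspline (S.q 1) (S.N 1) (S.t 1) j.2 (x 1)

/-- The spline function with coefficient vector `θ`. -/
def SplineSpace.fn (S : SplineSpace) (θ : EuclideanSpace ℝ S.Idx) (x : Plane) : ℝ :=
  ∑ j, S.basis j x * θ j

/-- The design matrix `B`, with rows the basis functions at the design points. -/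
def SplineSpace.design (S : SplineSpace) {n : ℕ} (X : Fin n → Plane) :
    Matrix (Fin n) S.Idx ℝ :=
  Matrix.of fun i j => S.basis j (X i)

/-! ### The empirical Bayes posterior -/

/-- The matrix `(BᵀB + Λ₀⁻¹)⁻¹`. -/
def postCov (S : SplineSpace) (Λ₀ : Matrix S.Idx S.Idx ℝ) {n : ℕ} (X : Fin n → Plane) :
    Matrix S.Idx S.Idx ℝ :=
  ((S.design X).transpose * S.design X + Λ₀⁻¹)⁻¹

/-- The posterior mean `(BᵀB + Λ₀⁻¹)⁻¹ (BᵀY + Λ₀⁻¹ θ₀)` of the coefficient vector. -/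
def postMean (S : SplineSpace) (θ₀ : S.Idx → ℝ) (Λ₀ : Matrix S.Idx S.Idx ℝ) {n : ℕ}
    (X : Fin n → Plane) (Y : Fin n → ℝ) : EuclideanSpace ℝ S.Idx :=
  WithLp.toLp 2 ((postCov S Λ₀ X).mulVec
    ((S.design X).transpose.mulVec Y + Λ₀⁻¹.mulVec θ₀))

/-- The empirical Bayes variance `n⁻¹ (Y - Bθ₀)ᵀ (B Λ₀ Bᵀ + I)⁻¹ (Y - Bθ₀)`. -/
def sigmaHatSq (S : SplineSpace) (θ₀ : S.Idx → ℝ) (Λ₀ : Matrix S.Idx S.Idx ℝ) {n : ℕ}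
    (X : Fin n → Plane) (Y : Fin n → ℝ) : ℝ :=
  (n : ℝ)⁻¹ * dotProduct (Y - (S.design X).mulVec θ₀)
    ((S.design X * Λ₀ * (S.design X).transpose + 1)⁻¹.mulVec (Y - (S.design X).mulVec θ₀))

/-- The empirical Bayes posterior of the coefficient vector, for the model
`Y | θ, σ² ∼ N(Bθ, σ² I)` with prior `θ | σ² ∼ N(θ₀, σ² Λ₀)`: the conditional law
`N((BᵀB + Λ₀⁻¹)⁻¹ (BᵀY + Λ₀⁻¹ θ₀), σ² (BᵀB + Λ₀⁻¹)⁻¹)` at `σ² = σ̂²`.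
The posterior of the function `f` is the law of `S.fn θ`. -/
def posterior (S : SplineSpace) (θ₀ : S.Idx → ℝ) (Λ₀ : Matrix S.Idx S.Idx ℝ) {n : ℕ}
    (X : Fin n → Plane) (Y : Fin n → ℝ) : Measure (EuclideanSpace ℝ S.Idx) :=
  multivariateGaussian (postMean S θ₀ Λ₀ X Y) (sigmaHatSq S θ₀ Λ₀ X Y • postCov S Λ₀ X)

/-- The posterior mean of the function `f`. -/
def postMeanFn (S : SplineSpace) (θ₀ : S.Idx → ℝ) (Λ₀ : Matrix S.Idx S.Idx ℝ) {n : ℕ}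
    (X : Fin n → Plane) (Y : Fin n → ℝ) : Plane → ℝ :=
  S.fn (postMean S θ₀ Λ₀ X Y)

/-! ### Design points and errors -/

/-- `μ` is a probability measure on the unit square with a positive continuous density there. -/
def HasPositiveContinuousDensity (μ : Measure Plane) : Prop :=
  IsProbabilityMeasure μ ∧ ∃ g : Plane → ℝ, ContinuousOn g unitSquare ∧
    (∀ x ∈ unitSquare, 0 < g x) ∧
    μ = (volume.restrict unitSquare).withDensity fun x => ENNReal.ofReal (g x)

/-- The cumulative distribution function of a measure on the plane. -/
def planeCDF (μ : Measure Plane) (x : Plane) : ℝ := μ.real {y | ∀ i, y i ≤ x i}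

/-- The empirical distribution function of `n` points of the plane. -/
def empiricalCDF {n : ℕ} (X : Fin n → Plane) (x : Plane) : ℝ :=
  (Nat.card {i : Fin n // ∀ k, X i k ≤ x k} : ℝ) / n

/-- Fixed design: the points are non-random points of the square, and
`sup |𝔾ₙ - 𝔾| = o(1 / (J₁ J₂))`. -/
def IsFixedDesign {Ω : Type*} (μ : Measure Plane) (S : ℕ → SplineSpace)
    (X : (n : ℕ) → Fin n → Ω → Plane) : Prop :=
  ∃ x : (n : ℕ) → Fin n → Plane, (∀ n i ω, X n i ω = x n i) ∧ (∀ n i, x n i ∈ unitSquare) ∧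
    ∀ c : ℝ, 0 < c → ∀ᶠ n in atTop, ∀ y ∈ unitSquare,
      |empiricalCDF (x n) y - planeCDF μ y| ≤ c / ((S n).J 0 * (S n).J 1)

/-- Random design: for each sample size the points are independent with law `μ`, and independent
of the errors. -/
def IsRandomDesign {Ω : Type*} [MeasurableSpace Ω] (P : Measure Ω) (μ : Measure Plane)
    (X : (n : ℕ) → Fin n → Ω → Plane) (ε : (n : ℕ) → Fin n → Ω → ℝ) : Prop :=
  ∀ n, (∀ i, Measurable (X n i) ∧ P.map (X n i) = μ) ∧ iIndepFun (X n) P ∧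
    IndepFun (fun ω i => X n i ω) (fun ω i => ε n i ω) P

/-- The errors: for each sample size independent, all with the same sub-Gaussian law of mean zero
and variance `σ₀²`. -/
structure IsErrorArray {Ω : Type*} [MeasurableSpace Ω] (P : Measure Ω) (σ₀ : ℝ)
    (ε : (n : ℕ) → Fin n → Ω → ℝ) : Prop where
  measurable : ∀ n i, Measurable (ε n i)
  indep : ∀ n, iIndepFun (ε n) P
  identDistrib : ∀ n i m j, IdentDistrib (ε n i) (ε m j) P P
  mean_zero : ∀ n i, ∫ ω, ε n i ω ∂P = 0
  variance_eq : ∀ n i, variance (ε n i) P = σ₀ ^ 2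
  subgaussian : ∃ c : ℝ≥0, ∀ n i, HasSubgaussianMGF (ε n i) c P

/-- The observations `Y_i = f(X_i) + ε_i`. -/
def response {Ω : Type*} (f : Plane → ℝ) (X : (n : ℕ) → Fin n → Ω → Plane)
    (ε : (n : ℕ) → Fin n → Ω → ℝ) (n : ℕ) (ω : Ω) : Fin n → ℝ :=
  fun i => f (X n i ω) + ε n i ω

/-- The rate `(n / log n)^{(2 - α) / (2 (α + 1))}`. -/
def rate (α : ℝ) (n : ℕ) : ℝ :=
  ((n : ℝ) / Real.log n) ^ ((2 - α) / (2 * (α + 1)))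

end FilamentPosterior

end

/-!
The proof separates a deterministic statement about ridges from a statement about coefficients in
the sup-norm.

*Ridges are stable.* If `g` is within `ε` of `f` together with its derivatives of first and second
order, then the filaments of `f` and `g` have Hausdorff distance at most `C ε`
(`exists_hausdorffEDist_filament_le`). Near a point `x₀` of the filament, the derivative of `f` in the
direction of its eigenfield is strictly monotone along short segments in the direction `V x₀`
(`exists_monotone_slope`; such segments do not leave the square, because the integral curve through
`x₀` runs in the square in both directions). The corresponding derivative of `g` is within a multiple
of `ε` of it, up to a positive factor, if the eigenvectors of `g` are obtained from those of `f` by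
applying the larger eigenvalue minus the Hessian (`ridgeVec`). So on each segment the zeros of the
two functions are at a distance of the order `ε` (`exists_local_stability`). Away from the filament
of `f`, nondegeneracy and compactness exclude points of the filament of `g`
(`eventually_filament_subset`).

*Splines.* With mesh width `w ≍ 1 / J`, there are coefficients `ζ` with spline error of the order
`w ^ α`, and `w ^ (α - 2)` for the second derivatives (`SplineSpace.exists_approximation`): take the
coefficients of the Taylor polynomials of `f` at nearby points, and compare them by local stability of
the B-spline basis (`exists_coeff_bound`, `SplineSpace.exists_abs_coeff_le`). An error of order
`w ^ α` in the coefficients changes the second derivatives by `w ^ (α - 2)`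
(`SplineSpace.exists_isC2Close`), which is the rate `(n / log n) ^ ((2 - α) / (2 (α + 1)))`. So it
suffices that the posterior mean and a draw from the posterior are within a multiple of `w ^ α` of
`ζ` in the sup-norm (`exists_concentration`); all three conclusions follow, the second one by the
triangle inequality.

*Posterior mean.* Up to an event of small probability, each small part of a knot rectangle contains
of the order of `m = n w ^ 2` design points (`tendsto_measure_not_isRegularDesign`). For such a design,
least squares is stable in the sup-norm with a constant that does not depend on `n`: the normal
equations are tested with the solution times a slowly varying exponential weight
(`IsStableDesign.abs_le_of_weight`, `exists_abs_le_of_normal_equation`). So the approximation error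
contributes `w ^ α` to the error of the posterior mean, the prior at most `w⁻¹ / m` by a crude
estimate in the Euclidean norm (`exists_abs_posterior_mean_sub_le`), and the noise is a linear form
in the errors with squared norm of the order `1 / m` (`IsStableDesign.noise_bound`). By a union bound
over the coefficients (`measure_exists_noise_le`) the noise is of the order
`√(log n / m) ≍ w ^ α`, conditionally on the design. The coordinates of the Gaussian posterior have
variances at most of the order `1 / m` as well, as `σ̂²` is bounded, and the same union bound applies
(`posterior_exists_le`, `IsScale.eventually_tail_le`).
-/

noncomputable section

namespace FilamentPosterior

/-! ### B-splines of one variable: the polynomial pieces -/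

open Polynomial in
theorem exists_derivative_bound_unit (d : ℕ) : ∃ M : ℝ, 0 < M ∧ ∀ p : ℝ[X], p.natDegree ≤ d →
    ∀ A : ℝ, (∀ x ∈ Icc (0 : ℝ) 1, |p.eval x| ≤ A) →
      ∀ x ∈ Icc (0 : ℝ) 1, |p.derivative.eval x| ≤ M * A := by
  classical
  set s : Finset ℕ := Finset.range (d + 1) with hs
  set v : ℕ → ℝ := fun i => (i : ℝ) / (d + 1) with hv
  have hinj : Set.InjOn v s := by
    intro i _ j _ hij
    have hd : (0 : ℝ) < d + 1 := by positivity
    simp only [hv] at hij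
    rw [div_left_inj' hd.ne'] at hij
    exact_mod_cast hij
  have hvmem : ∀ i ∈ s, v i ∈ Icc (0 : ℝ) 1 := by
    intro i hi
    have hd : (0 : ℝ) < d + 1 := by positivity
    have : (i : ℝ) ≤ d + 1 := by
      have := Finset.mem_range.1 hi
      exact_mod_cast this.le
    exact ⟨by positivity, by rw [hv]; exact (div_le_one hd).2 this⟩
  have hb : ∀ i, ∃ c : ℝ, 0 ≤ c ∧ ∀ x ∈ Icc (0 : ℝ) 1,
      |(derivative (Lagrange.basis s v i)).eval x| ≤ c := by
    intro i
    obtain ⟨c, hc⟩ := isCompact_Icc.exists_bound_of_continuousOn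
      (f := fun x : ℝ => (derivative (Lagrange.basis s v i)).eval x) (s := Icc (0 : ℝ) 1)
      (Polynomial.continuous _).continuousOn
    exact ⟨c, (norm_nonneg _).trans (hc 0 ⟨le_rfl, zero_le_one⟩), hc⟩
  choose c hc0 hc using hb
  refine ⟨∑ i ∈ s, c i + 1, add_pos_of_nonneg_of_pos (Finset.sum_nonneg fun i _ => hc0 i) one_pos,
    fun p hp A hA x hx => ?_⟩
  have hA0 : 0 ≤ A := (abs_nonneg _).trans (hA x hx)
  have hdeg : p.degree < s.card := by
    rw [hs, Finset.card_range]
    exact (degree_le_of_natDegree_le hp).trans_lt (by exact_mod_cast Nat.lt_succ_self d)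
  have hpe : p = Lagrange.interpolate s v fun i => p.eval (v i) :=
    Lagrange.eq_interpolate hinj hdeg
  have hde : p.derivative.eval x =
      ∑ i ∈ s, p.eval (v i) * (derivative (Lagrange.basis s v i)).eval x := by
    conv_lhs => rw [hpe]
    simp [Lagrange.interpolate_apply, eval_finsetSum]
  rw [hde]
  calc |∑ i ∈ s, p.eval (v i) * (derivative (Lagrange.basis s v i)).eval x|
      ≤ ∑ i ∈ s, A * c i := by
        refine (Finset.abs_sum_le_sum_abs _ _).trans (Finset.sum_le_sum fun i hi => ?_)
        rw [abs_mul]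
        exact mul_le_mul (hA _ (hvmem i hi)) (hc i x hx) (abs_nonneg _) hA0
    _ = (∑ i ∈ s, c i) * A := by rw [← Finset.mul_sum, mul_comm]
    _ ≤ (∑ i ∈ s, c i + 1) * A := by gcongr; linarith

open Polynomial in
/-- A Markov-type inequality: on an interval the derivative of a polynomial of bounded degree is
controlled by the polynomial itself and the length of the interval. The constant comes from
Lagrange interpolation at equidistant nodes and is not the optimal one. -/
theorem exists_derivative_bound (d : ℕ) : ∃ M : ℝ, 0 < M ∧ ∀ p : ℝ[X], p.natDegree ≤ d →
    ∀ a b A : ℝ, a < b → (∀ x ∈ Icc a b, |p.eval x| ≤ A) →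
      ∀ x ∈ Icc a b, |p.derivative.eval x| ≤ M / (b - a) * A := by
  obtain ⟨M, hM, h⟩ := exists_derivative_bound_unit d
  refine ⟨M, hM, fun p hp a b A hab hA x hx => ?_⟩
  have hba : 0 < b - a := sub_pos.2 hab
  set r : ℝ[X] := p.comp (C a + C (b - a) * X) with hr
  have hrdeg : r.natDegree ≤ d := by
    refine (natDegree_comp_le).trans ?_
    have : (C a + C (b - a) * X : ℝ[X]).natDegree ≤ 1 := by
      compute_degree
    calc _ ≤ p.natDegree * 1 := by gcongr
      _ ≤ d := by simpa using hp
  have hrA : ∀ y ∈ Icc (0 : ℝ) 1, |r.eval y| ≤ A := by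
    intro y hy
    have : r.eval y = p.eval (a + (b - a) * y) := by simp [hr]
    rw [this]
    refine hA _ ⟨by nlinarith [hy.1], by nlinarith [hy.2]⟩
  have hy : (x - a) / (b - a) ∈ Icc (0 : ℝ) 1 :=
    ⟨div_nonneg (by linarith [hx.1]) hba.le, (div_le_one hba).2 (by linarith [hx.2])⟩
  have := h r hrdeg A hrA _ hy
  have he : r.derivative.eval ((x - a) / (b - a)) = (b - a) * p.derivative.eval x := by
    have hx' : a + (b - a) * ((x - a) / (b - a)) = x := by field_simp; ring
    simp only [hr, derivative_comp, derivative_add, derivative_C, derivative_mul, derivative_X,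
      eval_mul, eval_comp, eval_add, eval_C, eval_X]
    rw [hx']; simp
  rw [he, abs_mul, abs_of_pos hba] at this
  rw [div_mul_eq_mul_div, le_div_iff₀ hba]
  linarith

section CellPoly

open Polynomial

/-- The polynomial that agrees with the B-spline of degree `k` and index `j` on the knot interval
`[τ μ, τ (μ + 1))`, by the Cox–de Boor recursion. -/
def cellPoly (τ : ℕ → ℝ) (μ : ℕ) : ℕ → ℕ → ℝ[X]
  | 0, j => if j = μ then 1 else 0
  | k + 1, j =>
      (X - C (τ j)) * (C (τ (j + k + 1) - τ j)⁻¹ * cellPoly τ μ k j) +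
      (C (τ (j + k + 2)) - X) * (C (τ (j + k + 2) - τ (j + 1))⁻¹ * cellPoly τ μ k (j + 1))

/-- The B-spline piece divided by the length of the support of the B-spline. -/
def cellQuot (τ : ℕ → ℝ) (μ k j : ℕ) : ℝ[X] :=
  C (τ (j + k + 1) - τ j)⁻¹ * cellPoly τ μ k j

theorem cellPoly_succ (τ : ℕ → ℝ) (μ k j : ℕ) :
    cellPoly τ μ (k + 1) j = (X - C (τ j)) * cellQuot τ μ k j +
      (C (τ (j + k + 2)) - X) * cellQuot τ μ k (j + 1) := by
  simp only [cellPoly, cellQuot]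
  rw [show j + 1 + k + 1 = j + k + 2 by ring]

theorem cellPoly_eq_zero (τ : ℕ → ℝ) (μ : ℕ) : ∀ k j : ℕ, ¬ (j ≤ μ ∧ μ ≤ j + k) →
    cellPoly τ μ k j = 0 := by
  intro k
  induction k with
  | zero =>
    intro j hj
    have : j ≠ μ := fun h => hj ⟨h.le, by omega⟩
    simp [cellPoly, this]
  | succ k ih =>
    intro j hj
    have h1 : ¬ (j ≤ μ ∧ μ ≤ j + k) := by omega
    have h2 : ¬ (j + 1 ≤ μ ∧ μ ≤ j + 1 + k) := by omega
    simp [cellPoly, ih j h1, ih (j + 1) h2]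

theorem cellQuot_eq_zero (τ : ℕ → ℝ) (μ k j : ℕ) (h : ¬ (j ≤ μ ∧ μ ≤ j + k)) :
    cellQuot τ μ k j = 0 := by
  rw [cellQuot, cellPoly_eq_zero τ μ k j h, mul_zero]

theorem natDegree_cellPoly_le (τ : ℕ → ℝ) (μ : ℕ) : ∀ k j, (cellPoly τ μ k j).natDegree ≤ k := by
  intro k
  induction k with
  | zero => intro j; simp only [cellPoly]; split_ifs <;> simp
  | succ k ih =>
    intro j
    have hq : ∀ j, (cellQuot τ μ k j).natDegree ≤ k := fun j =>
      (natDegree_C_mul_le _ _).trans (ih j)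
    rw [cellPoly_succ]
    refine natDegree_add_le_of_degree_le ?_ ?_
    · refine natDegree_mul_le.trans ?_
      have := hq j
      have h1 : (X - C (τ j) : ℝ[X]).natDegree ≤ 1 := by compute_degree
      omega
    · refine natDegree_mul_le.trans ?_
      have := hq (j + 1)
      have h1 : (C (τ (j + k + 2)) - X : ℝ[X]).natDegree ≤ 1 := by compute_degree
      omega

variable {τ : ℕ → ℝ} {μ : ℕ}

theorem knot_lt_of_active (hτ : Monotone τ) (hμ : τ μ < τ (μ + 1)) {k j : ℕ}
    (h : j ≤ μ ∧ μ ≤ j + k) : τ j < τ (j + k + 1) :=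
  (hτ h.1).trans_lt (hμ.trans_le (hτ (by omega)))

/-- Division by a knot difference is harmless: where the difference of the knots `a ≤ j` and
`b ≥ j + k + 1` vanishes, so does the B-spline piece. -/
theorem inv_mul_cellQuot (hτ : Monotone τ) (hμ : τ μ < τ (μ + 1)) {k j a b : ℕ}
    (ha : a ≤ j) (hb : j + k + 1 ≤ b) :
    C (τ b - τ a)⁻¹ * (C (τ b - τ a) * cellQuot τ μ k j) = cellQuot τ μ k j := by
  by_cases h : j ≤ μ ∧ μ ≤ j + k
  · have h1 := knot_lt_of_active hτ hμ h
    have h2 : τ b - τ a ≠ 0 := by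
      have := hτ ha
      have := hτ hb
      exact (by linarith : (0 : ℝ) < τ b - τ a).ne'
    rw [← mul_assoc, ← C_mul, inv_mul_cancel₀ h2, C_1, one_mul]
  · simp [cellQuot_eq_zero τ μ k j h]

theorem C_mul_cellQuot (hτ : Monotone τ) (hμ : τ μ < τ (μ + 1)) (k j : ℕ) :
    C (τ (j + k + 1) - τ j) * cellQuot τ μ k j = cellPoly τ μ k j := by
  by_cases h : j ≤ μ ∧ μ ≤ j + k
  · have h1 := knot_lt_of_active hτ hμ h
    rw [cellQuot, ← mul_assoc, ← C_mul, mul_inv_cancel₀ (sub_pos.2 h1).ne', C_1, one_mul]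
  · simp [cellQuot_eq_zero τ μ k j h, cellPoly_eq_zero τ μ k j h]

/-- The derivative of a B-spline is a difference of B-splines of one degree less. -/
theorem derivative_cellPoly (hτ : Monotone τ) (hμ : τ μ < τ (μ + 1)) : ∀ k j : ℕ,
    derivative (cellPoly τ μ (k + 1) j) =
      C ((k : ℝ) + 1) * (cellQuot τ μ k j - cellQuot τ μ k (j + 1)) := by
  intro k
  induction k with
  | zero =>
    intro j
    have h0 : ∀ j, derivative (cellQuot τ μ 0 j) = 0 := by
      intro j
      simp only [cellQuot, cellPoly]
      split_ifs <;> simp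
    rw [cellPoly_succ]
    simp only [derivative_add, derivative_mul, derivative_sub, derivative_X, derivative_C, h0]
    simp
    ring
  | succ k ih =>
    intro j
    have hd : ∀ j, derivative (cellQuot τ μ (k + 1) j) = C (τ (j + (k + 1) + 1) - τ j)⁻¹ *
        (C ((k : ℝ) + 1) * (cellQuot τ μ k j - cellQuot τ μ k (j + 1))) := by
      intro j
      rw [cellQuot, derivative_mul, derivative_C, ih]
      simp
    have e1 : (X - C (τ j)) * (C (τ (j + (k + 1) + 1) - τ j)⁻¹ *
        (cellQuot τ μ k j - cellQuot τ μ k (j + 1))) =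
        cellQuot τ μ (k + 1) j - cellQuot τ μ k (j + 1) := by
      have := inv_mul_cellQuot hτ hμ (k := k) (j := j + 1) (a := j) (b := j + (k + 1) + 1)
        (by omega) (by omega)
      rw [show cellQuot τ μ (k + 1) j = C (τ (j + (k + 1) + 1) - τ j)⁻¹ * cellPoly τ μ (k + 1) j
        from rfl, cellPoly_succ]
      rw [show j + k + 2 = j + (k + 1) + 1 by ring]
      simp only [C_sub] at this
      linear_combination -this
    have e2 : (C (τ (j + (k + 1) + 2)) - X) * (C (τ (j + 1 + (k + 1) + 1) - τ (j + 1))⁻¹ *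
        (cellQuot τ μ k (j + 1) - cellQuot τ μ k (j + 1 + 1))) =
        cellQuot τ μ k (j + 1) - cellQuot τ μ (k + 1) (j + 1) := by
      have := inv_mul_cellQuot hτ hμ (k := k) (j := j + 1) (a := j + 1) (b := j + 1 + (k + 1) + 1)
        (by omega) (by omega)
      rw [show cellQuot τ μ (k + 1) (j + 1) = C (τ (j + 1 + (k + 1) + 1) - τ (j + 1))⁻¹ *
        cellPoly τ μ (k + 1) (j + 1) from rfl, cellPoly_succ]
      rw [show j + (k + 1) + 2 = j + 1 + (k + 1) + 1 by ring,
        show j + 1 + k + 2 = j + 1 + (k + 1) + 1 by ring]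
      simp only [C_sub] at this
      linear_combination this
    rw [cellPoly_succ]
    simp only [derivative_add, derivative_mul, derivative_sub, derivative_X, derivative_C, hd]
    push_cast
    simp only [C_add, C_1]
    linear_combination (C (k : ℝ) + 1) * e1 + (C (k : ℝ) + 1) * e2

/-- Summation by parts for the derivative of a spline. -/
theorem derivative_sum_cellPoly (hτ : Monotone τ) (hμ : τ μ < τ (μ + 1)) {k n : ℕ}
    (hk : k + 1 ≤ μ) (hn : μ < n) (θ : ℕ → ℝ) :
    derivative (∑ j ∈ Finset.range n, C (θ j) * cellPoly τ μ (k + 1) j) =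
      ∑ j ∈ Finset.range n, C (((k : ℝ) + 1) * (θ j - θ (j - 1))) * cellQuot τ μ k j := by
  obtain ⟨n, rfl⟩ : ∃ n', n = n' + 1 := ⟨n - 1, by omega⟩
  have h0 : cellQuot τ μ k 0 = 0 := cellQuot_eq_zero _ _ _ _ (by omega)
  have hn0 : cellQuot τ μ k (n + 1) = 0 := cellQuot_eq_zero _ _ _ _ (by omega)
  have e1 : derivative (∑ j ∈ Finset.range (n + 1), C (θ j) * cellPoly τ μ (k + 1) j) =
      ∑ j ∈ Finset.range (n + 1), (C (((k : ℝ) + 1) * θ j) * cellQuot τ μ k j -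
        C (((k : ℝ) + 1) * θ j) * cellQuot τ μ k (j + 1)) := by
    rw [derivative_sum]
    refine Finset.sum_congr rfl fun j _ => ?_
    rw [derivative_mul, derivative_C, derivative_cellPoly hτ hμ, C_mul]
    ring
  have e2 : ∑ j ∈ Finset.range (n + 1), C (((k : ℝ) + 1) * θ j) * cellQuot τ μ k (j + 1) =
      ∑ j ∈ Finset.range (n + 1), C (((k : ℝ) + 1) * θ (j - 1)) * cellQuot τ μ k j := by
    rw [Finset.sum_range_succ, hn0, mul_zero, add_zero, Finset.sum_range_succ', h0, mul_zero,
      add_zero]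
    rfl
  rw [e1, Finset.sum_sub_distrib, e2, ← Finset.sum_sub_distrib]
  refine Finset.sum_congr rfl fun j _ => ?_
  rw [mul_sub, C_sub]
  ring

theorem sum_cellPoly (hτ : Monotone τ) (hμ : τ μ < τ (μ + 1)) {n : ℕ} (hn : μ < n) :
    ∀ k, k ≤ μ → ∑ j ∈ Finset.range n, cellPoly τ μ k j = 1 := by
  intro k
  obtain ⟨n, rfl⟩ : ∃ n', n = n' + 1 := ⟨n - 1, by omega⟩
  induction k with
  | zero => intro _; simp [cellPoly, hn]
  | succ k ih =>
    intro hk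
    have h0 : cellQuot τ μ k 0 = 0 := cellQuot_eq_zero _ _ _ _ (by omega)
    have hn0 : cellQuot τ μ k (n + 1) = 0 := cellQuot_eq_zero _ _ _ _ (by omega)
    have e2 : ∑ j ∈ Finset.range (n + 1), (C (τ (j + k + 2)) - X) * cellQuot τ μ k (j + 1) =
        ∑ j ∈ Finset.range (n + 1), (C (τ (j + k + 1)) - X) * cellQuot τ μ k j := by
      rw [Finset.sum_range_succ, hn0, mul_zero, add_zero, Finset.sum_range_succ', h0, mul_zero,
        add_zero]
      refine Finset.sum_congr rfl fun j _ => ?_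
      rw [show j + 1 + k + 1 = j + k + 2 by ring]
    simp only [cellPoly_succ]
    rw [Finset.sum_add_distrib, e2, ← Finset.sum_add_distrib, ← ih (by omega)]
    refine Finset.sum_congr rfl fun j _ => ?_
    rw [← C_mul_cellQuot hτ hμ k j, C_sub]
    ring

theorem cellPoly_nonneg (hτ : Monotone τ) {x : ℝ}
    (hx : x ∈ Icc (τ μ) (τ (μ + 1))) : ∀ k j, 0 ≤ (cellPoly τ μ k j).eval x := by
  intro k
  induction k with
  | zero => intro j; simp only [cellPoly]; split_ifs <;> simp
  | succ k ih =>
    intro j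
    have hq : ∀ j, 0 ≤ (cellQuot τ μ k j).eval x := by
      intro j
      rw [cellQuot, eval_mul, eval_C]
      exact mul_nonneg (inv_nonneg.2 (sub_nonneg.2 (hτ (by omega)))) (ih j)
    rw [cellPoly_succ]
    simp only [eval_add, eval_mul, eval_sub, eval_X, eval_C]
    refine add_nonneg ?_ ?_
    · by_cases h : j ≤ μ
      · exact mul_nonneg (sub_nonneg.2 ((hτ h).trans hx.1)) (hq j)
      · rw [cellQuot_eq_zero _ _ _ _ (by omega)]; simp
    · by_cases h : μ ≤ j + 1 + k
      · exact mul_nonneg (sub_nonneg.2 (hx.2.trans (hτ (by omega)))) (hq (j + 1))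
      · rw [cellQuot_eq_zero _ _ _ _ (by omega)]; simp

/-- At a simple knot the pieces on the two sides agree (for positive degree). -/
theorem eval_cellPoly_succ_knot (h1 : τ μ < τ (μ + 1)) (h2 : τ (μ + 1) < τ (μ + 2)) :
    ∀ k j, (cellPoly τ μ (k + 1) j).eval (τ (μ + 1)) =
      (cellPoly τ (μ + 1) (k + 1) j).eval (τ (μ + 1)) := by
  intro k
  induction k with
  | zero =>
    intro j
    have a1 : τ (μ + 1) - τ μ ≠ 0 := (sub_pos.2 h1).ne'
    have a2 : τ (μ + 2) - τ (μ + 1) ≠ 0 := (sub_pos.2 h2).ne'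
    simp only [cellPoly, eval_add, eval_mul, eval_sub, eval_X, eval_C]
    by_cases c1 : j = μ
    · subst c1
      simp [a1, a2]
    · by_cases c2 : j + 1 = μ
      · subst c2
        simp [show ¬ (j = j + 1 + 1) by omega]
      · by_cases c3 : j = μ + 1
        · subst c3
          simp [show ¬ (μ + 1 + 1 = μ) by omega]
        · simp [c1, c2, c3]
  | succ k ih =>
    intro j
    rw [cellPoly_succ, cellPoly_succ]
    simp only [cellQuot, eval_add, eval_mul, eval_sub, eval_X, eval_C, ih]

end CellPoly

/-! ### B-splines of one variable: local stability, polynomials, smoothness -/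

section OneVariable

open Polynomial

/-- The B-spline coefficients that matter on a knot interval are controlled by the size of the
spline on that interval. By induction on the degree: the coefficients of the derivative are
divided differences of the coefficients, so neighbouring coefficients are close, and the spline is
an average of them. -/
theorem exists_coeff_bound {κ : ℝ} (hκ : 0 < κ) (k : ℕ) : ∃ K : ℝ, 0 < K ∧
    ∀ (τ : ℕ → ℝ) (μ n : ℕ), Monotone τ → τ μ < τ (μ + 1) →
      (∀ m, τ (m + 1) - τ m ≤ κ * (τ (μ + 1) - τ μ)) → k ≤ μ → μ < n →
      ∀ (θ : ℕ → ℝ) (A : ℝ),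
        (∀ x ∈ Icc (τ μ) (τ (μ + 1)),
          |(∑ j ∈ Finset.range n, C (θ j) * cellPoly τ μ k j).eval x| ≤ A) →
        ∀ j, j ≤ μ → μ ≤ j + k → |θ j| ≤ K * A := by
  induction k with
  | zero =>
    refine ⟨1, one_pos, fun τ μ n hτ hμ _ _ hn θ A hA j hj hj' => ?_⟩
    obtain rfl : j = μ := by omega
    have := hA (τ j) ⟨le_rfl, hμ.le⟩
    simpa [cellPoly, eval_finsetSum, apply_ite, hn] using this
  | succ k ih =>
    obtain ⟨K, hK, ih⟩ := ih
    obtain ⟨M, hM, hder⟩ := exists_derivative_bound (k + 1)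
    refine ⟨1 + 2 * (k + 1) * (K * M * κ), by positivity,
      fun τ μ n hτ hμ hstep hk hn θ A hA => ?_⟩
    set w := τ (μ + 1) - τ μ with hw
    have hw0 : 0 < w := sub_pos.2 hμ
    have hA0 : 0 ≤ A := (abs_nonneg _).trans (hA (τ μ) ⟨le_rfl, hμ.le⟩)
    set s := ∑ j ∈ Finset.range n, C (θ j) * cellPoly τ μ (k + 1) j with hs
    have hdeg : s.natDegree ≤ k + 1 := natDegree_sum_le_of_forall_le _ _ fun j _ =>
      (natDegree_C_mul_le _ _).trans (natDegree_cellPoly_le τ μ (k + 1) j)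
    have hs' := hder s hdeg _ _ A hμ hA
    set ζ : ℕ → ℝ := fun j => ((k : ℝ) + 1) * (θ j - θ (j - 1)) * (τ (j + k + 1) - τ j)⁻¹ with hζ
    have hds : s.derivative = ∑ j ∈ Finset.range n, C (ζ j) * cellPoly τ μ k j := by
      rw [hs, derivative_sum_cellPoly hτ hμ hk hn]
      refine Finset.sum_congr rfl fun j _ => ?_
      rw [cellQuot, hζ, ← mul_assoc, ← C_mul]
    rw [hds] at hs'
    have hζb := ih τ μ n hτ hμ hstep (by omega) hn ζ _ hs'
    have hlen : ∀ d j, τ (j + d) - τ j ≤ d * (κ * w) := by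
      intro d j
      induction d with
      | zero => simp
      | succ d ihd =>
        have := hstep (j + d)
        rw [show j + (d + 1) = j + d + 1 by ring]
        push_cast
        linarith
    set E := K * M * κ * A with hE
    have hE0 : 0 ≤ E := by positivity
    have hdiff : ∀ j, j ≤ μ → μ ≤ j + k → |θ j - θ (j - 1)| ≤ E := by
      intro j hj hj'
      have h1 := hζb j hj hj'
      have hpos : 0 < τ (j + k + 1) - τ j := sub_pos.2 (knot_lt_of_active hτ hμ ⟨hj, hj'⟩)
      have h2 : τ (j + k + 1) - τ j ≤ ((k : ℝ) + 1) * (κ * w) := by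
        have := hlen (k + 1) j
        rw [← add_assoc] at this
        exact_mod_cast this
      rw [hζ, abs_mul, abs_mul, abs_inv, abs_of_pos hpos,
        abs_of_pos (by positivity : (0 : ℝ) < (k : ℝ) + 1), ← div_eq_mul_inv,
        div_le_iff₀ hpos] at h1
      have h3 : K * (M / w * A) * (τ (j + k + 1) - τ j) ≤
          K * (M / w * A) * (((k : ℝ) + 1) * (κ * w)) := by gcongr
      have h4 : K * (M / w * A) * (((k : ℝ) + 1) * (κ * w)) = ((k : ℝ) + 1) * E := by
        rw [hE]; field_simp
      have h5 : ((k : ℝ) + 1) * |θ j - θ (j - 1)| ≤ ((k : ℝ) + 1) * E := by linarith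
      exact le_of_mul_le_mul_left h5 (by positivity)
    have hchain : ∀ d, d ≤ k + 1 → |θ μ - θ (μ - d)| ≤ d * E := by
      intro d
      induction d with
      | zero => simp
      | succ d ihd =>
        intro hd
        have h1 := ihd (by omega)
        have h2 := hdiff (μ - d) (by omega) (by omega)
        rw [show μ - d - 1 = μ - (d + 1) by omega] at h2
        have h3 : θ μ - θ (μ - (d + 1)) =
            (θ μ - θ (μ - d)) + (θ (μ - d) - θ (μ - (d + 1))) := by ring
        rw [h3]
        refine (abs_add_le _ _).trans ?_
        push_cast
        linarith
    have hmu : ∀ j, j ≤ μ → μ ≤ j + (k + 1) → |θ μ - θ j| ≤ (k + 1) * E := by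
      intro j hj hj'
      have h1 := hchain (μ - j) (by omega)
      rw [show μ - (μ - j) = j by omega] at h1
      refine h1.trans ?_
      gcongr
      have : μ - j ≤ k + 1 := by omega
      exact_mod_cast this
    intro i hi hi'
    set x := τ μ
    have hx : x ∈ Icc (τ μ) (τ (μ + 1)) := ⟨le_rfl, hμ.le⟩
    have hone : ∑ j ∈ Finset.range n, (cellPoly τ μ (k + 1) j).eval x = 1 := by
      rw [← eval_finsetSum, sum_cellPoly hτ hμ hn (k + 1) hk, eval_one]
    have hsx : θ i = s.eval x + ∑ j ∈ Finset.range n,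
        (θ i - θ j) * (cellPoly τ μ (k + 1) j).eval x := by
      have : s.eval x = ∑ j ∈ Finset.range n, θ j * (cellPoly τ μ (k + 1) j).eval x := by
        simp [hs, eval_finsetSum]
      rw [this, ← Finset.sum_add_distrib]
      calc θ i = θ i * ∑ j ∈ Finset.range n, (cellPoly τ μ (k + 1) j).eval x := by
            rw [hone, mul_one]
        _ = _ := by
            rw [Finset.mul_sum]
            exact Finset.sum_congr rfl fun j _ => by ring
    have hsum : |∑ j ∈ Finset.range n, (θ i - θ j) * (cellPoly τ μ (k + 1) j).eval x| ≤
        2 * (k + 1) * E := by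
      refine (Finset.abs_sum_le_sum_abs _ _).trans ?_
      calc ∑ j ∈ Finset.range n, |(θ i - θ j) * (cellPoly τ μ (k + 1) j).eval x|
          ≤ ∑ j ∈ Finset.range n, 2 * (k + 1) * E * (cellPoly τ μ (k + 1) j).eval x := by
            refine Finset.sum_le_sum fun j _ => ?_
            have hnn := cellPoly_nonneg hτ hx (k + 1) j
            rw [abs_mul, abs_of_nonneg hnn]
            by_cases hj : j ≤ μ ∧ μ ≤ j + (k + 1)
            · refine mul_le_mul_of_nonneg_right ?_ hnn
              have h1 := hmu i hi hi'
              have h2 := hmu j hj.1 hj.2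
              have h3 : θ i - θ j = (θ μ - θ j) - (θ μ - θ i) := by ring
              rw [h3]
              refine (abs_sub _ _).trans ?_
              linarith
            · simp [cellPoly_eq_zero τ μ (k + 1) j hj]
        _ = 2 * (k + 1) * E := by rw [← Finset.mul_sum, hone, mul_one]
    calc |θ i| ≤ |s.eval x| + 2 * (k + 1) * E := by
          rw [hsx]
          exact (abs_add_le _ _).trans (by gcongr)
      _ ≤ A + 2 * (k + 1) * E := by gcongr; exact hA x hx
      _ = (1 + 2 * (k + 1) * (K * M * κ)) * A := by rw [hE]; ring

/-- An extended knot sequence on `[0,1]` for splines of degree `p` with `N` interior knots: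
the knots `τ p, …, τ (p + N + 1)` are strictly increasing from `0` to `1`, and the end points are
repeated. The knot intervals have the indices `p, …, p + N`. -/
structure IsKnotSeq (p N : ℕ) (τ : ℕ → ℝ) : Prop where
  mono : Monotone τ
  zero : ∀ m ≤ p, τ m = 0
  one : ∀ m, p + N < m → τ m = 1
  lt : ∀ μ, p ≤ μ → μ ≤ p + N → τ μ < τ (μ + 1)

variable {p N : ℕ} {τ : ℕ → ℝ}

theorem eval_sum_cellPoly_knot {μ : ℕ} (h1 : τ μ < τ (μ + 1)) (h2 : τ (μ + 1) < τ (μ + 2))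
    (k n : ℕ) (θ : ℕ → ℝ) :
    (∑ j ∈ Finset.range n, C (θ j) * cellPoly τ μ (k + 1) j).eval (τ (μ + 1)) =
      (∑ j ∈ Finset.range n, C (θ j) * cellPoly τ (μ + 1) (k + 1) j).eval (τ (μ + 1)) := by
  simp only [eval_finsetSum, eval_mul]
  exact Finset.sum_congr rfl fun j _ => by rw [eval_cellPoly_succ_knot h1 h2 k j]

/-- Polynomials are splines: by induction on the degree, integrating the coefficients. -/
theorem exists_coeff_of_polynomial (h : IsKnotSeq p N τ) (k : ℕ) : k ≤ p →
    ∀ P : ℝ[X], P.natDegree ≤ k → ∃ θ : ℕ → ℝ, ∀ μ, p ≤ μ → μ ≤ p + N →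
      ∑ j ∈ Finset.range (p + N + 1), C (θ j) * cellPoly τ μ k j = P := by
  induction k with
  | zero =>
    intro _ P hP
    refine ⟨fun _ => P.coeff 0, fun μ h1 h2 => ?_⟩
    rw [← Finset.mul_sum, sum_cellPoly h.mono (h.lt μ h1 h2) (by omega) 0 (by omega), mul_one]
    exact (eq_C_of_natDegree_le_zero hP).symm
  | succ k ih =>
    intro hk P hP
    obtain ⟨ζ, hζ⟩ := ih (by omega) P.derivative
      ((natDegree_derivative_le P).trans (by omega))
    set θ : ℕ → ℝ := fun j => ∑ i ∈ Finset.range (j + 1),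
      ζ i * (τ (i + k + 1) - τ i) / ((k : ℝ) + 1) with hθ
    set s : ℕ → ℝ[X] := fun μ =>
      ∑ j ∈ Finset.range (p + N + 1), C (θ j) * cellPoly τ μ (k + 1) j with hs
    -- on each knot interval the spline `s` has the derivative of `P`, so it differs from `P` by a
    -- constant; by continuity at the knots this is the same constant on all intervals
    have hder : ∀ μ, p ≤ μ → μ ≤ p + N → derivative (s μ - P) = 0 := by
      intro μ h1 h2
      rw [derivative_sub, sub_eq_zero, ← hζ μ h1 h2, hs]
      simp only
      rw [derivative_sum_cellPoly h.mono (h.lt μ h1 h2) (by omega) (by omega)]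
      refine Finset.sum_congr rfl fun j _ => ?_
      by_cases hj : j ≤ μ ∧ μ ≤ j + k
      · obtain ⟨i, rfl⟩ : ∃ i, j = i + 1 := ⟨j - 1, by omega⟩
        have hd : ((k : ℝ) + 1) * (θ (i + 1) - θ (i + 1 - 1)) =
            ζ (i + 1) * (τ (i + 1 + k + 1) - τ (i + 1)) := by
          have : (k : ℝ) + 1 ≠ 0 := by positivity
          simp only [hθ, Nat.add_sub_cancel]
          rw [Finset.sum_range_succ _ (i + 1)]
          field_simp
          ring
        rw [hd, C_mul, mul_assoc, C_mul_cellQuot h.mono (h.lt μ h1 h2)]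
      · rw [cellQuot_eq_zero _ _ _ _ hj, cellPoly_eq_zero _ _ _ _ hj, mul_zero, mul_zero]
    have hconst : ∀ μ, p ≤ μ → μ ≤ p + N → s μ - P = C ((s μ - P).coeff 0) := fun μ h1 h2 =>
      eq_C_of_derivative_eq_zero (hder μ h1 h2)
    have hsame : ∀ d, d ≤ N → (s (p + d) - P).coeff 0 = (s p - P).coeff 0 := by
      intro d
      induction d with
      | zero => simp
      | succ d ihd =>
        intro hd
        rw [← ihd (by omega)]
        have e1 := congrArg (eval (τ (p + d + 1))) (hconst (p + d) (by omega) (by omega))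
        have e2 := congrArg (eval (τ (p + d + 1))) (hconst (p + (d + 1)) (by omega) (by omega))
        rw [eval_C, eval_sub] at e1 e2
        have e3 := eval_sum_cellPoly_knot (h.lt (p + d) (by omega) (by omega))
          (h.lt (p + d + 1) (by omega) (by omega)) k (p + N + 1) θ
        have e4 : (s (p + d)).eval (τ (p + d + 1)) = (s (p + (d + 1))).eval (τ (p + d + 1)) := e3
        linarith
    refine ⟨fun j => θ j - (s p - P).coeff 0, fun μ h1 h2 => ?_⟩
    have e1 := hconst μ h1 h2
    have e2 := hsame (μ - p) (by omega)
    rw [show p + (μ - p) = μ by omega] at e2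
    rw [e2] at e1
    have e3 : ∑ j ∈ Finset.range (p + N + 1),
        C (θ j - (s p - P).coeff 0) * cellPoly τ μ (k + 1) j =
        s μ - C ((s p - P).coeff 0) := by
      simp only [C_sub, sub_mul, Finset.sum_sub_distrib, hs]
      rw [← Finset.mul_sum, sum_cellPoly h.mono (h.lt μ h1 h2) (by omega) (k + 1) (by omega),
        mul_one]
    rw [e3, ← e1]
    ring

theorem IsKnotSeq.nonneg (h : IsKnotSeq p N τ) (m : ℕ) : 0 ≤ τ m := by
  rw [← h.zero 0 (Nat.zero_le _)]; exact h.mono (Nat.zero_le _)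

theorem IsKnotSeq.le_one (h : IsKnotSeq p N τ) (m : ℕ) : τ m ≤ 1 := by
  rw [← h.one (p + N + 1 + m) (by omega)]; exact h.mono (by omega)

/-- The knot interval of a point: half-open on the left, but containing `0`. -/
theorem IsKnotSeq.exists_cell (h : IsKnotSeq p N τ) {x : ℝ} (hx : x ∈ Icc (0 : ℝ) 1) :
    ∃ μ, p ≤ μ ∧ μ ≤ p + N ∧ x ∈ Icc (τ μ) (τ (μ + 1)) ∧ (μ = p ∨ τ μ < x) := by
  classical
  have hex : ∃ d, x ≤ τ (p + d + 1) := ⟨N, by rw [h.one _ (by omega)]; exact hx.2⟩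
  have hle := Nat.find_spec hex
  have hdN : Nat.find hex ≤ N := Nat.find_min' hex (by rw [h.one _ (by omega)]; exact hx.2)
  refine ⟨p + Nat.find hex, by omega, by omega, ?_⟩
  rcases Nat.eq_zero_or_pos (Nat.find hex) with h0 | h0
  · rw [h0] at hle ⊢
    exact ⟨⟨by rw [h.zero _ (by omega)]; exact hx.1, hle⟩, Or.inl rfl⟩
  · have := Nat.find_min hex (m := Nat.find hex - 1) (by omega)
    rw [show p + (Nat.find hex - 1) + 1 = p + Nat.find hex by omega, not_le] at this
    exact ⟨⟨this.le, hle⟩, Or.inr this⟩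

theorem bsplineDeg_zero_eq (h : IsKnotSeq p N τ) {μ : ℕ} (h1 : p ≤ μ) (h2 : μ ≤ p + N) {x : ℝ}
    (hx : x ∈ Ico (τ μ) (τ (μ + 1)) ∨ (x = 1 ∧ τ (μ + 1) = 1)) (j : ℕ) :
    bsplineDeg τ 0 j x = (cellPoly τ μ 0 j).eval x := by
  have hlt := h.lt μ h1 h2
  have hle := h.le_one (μ + 1)
  simp only [bsplineDeg, cellPoly]
  rcases lt_trichotomy j μ with hj | rfl | hj
  · have hm : τ (j + 1) ≤ τ μ := h.mono hj
    rw [if_neg, if_neg hj.ne, eval_zero]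
    rintro (⟨h3, h4⟩ | ⟨h3, h4, h5⟩)
    · rcases hx with hx | hx
      · linarith [hx.1]
      · linarith [hx.1]
    · linarith
  · rw [if_pos, if_pos rfl, eval_one]
    rcases hx with hx | hx
    · exact Or.inl hx
    · exact Or.inr ⟨hx.1, by linarith, hx.2⟩
  · have hm : τ (μ + 1) ≤ τ j := h.mono hj
    rw [if_neg, if_neg hj.ne', eval_zero]
    rintro (⟨h3, h4⟩ | ⟨h3, h4, h5⟩)
    · rcases hx with hx | hx
      · linarith [hx.2]
      · have := h.le_one (j + 1); linarith
    · rcases hx with hx | hx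
      · linarith [hx.2]
      · linarith

theorem bsplineDeg_eq_of_Ico (h : IsKnotSeq p N τ) {μ : ℕ} (h1 : p ≤ μ) (h2 : μ ≤ p + N) {x : ℝ}
    (hx : x ∈ Ico (τ μ) (τ (μ + 1)) ∨ (x = 1 ∧ τ (μ + 1) = 1)) : ∀ k j,
    bsplineDeg τ k j x = (cellPoly τ μ k j).eval x := by
  intro k
  induction k with
  | zero => exact bsplineDeg_zero_eq h h1 h2 hx
  | succ k ih =>
    intro j
    simp only [bsplineDeg, cellPoly, ih, eval_add, eval_mul, eval_sub, eval_X, eval_C]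
    ring

/-- B-splines of positive degree are polynomials on closed knot intervals. -/
theorem bsplineDeg_succ_eq (h : IsKnotSeq p N τ) {μ : ℕ} (h1 : p ≤ μ) (h2 : μ ≤ p + N) {x : ℝ}
    (hx : x ∈ Icc (τ μ) (τ (μ + 1))) (k j : ℕ) :
    bsplineDeg τ (k + 1) j x = (cellPoly τ μ (k + 1) j).eval x := by
  rcases hx.2.lt_or_eq with hlt | heq
  · exact bsplineDeg_eq_of_Ico h h1 h2 (Or.inl ⟨hx.1, hlt⟩) _ _
  · rcases h2.lt_or_eq with h3 | h3
    · have hl := h.lt (μ + 1) (by omega) (by omega)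
      rw [bsplineDeg_eq_of_Ico h (μ := μ + 1) (by omega) (by omega) (Or.inl ⟨heq.ge, heq ▸ hl⟩),
        heq, eval_cellPoly_succ_knot (h.lt μ h1 h2) hl]
    · have : τ (μ + 1) = 1 := h.one _ (by omega)
      exact bsplineDeg_eq_of_Ico h h1 h2 (Or.inr ⟨by rw [heq, this], this⟩) _ _

/-- The derivative of order `r` of the B-spline of degree `k` with index `j`, by the recursion for
derivatives of B-splines. It is the derivative on all of `[0,1]`, knots included, if `r < k`. -/
def bsplineDeriv (τ : ℕ → ℝ) : ℕ → ℕ → ℕ → ℝ → ℝ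
  | 0, k, j, x => bsplineDeg τ k j x
  | r + 1, k, j, x => (k : ℝ) * ((τ (j + k) - τ j)⁻¹ * bsplineDeriv τ r (k - 1) j x -
      (τ (j + k + 1) - τ (j + 1))⁻¹ * bsplineDeriv τ r (k - 1) (j + 1) x)

theorem bsplineDeriv_eq (h : IsKnotSeq p N τ) {μ : ℕ} (h1 : p ≤ μ) (h2 : μ ≤ p + N) {x : ℝ}
    (hx : x ∈ Icc (τ μ) (τ (μ + 1))) : ∀ r k j, r < k →
    bsplineDeriv τ r k j x = (derivative^[r] (cellPoly τ μ k j)).eval x := by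
  intro r
  induction r with
  | zero =>
    intro k j hk
    obtain ⟨k, rfl⟩ : ∃ k', k = k' + 1 := ⟨k - 1, by omega⟩
    exact bsplineDeg_succ_eq h h1 h2 hx k j
  | succ r ih =>
    intro k j hk
    obtain ⟨k, rfl⟩ : ∃ k', k = k' + 1 := ⟨k - 1, by omega⟩
    rw [Function.iterate_succ_apply, derivative_cellPoly h.mono (h.lt μ h1 h2)]
    simp only [bsplineDeriv, cellQuot, Nat.add_sub_cancel]
    rw [ih k j (by omega), ih k (j + 1) (by omega), iterate_derivative_C_mul,
      iterate_derivative_sub, iterate_derivative_C_mul, iterate_derivative_C_mul]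
    simp only [eval_mul, eval_sub, eval_C]
    push_cast
    rw [show j + 1 + k + 1 = j + (k + 1) + 1 by ring, show j + (k + 1) = j + k + 1 by ring]

/-- A function that is glued from polynomials on the knot intervals is differentiable if the
derivatives agree at the knots. -/
theorem hasDerivWithinAt_of_cells (h : IsKnotSeq p N τ) {f g : ℝ → ℝ} {P : ℕ → ℝ[X]}
    (hf : ∀ μ, p ≤ μ → μ ≤ p + N → ∀ x ∈ Icc (τ μ) (τ (μ + 1)), f x = (P μ).eval x)
    (hg : ∀ μ, p ≤ μ → μ ≤ p + N → ∀ x ∈ Icc (τ μ) (τ (μ + 1)),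
      g x = (derivative (P μ)).eval x) (x : ℝ) :
    HasDerivWithinAt f (g x) (Icc 0 1) x := by
  have hcell : ∀ μ, p ≤ μ → μ ≤ p + N →
      HasDerivWithinAt f (g x) (Icc (τ μ) (τ (μ + 1))) x := by
    intro μ h1 h2
    by_cases hx : x ∈ Icc (τ μ) (τ (μ + 1))
    · rw [hg μ h1 h2 x hx]
      exact ((P μ).hasDerivAt x).hasDerivWithinAt.congr (hf μ h1 h2) (hf μ h1 h2 x hx)
    · refine hasDerivWithinAt_iff_hasFDerivWithinAt.2 (HasFDerivWithinAt.of_notMem_closure ?_)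
      rwa [isClosed_Icc.closure_eq]
  have hunion : ∀ d, d ≤ N + 1 → HasDerivWithinAt f (g x) (Icc (τ p) (τ (p + d))) x := by
    intro d
    induction d with
    | zero =>
      intro _
      rw [add_zero, Icc_self]
      exact hasDerivWithinAt_iff_hasFDerivWithinAt.2 HasFDerivWithinAt.singleton
    | succ d ih =>
      intro hd
      rw [← Icc_union_Icc_eq_Icc (h.mono (by omega : p ≤ p + d))
        (h.mono (by omega : p + d ≤ p + (d + 1)))]
      exact (ih (by omega)).union (hcell (p + d) (by omega) (by omega))
  have := hunion (N + 1) le_rfl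
  rwa [h.zero p le_rfl, h.one _ (by omega)] at this

theorem hasDerivWithinAt_bsplineDeriv (h : IsKnotSeq p N τ) {r k : ℕ} (hr : r + 1 < k) (j : ℕ)
    (x : ℝ) :
    HasDerivWithinAt (bsplineDeriv τ r k j) (bsplineDeriv τ (r + 1) k j x) (Icc 0 1) x :=
  hasDerivWithinAt_of_cells h (P := fun μ => derivative^[r] (cellPoly τ μ k j))
    (fun μ h1 h2 x hx => bsplineDeriv_eq h h1 h2 hx r k j (by omega))
    (fun μ h1 h2 x hx => by
      rw [bsplineDeriv_eq h h1 h2 hx (r + 1) k j hr, Function.iterate_succ_apply']) x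

theorem continuousOn_bsplineDeriv (h : IsKnotSeq p N τ) {r k : ℕ} (hr : r < k) (j : ℕ) :
    ContinuousOn (bsplineDeriv τ r k j) (Icc 0 1) := by
  have hunion : ∀ d, d ≤ N + 1 →
      ContinuousOn (bsplineDeriv τ r k j) (Icc (τ p) (τ (p + d))) := by
    intro d
    induction d with
    | zero => intro _; rw [add_zero, Icc_self]; exact continuousOn_singleton _ _
    | succ d ih =>
      intro hd
      rw [← Icc_union_Icc_eq_Icc (h.mono (by omega : p ≤ p + d))
        (h.mono (by omega : p + d ≤ p + (d + 1)))]
      refine (ih (by omega)).union_of_isClosed ?_ isClosed_Icc isClosed_Icc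
      exact (Polynomial.continuous (derivative^[r] (cellPoly τ (p + d) k j))).continuousOn.congr
        fun x hx => bsplineDeriv_eq h (by omega) (by omega) hx r k j hr
  have := hunion (N + 1) le_rfl
  rwa [h.zero p le_rfl, h.one _ (by omega)] at this

theorem bsplineDeriv_eq_zero (h : IsKnotSeq p N τ) {μ : ℕ} (h1 : p ≤ μ) (h2 : μ ≤ p + N) {x : ℝ}
    (hx : x ∈ Icc (τ μ) (τ (μ + 1))) {r k j : ℕ} (hr : r < k) (hj : ¬ (j ≤ μ ∧ μ ≤ j + k)) :
    bsplineDeriv τ r k j x = 0 := by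
  rw [bsplineDeriv_eq h h1 h2 hx r k j hr, cellPoly_eq_zero τ μ k j hj]
  simp

theorem abs_bsplineDeriv_le (h : IsKnotSeq p N τ) {w : ℝ} (hw : 0 < w)
    (hmesh : ∀ μ, p ≤ μ → μ ≤ p + N → w ≤ τ (μ + 1) - τ μ) {x : ℝ} (hx : x ∈ Icc (0 : ℝ) 1) :
    ∀ r k j, r < k → k ≤ p → |bsplineDeriv τ r k j x| ≤ (2 * p / w) ^ r := by
  obtain ⟨μ, h1, h2, hxμ, -⟩ := h.exists_cell hx
  have hlt := h.lt μ h1 h2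
  intro r
  induction r with
  | zero =>
    intro k j hr hk
    have hnn := fun j => cellPoly_nonneg h.mono hxμ k j
    rw [bsplineDeriv_eq h h1 h2 hxμ 0 k j hr, pow_zero, Function.iterate_zero, id,
      abs_of_nonneg (hnn j)]
    by_cases hj : j ≤ μ
    · have hsum : ∑ j ∈ Finset.range (μ + 1), (cellPoly τ μ k j).eval x = 1 := by
        rw [← eval_finsetSum, sum_cellPoly h.mono hlt (by omega) k (by omega), eval_one]
      rw [← hsum]
      exact Finset.single_le_sum (f := fun j => (cellPoly τ μ k j).eval x)
        (fun j _ => hnn j) (Finset.mem_range.2 (by omega))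
    · rw [cellPoly_eq_zero _ _ _ _ (by omega), eval_zero]; exact zero_le_one
  | succ r ih =>
    intro k j hr hk
    obtain ⟨k, rfl⟩ : ∃ k', k = k' + 1 := ⟨k - 1, by omega⟩
    have hq : ∀ j, |(τ (j + k + 1) - τ j)⁻¹ * bsplineDeriv τ r k j x| ≤
        w⁻¹ * (2 * p / w) ^ r := by
      intro j
      by_cases hj : j ≤ μ ∧ μ ≤ j + k
      · have hle : w ≤ τ (j + k + 1) - τ j := by
          have a1 := hmesh μ h1 h2
          have a2 : τ j ≤ τ μ := h.mono hj.1
          have a3 : τ (μ + 1) ≤ τ (j + k + 1) := h.mono (by omega)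
          linarith
        have hpos : 0 < τ (j + k + 1) - τ j := hw.trans_le hle
        rw [abs_mul, abs_inv, abs_of_pos hpos]
        gcongr
        exact ih k j (by omega) (by omega)
      · rw [bsplineDeriv_eq_zero h h1 h2 hxμ (by omega) hj, mul_zero, abs_zero]
        positivity
    have e1 := hq j
    have e2 := hq (j + 1)
    rw [show j + 1 + k + 1 = j + k + 1 + 1 by ring] at e2
    simp only [bsplineDeriv, Nat.add_sub_cancel]
    rw [show j + (k + 1) = j + k + 1 by ring, abs_mul]
    calc |((k + 1 : ℕ) : ℝ)| * |(τ (j + k + 1) - τ j)⁻¹ * bsplineDeriv τ r k j x -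
          (τ (j + k + 1 + 1) - τ (j + 1))⁻¹ * bsplineDeriv τ r k (j + 1) x|
        ≤ p * (w⁻¹ * (2 * p / w) ^ r + w⁻¹ * (2 * p / w) ^ r) := by
          refine mul_le_mul ?_ ((abs_sub _ _).trans (add_le_add e1 e2)) (abs_nonneg _)
            (by positivity)
          rw [Nat.abs_cast]
          exact_mod_cast hk
      _ = (2 * p / w) ^ (r + 1) := by rw [pow_succ]; ring

end OneVariable

/-! ### Calculus on the unit square -/

section Square

theorem isCompact_box (a b : Fin 2 → ℝ) : IsCompact {x : Plane | ∀ k, x k ∈ Icc (a k) (b k)} := by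
  have h : {x : Plane | ∀ k, x k ∈ Icc (a k) (b k)} =
      (WithLp.toLp 2) '' (Set.pi univ fun k => Icc (a k) (b k)) := by
    ext x
    constructor
    · intro hx
      exact ⟨fun k => x k, fun k _ => hx k, rfl⟩
    · rintro ⟨y, hy, rfl⟩ k
      exact hy k (mem_univ k)
  rw [h]
  exact (isCompact_univ_pi fun k => isCompact_Icc).image (PiLp.continuous_toLp 2 _)

theorem isCompact_unitSquare : IsCompact unitSquare := isCompact_box (fun _ => 0) (fun _ => 1)

theorem convex_unitSquare : Convex ℝ unitSquare := by
  intro x hx y hy a b ha hb hab k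
  have := convex_Icc (0 : ℝ) 1 (hx k) (hy k) ha hb hab
  simpa using this

theorem interior_unitSquare_nonempty : (interior unitSquare).Nonempty := by
  refine ⟨!₂[1 / 2, 1 / 2], mem_interior.2 ⟨{x : Plane | ∀ k, x k ∈ Ioo (0 : ℝ) 1}, ?_, ?_, ?_⟩⟩
  · exact fun x hx k => Ioo_subset_Icc_self (hx k)
  · have : {x : Plane | ∀ k, x k ∈ Ioo (0 : ℝ) 1} = ⋂ k, {x : Plane | x k ∈ Ioo (0 : ℝ) 1} := by
      ext; simp
    rw [this]
    exact isOpen_iInter_of_finite fun k => isOpen_Ioo.preimage (by fun_prop)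
  · intro k
    fin_cases k <;> simp <;> norm_num

theorem uniqueDiffOn_unitSquare : UniqueDiffOn ℝ unitSquare :=
  uniqueDiffOn_convex convex_unitSquare interior_unitSquare_nonempty

theorem pderiv_congr {f g : Plane → ℝ} (h : EqOn f g unitSquare) (i : Fin 2) :
    EqOn (pderiv i f) (pderiv i g) unitSquare := by
  intro x hx
  simp only [pderiv]
  rw [fderivWithin_congr h (h hx)]

theorem pderiv_eq_of_hasFDerivWithinAt {f : Plane → ℝ} {x : Plane} {f' : Plane →L[ℝ] ℝ}
    (hx : x ∈ unitSquare) (h : HasFDerivWithinAt f f' unitSquare x) (i : Fin 2) :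
    pderiv i f x = f' (EuclideanSpace.single i 1) := by
  rw [pderiv, h.fderivWithin (uniqueDiffOn_unitSquare x hx)]

theorem contDiffOn_pderiv {f : Plane → ℝ} {m : ℕ} (h : ContDiffOn ℝ ((m + 1 : ℕ) : ℕ∞) f unitSquare)
    (i : Fin 2) : ContDiffOn ℝ (m : ℕ∞) (pderiv i f) unitSquare := by
  have h1 := h.fderivWithin (m := ((m : ℕ∞) : WithTop ℕ∞)) uniqueDiffOn_unitSquare
    (by norm_cast)
  exact h1.clm_apply contDiffOn_const

/-- Continuity of the first and second partial derivatives on the square, and symmetry of the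
Hessian matrix. -/
structure IsRegular (f : Plane → ℝ) : Prop where
  continuousOn_pderiv : ∀ i, ContinuousOn (pderiv i f) unitSquare
  continuousOn_hess : ∀ i j, ContinuousOn (fun x => hess f x i j) unitSquare
  symm : ∀ x ∈ unitSquare, hess f x 1 0 = hess f x 0 1

/-- All first and second partial derivatives of `f` and `g` differ by at most `ε` on the
square. -/
def IsC2Close (f g : Plane → ℝ) (ε : ℝ) : Prop :=
  ∀ x ∈ unitSquare, (∀ i, |pderiv i f x - pderiv i g x| ≤ ε) ∧
    ∀ i j, |hess f x i j - hess g x i j| ≤ ε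

end Square

/-! ### Tensor product splines -/

section Tensor

namespace SplineSpace

variable (S : SplineSpace)

/-- The extended knot sequence in coordinate `k`. -/
def knot (k : Fin 2) : ℕ → ℝ := extKnots (S.q k) (S.N k) (S.t k)

/-- The knots are quasi-uniform, with spacings between `w` and `κ w`, and the splines are twice
continuously differentiable. -/
structure IsMesh (w κ : ℝ) : Prop where
  four_le : ∀ k, 4 ≤ S.q k
  knots : ∀ k, IsKnotSeq (S.q k - 1) (S.N k) (S.knot k)
  pos : 0 < w
  le : ∀ k μ, S.q k - 1 ≤ μ → μ ≤ S.q k - 1 + S.N k → w ≤ S.knot k (μ + 1) - S.knot k μ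
  le_mul : ∀ k m, S.knot k (m + 1) - S.knot k m ≤ κ * w

/-- The indices of the knot rectangles. -/
def IsCell (μ : Fin 2 → ℕ) : Prop := ∀ k, S.q k - 1 ≤ μ k ∧ μ k ≤ S.q k - 1 + S.N k

/-- The closed knot rectangle. -/
def rect (μ : Fin 2 → ℕ) : Set Plane := {x | ∀ k, x k ∈ Icc (S.knot k (μ k)) (S.knot k (μ k + 1))}

/-- The knot rectangle `μ` belongs to the support of the tensor product B-spline with index `j`. -/
def IsActive (μ : Fin 2 → ℕ) (j : S.Idx) : Prop :=
  ((j.1 : ℕ) ≤ μ 0 ∧ μ 0 ≤ j.1 + (S.q 0 - 1)) ∧ ((j.2 : ℕ) ≤ μ 1 ∧ μ 1 ≤ j.2 + (S.q 1 - 1))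

/-- Mixed derivatives of the tensor product B-splines. -/
def basisDeriv (r s : ℕ) (j : S.Idx) (x : Plane) : ℝ :=
  bsplineDeriv (S.knot 0) r (S.q 0 - 1) j.1 (x 0) * bsplineDeriv (S.knot 1) s (S.q 1 - 1) j.2 (x 1)

/-- Mixed derivatives of the spline functions. -/
def fnDeriv (r s : ℕ) (θ : S.Idx → ℝ) (x : Plane) : ℝ := ∑ j, S.basisDeriv r s j x * θ j

theorem fn_eq (θ : EuclideanSpace ℝ S.Idx) : S.fn θ = S.fnDeriv 0 0 θ := rfl

theorem basis_eq (j : S.Idx) (x : Plane) : S.basis j x = S.basisDeriv 0 0 j x := rfl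

variable {S} {w κ : ℝ}

theorem IsMesh.rect_subset (h : S.IsMesh w κ) (μ : Fin 2 → ℕ) : S.rect μ ⊆ unitSquare :=
  fun _ hx k => ⟨((h.knots k).nonneg _).trans (hx k).1, (hx k).2.trans ((h.knots k).le_one _)⟩

theorem IsMesh.exists_cell (h : S.IsMesh w κ) {x : Plane} (hx : x ∈ unitSquare) :
    ∃ μ, S.IsCell μ ∧ x ∈ S.rect μ ∧ ∀ k, μ k = S.q k - 1 ∨ S.knot k (μ k) < x k := by
  choose μ h1 h2 h3 h4 using fun k => (h.knots k).exists_cell (hx k)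
  exact ⟨μ, fun k => ⟨h1 k, h2 k⟩, h3, h4⟩

theorem IsMesh.basisDeriv_eq_zero (h : S.IsMesh w κ) {μ : Fin 2 → ℕ} (hμ : S.IsCell μ) {x : Plane}
    (hx : x ∈ S.rect μ) {r s : ℕ} (hr : r < S.q 0 - 1) (hs : s < S.q 1 - 1) {j : S.Idx}
    (hj : ¬ S.IsActive μ j) : S.basisDeriv r s j x = 0 := by
  rw [IsActive, not_and_or] at hj
  rw [basisDeriv]
  rcases hj with hj | hj
  · rw [bsplineDeriv_eq_zero (h.knots 0) (hμ 0).1 (hμ 0).2 (hx 0) hr hj, zero_mul]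
  · rw [bsplineDeriv_eq_zero (h.knots 1) (hμ 1).1 (hμ 1).2 (hx 1) hs hj, mul_zero]

theorem IsMesh.abs_basisDeriv_le (h : S.IsMesh w κ) {x : Plane} (hx : x ∈ unitSquare) {r s : ℕ}
    (hr : r < S.q 0 - 1) (hs : s < S.q 1 - 1) (j : S.Idx) :
    |S.basisDeriv r s j x| ≤
      (2 * (S.q 0 - 1 : ℕ) / w) ^ r * (2 * (S.q 1 - 1 : ℕ) / w) ^ s := by
  have hw := h.pos
  rw [basisDeriv, abs_mul]
  exact mul_le_mul (abs_bsplineDeriv_le (h.knots 0) h.pos (h.le 0) (hx 0) r _ _ hr le_rfl)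
    (abs_bsplineDeriv_le (h.knots 1) h.pos (h.le 1) (hx 1) s _ _ hs le_rfl) (abs_nonneg _)
    (by positivity)

theorem card_active_le (S : SplineSpace) (μ : Fin 2 → ℕ) (s : Finset S.Idx)
    (hs : ∀ j ∈ s, S.IsActive μ j) : s.card ≤ (S.q 0 - 1 + 1) * (S.q 1 - 1 + 1) := by
  classical
  have hinj : Set.InjOn (fun j : S.Idx => (μ 0 - j.1, μ 1 - j.2)) s := by
    intro i hi j hj hij
    have hi' := hs i hi
    have hj' := hs j hj
    simp only [Prod.mk.injEq] at hij
    obtain ⟨⟨a1, a2⟩, ⟨a3, a4⟩⟩ := hi'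
    obtain ⟨⟨b1, b2⟩, ⟨b3, b4⟩⟩ := hj'
    ext <;> omega
  have := Finset.card_le_card_of_injOn (t := Finset.range (S.q 0 - 1 + 1) ×ˢ
    Finset.range (S.q 1 - 1 + 1)) (fun j : S.Idx => (μ 0 - j.1, μ 1 - j.2)) (by
      intro j hj
      obtain ⟨⟨a1, a2⟩, ⟨a3, a4⟩⟩ := hs j hj
      simp only [Finset.coe_product, Finset.coe_range, Set.mem_prod, Set.mem_Iio]
      omega) hinj
  simpa using this

/-- A derivative of a spline on a knot rectangle is controlled by the active coefficients. -/
theorem IsMesh.abs_fnDeriv_le (h : S.IsMesh w κ) {μ : Fin 2 → ℕ} (hμ : S.IsCell μ) {x : Plane}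
    (hx : x ∈ S.rect μ) {r s : ℕ} (hr : r < S.q 0 - 1) (hs : s < S.q 1 - 1) {θ : S.Idx → ℝ}
    {A : ℝ} (hA0 : 0 ≤ A) (hA : ∀ j, S.IsActive μ j → |θ j| ≤ A) :
    |S.fnDeriv r s θ x| ≤ ((S.q 0 - 1 + 1) * (S.q 1 - 1 + 1) : ℕ) *
      ((2 * (S.q 0 - 1 : ℕ) / w) ^ r * (2 * (S.q 1 - 1 : ℕ) / w) ^ s) * A := by
  classical
  have hw := h.pos
  set E := (2 * ((S.q 0 - 1 : ℕ) : ℝ) / w) ^ r * (2 * (S.q 1 - 1 : ℕ) / w) ^ s with hE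
  have hE0 : 0 ≤ E := by positivity
  set a := Finset.univ.filter fun j => S.IsActive μ j
  have hsum : S.fnDeriv r s θ x = ∑ j ∈ a, S.basisDeriv r s j x * θ j := by
    rw [fnDeriv]
    refine (Finset.sum_subset (Finset.subset_univ _) fun j _ hj => ?_).symm
    rw [h.basisDeriv_eq_zero hμ hx hr hs (by simpa [a] using hj), zero_mul]
  rw [hsum]
  calc |∑ j ∈ a, S.basisDeriv r s j x * θ j| ≤ ∑ _j ∈ a, E * A := by
        refine (Finset.abs_sum_le_sum_abs _ _).trans (Finset.sum_le_sum fun j hj => ?_)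
        rw [abs_mul]
        exact mul_le_mul (h.abs_basisDeriv_le (h.rect_subset μ hx) hr hs j)
          (hA j (by simpa [a] using hj)) (abs_nonneg _) hE0
    _ = a.card * (E * A) := by simp
    _ ≤ ((S.q 0 - 1 + 1) * (S.q 1 - 1 + 1) : ℕ) * (E * A) := by
        gcongr
        exact card_active_le S μ a (by simp [a])
    _ = _ := by ring

theorem IsMesh.hasFDerivWithinAt_basisDeriv (h : S.IsMesh w κ) {r s : ℕ} (hr : r + 1 < S.q 0 - 1)
    (hs : s + 1 < S.q 1 - 1) (j : S.Idx) {x : Plane} :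
    HasFDerivWithinAt (S.basisDeriv r s j)
      (S.basisDeriv (r + 1) s j x • EuclideanSpace.proj (𝕜 := ℝ) (0 : Fin 2) +
        S.basisDeriv r (s + 1) j x • EuclideanSpace.proj (𝕜 := ℝ) (1 : Fin 2)) unitSquare x := by
  have hp : ∀ k : Fin 2, HasFDerivWithinAt (fun y : Plane => y k)
      (EuclideanSpace.proj (𝕜 := ℝ) k : Plane →L[ℝ] ℝ) unitSquare x := fun k =>
    (EuclideanSpace.proj (𝕜 := ℝ) k : Plane →L[ℝ] ℝ).hasFDerivWithinAt
  have h0 := (hasDerivWithinAt_bsplineDeriv (h.knots 0) hr j.1 (x 0)).comp_hasFDerivWithinAt x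
    (hp 0) (fun y hy => hy 0)
  have h1 := (hasDerivWithinAt_bsplineDeriv (h.knots 1) hs j.2 (x 1)).comp_hasFDerivWithinAt x
    (hp 1) (fun y hy => hy 1)
  refine (h0.mul h1).congr_fderiv ?_
  ext v
  simp only [basisDeriv, Function.comp, add_apply,
    smul_apply, smul_eq_mul]
  ring

theorem IsMesh.pderiv_fnDeriv (h : S.IsMesh w κ) {r s : ℕ} (hr : r + 1 < S.q 0 - 1)
    (hs : s + 1 < S.q 1 - 1) (θ : S.Idx → ℝ) :
    EqOn (pderiv 0 (S.fnDeriv r s θ)) (S.fnDeriv (r + 1) s θ) unitSquare ∧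
      EqOn (pderiv 1 (S.fnDeriv r s θ)) (S.fnDeriv r (s + 1) θ) unitSquare := by
  have hd : ∀ x, HasFDerivWithinAt (S.fnDeriv r s θ)
      (∑ j, θ j • (S.basisDeriv (r + 1) s j x • EuclideanSpace.proj (𝕜 := ℝ) (0 : Fin 2) +
        S.basisDeriv r (s + 1) j x • EuclideanSpace.proj (𝕜 := ℝ) (1 : Fin 2))) unitSquare x :=
    fun x => HasFDerivWithinAt.fun_sum fun j _ =>
      (h.hasFDerivWithinAt_basisDeriv hr hs j).mul_const (θ j)
  constructor
  · intro x hx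
    rw [pderiv_eq_of_hasFDerivWithinAt hx (hd x)]
    simp [fnDeriv, mul_comm]
  · intro x hx
    rw [pderiv_eq_of_hasFDerivWithinAt hx (hd x)]
    simp [fnDeriv, mul_comm]

theorem IsMesh.continuousOn_fnDeriv (h : S.IsMesh w κ) {r s : ℕ} (hr : r < S.q 0 - 1)
    (hs : s < S.q 1 - 1) (θ : S.Idx → ℝ) : ContinuousOn (S.fnDeriv r s θ) unitSquare := by
  have hp : ∀ k : Fin 2, ContinuousOn (fun y : Plane => y k) unitSquare := fun k => by fun_prop
  refine continuousOn_finsetSum _ fun j _ => ContinuousOn.mul (ContinuousOn.mul ?_ ?_)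
    continuousOn_const
  · exact (continuousOn_bsplineDeriv (h.knots 0) hr j.1).comp (hp 0) fun y hy => hy 0
  · exact (continuousOn_bsplineDeriv (h.knots 1) hs j.2).comp (hp 1) fun y hy => hy 1

theorem IsMesh.pderiv_fn (h : S.IsMesh w κ) (θ : EuclideanSpace ℝ S.Idx) {x : Plane}
    (hx : x ∈ unitSquare) :
    pderiv 0 (S.fn θ) x = S.fnDeriv 1 0 θ x ∧ pderiv 1 (S.fn θ) x = S.fnDeriv 0 1 θ x ∧
    hess (S.fn θ) x 0 0 = S.fnDeriv 2 0 θ x ∧ hess (S.fn θ) x 0 1 = S.fnDeriv 1 1 θ x ∧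
    hess (S.fn θ) x 1 0 = S.fnDeriv 1 1 θ x ∧ hess (S.fn θ) x 1 1 = S.fnDeriv 0 2 θ x := by
  have q0 := h.four_le 0
  have q1 := h.four_le 1
  have a := h.pderiv_fnDeriv (r := 0) (s := 0) (by omega) (by omega) θ
  have b := h.pderiv_fnDeriv (r := 1) (s := 0) (by omega) (by omega) θ
  have c := h.pderiv_fnDeriv (r := 0) (s := 1) (by omega) (by omega) θ
  rw [S.fn_eq]
  refine ⟨a.1 hx, a.2 hx, ?_, ?_, ?_, ?_⟩
  · exact (pderiv_congr a.1 0 hx).trans (b.1 hx)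
  · exact (pderiv_congr a.2 0 hx).trans (c.1 hx)
  · exact (pderiv_congr a.1 1 hx).trans (b.2 hx)
  · exact (pderiv_congr a.2 1 hx).trans (c.2 hx)

theorem IsMesh.isRegular_fn (h : S.IsMesh w κ) (θ : EuclideanSpace ℝ S.Idx) :
    IsRegular (S.fn θ) := by
  have q0 := h.four_le 0
  have q1 := h.four_le 1
  have hc : ∀ r s, r ≤ 2 → s ≤ 2 → ContinuousOn (S.fnDeriv r s θ) unitSquare := fun r s hr hs =>
    h.continuousOn_fnDeriv (by omega) (by omega) θ
  refine ⟨fun i => ?_, fun i j => ?_, fun x hx => ?_⟩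
  · fin_cases i
    · exact (hc 1 0 (by omega) (by omega)).congr fun x hx => (h.pderiv_fn θ hx).1
    · exact (hc 0 1 (by omega) (by omega)).congr fun x hx => (h.pderiv_fn θ hx).2.1
  · fin_cases i <;> fin_cases j
    · exact (hc 2 0 (by omega) (by omega)).congr fun x hx => (h.pderiv_fn θ hx).2.2.1
    · exact (hc 1 1 (by omega) (by omega)).congr fun x hx => (h.pderiv_fn θ hx).2.2.2.1
    · exact (hc 1 1 (by omega) (by omega)).congr fun x hx => (h.pderiv_fn θ hx).2.2.2.2.1
    · exact (hc 0 2 (by omega) (by omega)).congr fun x hx => (h.pderiv_fn θ hx).2.2.2.2.2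
  · rw [(h.pderiv_fn θ hx).2.2.2.2.1, (h.pderiv_fn θ hx).2.2.2.1]

theorem fnDeriv_sub (r s : ℕ) (θ ζ : S.Idx → ℝ) (x : Plane) :
    S.fnDeriv r s (fun j => θ j - ζ j) x = S.fnDeriv r s θ x - S.fnDeriv r s ζ x := by
  simp [fnDeriv, mul_sub, Finset.sum_sub_distrib]

/-- The sizes of the derivatives of a spline of order at most two, in terms of the mesh width. -/
theorem exists_abs_fnDeriv_le (q : Fin 2 → ℕ) : ∃ K : ℝ, 0 < K ∧ ∀ (S : SplineSpace) (w κ : ℝ),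
    S.q = q → S.IsMesh w κ → w ≤ 1 → ∀ μ, S.IsCell μ → ∀ x ∈ S.rect μ, ∀ r s : ℕ, r + s ≤ 2 →
    ∀ (θ : S.Idx → ℝ) (A : ℝ), 0 ≤ A → (∀ j, S.IsActive μ j → |θ j| ≤ A) →
      |S.fnDeriv r s θ x| ≤ K * (w ^ 2)⁻¹ * A ∧
      (r = 0 → s = 0 → |S.fnDeriv r s θ x| ≤ K * A) := by
  set Q : ℝ := 2 * (q 0 : ℝ) + 2 * q 1 + 1 with hQ
  set c : ℝ := (((q 0 - 1 + 1) * (q 1 - 1 + 1) : ℕ) : ℝ) with hc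
  have hc0 : 0 < c := by rw [hc]; positivity
  have hQ1 : 1 ≤ Q := by
    have : (0 : ℝ) ≤ 2 * (q 0 : ℝ) + 2 * q 1 := by positivity
    linarith
  refine ⟨c * Q ^ 2, by positivity, ?_⟩
  rintro S w κ rfl h hw1 μ hμ x hx r s hrs θ A hA0 hA
  have q0 := h.four_le 0
  have q1 := h.four_le 1
  have hw := h.pos
  have hb := h.abs_fnDeriv_le hμ hx (r := r) (s := s) (by omega) (by omega) hA0 hA
  have hQw : 1 ≤ Q / w := by rw [le_div_iff₀ hw]; linarith
  constructor
  · refine hb.trans ?_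
    have e0 : ((S.q 0 - 1 : ℕ) : ℝ) ≤ S.q 0 := by exact_mod_cast Nat.sub_le _ _
    have e1 : ((S.q 1 - 1 : ℕ) : ℝ) ≤ S.q 1 := by exact_mod_cast Nat.sub_le _ _
    have h0 : (0 : ℝ) ≤ S.q 0 := by positivity
    have h1 : (0 : ℝ) ≤ S.q 1 := by positivity
    have hE : (2 * ((S.q 0 - 1 : ℕ) : ℝ) / w) ^ r * (2 * ((S.q 1 - 1 : ℕ) : ℝ) / w) ^ s ≤
        Q ^ 2 * (w ^ 2)⁻¹ := by
      calc (2 * ((S.q 0 - 1 : ℕ) : ℝ) / w) ^ r * (2 * ((S.q 1 - 1 : ℕ) : ℝ) / w) ^ s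
          ≤ (Q / w) ^ r * (Q / w) ^ s := by
            gcongr <;> linarith
        _ = (Q / w) ^ (r + s) := by rw [pow_add]
        _ ≤ (Q / w) ^ 2 := pow_le_pow_right₀ hQw hrs
        _ = Q ^ 2 * (w ^ 2)⁻¹ := by rw [div_pow, div_eq_mul_inv]
    calc c * ((2 * ((S.q 0 - 1 : ℕ) : ℝ) / w) ^ r * (2 * ((S.q 1 - 1 : ℕ) : ℝ) / w) ^ s) * A
        ≤ c * (Q ^ 2 * (w ^ 2)⁻¹) * A := by gcongr
      _ = c * Q ^ 2 * (w ^ 2)⁻¹ * A := by ring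
  · rintro rfl rfl
    refine hb.trans ?_
    simp only [pow_zero, mul_one]
    have : 1 ≤ Q ^ 2 := one_le_pow₀ hQ1
    have : c * 1 ≤ c * Q ^ 2 := by gcongr
    rw [mul_one] at this
    gcongr

end SplineSpace

end Tensor

/-! ### Tensor product splines: local stability and polynomials -/

section TensorLocal

namespace SplineSpace

open Polynomial

variable {S : SplineSpace} {w κ : ℝ}

/-- The coefficients as a doubly indexed sequence, extended by zero. -/
def extCoeff (S : SplineSpace) (θ : S.Idx → ℝ) (a b : ℕ) : ℝ :=
  if h : a < S.J 0 ∧ b < S.J 1 then θ (⟨a, h.1⟩, ⟨b, h.2⟩) else 0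

theorem extCoeff_coe (θ : S.Idx → ℝ) (j : S.Idx) : S.extCoeff θ j.1 j.2 = θ j := by
  simp [extCoeff]

/-- The restriction of a spline to the horizontal line at height `y` through a knot rectangle. -/
def rowPoly (S : SplineSpace) (μ : Fin 2 → ℕ) (θ : S.Idx → ℝ) (y : ℝ) : ℝ[X] :=
  ∑ a ∈ Finset.range (S.J 0),
    C (∑ b ∈ Finset.range (S.J 1),
      S.extCoeff θ a b * (cellPoly (S.knot 1) (μ 1) (S.q 1 - 1) b).eval y) *
    cellPoly (S.knot 0) (μ 0) (S.q 0 - 1) a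

/-- The restriction of a spline to the vertical line at `x` through a knot rectangle. -/
def colPoly (S : SplineSpace) (μ : Fin 2 → ℕ) (θ : S.Idx → ℝ) (x : ℝ) : ℝ[X] :=
  ∑ b ∈ Finset.range (S.J 1),
    C (∑ a ∈ Finset.range (S.J 0),
      S.extCoeff θ a b * (cellPoly (S.knot 0) (μ 0) (S.q 0 - 1) a).eval x) *
    cellPoly (S.knot 1) (μ 1) (S.q 1 - 1) b

theorem eval_rowPoly_eq (μ : Fin 2 → ℕ) (θ : S.Idx → ℝ) (x y : ℝ) :
    (S.rowPoly μ θ y).eval x = (S.colPoly μ θ x).eval y := by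
  simp only [rowPoly, colPoly, eval_finsetSum, eval_mul, eval_C, Finset.sum_mul]
  rw [Finset.sum_comm]
  exact Finset.sum_congr rfl fun b _ => Finset.sum_congr rfl fun a _ => by ring

theorem IsMesh.fnDeriv_eq_rowPoly (h : S.IsMesh w κ) {μ : Fin 2 → ℕ} (hμ : S.IsCell μ) {x : Plane}
    (hx : x ∈ S.rect μ) (θ : S.Idx → ℝ) :
    S.fnDeriv 0 0 θ x = (S.rowPoly μ θ (x 1)).eval (x 0) := by
  have q0 := h.four_le 0
  have q1 := h.four_le 1
  have e0 : ∀ a, bsplineDeriv (S.knot 0) 0 (S.q 0 - 1) a (x 0) =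
      (cellPoly (S.knot 0) (μ 0) (S.q 0 - 1) a).eval (x 0) := fun a =>
    bsplineDeriv_eq (h.knots 0) (hμ 0).1 (hμ 0).2 (hx 0) 0 _ a (by omega)
  have e1 : ∀ b, bsplineDeriv (S.knot 1) 0 (S.q 1 - 1) b (x 1) =
      (cellPoly (S.knot 1) (μ 1) (S.q 1 - 1) b).eval (x 1) := fun b =>
    bsplineDeriv_eq (h.knots 1) (hμ 1).1 (hμ 1).2 (hx 1) 0 _ b (by omega)
  simp only [rowPoly, eval_finsetSum, eval_mul, eval_C]
  rw [fnDeriv, Fintype.sum_prod_type, ← Fin.sum_univ_eq_sum_range (fun a =>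
    (∑ b ∈ Finset.range (S.J 1),
      S.extCoeff θ a b * (cellPoly (S.knot 1) (μ 1) (S.q 1 - 1) b).eval (x 1)) *
    (cellPoly (S.knot 0) (μ 0) (S.q 0 - 1) a).eval (x 0))]
  refine Finset.sum_congr rfl fun a _ => ?_
  rw [← Fin.sum_univ_eq_sum_range (fun b =>
      S.extCoeff θ a b * (cellPoly (S.knot 1) (μ 1) (S.q 1 - 1) b).eval (x 1)), Finset.sum_mul]
  refine Finset.sum_congr rfl fun b _ => ?_
  rw [basisDeriv, e0, e1, ← extCoeff_coe θ (a, b)]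
  ring

theorem IsMesh.cell_lt (h : S.IsMesh w κ) {μ : Fin 2 → ℕ} (hμ : S.IsCell μ) (k : Fin 2) :
    S.knot k (μ k) < S.knot k (μ k + 1) := (h.knots k).lt _ (hμ k).1 (hμ k).2

theorem IsMesh.cell_lt_J (h : S.IsMesh w κ) {μ : Fin 2 → ℕ} (hμ : S.IsCell μ) (k : Fin 2) :
    μ k < S.J k := by
  have := h.four_le k
  have := (hμ k).2
  simp only [SplineSpace.J]
  omega

theorem mem_rect_mk {μ : Fin 2 → ℕ} {x y : ℝ}
    (hx : x ∈ Icc (S.knot 0 (μ 0)) (S.knot 0 (μ 0 + 1)))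
    (hy : y ∈ Icc (S.knot 1 (μ 1)) (S.knot 1 (μ 1 + 1))) : !₂[x, y] ∈ S.rect μ := by
  intro k
  fin_cases k
  · simpa using hx
  · simpa using hy

/-- Local stability of the tensor product B-spline basis. -/
theorem exists_abs_coeff_le (q : Fin 2 → ℕ) {κ : ℝ} (hκ : 0 < κ) : ∃ K : ℝ, 0 < K ∧
    ∀ (S : SplineSpace) (w : ℝ), S.q = q → S.IsMesh w κ → ∀ μ, S.IsCell μ →
    ∀ (θ : S.Idx → ℝ) (A : ℝ), (∀ x ∈ S.rect μ, |S.fnDeriv 0 0 θ x| ≤ A) →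
      ∀ j, S.IsActive μ j → |θ j| ≤ K * A := by
  obtain ⟨K0, hK0, h0⟩ := exists_coeff_bound hκ (q 0 - 1)
  obtain ⟨K1, hK1, h1⟩ := exists_coeff_bound hκ (q 1 - 1)
  refine ⟨K1 * K0, by positivity, ?_⟩
  rintro S w rfl h μ hμ θ A hA j hj
  have hstep : ∀ k m, S.knot k (m + 1) - S.knot k m ≤
      κ * (S.knot k (μ k + 1) - S.knot k (μ k)) := fun k m =>
    (h.le_mul k m).trans (by gcongr; exact h.le k (μ k) (hμ k).1 (hμ k).2)
  have hrow : ∀ y ∈ Icc (S.knot 1 (μ 1)) (S.knot 1 (μ 1 + 1)),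
      |∑ b ∈ Finset.range (S.J 1), S.extCoeff θ j.1 b *
        (cellPoly (S.knot 1) (μ 1) (S.q 1 - 1) b).eval y| ≤ K0 * A := by
    intro y hy
    refine h0 (S.knot 0) (μ 0) (S.J 0) (h.knots 0).mono (h.cell_lt hμ 0) (hstep 0) (hμ 0).1
      (h.cell_lt_J hμ 0) (fun a => ∑ b ∈ Finset.range (S.J 1), S.extCoeff θ a b *
        (cellPoly (S.knot 1) (μ 1) (S.q 1 - 1) b).eval y) A ?_ j.1 hj.1.1 hj.1.2
    intro x hx
    have hm := mem_rect_mk hx hy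
    have := hA _ hm
    rw [h.fnDeriv_eq_rowPoly hμ hm] at this
    simpa [rowPoly] using this
  have := h1 (S.knot 1) (μ 1) (S.J 1) (h.knots 1).mono (h.cell_lt hμ 1) (hstep 1) (hμ 1).1
      (h.cell_lt_J hμ 1) (fun b => S.extCoeff θ j.1 b) (K0 * A) (by
        intro y hy
        have := hrow y hy
        simpa [eval_finsetSum] using this) j.2 hj.2.1 hj.2.2
  rw [extCoeff_coe] at this
  linarith [this]

theorem abs_eval_sub_le {d : ℕ} {M : ℝ}
    (hM : ∀ p : ℝ[X], p.natDegree ≤ d → ∀ a b A : ℝ, a < b →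
      (∀ x ∈ Icc a b, |p.eval x| ≤ A) → ∀ x ∈ Icc a b, |p.derivative.eval x| ≤ M / (b - a) * A)
    {p : ℝ[X]} (hp : p.natDegree ≤ d) {a b A : ℝ} (hab : a < b)
    (hA : ∀ x ∈ Icc a b, |p.eval x| ≤ A) {x y : ℝ} (hx : x ∈ Icc a b) (hy : y ∈ Icc a b) :
    |p.eval x - p.eval y| ≤ M / (b - a) * A * |x - y| :=
  (convex_Icc a b).norm_image_sub_le_of_norm_hasDerivWithin_le
    (fun z _ => (p.hasDerivAt z).hasDerivWithinAt) (fun z hz => hM p hp a b A hab hA z hz) hy hx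

theorem natDegree_rowPoly_le (μ : Fin 2 → ℕ) (θ : S.Idx → ℝ) (y : ℝ) :
    (S.rowPoly μ θ y).natDegree ≤ S.q 0 - 1 :=
  natDegree_sum_le_of_forall_le _ _ fun _ _ =>
    (natDegree_C_mul_le _ _).trans (natDegree_cellPoly_le _ _ _ _)

theorem natDegree_colPoly_le (μ : Fin 2 → ℕ) (θ : S.Idx → ℝ) (x : ℝ) :
    (S.colPoly μ θ x).natDegree ≤ S.q 1 - 1 :=
  natDegree_sum_le_of_forall_le _ _ fun _ _ =>
    (natDegree_C_mul_le _ _).trans (natDegree_cellPoly_le _ _ _ _)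

/-- In each knot rectangle there is a point (a maximum point of the modulus) near which the spline
is at least as large as its active coefficients, up to a constant. -/
theorem exists_peak (q : Fin 2 → ℕ) {κ : ℝ} (hκ : 0 < κ) : ∃ K : ℝ, 0 < K ∧
    ∀ (S : SplineSpace) (w : ℝ), S.q = q → S.IsMesh w κ → ∀ μ, S.IsCell μ →
    ∀ θ : S.Idx → ℝ, ∃ z ∈ S.rect μ, ∀ y ∈ S.rect μ, (∀ k, |y k - z k| ≤ w / K) →
      ∀ j, S.IsActive μ j → |θ j| ≤ K * |S.fnDeriv 0 0 θ y| := by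
  obtain ⟨K, hK, hcoef⟩ := exists_abs_coeff_le q hκ
  obtain ⟨M0, hM0, hd0⟩ := exists_derivative_bound (q 0 - 1)
  obtain ⟨M1, hM1, hd1⟩ := exists_derivative_bound (q 1 - 1)
  set L := 2 * K + 4 * M0 + 4 * M1 with hL
  have hLpos : 0 < L := by positivity
  refine ⟨L, hLpos, ?_⟩
  rintro S w rfl h μ hμ θ
  have q0 := h.four_le 0
  have q1 := h.four_le 1
  have hw := h.pos
  have hne : (S.rect μ).Nonempty :=
    ⟨_, mem_rect_mk ⟨le_rfl, (h.cell_lt hμ 0).le⟩ ⟨le_rfl, (h.cell_lt hμ 1).le⟩⟩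
  have hcont : ContinuousOn (fun x => |S.fnDeriv 0 0 θ x|) (S.rect μ) :=
    ((h.continuousOn_fnDeriv (by omega) (by omega) θ).mono (h.rect_subset μ)).abs
  obtain ⟨z, hz, hmax⟩ := (isCompact_box _ _).exists_isMaxOn hne hcont
  set A := |S.fnDeriv 0 0 θ z| with hA
  have hA0 : 0 ≤ A := abs_nonneg _
  have hle : ∀ x ∈ S.rect μ, |S.fnDeriv 0 0 θ x| ≤ A := fun x hx => hmax hx
  refine ⟨z, hz, fun y hy hyz j hj => ?_⟩
  have hcell0 := h.le 0 (μ 0) (hμ 0).1 (hμ 0).2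
  have hcell1 := h.le 1 (μ 1) (hμ 1).1 (hμ 1).2
  -- by the bounds for derivatives of polynomials, moving from `z` to `y` one coordinate at a time
  -- changes the spline by at most half of its maximum `A`
  have hrow : ∀ v ∈ Icc (S.knot 1 (μ 1)) (S.knot 1 (μ 1 + 1)),
      ∀ u ∈ Icc (S.knot 0 (μ 0)) (S.knot 0 (μ 0 + 1)), |(S.rowPoly μ θ v).eval u| ≤ A := by
    intro v hv u hu
    have hm := mem_rect_mk hu hv
    have := hle _ hm
    rw [h.fnDeriv_eq_rowPoly hμ hm] at this
    simpa using this
  have e1 : |(S.rowPoly μ θ (y 1)).eval (y 0) - (S.rowPoly μ θ (y 1)).eval (z 0)| ≤ A / 4 := by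
    have h1 := abs_eval_sub_le hd0 (natDegree_rowPoly_le μ θ (y 1)) (h.cell_lt hμ 0)
      (hrow _ (hy 1)) (hy 0) (hz 0)
    refine h1.trans ?_
    calc M0 / (S.knot 0 (μ 0 + 1) - S.knot 0 (μ 0)) * A * |y 0 - z 0|
        ≤ M0 / w * A * (w / L) := by gcongr; exact hyz 0
      _ = M0 / L * A := by field_simp
      _ ≤ 1 / 4 * A :=
          mul_le_mul_of_nonneg_right (by rw [div_le_iff₀ hLpos]; linarith) hA0
      _ = A / 4 := by ring
  have e2 : |(S.colPoly μ θ (z 0)).eval (y 1) - (S.colPoly μ θ (z 0)).eval (z 1)| ≤ A / 4 := by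
    have h1 := abs_eval_sub_le hd1 (natDegree_colPoly_le μ θ (z 0)) (h.cell_lt hμ 1)
      (fun v hv => by rw [← eval_rowPoly_eq]; exact hrow v hv _ (hz 0)) (hy 1) (hz 1)
    refine h1.trans ?_
    calc M1 / (S.knot 1 (μ 1 + 1) - S.knot 1 (μ 1)) * A * |y 1 - z 1|
        ≤ M1 / w * A * (w / L) := by gcongr; exact hyz 1
      _ = M1 / L * A := by field_simp
      _ ≤ 1 / 4 * A :=
          mul_le_mul_of_nonneg_right (by rw [div_le_iff₀ hLpos]; linarith) hA0
      _ = A / 4 := by ring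
  rw [← eval_rowPoly_eq, ← eval_rowPoly_eq] at e2
  have hzA : A ≤ |S.fnDeriv 0 0 θ y| + A / 2 := by
    rw [hA, h.fnDeriv_eq_rowPoly hμ hz, h.fnDeriv_eq_rowPoly hμ hy]
    have t1 := abs_sub_abs_le_abs_sub ((S.rowPoly μ θ (z 1)).eval (z 0))
      ((S.rowPoly μ θ (y 1)).eval (y 0))
    have t2 := abs_sub_le ((S.rowPoly μ θ (y 1)).eval (y 0)) ((S.rowPoly μ θ (y 1)).eval (z 0))
      ((S.rowPoly μ θ (z 1)).eval (z 0))
    rw [abs_sub_comm] at t1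
    have t3 : A = |(S.rowPoly μ θ (z 1)).eval (z 0)| := by
      rw [hA, h.fnDeriv_eq_rowPoly hμ hz]
    rw [← t3] at t1 ⊢
    linarith
  have hj' := hcoef S w rfl h μ hμ θ A hle j hj
  calc |θ j| ≤ K * A := hj'
    _ ≤ K * (2 * |S.fnDeriv 0 0 θ y|) := by gcongr; linarith
    _ = 2 * K * |S.fnDeriv 0 0 θ y| := by ring
    _ ≤ L * |S.fnDeriv 0 0 θ y| := by gcongr; linarith

/-- Monomials of coordinate degrees less than the orders are splines. -/
theorem IsMesh.exists_coeff_monomial (h : S.IsMesh w κ) (z : Plane) {a b : ℕ} (ha : a < S.q 0)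
    (hb : b < S.q 1) : ∃ θ : S.Idx → ℝ, ∀ x ∈ unitSquare,
      S.fnDeriv 0 0 θ x = (x 0 - z 0) ^ a * (x 1 - z 1) ^ b := by
  have q0 := h.four_le 0
  have q1 := h.four_le 1
  obtain ⟨θ0, h0⟩ := exists_coeff_of_polynomial (h.knots 0) (S.q 0 - 1) le_rfl
    ((X - C (z 0)) ^ a) (by rw [natDegree_pow, natDegree_X_sub_C]; omega)
  obtain ⟨θ1, h1⟩ := exists_coeff_of_polynomial (h.knots 1) (S.q 1 - 1) le_rfl
    ((X - C (z 1)) ^ b) (by rw [natDegree_pow, natDegree_X_sub_C]; omega)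
  refine ⟨fun j => θ0 j.1 * θ1 j.2, fun x hx => ?_⟩
  obtain ⟨μ, hμ, hxμ, -⟩ := h.exists_cell hx
  have e0 : ∀ i, bsplineDeriv (S.knot 0) 0 (S.q 0 - 1) i (x 0) =
      (cellPoly (S.knot 0) (μ 0) (S.q 0 - 1) i).eval (x 0) := fun i =>
    bsplineDeriv_eq (h.knots 0) (hμ 0).1 (hμ 0).2 (hxμ 0) 0 _ i (by omega)
  have e1 : ∀ i, bsplineDeriv (S.knot 1) 0 (S.q 1 - 1) i (x 1) =
      (cellPoly (S.knot 1) (μ 1) (S.q 1 - 1) i).eval (x 1) := fun i =>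
    bsplineDeriv_eq (h.knots 1) (hμ 1).1 (hμ 1).2 (hxμ 1) 0 _ i (by omega)
  have s0 : ∑ i : Fin (S.J 0), θ0 i * (cellPoly (S.knot 0) (μ 0) (S.q 0 - 1) i).eval (x 0) =
      (x 0 - z 0) ^ a := by
    have := congrArg (eval (x 0)) (h0 (μ 0) (hμ 0).1 (hμ 0).2)
    rw [Fin.sum_univ_eq_sum_range (fun i => θ0 i *
      (cellPoly (S.knot 0) (μ 0) (S.q 0 - 1) i).eval (x 0))]
    rw [show S.J 0 = S.q 0 - 1 + S.N 0 + 1 by simp only [SplineSpace.J]; omega]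
    simpa [eval_finsetSum] using this
  have s1 : ∑ i : Fin (S.J 1), θ1 i * (cellPoly (S.knot 1) (μ 1) (S.q 1 - 1) i).eval (x 1) =
      (x 1 - z 1) ^ b := by
    have := congrArg (eval (x 1)) (h1 (μ 1) (hμ 1).1 (hμ 1).2)
    rw [Fin.sum_univ_eq_sum_range (fun i => θ1 i *
      (cellPoly (S.knot 1) (μ 1) (S.q 1 - 1) i).eval (x 1))]
    rw [show S.J 1 = S.q 1 - 1 + S.N 1 + 1 by simp only [SplineSpace.J]; omega]
    simpa [eval_finsetSum] using this
  rw [fnDeriv, Fintype.sum_prod_type, ← s0, ← s1, Finset.sum_mul_sum]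
  refine Finset.sum_congr rfl fun i _ => Finset.sum_congr rfl fun l _ => ?_
  rw [basisDeriv, e0, e1]
  ring

theorem IsMesh.exists_coeff_sum_monomial (h : S.IsMesh w κ) (z : Plane) {ι : Type*} (F : Finset ι)
    (c : ι → ℝ) (a b : ι → ℕ) (ha : ∀ i ∈ F, a i < S.q 0) (hb : ∀ i ∈ F, b i < S.q 1) :
    ∃ θ : S.Idx → ℝ, ∀ x ∈ unitSquare,
      S.fnDeriv 0 0 θ x = ∑ i ∈ F, c i * ((x 0 - z 0) ^ a i * (x 1 - z 1) ^ b i) := by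
  classical
  have hex : ∀ i : ι, ∃ θ : S.Idx → ℝ, i ∈ F → ∀ x ∈ unitSquare,
      S.fnDeriv 0 0 θ x = (x 0 - z 0) ^ a i * (x 1 - z 1) ^ b i := by
    intro i
    by_cases hi : i ∈ F
    · obtain ⟨θ, hθ⟩ := h.exists_coeff_monomial z (ha i hi) (hb i hi)
      exact ⟨θ, fun _ => hθ⟩
    · exact ⟨0, fun hi' => absurd hi' hi⟩
  choose θ hθ using hex
  refine ⟨fun j => ∑ i ∈ F, c i * θ i j, fun x hx => ?_⟩
  have : S.fnDeriv 0 0 (fun j => ∑ i ∈ F, c i * θ i j) x =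
      ∑ i ∈ F, c i * S.fnDeriv 0 0 (θ i) x := by
    simp only [fnDeriv, Finset.mul_sum]
    rw [Finset.sum_comm]
    exact Finset.sum_congr rfl fun i _ => Finset.sum_congr rfl fun j _ => by ring
  rw [this]
  exact Finset.sum_congr rfl fun i hi => by rw [hθ i hi x hx]

end SplineSpace

end TensorLocal

/-! ### Taylor polynomials of Hölder functions -/

section Taylor

/-- Taylor's formula with Hölder remainder for functions of one variable. -/
theorem abs_sub_taylor_le {C β : ℝ} (hβ : 0 < β) {s : Set ℝ} (hs : Convex ℝ s) (m : ℕ) :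
    ∀ u : ℕ → ℝ → ℝ, (∀ k < m, ∀ x ∈ s, HasDerivWithinAt (u k) (u (k + 1) x) s x) →
      ∀ z ∈ s, (∀ x ∈ s, |u m x - u m z| ≤ C * |x - z| ^ β) →
      ∀ x ∈ s, |u 0 x - ∑ k ∈ Finset.range (m + 1), u k z / k.factorial * (x - z) ^ k| ≤
        C * |x - z| ^ (m + β) := by
  induction m with
  | zero =>
    intro u _ z _ h x hx
    simpa using h x hx
  | succ m ih =>
    intro u hu z hz h x hx
    have hih := ih (fun k => u (k + 1)) (fun k hk y hy => hu (k + 1) (by omega) y hy) z hz h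
    set W : ℝ → ℝ := fun y =>
      u 0 y - ∑ k ∈ Finset.range (m + 1 + 1), u k z / k.factorial * (y - z) ^ k with hW
    set W' : ℝ → ℝ := fun y =>
      u 1 y - ∑ k ∈ Finset.range (m + 1), u (k + 1) z / k.factorial * (y - z) ^ k with hW'
    have hsub : segment ℝ z x ⊆ s := hs.segment_subset hz hx
    have hder : ∀ y ∈ segment ℝ z x, HasDerivWithinAt W (W' y) (segment ℝ z x) y := by
      intro y hy
      refine ((hu 0 (by omega) y (hsub hy)).mono hsub).sub (HasDerivAt.hasDerivWithinAt ?_)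
      have h1 : (fun t : ℝ => ∑ k ∈ Finset.range (m + 1 + 1),
          u k z / k.factorial * (t - z) ^ k) = fun t => ∑ k ∈ Finset.range (m + 1),
          u (k + 1) z / (k + 1).factorial * (t - z) ^ (k + 1) + u 0 z := by
        funext t
        rw [Finset.sum_range_succ']
        simp
      rw [h1]
      refine HasDerivAt.add_const _ (HasDerivAt.fun_sum fun k _ => ?_)
      have h2 := ((((hasDerivAt_id y).sub_const z).pow (k + 1)).const_mul
        (u (k + 1) z / (k + 1).factorial))
      refine h2.congr_deriv ?_
      have : ((k + 1).factorial : ℝ) = (k + 1) * k.factorial := by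
        rw [Nat.factorial_succ]; push_cast; ring
      rw [this]
      have hk : (k.factorial : ℝ) ≠ 0 := by positivity
      have hk1 : (k : ℝ) + 1 ≠ 0 := by positivity
      simp only [id, Nat.add_sub_cancel]
      push_cast
      field_simp
    have hseg : ∀ y ∈ segment ℝ z x, |y - z| ≤ |x - z| := by
      intro y hy
      obtain ⟨t, ht, rfl⟩ := (segment_eq_image' ℝ z x) ▸ hy
      simp only [smul_eq_mul, add_sub_cancel_left, abs_mul]
      rw [abs_of_nonneg ht.1]
      exact mul_le_of_le_one_left (abs_nonneg _) ht.2
    have hC : x ≠ z → 0 ≤ C := by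
      intro hxz
      have h1 := (abs_nonneg _).trans (h x hx)
      exact nonneg_of_mul_nonneg_left h1 (Real.rpow_pos_of_pos (abs_pos.2 (sub_ne_zero.2 hxz)) _)
    have hWz : W z = 0 := by
      simp only [hW]
      rw [Finset.sum_range_succ']
      simp
    rcases eq_or_ne x z with rfl | hxz
    · change |W x| ≤ _
      rw [hWz, sub_self, abs_zero, Real.zero_rpow (by positivity), mul_zero]
    · have hb := (convex_segment (𝕜 := ℝ) z x).norm_image_sub_le_of_norm_hasDerivWithin_le
        (C := C * |x - z| ^ (m + β)) hder (fun y hy => by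
          refine (hih y (hsub hy)).trans ?_
          have := hC hxz
          exact mul_le_mul_of_nonneg_left
            (Real.rpow_le_rpow (abs_nonneg _) (hseg y hy) (by positivity)) this) (left_mem_segment ℝ z x) (right_mem_segment ℝ z x)
      rw [hWz, sub_zero] at hb
      refine hb.trans (le_of_eq ?_)
      have hpos : 0 < |x - z| := abs_pos.2 (sub_ne_zero.2 hxz)
      rw [Real.norm_eq_abs, mul_assoc, ← Real.rpow_add_one hpos.ne']
      congr 2
      push_cast
      ring

theorem contDiffOn_iterate_pderiv {f : Plane → ℝ} (i : Fin 2) (r : ℕ) : ∀ {m : ℕ},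
    ContDiffOn ℝ ((m + r : ℕ) : ℕ∞) f unitSquare →
      ContDiffOn ℝ (m : ℕ∞) ((pderiv i)^[r] f) unitSquare := by
  induction r with
  | zero => intro m h; exact h
  | succ r ih =>
    intro m h
    rw [Function.iterate_succ_apply']
    exact contDiffOn_pderiv (ih (m := m + 1) (by rwa [show m + 1 + r = m + (r + 1) by ring])) i

theorem contDiffOn_mixedDeriv {f : Plane → ℝ} {m : ℕ} (hf : ContDiffOn ℝ (m : ℕ∞) f unitSquare)
    {a b k : ℕ} (h : k + a + b ≤ m) : ContDiffOn ℝ (k : ℕ∞) (mixedDeriv a b f) unitSquare :=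
  contDiffOn_iterate_pderiv 0 a (contDiffOn_iterate_pderiv 1 b
    (hf.of_le (by exact_mod_cast h)))

/-- The affine line through `x` in the direction of the `i`-th coordinate. -/
theorem hasDerivWithinAt_line {g : Plane → ℝ} (hg : ContDiffOn ℝ (1 : ℕ) g unitSquare) (i : Fin 2)
    {γ : ℝ → Plane} (hγ : ∀ t, HasDerivAt γ (EuclideanSpace.single i 1) t)
    (hmem : ∀ t ∈ Icc (0 : ℝ) 1, γ t ∈ unitSquare) {t : ℝ} (ht : t ∈ Icc (0 : ℝ) 1) :
    HasDerivWithinAt (fun t => g (γ t)) (pderiv i g (γ t)) (Icc 0 1) t := by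
  have hd : DifferentiableWithinAt ℝ g unitSquare (γ t) :=
    (hg.differentiableOn (by norm_num)) _ (hmem t ht)
  exact hd.hasFDerivWithinAt.comp_hasDerivWithinAt t (hγ t).hasDerivWithinAt
    (fun s hs => hmem s hs)

theorem hasDerivAt_mk_left (c t : ℝ) :
    HasDerivAt (fun t : ℝ => (!₂[t, c] : Plane)) (EuclideanSpace.single 0 1) t := by
  have h : (fun t : ℝ => (!₂[t, c] : Plane)) =
      fun t => t • EuclideanSpace.single 0 1 + !₂[0, c] := by
    funext t; ext k; fin_cases k <;> simp
  rw [h]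
  simpa using (hasDerivAt_id t).smul_const (EuclideanSpace.single 0 1 : Plane)

theorem hasDerivAt_mk_right (c t : ℝ) :
    HasDerivAt (fun t : ℝ => (!₂[c, t] : Plane)) (EuclideanSpace.single 1 1) t := by
  have h : (fun t : ℝ => (!₂[c, t] : Plane)) =
      fun t => t • EuclideanSpace.single 1 1 + !₂[c, 0] := by
    funext t; ext k; fin_cases k <;> simp
  rw [h]
  simpa using (hasDerivAt_id t).smul_const (EuclideanSpace.single 1 1 : Plane)

theorem mk_mem_unitSquare {x y : ℝ} (hx : x ∈ Icc (0 : ℝ) 1) (hy : y ∈ Icc (0 : ℝ) 1) :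
    (!₂[x, y] : Plane) ∈ unitSquare := by
  intro k
  fin_cases k
  · simpa using hx
  · simpa using hy

/-- Index set of the Taylor polynomial of degree `m`: the pairs `(b, a)` with `a + b ≤ m`. -/
def taylorIdx (m : ℕ) : Finset (Σ _ : ℕ, ℕ) :=
  (Finset.range (m + 1)).sigma fun b => Finset.range (m + 1 - b)

/-- The coefficients of the Taylor polynomial of `f` at `z`. -/
def taylorCoeff (f : Plane → ℝ) (z : Plane) (i : Σ _ : ℕ, ℕ) : ℝ :=
  mixedDeriv i.2 i.1 f z / (i.2.factorial * i.1.factorial)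

/-- The Taylor polynomial of `f` at `z` of total degree `m`. -/
def taylorPoly (m : ℕ) (f : Plane → ℝ) (z x : Plane) : ℝ :=
  ∑ i ∈ taylorIdx m, taylorCoeff f z i * ((x 0 - z 0) ^ i.2 * (x 1 - z 1) ^ i.1)

/-- Taylor's formula on the square, by expanding first in the second coordinate and then the
coefficients in the first coordinate. -/
theorem exists_abs_sub_taylorPoly_le {α : ℝ} (hα : 1 < α) {f : Plane → ℝ} (hf : IsHolder α f) :
    ∃ K : ℝ, 0 < K ∧ ∀ z ∈ unitSquare, ∀ x ∈ unitSquare, ∀ D : ℝ, (∀ k, |x k - z k| ≤ D) →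
      |f x - taylorPoly (strictFloor α) f z x| ≤ K * D ^ α := by
  obtain ⟨hcd, C, -, hH⟩ := hf
  set m := strictFloor α with hm
  have hmα : (m : ℝ) < α := by
    have h1 : 0 < ⌈α⌉₊ := Nat.ceil_pos.2 (by linarith)
    have h2 : (⌈α⌉₊ : ℝ) < α + 1 := Nat.ceil_lt_add_one (by linarith)
    rw [hm, strictFloor, Nat.cast_sub h1]
    push_cast
    linarith
  set β := α - m with hβdef
  have hβ : 0 < β := sub_pos.2 hmα
  set C' := max C 1 with hC'
  have hC'0 : 0 < C' := lt_max_of_lt_right one_pos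
  refine ⟨C' * (m + 2), by positivity, fun z hz x hx D hD => ?_⟩
  have hD0 : 0 ≤ D := (abs_nonneg _).trans (hD 0)
  -- expansion in the second coordinate, on the vertical line through `x`
  have e1 : |f !₂[x 0, x 1] - ∑ b ∈ Finset.range (m + 1),
      mixedDeriv 0 b f !₂[x 0, z 1] / b.factorial * (x 1 - z 1) ^ b| ≤
      C' * |x 1 - z 1| ^ (m + β) := by
    refine abs_sub_taylor_le hβ (convex_Icc 0 1) m (fun b t => mixedDeriv 0 b f !₂[x 0, t])
      ?_ (z 1) (hz 1) ?_ (x 1) (hx 1)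
    · intro b hb t ht
      have h1 : ContDiffOn ℝ (1 : ℕ) (mixedDeriv 0 b f) unitSquare :=
        contDiffOn_mixedDeriv hcd (by omega)
      have h2 := hasDerivWithinAt_line h1 1 (γ := fun t => !₂[x 0, t])
        (hasDerivAt_mk_right (x 0)) (fun t ht => mk_mem_unitSquare (hx 0) ht) ht
      have h3 : mixedDeriv 0 (b + 1) f = pderiv 1 (mixedDeriv 0 b f) := by
        simp only [mixedDeriv, Function.iterate_zero, id]
        rw [Function.iterate_succ_apply']
      rw [h3]
      exact h2
    · intro t ht
      have h1 := hH 0 m (by omega) _ (mk_mem_unitSquare (hx 0) ht) _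
        (mk_mem_unitSquare (hx 0) (hz 1))
      refine h1.trans ?_
      have h2 : ‖(!₂[x 0, t] : Plane) - !₂[x 0, z 1]‖ = |t - z 1| := by
        rw [EuclideanSpace.norm_eq]
        simp [Fin.sum_univ_two, Real.sqrt_sq_eq_abs]
      rw [h2]
      gcongr
      exact le_max_left _ _
  have e2 : ∀ b ∈ Finset.range (m + 1), |mixedDeriv 0 b f !₂[x 0, z 1] -
      ∑ a ∈ Finset.range (m + 1 - b), mixedDeriv a b f z / a.factorial * (x 0 - z 0) ^ a| ≤
      C' * |x 0 - z 0| ^ ((m - b : ℕ) + β) := by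
    intro b hb
    have hbm : b ≤ m := Nat.lt_succ_iff.1 (Finset.mem_range.1 hb)
    have hz' : z = !₂[z 0, z 1] := by
      ext k; fin_cases k <;> simp
    have := abs_sub_taylor_le hβ (convex_Icc 0 1) (m - b)
      (fun a t => mixedDeriv a b f !₂[t, z 1]) (C := C')
      (by
        intro a ha t ht
        have h1 : ContDiffOn ℝ (1 : ℕ) (mixedDeriv a b f) unitSquare :=
          contDiffOn_mixedDeriv hcd (by omega)
        have h2 := hasDerivWithinAt_line h1 0 (γ := fun t => !₂[t, z 1])
          (hasDerivAt_mk_left (z 1)) (fun t ht => mk_mem_unitSquare ht (hz 1)) ht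
        have h3 : mixedDeriv (a + 1) b f = pderiv 0 (mixedDeriv a b f) := by
          simp only [mixedDeriv]
          rw [Function.iterate_succ_apply']
        rw [h3]
        exact h2) (z 0) (hz 0)
      (by
        intro t ht
        have h1 := hH (m - b) b (by omega) _ (mk_mem_unitSquare ht (hz 1)) _
          (mk_mem_unitSquare (hz 0) (hz 1))
        refine h1.trans ?_
        have h2 : ‖(!₂[t, z 1] : Plane) - !₂[z 0, z 1]‖ = |t - z 0| := by
          rw [EuclideanSpace.norm_eq]
          simp [Fin.sum_univ_two, Real.sqrt_sq_eq_abs]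
        rw [h2]
        gcongr
        exact le_max_left _ _) (x 0) (hx 0)
    rw [← hz'] at this
    rwa [show m + 1 - b = m - b + 1 by omega]
  have hx' : x = !₂[x 0, x 1] := by
    ext k; fin_cases k <;> simp
  have hTeq : taylorPoly m f z x = ∑ b ∈ Finset.range (m + 1),
      (∑ a ∈ Finset.range (m + 1 - b), mixedDeriv a b f z / a.factorial * (x 0 - z 0) ^ a) /
        b.factorial * (x 1 - z 1) ^ b := by
    rw [taylorPoly, taylorIdx, Finset.sum_sigma]
    refine Finset.sum_congr rfl fun b _ => ?_
    rw [Finset.sum_div, Finset.sum_mul]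
    refine Finset.sum_congr rfl fun a _ => ?_
    simp only [taylorCoeff]
    field_simp
  have hpow : ∀ b ∈ Finset.range (m + 1), |(mixedDeriv 0 b f !₂[x 0, z 1] -
      ∑ a ∈ Finset.range (m + 1 - b), mixedDeriv a b f z / a.factorial * (x 0 - z 0) ^ a) /
        b.factorial * (x 1 - z 1) ^ b| ≤ C' * D ^ α := by
    intro b hb
    have hbm : b ≤ m := Nat.lt_succ_iff.1 (Finset.mem_range.1 hb)
    rw [abs_mul, abs_div, abs_pow, Nat.abs_cast]
    have hfac : (1 : ℝ) ≤ b.factorial := by exact_mod_cast Nat.factorial_pos b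
    have hexp : ((m - b : ℕ) : ℝ) + β = α - b := by
      rw [Nat.cast_sub hbm, hβdef]; ring
    calc _ ≤ C' * |x 0 - z 0| ^ ((m - b : ℕ) + β) * |x 1 - z 1| ^ b := by
          gcongr
          exact (div_le_self (abs_nonneg _) hfac).trans (e2 b hb)
      _ ≤ C' * D ^ ((m - b : ℕ) + β) * D ^ b := by
          gcongr
          · exact hD 0
          · exact hD 1
      _ = C' * D ^ α := by
          rw [hexp, mul_assoc]
          congr 1
          have hαb : α - b + b = α := by ring
          conv_rhs => rw [← hαb]
          rw [Real.rpow_add' hD0 (by linarith), Real.rpow_natCast]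
  have e1' : C' * |x 1 - z 1| ^ (m + β) ≤ C' * D ^ α := by
    have : (m : ℝ) + β = α := by rw [hβdef]; ring
    rw [this]
    gcongr
    exact hD 1
  have hsplit : f x - taylorPoly m f z x = (f !₂[x 0, x 1] - ∑ b ∈ Finset.range (m + 1),
      mixedDeriv 0 b f !₂[x 0, z 1] / b.factorial * (x 1 - z 1) ^ b) +
      ∑ b ∈ Finset.range (m + 1), (mixedDeriv 0 b f !₂[x 0, z 1] -
      ∑ a ∈ Finset.range (m + 1 - b), mixedDeriv a b f z / a.factorial * (x 0 - z 0) ^ a) /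
        b.factorial * (x 1 - z 1) ^ b := by
    rw [hTeq, ← hx']
    simp only [sub_div, sub_mul, Finset.sum_sub_distrib]
    ring
  rw [hsplit]
  refine (abs_add_le _ _).trans ?_
  have e3 := (Finset.abs_sum_le_sum_abs _ _).trans (Finset.sum_le_sum hpow)
  rw [Finset.sum_const, Finset.card_range, nsmul_eq_mul] at e3
  push_cast at e3
  linarith

/-- Finite sums of monomials centred at `z`: derivatives. -/
theorem pderiv_sum_monomial {ι : Type*} (F : Finset ι) (c : ι → ℝ) (a b : ι → ℕ) (z : Plane)
    {x : Plane} (hx : x ∈ unitSquare) :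
    pderiv 0 (fun x => ∑ i ∈ F, c i * ((x 0 - z 0) ^ a i * (x 1 - z 1) ^ b i)) x =
      ∑ i ∈ F, (c i * a i) * ((x 0 - z 0) ^ (a i - 1) * (x 1 - z 1) ^ b i) ∧
    pderiv 1 (fun x => ∑ i ∈ F, c i * ((x 0 - z 0) ^ a i * (x 1 - z 1) ^ b i)) x =
      ∑ i ∈ F, (c i * b i) * ((x 0 - z 0) ^ a i * (x 1 - z 1) ^ (b i - 1)) := by
  have hp : ∀ k : Fin 2, HasFDerivWithinAt (fun y : Plane => y k - z k)
      (EuclideanSpace.proj (𝕜 := ℝ) k : Plane →L[ℝ] ℝ) unitSquare x := fun k =>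
    (EuclideanSpace.proj (𝕜 := ℝ) k : Plane →L[ℝ] ℝ).hasFDerivWithinAt.sub_const _
  have hd : HasFDerivWithinAt
      (fun x : Plane => ∑ i ∈ F, c i * ((x 0 - z 0) ^ a i * (x 1 - z 1) ^ b i)) _ unitSquare x :=
    HasFDerivWithinAt.fun_sum fun i _ =>
      ((((hp 0).pow (a i)).mul ((hp 1).pow (b i))).const_mul (c i))
  constructor
  · rw [pderiv_eq_of_hasFDerivWithinAt hx hd, sum_apply]
    refine Finset.sum_congr rfl fun i _ => ?_
    simp
    ring
  · rw [pderiv_eq_of_hasFDerivWithinAt hx hd, sum_apply]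
    refine Finset.sum_congr rfl fun i _ => ?_
    simp
    ring

theorem mem_taylorIdx {m : ℕ} {i : Σ _ : ℕ, ℕ} : i ∈ taylorIdx m ↔ i.1 + i.2 ≤ m := by
  simp only [taylorIdx, Finset.mem_sigma, Finset.mem_range]
  omega

theorem sum_taylorIdx_eq {m : ℕ} {c : (Σ _ : ℕ, ℕ) → ℝ} {z : Plane} {e e' : (Σ _ : ℕ, ℕ) → ℕ}
    (i₀ : Σ _ : ℕ, ℕ) (hi₀ : i₀.1 + i₀.2 ≤ m) (h0 : e i₀ = 0 ∧ e' i₀ = 0)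
    (h : ∀ i, i ≠ i₀ → c i = 0 ∨ e i ≠ 0 ∨ e' i ≠ 0) :
    ∑ i ∈ taylorIdx m, c i * ((z 0 - z 0) ^ e i * (z 1 - z 1) ^ e' i) = c i₀ := by
  rw [Finset.sum_eq_single i₀]
  · simp [h0.1, h0.2]
  · intro i _ hi
    rcases h i hi with h | h | h
    · simp [h]
    · simp [h]
    · simp [h]
  · intro hn
    exact absurd (mem_taylorIdx.2 hi₀) hn

theorem taylorPoly_self (m : ℕ) (f : Plane → ℝ) (z : Plane) : taylorPoly m f z z = f z := by
  rw [taylorPoly, sum_taylorIdx_eq ⟨0, 0⟩ (by simp) ⟨rfl, rfl⟩]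
  · simp [taylorCoeff, mixedDeriv]
  · rintro ⟨b, a⟩ hi
    by_contra! hcon
    exact hi (by simp only at hcon; rw [hcon.2.1, hcon.2.2])

theorem pderiv_taylorPoly_self {m : ℕ} (hm : 2 ≤ m) (f : Plane → ℝ)
    (hsymm : ∀ x ∈ unitSquare, hess f x 1 0 = hess f x 0 1) {z : Plane}
    (hz : z ∈ unitSquare) :
    (∀ i, pderiv i (taylorPoly m f z) z = pderiv i f z) ∧
      ∀ i j, hess (taylorPoly m f z) z i j = hess f z i j := by
  set F := taylorIdx m
  set c := taylorCoeff f z with hc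
  have h0 : EqOn (pderiv 0 (taylorPoly m f z)) (fun x => ∑ i ∈ F,
      (c i * i.2) * ((x 0 - z 0) ^ (i.2 - 1) * (x 1 - z 1) ^ i.1)) unitSquare := fun x hx =>
    (pderiv_sum_monomial F c (fun i => i.2) (fun i => i.1) z hx).1
  have h1 : EqOn (pderiv 1 (taylorPoly m f z)) (fun x => ∑ i ∈ F,
      (c i * i.1) * ((x 0 - z 0) ^ i.2 * (x 1 - z 1) ^ (i.1 - 1))) unitSquare := fun x hx =>
    (pderiv_sum_monomial F c (fun i => i.2) (fun i => i.1) z hx).2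
  have p0 : pderiv 0 (taylorPoly m f z) z = pderiv 0 f z := by
    rw [h0 hz]
    simp only
    rw [sum_taylorIdx_eq ⟨0, 1⟩ (by simp; omega) ⟨rfl, rfl⟩]
    · simp [hc, taylorCoeff, mixedDeriv]
    · rintro ⟨b, a⟩ hi
      by_contra! hcon
      simp only [mul_ne_zero_iff, Nat.cast_ne_zero] at hcon
      refine hi ?_
      rw [show b = 0 by omega, show a = 1 by omega]
  have p1 : pderiv 1 (taylorPoly m f z) z = pderiv 1 f z := by
    rw [h1 hz]
    simp only
    rw [sum_taylorIdx_eq ⟨1, 0⟩ (by simp; omega) ⟨rfl, rfl⟩]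
    · simp [hc, taylorCoeff, mixedDeriv]
    · rintro ⟨b, a⟩ hi
      by_contra! hcon
      simp only [mul_ne_zero_iff, Nat.cast_ne_zero] at hcon
      refine hi ?_
      rw [show b = 1 by omega, show a = 0 by omega]
  have p00 : hess (taylorPoly m f z) z 0 0 = hess f z 0 0 := by
    change pderiv 0 (pderiv 0 (taylorPoly m f z)) z = pderiv 0 (pderiv 0 f) z
    rw [pderiv_congr h0 0 hz, (pderiv_sum_monomial F _ (fun i => i.2 - 1) (fun i => i.1) z hz).1,
      sum_taylorIdx_eq ⟨0, 2⟩ (by simp; omega) ⟨rfl, rfl⟩]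
    · simp [hc, taylorCoeff, mixedDeriv]
    · rintro ⟨b, a⟩ hi
      by_contra! hcon
      simp only [mul_ne_zero_iff, Nat.cast_ne_zero] at hcon
      refine hi ?_
      rw [show b = 0 by omega, show a = 2 by omega]
  have p01 : hess (taylorPoly m f z) z 0 1 = hess f z 0 1 := by
    change pderiv 0 (pderiv 1 (taylorPoly m f z)) z = pderiv 0 (pderiv 1 f) z
    rw [pderiv_congr h1 0 hz, (pderiv_sum_monomial F _ (fun i => i.2) (fun i => i.1 - 1) z hz).1,
      sum_taylorIdx_eq ⟨1, 1⟩ (by simp; omega) ⟨rfl, rfl⟩]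
    · simp [hc, taylorCoeff, mixedDeriv]
    · rintro ⟨b, a⟩ hi
      by_contra! hcon
      simp only [mul_ne_zero_iff, Nat.cast_ne_zero] at hcon
      refine hi ?_
      rw [show b = 1 by omega, show a = 1 by omega]
  have p10 : hess (taylorPoly m f z) z 1 0 = hess f z 1 0 := by
    rw [hsymm z hz]
    change pderiv 1 (pderiv 0 (taylorPoly m f z)) z = pderiv 0 (pderiv 1 f) z
    rw [pderiv_congr h0 1 hz, (pderiv_sum_monomial F _ (fun i => i.2 - 1) (fun i => i.1) z hz).2,
      sum_taylorIdx_eq ⟨1, 1⟩ (by simp; omega) ⟨rfl, rfl⟩]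
    · simp [hc, taylorCoeff, mixedDeriv]
    · rintro ⟨b, a⟩ hi
      by_contra! hcon
      simp only [mul_ne_zero_iff, Nat.cast_ne_zero] at hcon
      refine hi ?_
      rw [show b = 1 by omega, show a = 1 by omega]
  have p11 : hess (taylorPoly m f z) z 1 1 = hess f z 1 1 := by
    change pderiv 1 (pderiv 1 (taylorPoly m f z)) z = pderiv 1 (pderiv 1 f) z
    rw [pderiv_congr h1 1 hz, (pderiv_sum_monomial F _ (fun i => i.2) (fun i => i.1 - 1) z hz).2,
      sum_taylorIdx_eq ⟨2, 0⟩ (by simp; omega) ⟨rfl, rfl⟩]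
    · simp [hc, taylorCoeff, mixedDeriv]
    · rintro ⟨b, a⟩ hi
      by_contra! hcon
      simp only [mul_ne_zero_iff, Nat.cast_ne_zero] at hcon
      refine hi ?_
      rw [show b = 2 by omega, show a = 0 by omega]
  constructor
  · intro i
    fin_cases i
    · exact p0
    · exact p1
  · intro i j
    fin_cases i <;> fin_cases j
    · exact p00
    · exact p01
    · exact p10
    · exact p11

end Taylor

/-! ### Spline approximation of Hölder functions -/

section Approximation

theorem isRegular_of_contDiffOn {f : Plane → ℝ} (hf : ContDiffOn ℝ (2 : ℕ) f unitSquare) :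
    IsRegular f := by
  have h1 : ∀ i, ContDiffOn ℝ (1 : ℕ) (pderiv i f) unitSquare := fun i =>
    contDiffOn_pderiv (m := 1) hf i
  have h2 : ∀ i j, ContDiffOn ℝ (0 : ℕ) (pderiv i (pderiv j f)) unitSquare := fun i j =>
    contDiffOn_pderiv (m := 0) (h1 j) i
  refine ⟨fun i => (h1 i).continuousOn, fun i j => (h2 i j).continuousOn, fun x hx => ?_⟩
  have hne : x ∈ closure (interior unitSquare) := by
    rw [convex_unitSquare.closure_interior_eq_closure_of_nonempty_interior interior_unitSquare_nonempty]
    exact subset_closure hx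
  have hsymm := (hf x hx).isSymmSndFDerivWithinAt (by simp) uniqueDiffOn_unitSquare hne hx
  have hd : DifferentiableWithinAt ℝ (fderivWithin ℝ f unitSquare) unitSquare x :=
    ((hf.fderivWithin (m := 1) uniqueDiffOn_unitSquare (by norm_num)).differentiableOn
      (by norm_num)) x hx
  have hij : ∀ i j, pderiv i (pderiv j f) x =
      fderivWithin ℝ (fderivWithin ℝ f unitSquare) unitSquare x (EuclideanSpace.single i 1)
        (EuclideanSpace.single j 1) := by
    intro i j
    have h3 := hd.hasFDerivWithinAt.clm_apply
      (hasFDerivWithinAt_const (EuclideanSpace.single j (1 : ℝ)) x unitSquare)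
    refine (pderiv_eq_of_hasFDerivWithinAt (f := pderiv j f) hx h3 i).trans ?_
    simp
  change pderiv 1 (pderiv 0 f) x = pderiv 0 (pderiv 1 f) x
  rw [hij, hij, hsymm.eq]

theorem strictFloor_add_one_le {α : ℝ} {q : ℕ} (hα : 0 < α) (h : α ≤ q) :
    strictFloor α + 1 ≤ q := by
  have h1 : ⌈α⌉₊ ≤ q := Nat.ceil_le.2 h
  have h2 : 0 < ⌈α⌉₊ := Nat.ceil_pos.2 hα
  simp only [strictFloor]
  omega

theorem three_le_strictFloor {α : ℝ} (hα : 4 ≤ α) : 3 ≤ strictFloor α := by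
  have h1 : 4 ≤ ⌈α⌉₊ := by
    have : (4 : ℝ) ≤ (⌈α⌉₊ : ℝ) := hα.trans (Nat.le_ceil α)
    exact_mod_cast this
  simp only [strictFloor]
  omega

theorem IsHolder.contDiffOn_three {α : ℝ} (hα : 4 ≤ α) {f : Plane → ℝ} (hf : IsHolder α f) :
    ContDiffOn ℝ (3 : ℕ) f unitSquare :=
  hf.1.of_le (by exact_mod_cast three_le_strictFloor hα)

theorem IsHolder.isRegular {α : ℝ} (hα : 4 ≤ α) {f : Plane → ℝ} (hf : IsHolder α f) :
    IsRegular f :=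
  isRegular_of_contDiffOn ((hf.contDiffOn_three hα).of_le (by exact_mod_cast (by omega : 2 ≤ 3)))

theorem IsHolder.exists_bound {α : ℝ} {f : Plane → ℝ} (hf : IsHolder α f) :
    ∃ K : ℝ, 0 < K ∧ ∀ x ∈ unitSquare, |f x| ≤ K := by
  obtain ⟨-, C, hC, -⟩ := hf
  exact ⟨max C 1, lt_max_of_lt_right one_pos, fun x hx =>
    (hC 0 0 (by omega) x hx).trans (le_max_left _ _)⟩

namespace SplineSpace

variable {S : SplineSpace} {w κ : ℝ}

/-- A knot rectangle in the support of the `j`-th tensor product B-spline. -/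
def homeCell (S : SplineSpace) (j : S.Idx) : Fin 2 → ℕ :=
  ![max j.1 (S.q 0 - 1), max j.2 (S.q 1 - 1)]

theorem IsMesh.isCell_homeCell (h : S.IsMesh w κ) (j : S.Idx) : S.IsCell (S.homeCell j) := by
  have q0 := h.four_le 0
  have q1 := h.four_le 1
  have h1 := j.1.2
  have h2 := j.2.2
  simp only [SplineSpace.J] at h1 h2
  intro k
  fin_cases k
  · simp [homeCell]; omega
  · simp [homeCell]; omega

theorem isActive_homeCell (j : S.Idx) : S.IsActive (S.homeCell j) j := by
  simp only [IsActive, homeCell, Matrix.cons_val_zero, Matrix.cons_val_one]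
  omega

/-- Two points in knot rectangles on which the same B-spline is active are close. -/
theorem IsMesh.abs_sub_le (h : S.IsMesh w κ) {μ ν : Fin 2 → ℕ}
    {j : S.Idx} (hμ : S.IsActive μ j) (hν : S.IsActive ν j) {x y : Plane} (hx : x ∈ S.rect μ)
    (hy : y ∈ S.rect ν) (k : Fin 2) : |x k - y k| ≤ (S.q 0 + S.q 1 : ℕ) * (κ * w) := by
  have hκw : 0 ≤ κ * w := by
    have := h.le_mul 0 0
    have h0 := (h.knots 0).mono (Nat.zero_le 1)
    linarith
  have hlen : ∀ k d m, S.knot k (m + d) - S.knot k m ≤ d * (κ * w) := by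
    intro k d m
    induction d with
    | zero => simp
    | succ d ihd =>
      have := h.le_mul k (m + d)
      rw [show m + (d + 1) = m + d + 1 by ring]
      push_cast
      linarith
  have key : ∀ k i : ℕ, ∀ c : Fin 2, (i ≤ μ c ∧ μ c ≤ i + (S.q c - 1)) →
      (i ≤ ν c ∧ ν c ≤ i + (S.q c - 1)) → |x c - y c| ≤ (S.q c : ℕ) * (κ * w) := by
    intro k i c h1 h2
    have hq := h.four_le c
    have hm := (h.knots c).mono
    have l1 := hlen c (S.q c) i
    have a1 : S.knot c i ≤ x c := (hm h1.1).trans (hx c).1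
    have a2 : S.knot c i ≤ y c := (hm h2.1).trans (hy c).1
    have a3 : x c ≤ S.knot c (i + S.q c) := (hx c).2.trans (hm (by omega))
    have a4 : y c ≤ S.knot c (i + S.q c) := (hy c).2.trans (hm (by omega))
    rw [abs_le]
    constructor <;> linarith
  have c0 : (0 : ℝ) ≤ (S.q 0 : ℝ) := by positivity
  have c1 : (0 : ℝ) ≤ (S.q 1 : ℝ) := by positivity
  fin_cases k
  · refine (key 0 j.1 0 hμ.1 hν.1).trans ?_
    push_cast
    nlinarith
  · refine (key 0 j.2 1 hμ.2 hν.2).trans ?_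
    push_cast
    nlinarith

/-- Splines of orders at least `α` approximate functions of Hölder smoothness `α`, together with
the derivatives up to order two. The coefficients of the approximation are those of the Taylor
polynomial at a point of the support of the B-spline; at a point `x` they are compared with the
coefficients of the Taylor polynomial at `x`, which is reproduced exactly. -/
theorem exists_approximation {α : ℝ} (hα : 4 ≤ α) {f : Plane → ℝ} (hf : IsHolder α f)
    (q : Fin 2 → ℕ) (hq : ∀ k, α ≤ q k) {κ : ℝ} (hκ : 0 < κ) : ∃ K : ℝ, 0 < K ∧
    ∀ (S : SplineSpace) (w : ℝ), S.q = q → S.IsMesh w κ → w ≤ 1 →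
      ∃ θ : S.Idx → ℝ, (∀ j, |θ j| ≤ K) ∧
        (∀ x ∈ unitSquare, |S.fnDeriv 0 0 θ x - f x| ≤ K * w ^ α) ∧
        IsC2Close (S.fnDeriv 0 0 θ) f (K * w ^ (α - 2)) := by
  obtain ⟨KT, hKT, hT⟩ := exists_abs_sub_taylorPoly_le (by linarith : 1 < α) hf
  obtain ⟨KS, hKS, hS⟩ := exists_abs_coeff_le q hκ
  obtain ⟨KD, hKD, hD⟩ := exists_abs_fnDeriv_le q
  obtain ⟨KF, hKF, hF⟩ := hf.exists_bound
  have hreg := hf.isRegular hα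
  set m := strictFloor α with hm
  have hm3 : 3 ≤ m := three_le_strictFloor hα
  set Q : ℝ := ((q 0 + q 1 : ℕ) : ℝ) * κ with hQ
  have hQ0 : 0 ≤ Q := by positivity
  set E : ℝ := KS * (2 * KT * Q ^ α) with hE
  have hE0 : 0 ≤ E := by positivity
  set B : ℝ := KS * (KF + KT * Q ^ α) with hB
  have hB0 : 0 ≤ B := by positivity
  refine ⟨B + KD * E + 1, by positivity, ?_⟩
  rintro S w rfl h hw1
  have hw := h.pos
  have hmq : ∀ k, m + 1 ≤ S.q k := fun k => strictFloor_add_one_le (by linarith) (hq k)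
  have hcoef : ∀ z : Plane, ∃ ζ : S.Idx → ℝ, ∀ x ∈ unitSquare,
      S.fnDeriv 0 0 ζ x = taylorPoly m f z x := by
    intro z
    refine h.exists_coeff_sum_monomial z (taylorIdx m) (taylorCoeff f z) (fun i => i.2)
      (fun i => i.1) (fun i hi => ?_) (fun i hi => ?_)
    · have := mem_taylorIdx.1 hi; have := hmq 0; omega
    · have := mem_taylorIdx.1 hi; have := hmq 1; omega
  choose ζ hζ using hcoef
  -- the centre for the `j`-th coefficient is a corner of a rectangle in the support
  set c : S.Idx → Plane := fun j =>
    !₂[S.knot 0 (S.homeCell j 0), S.knot 1 (S.homeCell j 1)] with hc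
  have hcmem : ∀ j, c j ∈ S.rect (S.homeCell j) := fun j =>
    mem_rect_mk ⟨le_rfl, (h.cell_lt (h.isCell_homeCell j) 0).le⟩
      ⟨le_rfl, (h.cell_lt (h.isCell_homeCell j) 1).le⟩
  have hcQ : ∀ j, c j ∈ unitSquare := fun j => h.rect_subset _ (hcmem j)
  have hrpow : ((S.q 0 + S.q 1 : ℕ) * (κ * w)) ^ α = Q ^ α * w ^ α := by
    rw [hQ, ← Real.mul_rpow (by positivity) hw.le]; ring_nf
  -- comparison of the Taylor polynomials at a centre and at a point
  have hcomp : ∀ μ, S.IsCell μ → ∀ x ∈ S.rect μ, ∀ j, S.IsActive μ j →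
      |ζ (c j) j - ζ x j| ≤ E * w ^ α := by
    intro μ hμ x hx j hj
    have := hS S w rfl h μ hμ (fun i => ζ (c j) i - ζ x i) (2 * KT * Q ^ α * w ^ α) ?_ j hj
    · rw [hE]; linarith [this]
    intro y hy
    have hyQ := h.rect_subset _ hy
    rw [fnDeriv_sub, hζ _ y hyQ, hζ _ y hyQ]
    have t1 := hT (c j) (hcQ j) y hyQ _
      (h.abs_sub_le hj (isActive_homeCell j) hy (hcmem j))
    have t2 := hT x (h.rect_subset _ hx) y hyQ _ (h.abs_sub_le hj hj hy hx)
    rw [hrpow] at t1 t2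
    have t3 := abs_sub_le (taylorPoly m f (c j) y) (f y) (taylorPoly m f x y)
    rw [abs_sub_comm] at t1
    linarith
  have hmain : ∀ μ, S.IsCell μ → ∀ x ∈ S.rect μ, ∀ r s : ℕ, r + s ≤ 2 →
      |S.fnDeriv r s (fun j => ζ (c j) j) x - S.fnDeriv r s (ζ x) x| ≤
        KD * (w ^ 2)⁻¹ * (E * w ^ α) ∧ (r = 0 → s = 0 →
      |S.fnDeriv r s (fun j => ζ (c j) j) x - S.fnDeriv r s (ζ x) x| ≤ KD * (E * w ^ α)) := by
    intro μ hμ x hx r s hrs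
    rw [← fnDeriv_sub]
    exact hD S w κ rfl h hw1 μ hμ x hx r s hrs _ _ (by positivity) (hcomp μ hμ x hx)
  have hpow : KD * (w ^ 2)⁻¹ * (E * w ^ α) = KD * E * w ^ (α - 2) := by
    rw [Real.rpow_sub hw, Real.rpow_two]
    field_simp
  have hle : KD * E * w ^ (α - 2) ≤ (B + KD * E + 1) * w ^ (α - 2) := by
    gcongr; linarith
  refine ⟨fun j => ζ (c j) j, fun j => ?_, fun x hx => ?_, fun x hx => ?_⟩
  · have := hS S w rfl h _ (h.isCell_homeCell j) (ζ (c j)) (KF + KT * Q ^ α) ?_ j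
      (isActive_homeCell j)
    · have h3 : 0 ≤ KD * E := by positivity
      linarith
    intro y hy
    have hyQ := h.rect_subset _ hy
    rw [hζ _ y hyQ]
    have t1 := hT (c j) (hcQ j) y hyQ _
      (h.abs_sub_le (isActive_homeCell j) (isActive_homeCell j) hy (hcmem j))
    rw [hrpow] at t1
    have t2 : w ^ α ≤ 1 := Real.rpow_le_one hw.le hw1 (by linarith)
    have t3 : KT * (Q ^ α * w ^ α) ≤ KT * Q ^ α := by
      gcongr
      exact mul_le_of_le_one_right (by positivity) t2
    have t4 := abs_sub_abs_le_abs_sub (taylorPoly m f (c j) y) (f y)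
    rw [abs_sub_comm] at t4
    have t5 := hF y hyQ
    linarith
  · obtain ⟨μ, hμ, hxμ, -⟩ := h.exists_cell hx
    have t1 := (hmain μ hμ x hxμ 0 0 (by omega)).2 rfl rfl
    rw [hζ x x hx, taylorPoly_self] at t1
    refine t1.trans ?_
    have : 0 ≤ w ^ α := by positivity
    nlinarith
  · obtain ⟨μ, hμ, hxμ, -⟩ := h.exists_cell hx
    have hTd := pderiv_taylorPoly_self (by omega : 2 ≤ m) f hreg.symm hx
    -- the spline `ζ x` is the Taylor polynomial at `x`, with the same derivatives as `f` there
    have hEq : EqOn (S.fnDeriv 0 0 (ζ x)) (taylorPoly m f x) unitSquare := fun y hy => hζ x y hy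
    have hp : ∀ i, pderiv i (S.fnDeriv 0 0 (ζ x)) x = pderiv i f x := fun i => by
      rw [pderiv_congr hEq i hx, hTd.1]
    have hh : ∀ i j, hess (S.fnDeriv 0 0 (ζ x)) x i j = hess f x i j := fun i j => by
      rw [← hTd.2 i j]
      exact pderiv_congr (pderiv_congr hEq j) i hx
    obtain ⟨a1, a2, a3, a4, a5, a6⟩ := h.pderiv_fn (WithLp.toLp 2 fun j => ζ (c j) j) hx
    obtain ⟨b1, b2, b3, b4, b5, b6⟩ := h.pderiv_fn (WithLp.toLp 2 (ζ x)) hx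
    rw [fn_eq] at a1 a2 a3 a4 a5 a6 b1 b2 b3 b4 b5 b6
    have hb : ∀ r s : ℕ, r + s ≤ 2 →
        |S.fnDeriv r s (fun j => ζ (c j) j) x - S.fnDeriv r s (ζ x) x| ≤
          (B + KD * E + 1) * w ^ (α - 2) := fun r s hrs =>
      ((hmain μ hμ x hxμ r s hrs).1.trans_eq hpow).trans hle
    constructor
    · intro i
      rw [← hp]
      fin_cases i
      · exact (congrArg abs (congrArg₂ (· - ·) a1 b1)).trans_le (hb 1 0 (by omega))
      · exact (congrArg abs (congrArg₂ (· - ·) a2 b2)).trans_le (hb 0 1 (by omega))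
    · intro i j
      rw [← hh]
      fin_cases i <;> fin_cases j
      · exact (congrArg abs (congrArg₂ (· - ·) a3 b3)).trans_le (hb 2 0 (by omega))
      · exact (congrArg abs (congrArg₂ (· - ·) a4 b4)).trans_le (hb 1 1 (by omega))
      · exact (congrArg abs (congrArg₂ (· - ·) a5 b5)).trans_le (hb 1 1 (by omega))
      · exact (congrArg abs (congrArg₂ (· - ·) a6 b6)).trans_le (hb 0 2 (by omega))

end SplineSpace

end Approximation

/-! ### The smaller eigenvalue and its eigenvectors -/

section Eigen

/-- The image of `u` under the Hessian's larger eigenvalue minus the Hessian: by the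
Cayley–Hamilton theorem an eigenvector for the smaller eigenvalue, depending continuously on the
Hessian. -/
def ridgeVec (f : Plane → ℝ) (x u : Plane) : Plane :=
  !₂[((hess f x 1 1 - hess f x 0 0 + eigGap f x) * u 0 - 2 * hess f x 0 1 * u 1) / 2,
     ((hess f x 0 0 - hess f x 1 1 + eigGap f x) * u 1 - 2 * hess f x 0 1 * u 0) / 2]

/-- The derivative of `f` at `x` in the direction `v`. -/
def slope (f : Plane → ℝ) (x v : Plane) : ℝ := pderiv 0 f x * v 0 + pderiv 1 f x * v 1

variable {f g : Plane → ℝ} {x u v : Plane}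

theorem inner_grad_eq (f : Plane → ℝ) (x v : Plane) : inner ℝ (grad f x) v = slope f x v := by
  simp only [grad, slope, PiLp.inner_apply, Fin.sum_univ_two, RCLike.inner_apply, conj_trivial]
  simp
  ring

theorem eigGap_nonneg (f : Plane → ℝ) (x : Plane) : 0 ≤ eigGap f x := Real.sqrt_nonneg _

theorem eigGap_sq (f : Plane → ℝ) (x : Plane) :
    eigGap f x ^ 2 = (hess f x 0 0 - hess f x 1 1) ^ 2 + 4 * hess f x 0 1 ^ 2 :=
  Real.sq_sqrt (by positivity)

theorem isMinEigenvector_iff (hs : hess f x 1 0 = hess f x 0 1) :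
    IsMinEigenvector f x v ↔ v ≠ 0 ∧
      hess f x 0 0 * v 0 + hess f x 0 1 * v 1 = lamMin f x * v 0 ∧
      hess f x 0 1 * v 0 + hess f x 1 1 * v 1 = lamMin f x * v 1 := by
  simp only [IsMinEigenvector, Fin.forall_fin_two, Fin.sum_univ_two, hs]

theorem isMinEigenvector_ridgeVec (hs : hess f x 1 0 = hess f x 0 1) (u : Plane)
    (h0 : ridgeVec f x u ≠ 0) : IsMinEigenvector f x (ridgeVec f x u) := by
  have hg := eigGap_sq f x
  refine (isMinEigenvector_iff hs).2 ⟨h0, ?_, ?_⟩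
  · simp [ridgeVec, lamMin]
    linear_combination (u 0 / 4) * hg
  · simp [ridgeVec, lamMin]
    linear_combination (u 1 / 4) * hg

/-- On an eigenvector for the smaller eigenvalue, `ridgeVec` acts as the difference of the
eigenvalues. -/
theorem ridgeVec_eq_smul (hs : hess f x 1 0 = hess f x 0 1) (hv : IsMinEigenvector f x v) :
    ridgeVec f x v = eigGap f x • v := by
  obtain ⟨-, h1, h2⟩ := (isMinEigenvector_iff hs).1 hv
  simp only [lamMin] at h1 h2
  ext i
  fin_cases i
  · simp [ridgeVec]
    linear_combination -h1
  · simp [ridgeVec]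
    linear_combination -h2

theorem norm_eq_one_iff_plane {v : Plane} : ‖v‖ = 1 ↔ v 0 ^ 2 + v 1 ^ 2 = 1 := by
  rw [← sq_eq_sq₀ (norm_nonneg _) zero_le_one, EuclideanSpace.real_norm_sq_eq, Fin.sum_univ_two,
    one_pow]

theorem abs_apply_le_one {v : Plane} (hv : ‖v‖ = 1) (i : Fin 2) : |v i| ≤ 1 := by
  have := PiLp.norm_apply_le v i
  rwa [hv] at this

/-- If the eigenvalues are distinct, the eigenvectors for the smaller one are multiples of a unit
eigenvector. -/
theorem IsMinEigenvector.eq_smul (hs : hess f x 1 0 = hess f x 0 1) (hgap : 0 < eigGap f x)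
    (hu : IsMinEigenvector f x u) (hv : IsMinEigenvector f x v) (hv1 : ‖v‖ = 1) :
    u = (u 0 * v 0 + u 1 * v 1) • v := by
  obtain ⟨-, a1, a2⟩ := (isMinEigenvector_iff hs).1 hu
  obtain ⟨-, b1, b2⟩ := (isMinEigenvector_iff hs).1 hv
  have hg := eigGap_sq f x
  rw [norm_eq_one_iff_plane] at hv1
  have hcross : u 0 * v 1 - u 1 * v 0 = 0 := by
    by_contra hc
    have e1 : (hess f x 0 0 - lamMin f x) * (u 0 * v 1 - u 1 * v 0) = 0 := by
      linear_combination v 1 * a1 - u 1 * b1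
    have e2 : hess f x 0 1 * (u 0 * v 1 - u 1 * v 0) = 0 := by
      linear_combination -v 0 * a1 + u 0 * b1
    have e3 : (hess f x 1 1 - lamMin f x) * (u 0 * v 1 - u 1 * v 0) = 0 := by
      linear_combination -v 0 * a2 + u 0 * b2
    have f1 := (mul_eq_zero.1 e1).resolve_right hc
    have f2 := (mul_eq_zero.1 e2).resolve_right hc
    have f3 := (mul_eq_zero.1 e3).resolve_right hc
    have : eigGap f x ^ 2 = 0 := by
      rw [hg, f2, show hess f x 0 0 - hess f x 1 1 = 0 by linarith]; ring
    exact hgap.ne' (by simpa using this)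
  ext i
  fin_cases i
  · simp
    linear_combination -u 0 * hv1 + v 1 * hcross
  · simp
    linear_combination -u 1 * hv1 - v 0 * hcross

/-- The Euclidean norm is Lipschitz for the `ℓ¹` norm; this avoids a lower bound for the root, so the
eigenvalues are Lipschitz in the Hessian also where they coincide. -/
theorem abs_sqrt_sub_sqrt_le (p q p' q' : ℝ) :
    |√(p ^ 2 + q ^ 2) - √(p' ^ 2 + q' ^ 2)| ≤ |p - p'| + |q - q'| := by
  have key : ∀ p q p' q' : ℝ,
      √(p ^ 2 + q ^ 2) - √(p' ^ 2 + q' ^ 2) ≤ |p - p'| + |q - q'| := by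
    intro p q p' q'
    set R := √(p' ^ 2 + q' ^ 2) with hR
    have hR0 : 0 ≤ R := Real.sqrt_nonneg _
    have hR2 : R ^ 2 = p' ^ 2 + q' ^ 2 := Real.sq_sqrt (by positivity)
    have h1 : |p'| ≤ R := Real.abs_le_sqrt (by nlinarith [sq_nonneg q'])
    have h2 : |q'| ≤ R := Real.abs_le_sqrt (by nlinarith [sq_nonneg p'])
    rw [sub_le_iff_le_add]
    have d1 := abs_nonneg (p - p')
    have d2 := abs_nonneg (q - q')
    refine Real.sqrt_le_iff.2 ⟨by positivity, ?_⟩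
    have e1 : p ^ 2 ≤ p' ^ 2 + 2 * R * |p - p'| + |p - p'| ^ 2 := by
      have : p' * (p - p') ≤ R * |p - p'| :=
        (le_abs_self _).trans (by rw [abs_mul]; gcongr)
      rw [sq_abs]; nlinarith
    have e2 : q ^ 2 ≤ q' ^ 2 + 2 * R * |q - q'| + |q - q'| ^ 2 := by
      have : q' * (q - q') ≤ R * |q - q'| :=
        (le_abs_self _).trans (by rw [abs_mul]; gcongr)
      rw [sq_abs]; nlinarith
    nlinarith [mul_nonneg d1 d2]
  rw [abs_le]
  constructor
  · have := key p' q' p q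
    rw [abs_sub_comm p', abs_sub_comm q'] at this
    linarith
  · exact key p q p' q'

variable {ε : ℝ}

theorem IsC2Close.abs_eigGap_sub_le (h : IsC2Close f g ε) (hx : x ∈ unitSquare) :
    |eigGap f x - eigGap g x| ≤ 4 * ε := by
  have h00 := abs_le.1 ((h x hx).2 0 0)
  have h01 := abs_le.1 ((h x hx).2 0 1)
  have h11 := abs_le.1 ((h x hx).2 1 1)
  have e : ∀ f : Plane → ℝ, eigGap f x =
      √((hess f x 0 0 - hess f x 1 1) ^ 2 + (2 * hess f x 0 1) ^ 2) := fun f => by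
    rw [eigGap]; ring_nf
  rw [e f, e g]
  refine (abs_sqrt_sub_sqrt_le _ _ _ _).trans ?_
  have t1 : |hess f x 0 0 - hess f x 1 1 - (hess g x 0 0 - hess g x 1 1)| ≤ 2 * ε := by
    rw [abs_le]; constructor <;> linarith
  have t2 : |2 * hess f x 0 1 - 2 * hess g x 0 1| ≤ 2 * ε := by
    rw [abs_le]; constructor <;> linarith
  linarith

theorem IsC2Close.abs_lamMin_sub_le (h : IsC2Close f g ε) (hx : x ∈ unitSquare) :
    |lamMin f x - lamMin g x| ≤ 3 * ε := by
  have h00 := abs_le.1 ((h x hx).2 0 0)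
  have h11 := abs_le.1 ((h x hx).2 1 1)
  have hg := abs_le.1 (h.abs_eigGap_sub_le hx)
  simp only [lamMin]
  rw [abs_le]; constructor <;> linarith

theorem abs_mul_add_mul_le {a b s t A B : ℝ} (ha : |a| ≤ A) (hb : |b| ≤ B) (hs : |s| ≤ 1)
    (ht : |t| ≤ 1) : |a * s + b * t| ≤ A + B := by
  refine (abs_add_le _ _).trans (add_le_add ?_ ?_)
  · rw [abs_mul]; nlinarith [abs_nonneg a, abs_nonneg s]
  · rw [abs_mul]; nlinarith [abs_nonneg b, abs_nonneg t]

theorem IsC2Close.abs_ridgeVec_sub_le (h : IsC2Close f g ε) (hx : x ∈ unitSquare)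
    (hu : ∀ i, |u i| ≤ 1) (i : Fin 2) : |ridgeVec f x u i - ridgeVec g x u i| ≤ 4 * ε := by
  have h00 := abs_le.1 ((h x hx).2 0 0)
  have h01 := abs_le.1 ((h x hx).2 0 1)
  have h11 := abs_le.1 ((h x hx).2 1 1)
  have hg := abs_le.1 (h.abs_eigGap_sub_le hx)
  fin_cases i
  · have e : ridgeVec f x u 0 - ridgeVec g x u 0 =
        ((hess f x 1 1 - hess f x 0 0 + eigGap f x) / 2 -
          (hess g x 1 1 - hess g x 0 0 + eigGap g x) / 2) * u 0 +
        (hess g x 0 1 - hess f x 0 1) * u 1 := by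
      simp [ridgeVec]; ring
    change |ridgeVec f x u 0 - ridgeVec g x u 0| ≤ _
    rw [e]
    refine (abs_mul_add_mul_le (A := 3 * ε) (B := ε) ?_ ?_ (hu 0) (hu 1)).trans (by linarith)
    · rw [abs_le]; constructor <;> linarith
    · rw [abs_le]; constructor <;> linarith
  · have e : ridgeVec f x u 1 - ridgeVec g x u 1 =
        ((hess f x 0 0 - hess f x 1 1 + eigGap f x) / 2 -
          (hess g x 0 0 - hess g x 1 1 + eigGap g x) / 2) * u 1 +
        (hess g x 0 1 - hess f x 0 1) * u 0 := by
      simp [ridgeVec]; ring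
    change |ridgeVec f x u 1 - ridgeVec g x u 1| ≤ _
    rw [e]
    refine (abs_mul_add_mul_le (A := 3 * ε) (B := ε) ?_ ?_ (hu 1) (hu 0)).trans (by linarith)
    · rw [abs_le]; constructor <;> linarith
    · rw [abs_le]; constructor <;> linarith

theorem IsC2Close.abs_slope_sub_le (h : IsC2Close f g ε) (hx : x ∈ unitSquare)
    (hu : ∀ i, |u i| ≤ 1) : |slope f x u - slope g x u| ≤ 2 * ε := by
  have e : slope f x u - slope g x u =
      (pderiv 0 f x - pderiv 0 g x) * u 0 + (pderiv 1 f x - pderiv 1 g x) * u 1 := by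
    simp only [slope]; ring
  rw [e]
  exact (abs_mul_add_mul_le ((h x hx).1 0) ((h x hx).1 1) (hu 0) (hu 1)).trans (by linarith)

theorem IsRegular.continuousOn_eigGap (hf : IsRegular f) : ContinuousOn (eigGap f) unitSquare := by
  have h00 := hf.continuousOn_hess 0 0
  have h01 := hf.continuousOn_hess 0 1
  have h11 := hf.continuousOn_hess 1 1
  exact Real.continuous_sqrt.comp_continuousOn
    (((h00.sub h11).pow 2).add (continuousOn_const.mul (h01.pow 2)))

theorem IsRegular.continuousOn_lamMin (hf : IsRegular f) : ContinuousOn (lamMin f) unitSquare := by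
  have h00 := hf.continuousOn_hess 0 0
  have h11 := hf.continuousOn_hess 1 1
  exact ((h00.add h11).sub hf.continuousOn_eigGap).div_const 2

/-- The derivative of `f` in the direction `ridgeVec f x u`, written out. -/
theorem slope_ridgeVec (f : Plane → ℝ) (x u : Plane) : slope f x (ridgeVec f x u) =
    pderiv 0 f x * (((hess f x 1 1 - hess f x 0 0 + eigGap f x) * u 0 -
      2 * hess f x 0 1 * u 1) / 2) +
    pderiv 1 f x * (((hess f x 0 0 - hess f x 1 1 + eigGap f x) * u 1 -
      2 * hess f x 0 1 * u 0) / 2) := by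
  simp [slope, ridgeVec]

theorem slope_smul (f : Plane → ℝ) (x v : Plane) (c : ℝ) : slope f x (c • v) = c * slope f x v := by
  simp [slope]; ring

/-- The ridge consists of the points at which the slope vanishes in the direction of a unit
eigenvector. -/
theorem exists_unit_of_mem_filament (hx : x ∈ filament f) :
    ∃ v, IsMinEigenvector f x v ∧ ‖v‖ = 1 ∧ slope f x v = 0 := by
  obtain ⟨-, -, v, hv, h0⟩ := hx
  have hn : ‖v‖ ≠ 0 := norm_ne_zero_iff.2 hv.1
  refine ⟨‖v‖⁻¹ • v, ⟨smul_ne_zero (inv_ne_zero hn) hv.1, fun i => ?_⟩, ?_, ?_⟩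
  · have := hv.2 i
    simp only [PiLp.smul_apply, smul_eq_mul]
    calc ∑ j, hess f x i j * (‖v‖⁻¹ * v j) = ‖v‖⁻¹ * ∑ j, hess f x i j * v j := by
          rw [Finset.mul_sum]; exact Finset.sum_congr rfl fun j _ => by ring
      _ = _ := by rw [this]; ring
  · rw [norm_smul, norm_inv, norm_norm, inv_mul_cancel₀ hn]
  · rw [slope_smul, ← inner_grad_eq, h0, mul_zero]

end Eigen

/-! ### Stability of the ridge under perturbations of the function -/

section Ridge

variable {f : Plane → ℝ} {δ η a : ℝ} {V : Plane → Plane} {Υ : Plane → ℝ → Plane}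
  {T : Plane → ℝ}

theorem filament_subset_filamentNhd (hδ : 0 < δ) : filament f ⊆ filamentNhd f δ :=
  fun _ hx => ⟨Metric.self_subset_thickening hδ _ hx, hx.1⟩

theorem filamentNhd_mem_nhdsWithin (hδ : 0 < δ) {x : Plane} (hx : x ∈ filament f) :
    filamentNhd f δ ∈ 𝓝[unitSquare] x := by
  rw [filamentNhd, inter_comm]
  exact inter_mem_nhdsWithin _
    (Metric.isOpen_thickening.mem_nhds (Metric.self_subset_thickening hδ _ hx))

/-- A short segment in the direction of the integral curve through a point of the ridge stays in
the square: where the ridge meets an edge, the curve, which runs in the square in both directions,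
is tangent to the edge. -/
theorem exists_segment_subset (hc : IsCurveSystem f V a Υ T) {x₀ : Plane}
    (hx₀ : x₀ ∈ filament f) (hV : ‖V x₀‖ = 1) : ∃ r > 0, ∀ x ∈ unitSquare, dist x x₀ < r →
      ∀ t ∈ Icc (-r) r, x + t • V x₀ ∈ unitSquare := by
  obtain ⟨h0, hcurve⟩ := hc.curve_filament x₀ hx₀
  have hmem0 : (0 : ℝ) ∈ Icc (-a) a := ⟨by linarith [hc.pos], hc.pos.le⟩
  have hnhds : Icc (-a) a ∈ 𝓝 (0 : ℝ) := Icc_mem_nhds (by linarith [hc.pos]) hc.pos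
  have hder : HasDerivAt (Υ x₀) (V x₀) 0 := by
    have := (hcurve 0 hmem0).2.hasDerivAt hnhds
    rwa [h0] at this
  have hderk : ∀ k : Fin 2, HasDerivAt (fun t => Υ x₀ t k) (V x₀ k) 0 := fun k =>
    (EuclideanSpace.proj (𝕜 := ℝ) k : Plane →L[ℝ] ℝ).hasFDerivAt.comp_hasDerivAt 0 hder
  have hk : ∀ k : Fin 2, ∃ r > 0, ∀ x ∈ unitSquare, dist x x₀ < r →
      ∀ t ∈ Icc (-r) r, x k + t * V x₀ k ∈ Icc (0 : ℝ) 1 := by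
    intro k
    have hb := hx₀.1 k
    have hev : ∀ᶠ t in 𝓝 (0 : ℝ), Υ x₀ t k ∈ Icc (0 : ℝ) 1 := by
      filter_upwards [hnhds] with t ht using (hcurve t ht).1 k
    by_cases hedge : x₀ k = 0 ∨ x₀ k = 1
    · have hz : V x₀ k = 0 := by
        rcases hedge with he | he
        · have hmin : IsLocalMin (fun t => Υ x₀ t k) 0 := by
            filter_upwards [hev] with t ht
            rw [h0, he]; exact ht.1
          exact hmin.hasDerivAt_eq_zero (hderk k)
        · have hmax : IsLocalMax (fun t => Υ x₀ t k) 0 := by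
            filter_upwards [hev] with t ht
            rw [h0, he]; exact ht.2
          exact hmax.hasDerivAt_eq_zero (hderk k)
      exact ⟨1, one_pos, fun x hx _ t _ => by rw [hz, mul_zero, add_zero]; exact hx k⟩
    · push Not at hedge
      have h1 : 0 < x₀ k := lt_of_le_of_ne hb.1 (Ne.symm hedge.1)
      have h2 : x₀ k < 1 := lt_of_le_of_ne hb.2 hedge.2
      set r := min (x₀ k) (1 - x₀ k) / 2 with hr
      have hm : 0 < min (x₀ k) (1 - x₀ k) := lt_min h1 (by linarith)
      have hm1 := min_le_left (x₀ k) (1 - x₀ k)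
      have hm2 := min_le_right (x₀ k) (1 - x₀ k)
      refine ⟨r, by positivity, fun x hx hd t ht => ?_⟩
      have e1 : |x k - x₀ k| ≤ dist x x₀ := by
        rw [dist_eq_norm]
        exact PiLp.norm_apply_le (x - x₀) k
      have e2 : |t * V x₀ k| ≤ r := by
        rw [abs_mul]
        have := abs_apply_le_one hV k
        have ht' : |t| ≤ r := abs_le.2 ht
        nlinarith [abs_nonneg t, abs_nonneg (V x₀ k)]
      have e3 := abs_le.1 (e1.trans hd.le)
      have e4 := abs_le.1 e2
      constructor <;> linarith
  choose r hr h using hk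
  refine ⟨min (r 0) (r 1), lt_min (hr 0) (hr 1), fun x hx hd t ht k => ?_⟩
  have hle : min (r 0) (r 1) ≤ r k := by
    fin_cases k
    · exact min_le_left _ _
    · exact min_le_right _ _
  have := h k x hx (hd.trans_le hle) t ⟨by linarith [ht.1], ht.2.trans hle⟩
  simpa using this

/-- Near a point of the ridge the derivative of the function in the direction of the eigenfield is
itself differentiable, because the eigenfield is a normalised Hessian image of a fixed vector. -/
theorem contDiffWithinAt_slope (hf : ContDiffOn ℝ (3 : ℕ) f unitSquare) (hδ : 0 < δ)
    (hV : IsEigenfield f (filamentNhd f δ) V) (hsep : HasSeparatedEigenvalues f δ η) {x₀ : Plane}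
    (hx₀ : x₀ ∈ filament f) :
    ContDiffWithinAt ℝ 1 (fun y => slope f y (V y)) unitSquare x₀ := by
  have hreg := isRegular_of_contDiffOn (hf.of_le (by exact_mod_cast (by omega : 2 ≤ 3)))
  have hxQ : x₀ ∈ unitSquare := hx₀.1
  have hD := filamentNhd_mem_nhdsWithin hδ hx₀
  have hxD := filament_subset_filamentNhd hδ hx₀
  set e := V x₀ with he
  have he1 := hV.norm_one x₀ hxQ
  have hVc : ContinuousWithinAt V unitSquare x₀ :=
    ((hV.continuousOn x₀ hxD).mono_of_mem_nhdsWithin hD)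
  -- near `x₀` the field points to the same side as `V x₀`, which fixes its sign
  have hin : ∀ᶠ y in 𝓝[unitSquare] x₀, 0 < e 0 * V y 0 + e 1 * V y 1 := by
    have hc : ContinuousWithinAt (fun y => e 0 * V y 0 + e 1 * V y 1) unitSquare x₀ := by
      have hk : ∀ k : Fin 2, ContinuousWithinAt (fun y => V y k) unitSquare x₀ := fun k =>
        (EuclideanSpace.proj (𝕜 := ℝ) k : Plane →L[ℝ] ℝ).continuous.continuousAt.comp_continuousWithinAt
          hVc
      exact (continuousWithinAt_const.mul (hk 0)).add (continuousWithinAt_const.mul (hk 1))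
    refine hc.eventually (lt_mem_nhds ?_)
    have := norm_eq_one_iff_plane.1 he1
    rw [← he] at this
    change 0 < e 0 * e 0 + e 1 * e 1
    nlinarith
  -- so the field is the normalised `ridgeVec` of the fixed vector `V x₀`, which is as smooth as the
  -- Hessian
  have hEq : (fun y => slope f y (V y)) =ᶠ[𝓝[unitSquare] x₀] fun y =>
      slope f y (ridgeVec f y e) / √(ridgeVec f y e 0 ^ 2 + ridgeVec f y e 1 ^ 2) := by
    filter_upwards [hin, hD, self_mem_nhdsWithin] with y hy hyD hyQ
    have hs := hreg.symm y hyQ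
    have hgap := (hsep y hyD).1
    have hVy := hV.eigenvector y hyQ
    have hVy1 := hV.norm_one y hyQ
    have hVy2 := norm_eq_one_iff_plane.1 hVy1
    have hrv := ridgeVec_eq_smul hs hVy
    have r0 : ridgeVec f y (V y) 0 = eigGap f y * V y 0 := by rw [hrv]; simp
    have r1 : ridgeVec f y (V y) 1 = eigGap f y * V y 1 := by rw [hrv]; simp
    have hsym : ridgeVec f y e 0 * V y 0 + ridgeVec f y e 1 * V y 1 =
        eigGap f y * (e 0 * V y 0 + e 1 * V y 1) := by
      simp [ridgeVec] at r0 r1 ⊢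
      linear_combination e 0 * r0 + e 1 * r1
    set c := eigGap f y * (e 0 * V y 0 + e 1 * V y 1) with hc
    have hc0 : 0 < c := mul_pos hgap hy
    have hne : ridgeVec f y e ≠ 0 := by
      intro h0
      rw [h0] at hsym
      simp at hsym
      exact hc0.ne hsym
    have hpar := (isMinEigenvector_ridgeVec hs e hne).eq_smul hs hgap hVy hVy1
    rw [hsym] at hpar
    rw [hpar, slope_smul]
    have hsq : √((c • V y) 0 ^ 2 + (c • V y) 1 ^ 2) = c := by
      rw [show (c • V y) 0 ^ 2 + (c • V y) 1 ^ 2 = c ^ 2 by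
        simp only [PiLp.smul_apply, smul_eq_mul]; linear_combination c ^ 2 * hVy2]
      exact Real.sqrt_sq hc0.le
    rw [hsq]
    field_simp
  have hp : ∀ i, ContDiffWithinAt ℝ 1 (pderiv i f) unitSquare x₀ := fun i =>
    ((contDiffOn_pderiv (m := 2) hf i) x₀ hxQ).of_le (by norm_num)
  have hh : ∀ i j, ContDiffWithinAt ℝ 1 (fun y => hess f y i j) unitSquare x₀ := fun i j =>
    (contDiffOn_pderiv (m := 1) (contDiffOn_pderiv (m := 2) hf j) i) x₀ hxQ
  have hgapx := (hsep x₀ hxD).1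
  have hg : ContDiffWithinAt ℝ 1 (eigGap f) unitSquare x₀ := by
    refine ContDiffWithinAt.sqrt ?_ ?_
    · exact (((hh 0 0).sub (hh 1 1)).pow 2).add (contDiffWithinAt_const.mul ((hh 0 1).pow 2))
    · intro h0
      rw [eigGap, h0, Real.sqrt_zero] at hgapx
      exact hgapx.false
  have hw0 : ContDiffWithinAt ℝ 1 (fun y => ridgeVec f y e 0) unitSquare x₀ := by
    have : (fun y => ridgeVec f y e 0) = fun y =>
        ((hess f y 1 1 - hess f y 0 0 + eigGap f y) * e 0 - 2 * hess f y 0 1 * e 1) / 2 := by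
      funext y; simp [ridgeVec]
    rw [this]
    exact (((((hh 1 1).sub (hh 0 0)).add hg).mul contDiffWithinAt_const).sub
      ((contDiffWithinAt_const.mul (hh 0 1)).mul contDiffWithinAt_const)).div_const 2
  have hw1 : ContDiffWithinAt ℝ 1 (fun y => ridgeVec f y e 1) unitSquare x₀ := by
    have : (fun y => ridgeVec f y e 1) = fun y =>
        ((hess f y 0 0 - hess f y 1 1 + eigGap f y) * e 1 - 2 * hess f y 0 1 * e 0) / 2 := by
      funext y; simp [ridgeVec]
    rw [this]
    exact (((((hh 0 0).sub (hh 1 1)).add hg).mul contDiffWithinAt_const).sub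
      ((contDiffWithinAt_const.mul (hh 0 1)).mul contDiffWithinAt_const)).div_const 2
  have hnorm : ridgeVec f x₀ e 0 ^ 2 + ridgeVec f x₀ e 1 ^ 2 = eigGap f x₀ ^ 2 := by
    have hrv := ridgeVec_eq_smul (hreg.symm x₀ hxQ) (hV.eigenvector x₀ hxQ)
    rw [← he] at hrv
    have := norm_eq_one_iff_plane.1 he1
    rw [hrv]
    simp only [PiLp.smul_apply, smul_eq_mul]
    rw [← he] at this
    linear_combination eigGap f x₀ ^ 2 * this
  have hpos : ridgeVec f x₀ e 0 ^ 2 + ridgeVec f x₀ e 1 ^ 2 ≠ 0 := by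
    rw [hnorm]; positivity
  refine ContDiffWithinAt.congr_of_eventuallyEq ?_ hEq (hEq.eq_of_nhdsWithin hxQ)
  refine ContDiffWithinAt.div ?_ (((hw0.pow 2).add (hw1.pow 2)).sqrt hpos)
    (Real.sqrt_ne_zero'.2 (lt_of_le_of_ne (by positivity) hpos.symm))
  exact ((hp 0).mul hw0).add ((hp 1).mul hw1)

/-- Along short segments in the direction of the eigenfield the slope is strictly monotone, with a
rate bounded from below. -/
theorem exists_monotone_slope (hf : ContDiffOn ℝ (3 : ℕ) f unitSquare) (hδ : 0 < δ)
    (hη : 0 < η) (hV : IsEigenfield f (filamentNhd f δ) V) (hc : IsCurveSystem f V a Υ T)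
    (hsep : HasSeparatedEigenvalues f δ η) (htrans : IsTransversal f V δ η) {x₀ : Plane}
    (hx₀ : x₀ ∈ filament f) : ∃ r > 0, ∃ s κ : ℝ, |s| = 1 ∧ 0 < κ ∧
      ∀ x ∈ unitSquare, dist x x₀ < r →
        (∀ t ∈ Icc (-r) r, x + t • V x₀ ∈ filamentNhd f δ ∧ κ ≤ eigGap f (x + t • V x₀)) ∧
        ContinuousOn (fun t => slope f (x + t • V x₀) (V (x + t • V x₀))) (Icc (-r) r) ∧
        ∀ t ∈ Icc (-r) r, ∀ t' ∈ Icc (-r) r, t ≤ t' → η / 2 * (t' - t) ≤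
          s * slope f (x + t' • V x₀) (V (x + t' • V x₀)) -
            s * slope f (x + t • V x₀) (V (x + t • V x₀)) := by
  have hreg := isRegular_of_contDiffOn (hf.of_le (by exact_mod_cast (by omega : 2 ≤ 3)))
  have hxQ : x₀ ∈ unitSquare := hx₀.1
  have hxD := filament_subset_filamentNhd hδ hx₀
  set e := V x₀ with he
  have he1 : ‖e‖ = 1 := hV.norm_one x₀ hxQ
  set G : Plane → ℝ := fun y => slope f y (V y) with hG
  have hGc := contDiffWithinAt_slope hf hδ hV hsep hx₀
  have hdiff : ∀ᶠ y in 𝓝[unitSquare] x₀, DifferentiableWithinAt ℝ G unitSquare y := by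
    have := hGc.eventually (by simp)
    rw [insert_eq_of_mem hxQ] at this
    filter_upwards [this] with y hy using hy.differentiableWithinAt (by norm_num)
  set L : Plane → ℝ := fun y => fderivWithin ℝ G unitSquare y e with hL
  have hLc : ContinuousWithinAt L unitSquare x₀ := by
    have h1 := (hGc.fderivWithin_right (m := 0) uniqueDiffOn_unitSquare (by norm_num)
      hxQ).continuousWithinAt
    exact h1.clm_apply continuousWithinAt_const
  have hLx : η ≤ |L x₀| := by
    have h1 := htrans x₀ hxD
    have h2 : (fun y => inner ℝ (grad f y) (V y)) = G := by
      funext y; exact inner_grad_eq f y (V y)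
    rw [h2, inner_grad_eq] at h1
    have h3 : slope G x₀ (V x₀) = L x₀ := by
      have hdec : e = e 0 • EuclideanSpace.single 0 1 + e 1 • EuclideanSpace.single 1 1 := by
        ext k; fin_cases k <;> simp
      simp only [hL, slope, pderiv]
      conv_rhs => rw [hdec, map_add, map_smul, map_smul]
      simp [mul_comm, ← he]
    rwa [h3] at h1
  obtain ⟨s, hs1, hsL⟩ : ∃ s : ℝ, |s| = 1 ∧ η ≤ s * L x₀ := by
    rcases abs_cases (L x₀) with ⟨h1, -⟩ | ⟨h1, -⟩
    · exact ⟨1, by simp, by rw [one_mul, ← h1]; exact hLx⟩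
    · exact ⟨-1, by simp, by rw [neg_one_mul, ← h1]; exact hLx⟩
  have hLev : ∀ᶠ y in 𝓝[unitSquare] x₀, η / 2 ≤ s * L y := by
    have : ContinuousWithinAt (fun y => s * L y) unitSquare x₀ := continuousWithinAt_const.mul hLc
    exact this.eventually (le_mem_nhds (by linarith))
  have hgap0 := (hsep x₀ hxD).1
  have hgev : ∀ᶠ y in 𝓝[unitSquare] x₀, eigGap f x₀ / 2 ≤ eigGap f y :=
    (hreg.continuousOn_eigGap x₀ hxQ).eventually (le_mem_nhds (by linarith))
  obtain ⟨R, hR, hball⟩ := Metric.mem_nhdsWithin_iff.1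
    (((hdiff.and hLev).and hgev).and (filamentNhd_mem_nhdsWithin hδ hx₀))
  obtain ⟨r, hr, hseg⟩ := exists_segment_subset hc hx₀ he1
  refine ⟨min r (R / 2), by positivity, s, eigGap f x₀ / 2, hs1, by positivity,
    fun x hx hd => ?_⟩
  set ρ := min r (R / 2) with hρ
  have hρr : ρ ≤ r := min_le_left _ _
  have hρR : ρ ≤ R / 2 := min_le_right _ _
  have hin : ∀ t ∈ Icc (-ρ) ρ, x + t • e ∈ unitSquare ∧ x + t • e ∈ Metric.ball x₀ R := by
    intro t ht
    refine ⟨hseg x hx (hd.trans_le hρr) t ⟨by linarith [ht.1], ht.2.trans hρr⟩, ?_⟩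
    rw [Metric.mem_ball]
    have h1 : dist (x + t • e) x ≤ ρ := by
      rw [dist_eq_norm, add_sub_cancel_left, norm_smul, he1, mul_one]
      exact abs_le.2 ht
    have := dist_triangle (x + t • e) x x₀
    linarith
  have hall := fun t ht => hball ⟨(hin t ht).2, (hin t ht).1⟩
  have hline : ∀ t, HasDerivAt (fun t : ℝ => x + t • e) e t := by
    intro t
    simpa using ((hasDerivAt_id t).smul_const e).const_add x
  have hder : ∀ t ∈ Icc (-ρ) ρ, HasDerivWithinAt (fun t => G (x + t • e)) (L (x + t • e))
      (Icc (-ρ) ρ) t := by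
    intro t ht
    have h1 : DifferentiableWithinAt ℝ G unitSquare (x + t • e) := (hall t ht).1.1.1
    exact h1.hasFDerivWithinAt.comp_hasDerivWithinAt t (hline t).hasDerivWithinAt
      (fun u hu => (hin u hu).1)
  have hcont : ContinuousOn (fun t => G (x + t • e)) (Icc (-ρ) ρ) := fun t ht =>
    (hder t ht).continuousWithinAt
  refine ⟨fun t ht => ⟨(hall t ht).2, (hall t ht).1.2⟩, hcont, fun t ht t' ht' htt' => ?_⟩
  set φ : ℝ → ℝ := fun t => s * G (x + t • e) - η / 2 * t with hφ
  have hmono : MonotoneOn φ (Icc (-ρ) ρ) := by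
    refine monotoneOn_of_deriv_nonneg (convex_Icc _ _) ?_ ?_ ?_
    · exact (continuousOn_const.mul hcont).sub (by fun_prop)
    · intro u hu
      rw [interior_Icc] at hu
      have h1 := (hder u (Ioo_subset_Icc_self hu)).hasDerivAt (Icc_mem_nhds hu.1 hu.2)
      exact ((h1.const_mul s).sub ((hasDerivAt_id u).const_mul _)).differentiableAt.differentiableWithinAt
    · intro u hu
      rw [interior_Icc] at hu
      have hu' := Ioo_subset_Icc_self hu
      have h1 := (hder u hu').hasDerivAt (Icc_mem_nhds hu.1 hu.2)
      have h2 := (h1.const_mul s).sub ((hasDerivAt_id u).const_mul (η / 2))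
      have h3 : deriv φ u = s * L (x + u • e) - η / 2 * 1 := h2.deriv
      rw [h3]
      have := (hall u hu').1.1.2
      linarith
  have := hmono ht ht' htt'
  simp only [hφ] at this
  linarith

end Ridge

section RidgeStability

variable {f : Plane → ℝ} {δ η a : ℝ} {V : Plane → Plane} {Υ : Plane → ℝ → Plane}
  {T : Plane → ℝ}

theorem exists_zero_of_endpoints {φ : ℝ → ℝ} {t : ℝ} (ht : 0 ≤ t) (hφ : ContinuousOn φ (Icc (-t) t))
    (h1 : φ (-t) ≤ 0) (h2 : 0 ≤ φ t) : ∃ u ∈ Icc (-t) t, φ u = 0 :=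
  intermediate_value_Icc (by linarith) hφ ⟨h1, h2⟩

theorem dist_add_smul_le {x e : Plane} (he : ‖e‖ = 1) {t r : ℝ} (ht : t ∈ Icc (-r) r) :
    edist x (x + t • e) ≤ ENNReal.ofReal r := by
  rw [edist_dist, dist_eq_norm, show x - (x + t • e) = -(t • e) by abel, norm_neg, norm_smul, he,
    mul_one]
  exact ENNReal.ofReal_le_ofReal (abs_le.2 ht)

set_option maxHeartbeats 1600000 in
/-- Stability of the ridge near one of its points: the slope in the direction of the eigenfield
changes sign along a short transversal segment, for the function as well as for its
perturbation. -/
theorem exists_local_stability (hf : ContDiffOn ℝ (3 : ℕ) f unitSquare) (hδ : 0 < δ)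
    (hη : 0 < η) (hV : IsEigenfield f (filamentNhd f δ) V) (hc : IsCurveSystem f V a Υ T)
    (hsep : HasSeparatedEigenvalues f δ η) (htrans : IsTransversal f V δ η) {x₀ : Plane}
    (hx₀ : x₀ ∈ filament f) : ∃ r > 0, ∃ C > 0, ∀ᶠ ε in 𝓝[>] (0 : ℝ),
      ∀ g : Plane → ℝ, IsRegular g → IsC2Close g f ε →
        (∀ x ∈ filament g, dist x x₀ < r →
          ∃ y ∈ filament f, edist x y ≤ ENNReal.ofReal (C * ε)) ∧
        (∀ x ∈ filament f, dist x x₀ < r →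
          ∃ y ∈ filament g, edist x y ≤ ENNReal.ofReal (C * ε)) := by
  have hreg := isRegular_of_contDiffOn (hf.of_le (by exact_mod_cast (by omega : 2 ≤ 3)))
  obtain ⟨r, hr, s, κ, hs1, hκ, hloc⟩ :=
    exists_monotone_slope hf hδ hη hV hc hsep htrans hx₀
  have he1 : ‖V x₀‖ = 1 := hV.norm_one x₀ hx₀.1
  set e := V x₀ with he
  have hs2 : s * s = 1 := by
    rw [← abs_mul_abs_self, hs1, one_mul]
  obtain ⟨K0, hK0⟩ := isCompact_unitSquare.exists_bound_of_continuousOn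
    (hreg.continuousOn_pderiv 0)
  obtain ⟨K1, hK1⟩ := isCompact_unitSquare.exists_bound_of_continuousOn
    (hreg.continuousOn_pderiv 1)
  obtain ⟨K2, hK2⟩ := isCompact_unitSquare.exists_bound_of_continuousOn hreg.continuousOn_eigGap
  set K := max (max K0 K1) (max K2 1) with hK
  have hK1' : 1 ≤ K := (le_max_right _ _).trans (le_max_right _ _)
  have hKp : ∀ y ∈ unitSquare, ∀ i, |pderiv i f y| ≤ K := by
    intro y hy i
    fin_cases i
    · exact (hK0 y hy).trans ((le_max_left _ _).trans (le_max_left _ _))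
    · exact (hK1 y hy).trans ((le_max_right _ _).trans (le_max_left _ _))
  have hKg : ∀ y ∈ unitSquare, eigGap f y ≤ K := fun y hy =>
    (le_abs_self _).trans ((hK2 y hy).trans ((le_max_left _ _).trans (le_max_right _ _)))
  set A : ℝ := 20 * K with hA
  have hA0 : 0 < A := by positivity
  -- slopes of `f` at ridge points of `g` are at most `4 A ε / κ`; since slopes grow at the rate
  -- `η / 2` along the segments, this size is exceeded at distance `C ε`
  set C : ℝ := 8 * A / (κ * η) with hC
  have hC0 : 0 < C := by positivity
  refine ⟨r, hr, C, hC0, ?_⟩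
  have hsmall : ∀ c : ℝ, 0 < c → ∀ᶠ ε in 𝓝[>] (0 : ℝ), ε ≤ c := fun c hc0 =>
    Filter.mem_of_superset (Ioc_mem_nhdsGT hc0) fun ε hε => hε.2
  filter_upwards [self_mem_nhdsWithin, hsmall (κ / 24) (by positivity), hsmall 1 one_pos,
    hsmall (r / C) (by positivity), hsmall (η / 4) (by positivity)]
    with ε hε0 hεκ hε1 hεr hεη g hg hgf
  have hε : 0 < ε := hε0
  set ρ := C * ε with hρ
  have hρ0 : 0 < ρ := by positivity
  have hρr : ρ ≤ r := by
    rw [le_div_iff₀ hC0] at hεr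
    rw [hρ]; linarith
  have hρη : η / 2 * ρ = 4 * A * ε / κ := by
    rw [hρ, hC]; field_simp; ring
  have hm0 : (0 : ℝ) ∈ Icc (-r) r := ⟨by linarith, hr.le⟩
  have hmρ : ρ ∈ Icc (-r) r := ⟨by linarith, hρr⟩
  have hmρ' : -ρ ∈ Icc (-r) r := ⟨by linarith, by linarith⟩
  have hsub : Icc (-ρ) ρ ⊆ Icc (-r) r := Icc_subset_Icc (by linarith) hρr
  constructor
  -- a ridge point of `g`: its eigenvector `v` for `g` is almost one for `f`, and `ridgeVec f x v` is
  -- one exactly, so the slope of `f` is of the order `ε`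
  · intro x hx hd
    have hxQ : x ∈ unitSquare := hx.1
    obtain ⟨h1, h2, h3⟩ := hloc x hxQ hd
    have h10 := h1 0 hm0
    rw [zero_smul, add_zero] at h10
    obtain ⟨hxD, hgapx⟩ := h10
    obtain ⟨v, hv, hv1, hv0⟩ := exists_unit_of_mem_filament hx
    have hvi := fun i => abs_apply_le_one hv1 i
    have hVx1 := hV.norm_one x hxQ
    have hs := hreg.symm x hxQ
    set u := ridgeVec f x v with hu
    have hgv : ridgeVec g x v = eigGap g x • v := ridgeVec_eq_smul (hg.symm x hxQ) hv
    have hdiff : ∀ i, |eigGap g x * v i - u i| ≤ 4 * ε := by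
      intro i
      have := hgf.abs_ridgeVec_sub_le hxQ hvi i
      rw [hgv] at this
      simpa using this
    have hgapg := abs_le.1 (hgf.abs_eigGap_sub_le hxQ)
    have hgap_le := hKg x hxQ
    have hgapg0 : 0 ≤ eigGap g x := eigGap_nonneg g x
    have hslope : |slope f x u| ≤ A * ε := by
      have e1 : slope f x u = eigGap g x * (slope f x v - slope g x v) -
          (pderiv 0 f x * (eigGap g x * v 0 - u 0) +
            pderiv 1 f x * (eigGap g x * v 1 - u 1)) := by
        rw [hv0]; simp only [slope]; ring
      rw [e1]
      have b1 : |eigGap g x * (slope f x v - slope g x v)| ≤ (K + 4 * ε) * (2 * ε) := by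
        rw [abs_mul, abs_of_nonneg hgapg0, abs_sub_comm]
        exact mul_le_mul (by linarith) (hgf.abs_slope_sub_le hxQ hvi) (abs_nonneg _)
          (by positivity)
      have b2 : |pderiv 0 f x * (eigGap g x * v 0 - u 0) +
          pderiv 1 f x * (eigGap g x * v 1 - u 1)| ≤ K * (4 * ε) + K * (4 * ε) := by
        refine (abs_add_le _ _).trans (add_le_add ?_ ?_)
        · rw [abs_mul]
          exact mul_le_mul (hKp x hxQ 0) (hdiff 0) (abs_nonneg _) (by positivity)
        · rw [abs_mul]
          exact mul_le_mul (hKp x hxQ 1) (hdiff 1) (abs_nonneg _) (by positivity)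
      refine (abs_sub _ _).trans ?_
      have : ε * ε ≤ K * ε := by nlinarith
      nlinarith
    -- one coordinate of the unit vector is at least `1 / 2`
    obtain ⟨i, hi⟩ : ∃ i, 1 / 2 ≤ |v i| := by
      by_contra! hcon
      have c0 := hcon 0
      have c1 := hcon 1
      have := norm_eq_one_iff_plane.1 hv1
      rw [← sq_abs (v 0), ← sq_abs (v 1)] at this
      nlinarith [abs_nonneg (v 0), abs_nonneg (v 1)]
    have hui : κ / 4 ≤ |u i| := by
      have t1 := abs_sub_abs_le_abs_sub (eigGap g x * v i) (u i)
      have t2 := hdiff i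
      rw [abs_mul, abs_of_nonneg hgapg0] at t1
      have t3 : (κ - 4 * ε) * (1 / 2) ≤ eigGap g x * |v i| :=
        mul_le_mul (by linarith) hi (by norm_num) hgapg0
      linarith
    have hune : u ≠ 0 := by
      intro h0
      rw [h0] at hui
      simp at hui
      linarith
    have hpar := (isMinEigenvector_ridgeVec hs v hune).eq_smul hs (hsep x hxD).1
      (hV.eigenvector x hxQ) hVx1
    rw [← hu] at hpar
    set c := u 0 * V x 0 + u 1 * V x 1 with hc'
    have hcabs : κ / 4 ≤ |c| := by
      have t1 : |u i| = |c| * |V x i| := by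
        conv_lhs => rw [hpar]
        simp [abs_mul]
      have t2 := abs_apply_le_one hVx1 i
      nlinarith [abs_nonneg c, abs_nonneg (V x i)]
    have hGx : |slope f x (V x)| ≤ 4 * A * ε / κ := by
      rw [hpar, slope_smul, abs_mul] at hslope
      rw [le_div_iff₀ hκ]
      nlinarith [abs_nonneg (slope f x (V x))]
    have hGs : |s * slope f x (V x)| ≤ 4 * A * ε / κ := by
      rw [abs_mul, hs1, one_mul]; exact hGx
    have hGs' := abs_le.1 hGs
    -- by monotonicity the slope of `f` has different signs at the end points of the segment
    have m1 := h3 0 hm0 ρ hmρ hρ0.le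
    have m2 := h3 (-ρ) hmρ' 0 hm0 (by linarith)
    rw [zero_smul, add_zero] at m1 m2
    rw [sub_zero, hρη] at m1
    rw [zero_sub, neg_neg, hρη] at m2
    obtain ⟨t, ht, hzero⟩ := exists_zero_of_endpoints hρ0.le
      (φ := fun t => s * slope f (x + t • e) (V (x + t • e)))
      (continuousOn_const.mul (h2.mono hsub)) (by linarith) (by linarith)
    have hyD := (h1 t (hsub ht)).1
    have hGy : slope f (x + t • e) (V (x + t • e)) = 0 := by
      rcases mul_eq_zero.1 hzero with h0 | h0
      · rw [h0] at hs1; simp at hs1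
      · exact h0
    refine ⟨x + t • e, ⟨hyD.2, ?_, V (x + t • e), hV.eigenvector _ hyD.2, ?_⟩,
      dist_add_smul_le he1 ht⟩
    · have := (hsep _ hyD).2; linarith
    · rw [inner_grad_eq, hGy]
  -- a ridge point of `f`: the slope of `g` along its own eigenvectors has different signs at the
  -- end points of a short segment
  · intro x hx hd
    have hxQ : x ∈ unitSquare := hx.1
    obtain ⟨h1, h2, h3⟩ := hloc x hxQ hd
    have h10 := h1 0 hm0
    rw [zero_smul, add_zero] at h10
    obtain ⟨hxD, hgapx⟩ := h10
    have hs := hreg.symm x hxQ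
    have hGx : slope f x (V x) = 0 := by
      obtain ⟨v, hv, hv1, hv0⟩ := exists_unit_of_mem_filament hx
      have hpar := (hV.eigenvector x hxQ).eq_smul hs (hsep x hxD).1 hv hv1
      rw [hpar, slope_smul, hv0, mul_zero]
    -- the slope of the perturbation in the direction of its own eigenvector
    set ψ : ℝ → ℝ := fun t => s * slope g (x + t • e) (ridgeVec g (x + t • e) (V (x + t • e)))
      with hψ
    have hymem : ∀ t ∈ Icc (-ρ) ρ, x + t • e ∈ filamentNhd f δ := fun t ht => (h1 t (hsub ht)).1
    have hline : ContinuousOn (fun t : ℝ => x + t • e) (Icc (-ρ) ρ) := by fun_prop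
    have hcomp : ∀ {F : Plane → ℝ}, ContinuousOn F unitSquare →
        ContinuousOn (fun t : ℝ => F (x + t • e)) (Icc (-ρ) ρ) := fun hF =>
      hF.comp hline fun t ht => (hymem t ht).2
    have hVk : ∀ k : Fin 2, ContinuousOn (fun t : ℝ => V (x + t • e) k) (Icc (-ρ) ρ) := fun k =>
      (EuclideanSpace.proj (𝕜 := ℝ) k : Plane →L[ℝ] ℝ).continuous.comp_continuousOn
        (hV.continuousOn.comp hline hymem)
    have hψc : ContinuousOn ψ (Icc (-ρ) ρ) := by
      have a00 := hcomp (hg.continuousOn_hess 0 0)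
      have a01 := hcomp (hg.continuousOn_hess 0 1)
      have a11 := hcomp (hg.continuousOn_hess 1 1)
      have p0 := hcomp (hg.continuousOn_pderiv 0)
      have p1 := hcomp (hg.continuousOn_pderiv 1)
      have gg := hcomp hg.continuousOn_eigGap
      simp only [hψ, slope_ridgeVec]
      exact continuousOn_const.mul ((p0.mul (((((a11.sub a00).add gg).mul (hVk 0)).sub
        ((continuousOn_const.mul a01).mul (hVk 1))).div_const 2)).add
        (p1.mul (((((a00.sub a11).add gg).mul (hVk 1)).sub
        ((continuousOn_const.mul a01).mul (hVk 0))).div_const 2)))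
    have hψd : ∀ t ∈ Icc (-ρ) ρ, |ψ t - eigGap f (x + t • e) *
        (s * slope f (x + t • e) (V (x + t • e)))| ≤ A * ε := by
      intro t ht
      have hyQ := (hymem t ht).2
      set y := x + t • e with hy
      have hVi := fun i => abs_apply_le_one (hV.norm_one y hyQ) i
      have hfv : ridgeVec f y (V y) = eigGap f y • V y :=
        ridgeVec_eq_smul (hreg.symm y hyQ) (hV.eigenvector y hyQ)
      have hd := hgf.abs_ridgeVec_sub_le hyQ hVi
      have e1 : ψ t - eigGap f y * (s * slope f y (V y)) =
          s * (((pderiv 0 g y) * (ridgeVec g y (V y) 0 - ridgeVec f y (V y) 0) +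
            (pderiv 1 g y) * (ridgeVec g y (V y) 1 - ridgeVec f y (V y) 1)) +
            eigGap f y * (slope g y (V y) - slope f y (V y))) := by
        simp only [hψ, hfv, slope, ← hy]
        simp
        ring
      have hpg : ∀ i, |pderiv i g y| ≤ K + ε := by
        intro i
        have t1 := abs_sub_abs_le_abs_sub (pderiv i g y) (pderiv i f y)
        have t2 := (hgf y hyQ).1 i
        have t3 := hKp y hyQ i
        linarith
      rw [e1, abs_mul, hs1, one_mul]
      refine (abs_add_le _ _).trans ?_
      have b1 : |pderiv 0 g y * (ridgeVec g y (V y) 0 - ridgeVec f y (V y) 0) +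
            (pderiv 1 g y) * (ridgeVec g y (V y) 1 - ridgeVec f y (V y) 1)| ≤
          (K + ε) * (4 * ε) + (K + ε) * (4 * ε) := by
        refine (abs_add_le _ _).trans (add_le_add ?_ ?_)
        · rw [abs_mul]
          exact mul_le_mul (hpg 0) (hd 0) (abs_nonneg _) (by positivity)
        · rw [abs_mul]
          exact mul_le_mul (hpg 1) (hd 1) (abs_nonneg _) (by positivity)
      have b2 : |eigGap f y * (slope g y (V y) - slope f y (V y))| ≤ K * (2 * ε) := by
        rw [abs_mul, abs_of_nonneg (eigGap_nonneg f y)]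
        exact mul_le_mul (hKg y hyQ) (hgf.abs_slope_sub_le hyQ hVi) (abs_nonneg _)
          (by positivity)
      have : ε * ε ≤ K * ε := by nlinarith
      nlinarith
    have m1 := h3 0 hm0 ρ hmρ hρ0.le
    have m2 := h3 (-ρ) hmρ' 0 hm0 (by linarith)
    rw [zero_smul, add_zero, hGx, mul_zero, sub_zero, sub_zero, hρη] at m1
    rw [zero_smul, add_zero, hGx, mul_zero, zero_sub, zero_sub, neg_neg, hρη] at m2
    have hρm : ρ ∈ Icc (-ρ) ρ := ⟨by linarith, le_rfl⟩
    have hρm' : -ρ ∈ Icc (-ρ) ρ := ⟨le_rfl, by linarith⟩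
    have hprod : ∀ γ b : ℝ, κ ≤ γ → 4 * A * ε / κ ≤ b → A * ε ≤ γ * b := by
      intro γ b h1 h2
      have h4 : 0 ≤ 4 * A * ε / κ := by positivity
      calc A * ε ≤ κ * (4 * A * ε / κ) := by
            rw [mul_div_cancel₀ _ hκ.ne']; nlinarith [mul_pos hA0 hε]
        _ ≤ γ * b := mul_le_mul h1 h2 h4 (hκ.le.trans h1)
    have d1 := abs_le.1 (hψd ρ hρm)
    have d2 := abs_le.1 (hψd (-ρ) hρm')
    have p1 := hprod _ _ (h1 ρ hmρ).2 m1
    have p2 := hprod _ _ (h1 (-ρ) hmρ').2 m2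
    obtain ⟨t, ht, hzero⟩ := exists_zero_of_endpoints hρ0.le hψc (by linarith) (by linarith)
    have hyD := hymem t ht
    have hyQ := hyD.2
    have hgapy := (h1 t (hsub ht)).2
    set y := x + t • e with hy
    have hVi := fun i => abs_apply_le_one (hV.norm_one y hyQ) i
    -- the zero of the slope is a ridge point, because the eigenvector does not vanish: its distance
    -- to `eigGap f y • V y`, which has norm at least `κ`, is small
    have hne : ridgeVec g y (V y) ≠ 0 := by
      intro h0
      have hd := hgf.abs_ridgeVec_sub_le hyQ hVi
      rw [h0, ridgeVec_eq_smul (hreg.symm y hyQ) (hV.eigenvector y hyQ)] at hd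
      have hd0 := hd 0
      have hd1 := hd 1
      simp only [PiLp.zero_apply, PiLp.smul_apply, smul_eq_mul, zero_sub, abs_neg, abs_mul,
        abs_of_nonneg (eigGap_nonneg f y)] at hd0 hd1
      have hn := norm_eq_one_iff_plane.1 (hV.norm_one y hyQ)
      rw [← sq_abs (V y 0), ← sq_abs (V y 1)] at hn
      have c0 : |V y 0| ≤ 1 / 6 := by
        have : κ * |V y 0| ≤ κ * (1 / 6) := by nlinarith [abs_nonneg (V y 0)]
        exact le_of_mul_le_mul_left this hκ
      have c1 : |V y 1| ≤ 1 / 6 := by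
        have : κ * |V y 1| ≤ κ * (1 / 6) := by nlinarith [abs_nonneg (V y 1)]
        exact le_of_mul_le_mul_left this hκ
      nlinarith [abs_nonneg (V y 0), abs_nonneg (V y 1)]
    refine ⟨y, ⟨hyQ, ?_, ridgeVec g y (V y), isMinEigenvector_ridgeVec (hg.symm y hyQ) _ hne, ?_⟩,
      dist_add_smul_le he1 ht⟩
    · have t1 := (hsep y hyD).2
      have t2 := abs_le.1 (hgf.abs_lamMin_sub_le hyQ)
      linarith
    · rw [inner_grad_eq]
      rcases mul_eq_zero.1 hzero with h0 | h0
      · rw [h0] at hs1; simp at hs1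
      · exact h0

/-- Away from the ridge, small perturbations have no ridge points: by nondegeneracy the defining
conditions, with `≤` in place of `<` for the eigenvalue, fail uniformly there. -/
theorem eventually_filament_subset (hreg : IsRegular f) (hnd : IsNondegenerate f) {U : Set Plane}
    (hU : IsOpen U) (hsub : filament f ⊆ U) : ∀ᶠ ε in 𝓝[>] (0 : ℝ),
      ∀ g : Plane → ℝ, IsRegular g → IsC2Close g f ε → filament g ⊆ U := by
  -- `Φ (x, v) = 0` for a unit vector `v` means that the smaller eigenvalue at `x` is at most zero, and
  -- that `v` is an eigenvector for it along which the slope vanishes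
  set Φ : Plane × Plane → ℝ := fun p => max (lamMin f p.1) 0 + |slope f p.1 p.2| +
    |hess f p.1 0 0 * p.2 0 + hess f p.1 0 1 * p.2 1 - lamMin f p.1 * p.2 0| +
    |hess f p.1 0 1 * p.2 0 + hess f p.1 1 1 * p.2 1 - lamMin f p.1 * p.2 1| with hΦ
  set Z : Set (Plane × Plane) := (unitSquare \ U) ×ˢ Metric.sphere (0 : Plane) 1 with hZ
  have hZc : IsCompact Z := (isCompact_unitSquare.diff hU).prod (isCompact_sphere _ _)
  have hfst : ContinuousOn (fun p : Plane × Plane => p.1) Z := continuousOn_fst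
  have hcomp : ∀ {F : Plane → ℝ}, ContinuousOn F unitSquare →
      ContinuousOn (fun p : Plane × Plane => F p.1) Z := fun hF =>
    hF.comp hfst fun p hp => hp.1.1
  have hk : ∀ k : Fin 2, ContinuousOn (fun p : Plane × Plane => p.2 k) Z := fun k =>
    ((EuclideanSpace.proj (𝕜 := ℝ) k : Plane →L[ℝ] ℝ).continuous.comp
      continuous_snd).continuousOn
  have hΦc : ContinuousOn Φ Z := by
    have a00 := hcomp (hreg.continuousOn_hess 0 0)
    have a01 := hcomp (hreg.continuousOn_hess 0 1)
    have a11 := hcomp (hreg.continuousOn_hess 1 1)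
    have p0 := hcomp (hreg.continuousOn_pderiv 0)
    have p1 := hcomp (hreg.continuousOn_pderiv 1)
    have l := hcomp hreg.continuousOn_lamMin
    exact (((l.sup continuousOn_const).add (((p0.mul (hk 0)).add (p1.mul (hk 1))).abs)).add
      ((((a00.mul (hk 0)).add (a01.mul (hk 1))).sub (l.mul (hk 0))).abs)).add
      ((((a01.mul (hk 0)).add (a11.mul (hk 1))).sub (l.mul (hk 1))).abs)
  have hpos : ∀ p ∈ Z, 0 < Φ p := by
    rintro ⟨x, v⟩ ⟨⟨hxQ, hxU⟩, hv⟩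
    have hv1 : ‖v‖ = 1 := by simpa using hv
    have n1 := le_max_right (lamMin f x) 0
    have n2 := abs_nonneg (slope f x v)
    have n3 := abs_nonneg (hess f x 0 0 * v 0 + hess f x 0 1 * v 1 - lamMin f x * v 0)
    have n4 := abs_nonneg (hess f x 0 1 * v 0 + hess f x 1 1 * v 1 - lamMin f x * v 1)
    by_contra hcon
    simp only [hΦ, not_lt] at hcon
    have z1 : max (lamMin f x) 0 = 0 := by linarith
    have z2 := abs_eq_zero.1 (by linarith : |slope f x v| = 0)
    have z3 := abs_eq_zero.1 (by linarith :
      |hess f x 0 0 * v 0 + hess f x 0 1 * v 1 - lamMin f x * v 0| = 0)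
    have z4 := abs_eq_zero.1 (by linarith :
      |hess f x 0 1 * v 0 + hess f x 1 1 * v 1 - lamMin f x * v 1| = 0)
    have hv0 : v ≠ 0 := by
      intro h0; rw [h0, norm_zero] at hv1; exact zero_ne_one hv1
    have heig : IsMinEigenvector f x v := (isMinEigenvector_iff (hreg.symm x hxQ)).2
      ⟨hv0, by linarith, by linarith⟩
    have hin : inner ℝ (grad f x) v = 0 := by rw [inner_grad_eq, z2]
    have hne := hnd x hxQ v heig hin
    have hle : lamMin f x ≤ 0 := max_eq_right_iff.1 z1
    exact hxU (hsub ⟨hxQ, lt_of_le_of_ne hle hne, v, heig, hin⟩)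
  obtain ⟨ρ, hρ, hmin⟩ : ∃ ρ > 0, ∀ p ∈ Z, ρ ≤ Φ p := by
    rcases Z.eq_empty_or_nonempty with h0 | h0
    · exact ⟨1, one_pos, by simp [h0]⟩
    · obtain ⟨p, hp, hmin⟩ := hZc.exists_isMinOn h0 hΦc
      exact ⟨Φ p, hpos p hp, fun q hq => hmin hq⟩
  have hev : ∀ᶠ ε in 𝓝[>] (0 : ℝ), ε < ρ / 15 :=
    Filter.mem_of_superset (Ioo_mem_nhdsGT (by positivity : 0 < ρ / 15)) fun ε hε => hε.2
  filter_upwards [hev, self_mem_nhdsWithin] with ε hε hε0 g hg hgf x hx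
  by_contra hxU
  have hxQ : x ∈ unitSquare := hx.1
  obtain ⟨v, hv, hv1, hv0⟩ := exists_unit_of_mem_filament hx
  have hvi := fun i => abs_apply_le_one hv1 i
  have hΦx := hmin (x, v) ⟨⟨hxQ, hxU⟩, by simpa using hv1⟩
  obtain ⟨-, g1, g2⟩ := (isMinEigenvector_iff (hg.symm x hxQ)).1 hv
  have hl := abs_le.1 (hgf.abs_lamMin_sub_le hxQ)
  have h00 := (hgf x hxQ).2 0 0
  have h01 := (hgf x hxQ).2 0 1
  have h11 := (hgf x hxQ).2 1 1
  rw [abs_sub_comm] at h00 h01 h11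
  have b1 : max (lamMin f x) 0 ≤ 3 * ε := by
    have hneg := hx.2.1
    have hε0' : 0 < ε := hε0
    exact max_le (by linarith) (by linarith)
  have b2 : |slope f x v| ≤ 2 * ε := by
    have := hgf.abs_slope_sub_le hxQ hvi
    rwa [hv0, zero_sub, abs_neg] at this
  have hl' : |lamMin g x - lamMin f x| ≤ 3 * ε := abs_le.2 hl
  have b3 : |hess f x 0 0 * v 0 + hess f x 0 1 * v 1 - lamMin f x * v 0| ≤ 5 * ε := by
    have e1 : hess f x 0 0 * v 0 + hess f x 0 1 * v 1 - lamMin f x * v 0 =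
        ((hess f x 0 0 - hess g x 0 0) + (lamMin g x - lamMin f x)) * v 0 +
          (hess f x 0 1 - hess g x 0 1) * v 1 := by
      linear_combination g1
    rw [e1]
    exact (abs_mul_add_mul_le ((abs_add_le _ _).trans (add_le_add h00 hl')) h01 (hvi 0)
      (hvi 1)).trans (by linarith)
  have b4 : |hess f x 0 1 * v 0 + hess f x 1 1 * v 1 - lamMin f x * v 1| ≤ 5 * ε := by
    have e1 : hess f x 0 1 * v 0 + hess f x 1 1 * v 1 - lamMin f x * v 1 =
        ((hess f x 1 1 - hess g x 1 1) + (lamMin g x - lamMin f x)) * v 1 +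
          (hess f x 0 1 - hess g x 0 1) * v 0 := by
      linear_combination g2
    rw [e1]
    exact (abs_mul_add_mul_le ((abs_add_le _ _).trans (add_le_add h11 hl')) h01 (hvi 1)
      (hvi 0)).trans (by linarith)
  simp only [hΦ] at hΦx
  linarith

/-- The ridge is stable: its Hausdorff distance to the ridge of a perturbation is at most of the
order of the perturbation in the `C²` norm. -/
theorem exists_hausdorffEDist_filament_le (hf : ContDiffOn ℝ (3 : ℕ) f unitSquare) (hδ : 0 < δ)
    (hη : 0 < η) (hV : IsEigenfield f (filamentNhd f δ) V) (hc : IsCurveSystem f V a Υ T)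
    (hsep : HasSeparatedEigenvalues f δ η) (htrans : IsTransversal f V δ η)
    (hcomp : IsCompact (filament f)) (hnd : IsNondegenerate f) : ∃ C > 0,
      ∀ᶠ ε in 𝓝[>] (0 : ℝ), ∀ g : Plane → ℝ, IsRegular g → IsC2Close g f ε →
        Metric.hausdorffEDist (filament g) (filament f) ≤ ENNReal.ofReal (C * ε) := by
  have hreg := isRegular_of_contDiffOn (hf.of_le (by exact_mod_cast (by omega : 2 ≤ 3)))
  -- finitely many of the neighbourhoods from local stability cover the compact ridge
  have hcover : ∃ U : Set Plane, IsOpen U ∧ filament f ⊆ U ∧ ∃ C > 0, ∀ᶠ ε in 𝓝[>] (0 : ℝ),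
      ∀ g : Plane → ℝ, IsRegular g → IsC2Close g f ε →
        (∀ x ∈ filament g, x ∈ U → ∃ y ∈ filament f, edist x y ≤ ENNReal.ofReal (C * ε)) ∧
        (∀ x ∈ filament f, x ∈ U → ∃ y ∈ filament g, edist x y ≤ ENNReal.ofReal (C * ε)) := by
    refine hcomp.induction_on (p := fun s => ∃ U : Set Plane, IsOpen U ∧ s ⊆ U ∧ ∃ C > 0,
      ∀ᶠ ε in 𝓝[>] (0 : ℝ), ∀ g : Plane → ℝ, IsRegular g → IsC2Close g f ε →
        (∀ x ∈ filament g, x ∈ U → ∃ y ∈ filament f, edist x y ≤ ENNReal.ofReal (C * ε)) ∧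
        (∀ x ∈ filament f, x ∈ U → ∃ y ∈ filament g, edist x y ≤ ENNReal.ofReal (C * ε)))
      ?_ ?_ ?_ ?_
    · exact ⟨∅, isOpen_empty, subset_rfl, 1, one_pos, by simp⟩
    · rintro s t hst ⟨U, hU, hsU, h⟩
      exact ⟨U, hU, hst.trans hsU, h⟩
    · rintro s t ⟨U, hU, hsU, C, hC, h⟩ ⟨U', hU', hsU', C', hC', h'⟩
      refine ⟨U ∪ U', hU.union hU', union_subset_union hsU hsU', C + C', by positivity, ?_⟩
      filter_upwards [h, h', self_mem_nhdsWithin] with ε hε hε' hε0 g hg hgf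
      have hε0' : 0 < ε := hε0
      have l1 : ENNReal.ofReal (C * ε) ≤ ENNReal.ofReal ((C + C') * ε) :=
        ENNReal.ofReal_le_ofReal (by gcongr; linarith)
      have l2 : ENNReal.ofReal (C' * ε) ≤ ENNReal.ofReal ((C + C') * ε) :=
        ENNReal.ofReal_le_ofReal (by gcongr; linarith)
      obtain ⟨a1, a2⟩ := hε g hg hgf
      obtain ⟨b1, b2⟩ := hε' g hg hgf
      constructor
      · rintro x hx (hxU | hxU)
        · obtain ⟨y, hy, hd⟩ := a1 x hx hxU
          exact ⟨y, hy, hd.trans l1⟩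
        · obtain ⟨y, hy, hd⟩ := b1 x hx hxU
          exact ⟨y, hy, hd.trans l2⟩
      · rintro x hx (hxU | hxU)
        · obtain ⟨y, hy, hd⟩ := a2 x hx hxU
          exact ⟨y, hy, hd.trans l1⟩
        · obtain ⟨y, hy, hd⟩ := b2 x hx hxU
          exact ⟨y, hy, hd.trans l2⟩
    · intro x₀ hx₀
      obtain ⟨r, hr, C, hC, h⟩ := exists_local_stability hf hδ hη hV hc hsep htrans hx₀
      exact ⟨Metric.ball x₀ r, mem_nhdsWithin_of_mem_nhds (Metric.ball_mem_nhds x₀ hr),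
        Metric.ball x₀ r, Metric.isOpen_ball, subset_rfl, C, hC, h⟩
  obtain ⟨U, hU, hsub, C, hC, h⟩ := hcover
  refine ⟨C, hC, ?_⟩
  filter_upwards [h, eventually_filament_subset hreg hnd hU hsub] with ε h1 h2 g hg hgf
  refine Metric.hausdorffEDist_le_of_mem_edist (fun x hx => ?_) (fun x hx => ?_)
  · exact (h1 g hg hgf).1 x hx (h2 g hg hgf hx)
  · exact (h1 g hg hgf).2 x hx (hsub hx)

end RidgeStability

/-! ### Sup-norm stability of least squares with a localised basis -/

section LeastSquares

variable {I 𝒥 : Type*} [Fintype I] [Fintype 𝒥]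

open Classical in
/-- A design matrix whose rows are partitions of unity, whose `i`-th row lives on the few indices
`j` with `act i j`, and for which single coefficients are controlled by the fitted values at the
data points where they are active. The number `m` is the order of the number of data points per
index, `C` bounds all constants. -/
structure IsStableDesign (B : Matrix I 𝒥 ℝ) (act : I → 𝒥 → Prop) (m C : ℝ) : Prop where
  pos : 0 < m
  one_le : 1 ≤ C
  nonneg : ∀ i j, 0 ≤ B i j
  row_sum : ∀ i, ∑ j, B i j = 1
  eq_zero : ∀ i j, ¬ act i j → B i j = 0
  col_sum : ∀ j, ∑ i, B i j ≤ C * m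
  card : ∀ i, ((Finset.univ.filter (act i)).card : ℝ) ≤ C
  lower : ∀ (u : 𝒥 → ℝ) j, m * u j ^ 2 ≤ C * ∑ i with act i j, (B.mulVec u i) ^ 2

variable {B : Matrix I 𝒥 ℝ} {act : I → 𝒥 → Prop} {m C : ℝ}

open Classical in
/-- The weighted sum of squares of the coefficients is controlled by the fitted values, if the weight
`ω` of a coefficient is comparable to the weights `ν` at the data points where it is active. -/
theorem IsStableDesign.sum_mul_sq_le (h : IsStableDesign B act m C) {ω : 𝒥 → ℝ} {ν : I → ℝ}
    (hω : ∀ j, 0 ≤ ω j) (hων : ∀ i j, act i j → ω j ≤ 2 * ν i) (u : 𝒥 → ℝ) (hν : ∀ i, 0 ≤ ν i) :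
    m * ∑ j, ω j * u j ^ 2 ≤ 2 * C ^ 2 * ∑ i, ν i * (B.mulVec u i) ^ 2 := by
  have hC := zero_le_one.trans h.one_le
  calc m * ∑ j, ω j * u j ^ 2 = ∑ j, ω j * (m * u j ^ 2) := by
        rw [Finset.mul_sum]; exact Finset.sum_congr rfl fun j _ => by ring
    _ ≤ ∑ j, ω j * (C * ∑ i with act i j, (B.mulVec u i) ^ 2) :=
        Finset.sum_le_sum fun j _ => mul_le_mul_of_nonneg_left (h.lower u j) (hω j)
    _ = ∑ j, ∑ i, if act i j then C * (ω j * (B.mulVec u i) ^ 2) else 0 := by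
        refine Finset.sum_congr rfl fun j _ => ?_
        rw [← Finset.sum_filter, Finset.mul_sum, Finset.mul_sum]
        exact Finset.sum_congr rfl fun i _ => by ring
    _ = ∑ i, ∑ j with act i j, C * (ω j * (B.mulVec u i) ^ 2) := by
        rw [Finset.sum_comm]
        simp only [Finset.sum_filter]
    _ ≤ ∑ i, ∑ j with act i j, C * (2 * ν i * (B.mulVec u i) ^ 2) := by
        refine Finset.sum_le_sum fun i _ => Finset.sum_le_sum fun j hj => ?_
        have := hων i j (Finset.mem_filter.1 hj).2
        gcongr
    _ ≤ ∑ i, C * (C * (2 * ν i * (B.mulVec u i) ^ 2)) := by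
        refine Finset.sum_le_sum fun i _ => ?_
        rw [Finset.sum_const, nsmul_eq_mul]
        have := hν i
        exact mul_le_mul_of_nonneg_right (h.card i) (by positivity)
    _ = 2 * C ^ 2 * ∑ i, ν i * (B.mulVec u i) ^ 2 := by
        rw [Finset.mul_sum]; exact Finset.sum_congr rfl fun i _ => by ring

theorem IsStableDesign.sum_sq_le (h : IsStableDesign B act m C) (u : 𝒥 → ℝ) :
    m * ∑ j, u j ^ 2 ≤ 2 * C ^ 2 * ∑ i, (B.mulVec u i) ^ 2 := by
  simpa using h.sum_mul_sq_le (ω := fun _ => 1) (ν := fun _ => 1) (by simp) (by norm_num) u (by simp)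

/-- Solutions of the normal equations are bounded by the data in the sup-norm. The equations are
tested with `ω u` for a weight `ω` that is concentrated near the index `j₀` and varies slowly, with
values close to `ν i` on the indices active at `i`. -/
theorem IsStableDesign.abs_le_of_weight (h : IsStableDesign B act m C) {ω : 𝒥 → ℝ} {ν : I → ℝ}
    {τ D R : ℝ} (hω : ∀ j, 0 < ω j) (hν : ∀ i, 0 < ν i)
    (hων : ∀ i j, act i j → |ω j - ν i| ≤ τ * ν i) (hτ0 : 0 ≤ τ) (hτ : τ * (8 * C ^ 3) ≤ 1 / 2)
    {j₀ : 𝒥} (hsum : ∑ j, ω j ≤ D * ω j₀) {u : 𝒥 → ℝ} {r : I → ℝ} (hr : ∀ i, |r i| ≤ R)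
    (hR : 0 ≤ R) (hu : ∀ j, ∑ i, B i j * (B.mulVec u i - r i) = 0) :
    u j₀ ^ 2 ≤ 4096 * C ^ 8 * D * R ^ 2 := by
  classical
  have hC1 := h.one_le
  have hC : 0 < C := zero_lt_one.trans_le hC1
  have hm := h.pos
  have hτ2 : τ ≤ 1 / 2 := by
    have : (1 : ℝ) ≤ C ^ 3 := one_le_pow₀ hC1
    nlinarith
  have hων1 : ∀ i j, act i j → ω j ≤ 2 * ν i := fun i j hij => by
    have := (abs_le.1 (hων i j hij)).2
    nlinarith [hν i]
  have hων2 : ∀ i j, act i j → ν i ≤ 2 * ω j := fun i j hij => by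
    have := (abs_le.1 (hων i j hij)).1
    nlinarith [hν i]
  set y := B.mulVec u with hy
  set z : I → ℝ := fun i => ∑ j, B i j * |u j| with hz
  have hz0 : ∀ i, 0 ≤ z i := fun i =>
    Finset.sum_nonneg fun j _ => mul_nonneg (h.nonneg i j) (abs_nonneg _)
  have hyz : ∀ i, |y i| ≤ z i := fun i => by
    simp only [hy, hz, Matrix.mulVec, dotProduct]
    refine (Finset.abs_sum_le_sum_abs _ _).trans (Finset.sum_le_sum fun j _ => ?_)
    rw [abs_mul, abs_of_nonneg (h.nonneg i j)]
  -- weighted squares of the fitted values and of the averaged moduli `z`; the vector `e` is the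
  -- commutator of the design matrix and the weight
  set E := ∑ i, ν i * y i ^ 2 with hE
  set F := ∑ i, ν i * z i ^ 2 with hF
  set e : I → ℝ := fun i => ∑ j, B i j * ((ω j - ν i) * u j) with he
  have hez : ∀ i, |e i| ≤ τ * ν i * z i := fun i => by
    simp only [he, hz, Finset.mul_sum]
    refine (Finset.abs_sum_le_sum_abs _ _).trans (Finset.sum_le_sum fun j _ => ?_)
    rw [abs_mul, abs_of_nonneg (h.nonneg i j), abs_mul]
    by_cases hij : act i j
    · nlinarith [mul_le_mul_of_nonneg_right (hων i j hij)
        (mul_nonneg (h.nonneg i j) (abs_nonneg (u j)))]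
    · simp [h.eq_zero i j hij]
  -- the normal equations tested with the weighted coefficients
  have htest : ∑ i, (y i - r i) * (ν i * y i + e i) = 0 := by
    have e1 : ∀ i, ν i * y i + e i = ∑ j, B i j * (ω j * u j) := fun i => by
      simp only [hy, he, Matrix.mulVec, dotProduct, Finset.mul_sum, ← Finset.sum_add_distrib]
      exact Finset.sum_congr rfl fun j _ => by ring
    calc ∑ i, (y i - r i) * (ν i * y i + e i)
        = ∑ i, ∑ j, ω j * u j * (B i j * (y i - r i)) := by
          refine Finset.sum_congr rfl fun i _ => ?_
          rw [e1, Finset.mul_sum]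
          exact Finset.sum_congr rfl fun j _ => by ring
      _ = ∑ j, ω j * u j * ∑ i, B i j * (y i - r i) := by
          rw [Finset.sum_comm]
          exact Finset.sum_congr rfl fun j _ => by rw [Finset.mul_sum]
      _ = 0 := Finset.sum_eq_zero fun j _ => by rw [hu j, mul_zero]
  have hEle : E ≤ τ * F + 2 * R * ∑ i, ν i * z i := by
    have : E = ∑ i, (ν i * y i * r i - (y i - r i) * e i) := by
      rw [hE, ← sub_eq_zero, ← htest, ← Finset.sum_sub_distrib]
      exact Finset.sum_congr rfl fun i _ => by ring
    rw [this, hF, Finset.mul_sum, Finset.mul_sum, ← Finset.sum_add_distrib]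
    refine Finset.sum_le_sum fun i _ => ?_
    have hνi := hν i
    have a1 : ν i * y i * r i ≤ ν i * z i * R := by
      refine (le_abs_self _).trans ?_
      rw [abs_mul, abs_mul, abs_of_pos hνi]
      have := hyz i
      have := hr i
      have := hz0 i
      gcongr
    have a2 : -((y i - r i) * e i) ≤ (z i + R) * (τ * ν i * z i) := by
      refine (neg_le_abs _).trans ?_
      rw [abs_mul]
      refine mul_le_mul ((abs_sub _ _).trans (add_le_add (hyz i) (hr i))) (hez i) (abs_nonneg _)
        (add_nonneg (hz0 i) hR)
    have a3 : τ * (R * (ν i * z i)) ≤ 1 * (R * (ν i * z i)) :=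
      mul_le_mul_of_nonneg_right (by linarith) (mul_nonneg hR (mul_nonneg hνi.le (hz0 i)))
    nlinarith
  -- the local lower bound makes the two quadratic forms comparable
  have hFE : F ≤ 8 * C ^ 3 * E := by
    have b1 : F ≤ ∑ i, ν i * ∑ j, B i j * u j ^ 2 := by
      refine Finset.sum_le_sum fun i _ => mul_le_mul_of_nonneg_left ?_ (hν i).le
      have := Finset.sum_mul_sq_le_sq_mul_sq Finset.univ (fun j => √(B i j))
        (fun j => √(B i j) * |u j|)
      simp only [mul_pow, Real.sq_sqrt (h.nonneg _ _), ← mul_assoc,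
        Real.mul_self_sqrt (h.nonneg _ _), h.row_sum, one_mul, sq_abs] at this
      exact this
    have b2 : ∑ i, ν i * ∑ j, B i j * u j ^ 2 ≤ 2 * C * m * ∑ j, ω j * u j ^ 2 := by
      simp only [Finset.mul_sum]
      rw [Finset.sum_comm]
      refine Finset.sum_le_sum fun j _ => ?_
      calc ∑ i, ν i * (B i j * u j ^ 2) ≤ ∑ i, B i j * (2 * ω j * u j ^ 2) := by
            refine Finset.sum_le_sum fun i _ => ?_
            by_cases hij : act i j
            · have := hων2 i j hij
              have := h.nonneg i j
              calc ν i * (B i j * u j ^ 2) ≤ 2 * ω j * (B i j * u j ^ 2) := by gcongr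
                _ = _ := by ring
            · simp [h.eq_zero i j hij]
        _ = (∑ i, B i j) * (2 * ω j * u j ^ 2) := by rw [Finset.sum_mul]
        _ ≤ C * m * (2 * ω j * u j ^ 2) :=
            mul_le_mul_of_nonneg_right (h.col_sum j) (by have := hω j; positivity)
        _ = _ := by ring
    have b3 := h.sum_mul_sq_le (fun j => (hω j).le) hων1 u fun i => (hν i).le
    have hE0 : 0 ≤ E := Finset.sum_nonneg fun i _ => mul_nonneg (hν i).le (sq_nonneg _)
    calc F ≤ 2 * C * (m * ∑ j, ω j * u j ^ 2) := by linarith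
      _ ≤ 2 * C * (2 * C ^ 2 * E) := mul_le_mul_of_nonneg_left b3 (by positivity)
      _ = 4 * (C ^ 3 * E) := by ring
      _ ≤ 8 * (C ^ 3 * E) := by
          have : 0 ≤ C ^ 3 * E := by positivity
          linarith
      _ = 8 * C ^ 3 * E := by ring
  -- absorption of the terms in `F` on the right-hand side, by the choice of `τ`
  have hFle : F ≤ 1024 * C ^ 6 * R ^ 2 * ∑ i, ν i := by
    have hF0 : 0 ≤ F := Finset.sum_nonneg fun i _ => mul_nonneg (hν i).le (sq_nonneg _)
    have c1 : F ≤ 32 * C ^ 3 * R * ∑ i, ν i * z i := by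
      have : 8 * C ^ 3 * E ≤ 8 * C ^ 3 * (τ * F + 2 * R * ∑ i, ν i * z i) := by gcongr
      nlinarith
    have c2 : 32 * C ^ 3 * R * ∑ i, ν i * z i ≤ 1 / 2 * F + 512 * C ^ 6 * R ^ 2 * ∑ i, ν i := by
      rw [hF, Finset.mul_sum, Finset.mul_sum, Finset.mul_sum, ← Finset.sum_add_distrib]
      refine Finset.sum_le_sum fun i _ => ?_
      nlinarith [mul_nonneg (hν i).le (sq_nonneg (z i - 32 * C ^ 3 * R))]
    linarith
  -- comparison with the weight at `j₀`
  have hνsum : ∑ i, ν i ≤ 2 * C * m * ∑ j, ω j := by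
    calc ∑ i, ν i = ∑ i, ∑ j, B i j * ν i := by
          refine Finset.sum_congr rfl fun i _ => ?_
          rw [← Finset.sum_mul, h.row_sum, one_mul]
      _ ≤ ∑ i, ∑ j, B i j * (2 * ω j) := by
          refine Finset.sum_le_sum fun i _ => Finset.sum_le_sum fun j _ => ?_
          by_cases hij : act i j
          · exact mul_le_mul_of_nonneg_left (hων2 i j hij) (h.nonneg i j)
          · simp [h.eq_zero i j hij]
      _ = ∑ j, (∑ i, B i j) * (2 * ω j) := by
          rw [Finset.sum_comm]
          exact Finset.sum_congr rfl fun j _ => by rw [Finset.sum_mul]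
      _ ≤ ∑ j, C * m * (2 * ω j) := Finset.sum_le_sum fun j _ =>
          mul_le_mul_of_nonneg_right (h.col_sum j) (by have := hω j; positivity)
      _ = _ := by rw [Finset.mul_sum]; exact Finset.sum_congr rfl fun j _ => by ring
  have hfin : ω j₀ * (m * u j₀ ^ 2) ≤ 2 * C * F := by
    calc ω j₀ * (m * u j₀ ^ 2) ≤ ω j₀ * (C * ∑ i with act i j₀, y i ^ 2) :=
          mul_le_mul_of_nonneg_left (h.lower u j₀) (hω j₀).le
      _ = C * ∑ i with act i j₀, ω j₀ * y i ^ 2 := by rw [← Finset.mul_sum]; ring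
      _ ≤ C * ∑ i with act i j₀, 2 * (ν i * z i ^ 2) := by
          refine mul_le_mul_of_nonneg_left (Finset.sum_le_sum fun i hi => ?_) hC.le
          have d1 := hων1 i j₀ (Finset.mem_filter.1 hi).2
          have d2 : y i ^ 2 ≤ z i ^ 2 := sq_le_sq.2 ((hyz i).trans (le_abs_self _))
          have := hν i
          calc ω j₀ * y i ^ 2 ≤ 2 * ν i * z i ^ 2 := by gcongr
            _ = _ := by ring
      _ ≤ C * ∑ i, 2 * (ν i * z i ^ 2) := by
          refine mul_le_mul_of_nonneg_left (Finset.sum_le_sum_of_subset_of_nonneg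
            (Finset.filter_subset _ _) fun i _ _ => ?_) hC.le
          have := hν i
          positivity
      _ = 2 * C * F := by rw [← Finset.mul_sum]; ring
  have hpos : 0 < ω j₀ * m := mul_pos (hω j₀) hm
  refine le_of_mul_le_mul_left ?_ hpos
  calc ω j₀ * m * u j₀ ^ 2 = ω j₀ * (m * u j₀ ^ 2) := by ring
    _ ≤ 2 * C * F := hfin
    _ ≤ 2 * C * (1024 * C ^ 6 * R ^ 2 * (2 * C * m * (D * ω j₀))) := by
        gcongr
        exact hFle.trans (mul_le_mul_of_nonneg_left
          (hνsum.trans (mul_le_mul_of_nonneg_left hsum (by positivity))) (by positivity))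
    _ = _ := by ring

/-- Exponential weights on a line have a total mass that does not depend on their centre `k` or the
length `N` of the line. -/
theorem sum_exp_neg_le {s : ℝ} (hs : 0 < s) (N : ℕ) (k : ℕ) :
    ∑ j : Fin N, Real.exp (-(s * |(j : ℝ) - k|)) ≤ 2 / (1 - Real.exp (-s)) := by
  have h1 : Real.exp (-s) < 1 := by rw [← Real.exp_zero]; exact Real.exp_lt_exp.2 (by linarith)
  have h0 := (Real.exp_pos (-s)).le
  have hs' : Summable fun n : ℕ => Real.exp (-s) ^ n := summable_geometric_of_lt_one h0 h1
  have hgeo : ∀ t : Finset ℕ, ∑ n ∈ t, Real.exp (-s) ^ n ≤ 1 / (1 - Real.exp (-s)) := fun t => by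
    rw [one_div, ← tsum_geometric_of_lt_one h0 h1]
    exact hs'.sum_le_tsum t fun n _ => pow_nonneg h0 n
  have hexp : ∀ n : ℕ, Real.exp (-s) ^ n = Real.exp (-(s * n)) := fun n => by
    rw [← Real.exp_nat_mul]; ring_nf
  rw [Fin.sum_univ_eq_sum_range (fun j : ℕ => Real.exp (-(s * |(j : ℝ) - k|))) N,
    ← Finset.sum_filter_add_sum_filter_not _ (fun j => k ≤ j)]
  have haux : ∀ (t : Finset ℕ) (g : ℕ → ℕ), Set.InjOn g t → (∀ j ∈ t, |(j : ℝ) - k| = g j) →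
      ∑ j ∈ t, Real.exp (-(s * |(j : ℝ) - k|)) ≤ 1 / (1 - Real.exp (-s)) := fun t g hg heq => by
    refine le_trans (le_of_eq ?_) (hgeo (t.image g))
    rw [Finset.sum_image hg]
    exact Finset.sum_congr rfl fun j hj => by rw [hexp, heq j hj]
  have e1 := haux ((Finset.range N).filter fun j => k ≤ j) (fun j => j - k)
    (fun i hi j hj hij => by
      have hi := (Finset.mem_filter.1 hi).2
      have hj := (Finset.mem_filter.1 hj).2
      simp only at hij
      omega)
    (fun j hj => by
      have hj := (Finset.mem_filter.1 hj).2
      have : (k : ℝ) ≤ j := by exact_mod_cast hj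
      rw [abs_of_nonneg (by linarith), Nat.cast_sub hj])
  have e2 := haux ((Finset.range N).filter fun j => ¬ k ≤ j) (fun j => k - j)
    (fun i hi j hj hij => by
      have hi := (Finset.mem_filter.1 hi).2
      have hj := (Finset.mem_filter.1 hj).2
      simp only at hij
      omega)
    (fun j hj => by
      have hj := (not_le.1 (Finset.mem_filter.1 hj).2).le
      have : (j : ℝ) ≤ k := by exact_mod_cast hj
      rw [abs_sub_comm, abs_of_nonneg (by linarith), Nat.cast_sub hj])
  calc _ ≤ _ := add_le_add e1 e2
    _ = _ := by ring

/-- For an index set in the plane lattice, with `act i j` bounding the lattice distance of `j` to a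
site attached to `i`, the normal equations are stable in the sup-norm, with a constant that does not
depend on the size of the index set. -/
theorem exists_abs_le_of_normal_equation (C : ℝ) (p : ℕ) : ∃ K > 0, ∀ {I : Type} [Fintype I]
    {J₀ J₁ : ℕ} {B : Matrix I (Fin J₀ × Fin J₁) ℝ} {act : I → Fin J₀ × Fin J₁ → Prop} {m : ℝ},
    IsStableDesign B act m C → ∀ l : I → ℕ × ℕ,
    (∀ i j, act i j → |((l i).1 : ℝ) - j.1| ≤ p ∧ |((l i).2 : ℝ) - j.2| ≤ p) →
    ∀ {u : Fin J₀ × Fin J₁ → ℝ} {r : I → ℝ} {R : ℝ}, (∀ i, |r i| ≤ R) → 0 ≤ R →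
    (∀ j, ∑ i, B i j * (B.mulVec u i - r i) = 0) → ∀ j, |u j| ≤ K * R := by
  by_cases hC : 1 ≤ C
  swap
  · exact ⟨1, one_pos, fun h => absurd h.one_le hC⟩
  have hC0 : 0 < C := zero_lt_one.trans_le hC
  -- the decay rate `s` of the weights is so small that they vary slowly
  set τ : ℝ := 1 / (16 * C ^ 3) with hτ
  have hτ0 : 0 < τ := by positivity
  have hτ1 : τ ≤ 1 := by
    rw [hτ, div_le_one (by positivity)]
    have : (1 : ℝ) ≤ C ^ 3 := one_le_pow₀ hC
    linarith
  set s : ℝ := τ / (4 * (p + 1)) with hs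
  have hs0 : 0 < s := by positivity
  set D : ℝ := (2 / (1 - Real.exp (-s))) ^ 2 with hD
  refine ⟨1 + 4096 * C ^ 8 * D, by positivity, ?_⟩
  intro I _ J₀ J₁ B act m h l hl u r R hr hR hu j₀
  set dst : ℕ × ℕ → ℝ := fun j => |(j.1 : ℝ) - (j₀.1 : ℕ)| + |(j.2 : ℝ) - (j₀.2 : ℕ)| with hd
  have key := h.abs_le_of_weight (ω := fun j => Real.exp (-(s * dst (j.1, j.2))))
    (ν := fun i => Real.exp (-(s * dst (l i)))) (τ := τ) (D := D) (R := R)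
    (fun j => Real.exp_pos _) (fun i => Real.exp_pos _) ?_ hτ0.le
    (by rw [hτ]; field_simp; norm_num) (j₀ := j₀) ?_ hr hR hu
  · have hD0 : 0 ≤ D := sq_nonneg _
    set X := 4096 * C ^ 8 * D with hX
    have hX0 : 0 ≤ X := by positivity
    refine abs_le_of_sq_le_sq (key.trans ?_) (by positivity)
    nlinarith [mul_nonneg hX0 (sq_nonneg R), sq_nonneg R, mul_nonneg (sq_nonneg X) (sq_nonneg R)]
  · intro i j hij
    obtain ⟨h1, h2⟩ := hl i j hij
    set x := s * dst (l i) - s * dst (j.1, j.2) with hx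
    have hxle : |x| ≤ τ / 2 := by
      rw [hx, ← mul_sub, abs_mul, abs_of_pos hs0]
      have e1 := abs_abs_sub_abs_le_abs_sub ((l i).1 - (j₀.1 : ℕ) : ℝ) ((j.1 : ℕ) - (j₀.1 : ℕ) : ℝ)
      have e2 := abs_abs_sub_abs_le_abs_sub ((l i).2 - (j₀.2 : ℕ) : ℝ) ((j.2 : ℕ) - (j₀.2 : ℕ) : ℝ)
      rw [sub_sub_sub_cancel_right] at e1 e2
      have e3 : |dst (l i) - dst (j.1, j.2)| ≤ 2 * (p + 1) := by
        simp only [hd]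
        rw [show ∀ a b c d : ℝ, a + b - (c + d) = (a - c) + (b - d) by intros; ring]
        refine (abs_add_le _ _).trans ?_
        linarith
      calc s * _ ≤ s * (2 * (p + 1)) := mul_le_mul_of_nonneg_left e3 hs0.le
        _ = τ / 2 := by rw [hs]; field_simp; ring
    have e4 : Real.exp (-(s * dst (j.1, j.2))) = Real.exp (-(s * dst (l i))) * Real.exp x := by
      rw [← Real.exp_add, hx]; ring_nf
    rw [e4, ← mul_sub_one, abs_mul, abs_of_pos (Real.exp_pos _), mul_comm]
    refine mul_le_mul_of_nonneg_right ?_ (Real.exp_pos _).le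
    have := Real.abs_exp_sub_one_le (x := x) (by linarith)
    linarith
  · have e0 : dst (j₀.1, j₀.2) = 0 := by simp [hd]
    simp only [e0, mul_zero, neg_zero, Real.exp_zero, mul_one]
    rw [Fintype.sum_prod_type]
    calc ∑ j₁ : Fin J₀, ∑ j₂ : Fin J₁, Real.exp (-(s * dst (j₁, j₂)))
        = (∑ j₁ : Fin J₀, Real.exp (-(s * |((j₁ : ℕ) : ℝ) - (j₀.1 : ℕ)|))) *
          ∑ j₂ : Fin J₁, Real.exp (-(s * |((j₂ : ℕ) : ℝ) - (j₀.2 : ℕ)|)) := by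
          rw [Finset.sum_mul_sum]
          refine Finset.sum_congr rfl fun j₁ _ => Finset.sum_congr rfl fun j₂ _ => ?_
          rw [← Real.exp_add]; simp only [hd]; ring_nf
      _ ≤ _ := by
          rw [hD, sq]
          exact mul_le_mul (sum_exp_neg_le hs0 _ _) (sum_exp_neg_le hs0 _ _)
            (Finset.sum_nonneg fun j _ => (Real.exp_pos _).le)
            (div_nonneg zero_le_two (by
              have : Real.exp (-s) ≤ 1 := by
                rw [← Real.exp_zero]; exact Real.exp_le_exp.2 (by linarith)
              linarith))

end LeastSquares

/-! ### Coercive matrices and the posterior mean -/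

section Coercive

set_option linter.unusedSectionVars false

variable {I 𝒥 : Type*} [Fintype I] [Fintype 𝒥] [DecidableEq 𝒥]

open Matrix

/-- A coercive matrix is invertible, also if it is not symmetric. -/
theorem mulVec_inv_of_coercive {M : Matrix 𝒥 𝒥 ℝ} {c : ℝ} (hc : 0 < c)
    (hM : ∀ w, c * (w ⬝ᵥ w) ≤ w ⬝ᵥ M *ᵥ w) (v : 𝒥 → ℝ) : M *ᵥ (M⁻¹ *ᵥ v) = v := by
  have hu : IsUnit M := by
    refine mulVec_injective_iff_isUnit.1 fun x y hxy => ?_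
    have h := hM (x - y)
    rw [mulVec_sub, sub_eq_zero.2 hxy, dotProduct_zero] at h
    have h0 : 0 ≤ (x - y) ⬝ᵥ (x - y) := by
      simpa using dotProduct_star_self_nonneg (x - y)
    have h1 : (x - y) ⬝ᵥ (x - y) = 0 := le_antisymm (by nlinarith) h0
    exact sub_eq_zero.1 (dotProduct_self_eq_zero.1 h1)
  rw [mulVec_mulVec, Matrix.mul_nonsing_inv _ ((Matrix.isUnit_iff_isUnit_det _).1 hu), one_mulVec]

theorem dotProduct_self_nonneg_real (w : 𝒥 → ℝ) : 0 ≤ w ⬝ᵥ w := by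
  simpa using dotProduct_star_self_nonneg w

theorem dotProduct_sq_le (w v : 𝒥 → ℝ) : (w ⬝ᵥ v) ^ 2 ≤ (w ⬝ᵥ w) * (v ⬝ᵥ v) := by
  have := Finset.sum_mul_sq_le_sq_mul_sq Finset.univ w v
  simpa [dotProduct, sq] using this

/-- The inverse of a matrix `M ≥ c` has operator norm at most `c⁻¹`. -/
theorem sq_mul_inv_mulVec_le {M : Matrix 𝒥 𝒥 ℝ} {c : ℝ} (hc : 0 < c)
    (hM : ∀ w, c * (w ⬝ᵥ w) ≤ w ⬝ᵥ M *ᵥ w) (v : 𝒥 → ℝ) :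
    c ^ 2 * ((M⁻¹ *ᵥ v) ⬝ᵥ (M⁻¹ *ᵥ v)) ≤ v ⬝ᵥ v := by
  set w := M⁻¹ *ᵥ v with hw
  have h1 := hM w
  rw [hw, mulVec_inv_of_coercive hc hM, ← hw] at h1
  have h2 := dotProduct_sq_le w v
  have h3 := dotProduct_self_nonneg_real w
  rcases h3.eq_or_lt with h4 | h4
  · rw [← h4, mul_zero]; exact dotProduct_self_nonneg_real v
  · have h5 : (c * (w ⬝ᵥ w)) ^ 2 ≤ (w ⬝ᵥ v) ^ 2 := pow_le_pow_left₀ (by positivity) h1 2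
    refine le_of_mul_le_mul_left ?_ h4
    nlinarith

theorem dotProduct_inv_mulVec_le {M : Matrix 𝒥 𝒥 ℝ} {c : ℝ} (hc : 0 < c)
    (hM : ∀ w, c * (w ⬝ᵥ w) ≤ w ⬝ᵥ M *ᵥ w) (v : 𝒥 → ℝ) :
    0 ≤ v ⬝ᵥ (M⁻¹ *ᵥ v) ∧ c * (v ⬝ᵥ (M⁻¹ *ᵥ v)) ≤ v ⬝ᵥ v := by
  set w := M⁻¹ *ᵥ v with hw
  have h1 := hM w
  rw [hw, mulVec_inv_of_coercive hc hM, ← hw] at h1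
  have h2 := dotProduct_sq_le w v
  have h3 := dotProduct_self_nonneg_real w
  have h5 := dotProduct_self_nonneg_real v
  rw [dotProduct_comm v w]
  have h4 : 0 ≤ w ⬝ᵥ v := le_trans (by positivity) h1
  refine ⟨h4, ?_⟩
  rcases h4.eq_or_lt with h6 | h6
  · rw [← h6, mul_zero]; exact h5
  · refine le_of_mul_le_mul_left ?_ h6
    nlinarith

theorem abs_apply_le_of_dotProduct_le {w : 𝒥 → ℝ} {b : ℝ} (hb : 0 ≤ b) (h : w ⬝ᵥ w ≤ b ^ 2)
    (j : 𝒥) : |w j| ≤ b := by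
  refine abs_le_of_sq_le_sq (le_trans ?_ h) hb
  rw [dotProduct, sq]
  exact Finset.single_le_sum (f := fun i => w i * w i) (fun i _ => mul_self_nonneg _)
    (Finset.mem_univ j)

variable {B : Matrix I 𝒥 ℝ} {act : I → 𝒥 → Prop} {m C : ℝ} {Λ : Matrix 𝒥 𝒥 ℝ} {c₁ : ℝ}

theorem dotProduct_gram (B : Matrix I 𝒥 ℝ) (w : 𝒥 → ℝ) :
    w ⬝ᵥ (Bᵀ * B) *ᵥ w = ∑ i, (B *ᵥ w) i ^ 2 := by
  rw [← mulVec_mulVec, dotProduct_mulVec, ← mulVec_transpose, transpose_transpose, dotProduct]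
  exact Finset.sum_congr rfl fun i _ => by rw [sq]

theorem IsStableDesign.coercive_gram (h : IsStableDesign B act m C) (w : 𝒥 → ℝ) :
    m / (2 * C ^ 2) * (w ⬝ᵥ w) ≤ w ⬝ᵥ (Bᵀ * B) *ᵥ w := by
  have hC : 0 < C := zero_lt_one.trans_le h.one_le
  have := h.sum_sq_le w
  rw [dotProduct_gram, div_mul_eq_mul_div, div_le_iff₀ (by positivity), dotProduct]
  simp only [← sq]
  linarith

theorem coercive_of_sub_posSemidef (hΛ : (Λ - c₁ • (1 : Matrix 𝒥 𝒥 ℝ)).PosSemidef) (w : 𝒥 → ℝ) :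
    c₁ * (w ⬝ᵥ w) ≤ w ⬝ᵥ Λ *ᵥ w := by
  have := hΛ.dotProduct_mulVec_nonneg w
  rw [sub_mulVec, dotProduct_sub, smul_mulVec, one_mulVec, dotProduct_smul, star_trivial,
    smul_eq_mul] at this
  linarith

theorem posSemidef_of_sub_posSemidef (hc₁ : 0 < c₁)
    (hΛ : (Λ - c₁ • (1 : Matrix 𝒥 𝒥 ℝ)).PosSemidef) : Λ.PosSemidef := by
  have := hΛ.add (Matrix.PosSemidef.one.smul hc₁.le)
  rwa [sub_add_cancel] at this

theorem coercive_add_inv {M : Matrix 𝒥 𝒥 ℝ} {c : ℝ} (hM : ∀ w, c * (w ⬝ᵥ w) ≤ w ⬝ᵥ M *ᵥ w)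
    (hΛ : Λ.PosSemidef) (w : 𝒥 → ℝ) : c * (w ⬝ᵥ w) ≤ w ⬝ᵥ (M + Λ⁻¹) *ᵥ w := by
  have := hΛ.inv.dotProduct_mulVec_nonneg w
  rw [add_mulVec, dotProduct_add]
  rw [star_trivial] at this
  linarith [hM w]

/-- Decomposition of the error of the posterior mean into the least squares fit `u` of the
approximation error, the influence of the prior, and the noise. -/
theorem posterior_mean_eq {M : Matrix 𝒥 𝒥 ℝ} {c : ℝ} (hc : 0 < c)
    (hA : ∀ w, c * (w ⬝ᵥ w) ≤ w ⬝ᵥ (Bᵀ * B + M) *ᵥ w) {θ₀ θ u : 𝒥 → ℝ} {r e : I → ℝ}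
    (hu : Bᵀ *ᵥ (B *ᵥ u - r) = 0) :
    (Bᵀ * B + M)⁻¹ *ᵥ (Bᵀ *ᵥ (B *ᵥ θ + r + e) + M *ᵥ θ₀) =
      θ + u + (Bᵀ * B + M)⁻¹ *ᵥ (M *ᵥ (θ₀ - θ - u)) + (Bᵀ * B + M)⁻¹ *ᵥ (Bᵀ *ᵥ e) := by
  set A := Bᵀ * B + M with hAdef
  have hinv := mulVec_inv_of_coercive hc hA
  have hinj : Function.Injective A.mulVec := by
    intro x y hxy
    have h := hA (x - y)
    rw [mulVec_sub, sub_eq_zero.2 hxy, dotProduct_zero] at h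
    have h1 : (x - y) ⬝ᵥ (x - y) = 0 :=
      le_antisymm (by nlinarith) (dotProduct_self_nonneg_real _)
    exact sub_eq_zero.1 (dotProduct_self_eq_zero.1 h1)
  apply hinj
  simp only [mulVec_add, hinv]
  rw [mulVec_sub] at hu
  have hu' : Bᵀ *ᵥ r = Bᵀ *ᵥ (B *ᵥ u) := (sub_eq_zero.1 hu).symm
  rw [hu', hAdef]
  simp only [add_mulVec, mulVec_sub, ← mulVec_mulVec]
  abel

/-- The error of the posterior mean in the sup-norm, up to the noise. The data are `B θ + r + e` with
an approximation error `r` and noise `e`. The approximation error enters without loss, by sup-norm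
stability of least squares; for the prior it suffices to bound the sup-norm by the Euclidean norm,
at the cost of the factor `D`, the square root of the number of coefficients. -/
theorem exists_abs_posterior_mean_sub_le (C : ℝ) (p : ℕ) {c₁ : ℝ} (hc₁ : 0 < c₁) : ∃ K > 0,
    ∀ {I : Type} [Fintype I]
    {J₀ J₁ : ℕ} {B : Matrix I (Fin J₀ × Fin J₁) ℝ} {act : I → Fin J₀ × Fin J₁ → Prop} {m : ℝ}
    {Λ : Matrix (Fin J₀ × Fin J₁) (Fin J₀ × Fin J₁) ℝ},
    IsStableDesign B act m C → ∀ l : I → ℕ × ℕ,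
    (∀ i j, act i j → |((l i).1 : ℝ) - j.1| ≤ p ∧ |((l i).2 : ℝ) - j.2| ≤ p) →
    (Λ - c₁ • (1 : Matrix _ _ ℝ)).PosSemidef →
    ∀ {θ₀ θ : Fin J₀ × Fin J₁ → ℝ} {r e : I → ℝ} {R L D : ℝ}, (∀ i, |r i| ≤ R) → 0 ≤ R →
    (∀ j, |θ₀ j - θ j| ≤ L) → 0 ≤ L → (J₀ : ℝ) * J₁ ≤ D ^ 2 → 0 ≤ D → ∀ j,
    |((Bᵀ * B + Λ⁻¹)⁻¹ *ᵥ (Bᵀ *ᵥ (B *ᵥ θ + r + e) + Λ⁻¹ *ᵥ θ₀)) j - θ j| ≤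
      K * R + K * D / m * (L + R) + |((Bᵀ * B + Λ⁻¹)⁻¹ *ᵥ (Bᵀ *ᵥ e)) j| := by
  obtain ⟨K, hK, hKu⟩ := exists_abs_le_of_normal_equation C p
  refine ⟨K + 2 * C ^ 2 * c₁⁻¹ * (1 + K), by positivity, ?_⟩
  intro I _ J₀ J₁ B act m Λ h l hl hΛ θ₀ θ r e R L D hr hR hL hL0 hJD hD j
  have hC : 0 < C := zero_lt_one.trans_le h.one_le
  have hm := h.pos
  have hc : 0 < m / (2 * C ^ 2) := by positivity
  have hΛp := posSemidef_of_sub_posSemidef hc₁ hΛ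
  have hA := coercive_add_inv h.coercive_gram hΛp
  set u := (Bᵀ * B)⁻¹ *ᵥ (Bᵀ *ᵥ r) with hu
  have hu0 : Bᵀ *ᵥ (B *ᵥ u - r) = 0 := by
    rw [mulVec_sub, mulVec_mulVec, hu, mulVec_inv_of_coercive hc h.coercive_gram, sub_self]
  have hub : ∀ j, |u j| ≤ K * R := hKu h l hl hr hR fun j => by
    have := congrFun hu0 j
    simpa [mulVec, dotProduct] using this
  rw [posterior_mean_eq hc hA hu0]
  set z := θ₀ - θ - u with hz
  have hzb : ∀ j, |z j| ≤ (1 + K) * (L + R) := fun j => by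
    simp only [hz, Pi.sub_apply]
    refine (abs_sub _ _).trans ((add_le_add (hL j) (hub j)).trans ?_)
    nlinarith [mul_nonneg hK.le hL0]
  set Z := (1 + K) * (L + R) with hZ
  have hZ0 : 0 ≤ Z := by positivity
  have hzz : z ⬝ᵥ z ≤ (D * Z) ^ 2 := by
    rw [dotProduct]
    calc ∑ j, z j * z j ≤ ∑ _j : Fin J₀ × Fin J₁, Z ^ 2 := Finset.sum_le_sum fun j _ => by
          rw [← sq, ← sq_abs]; exact pow_le_pow_left₀ (abs_nonneg _) (hzb j) 2
      _ = (J₀ : ℝ) * J₁ * Z ^ 2 := by simp [Fintype.card_prod]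
      _ ≤ D ^ 2 * Z ^ 2 := by gcongr
      _ = _ := by ring
  set v := Λ⁻¹ *ᵥ z with hv
  have hvv : v ⬝ᵥ v ≤ (c₁⁻¹ * (D * Z)) ^ 2 := by
    have := sq_mul_inv_mulVec_le hc₁ (coercive_of_sub_posSemidef hΛ) z
    rw [← hv] at this
    calc v ⬝ᵥ v = c₁⁻¹ ^ 2 * (c₁ ^ 2 * (v ⬝ᵥ v)) := by field_simp
      _ ≤ c₁⁻¹ ^ 2 * (D * Z) ^ 2 := by gcongr; exact this.trans hzz
      _ = _ := by ring
  set c := m / (2 * C ^ 2) with hcdef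
  have hw : ∀ j, |((Bᵀ * B + Λ⁻¹)⁻¹ *ᵥ v) j| ≤ c⁻¹ * (c₁⁻¹ * (D * Z)) := by
    refine abs_apply_le_of_dotProduct_le (by positivity) ?_
    have := sq_mul_inv_mulVec_le hc hA v
    set w := (Bᵀ * B + Λ⁻¹)⁻¹ *ᵥ v
    calc w ⬝ᵥ w = c⁻¹ ^ 2 * (c ^ 2 * (w ⬝ᵥ w)) := by field_simp
      _ ≤ c⁻¹ ^ 2 * (c₁⁻¹ * (D * Z)) ^ 2 := by gcongr; exact this.trans hvv
      _ = _ := by ring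
  set W := ((Bᵀ * B + Λ⁻¹)⁻¹ *ᵥ (Bᵀ *ᵥ e)) j with hW
  have e1 : c⁻¹ * (c₁⁻¹ * (D * Z)) = 2 * C ^ 2 * c₁⁻¹ * (1 + K) * D / m * (L + R) := by
    rw [hcdef, hZ]; field_simp
  have e2 := hw j
  rw [e1] at e2
  have e3 : (K + 2 * C ^ 2 * c₁⁻¹ * (1 + K)) * D / m * (L + R) =
      2 * C ^ 2 * c₁⁻¹ * (1 + K) * D / m * (L + R) + K * D / m * (L + R) := by ring
  have e4 : 0 ≤ K * D / m * (L + R) := by positivity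
  have e5 : 0 ≤ 2 * C ^ 2 * c₁⁻¹ * (1 + K) * R := by positivity
  simp only [Pi.add_apply]
  rw [show θ j + u j + ((Bᵀ * B + Λ⁻¹)⁻¹ *ᵥ v) j + W - θ j =
    u j + ((Bᵀ * B + Λ⁻¹)⁻¹ *ᵥ v) j + W by ring]
  refine (abs_add_le _ _).trans (add_le_add ((abs_add_le _ _).trans ?_) le_rfl)
  have := hub j
  rw [e3]
  nlinarith

/-- The vector which represents the noise in the `j`-th coordinate of the posterior mean has squared
norm of the order `1 / m`, and so has the `j`-th diagonal entry of the posterior covariance. -/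
theorem IsStableDesign.noise_bound (h : IsStableDesign B act m C) (hΛ : Λ.PosSemidef) (j : 𝒥) :
    ∑ i, (B * (Bᵀ * B + Λ⁻¹)⁻¹) i j ^ 2 ≤ 2 * C ^ 2 / m ∧
      (Bᵀ * B + Λ⁻¹)⁻¹ j j ≤ 2 * C ^ 2 / m := by
  have hC : 0 < C := zero_lt_one.trans_le h.one_le
  have hm := h.pos
  have hc : 0 < m / (2 * C ^ 2) := by positivity
  have hA := coercive_add_inv h.coercive_gram hΛ
  set A := Bᵀ * B + Λ⁻¹ with hAdef
  set w := A⁻¹ *ᵥ Pi.single j 1 with hw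
  have hwi : ∀ k, w k = A⁻¹ k j := fun k => by rw [hw, mulVec_single_one]; rfl
  have h1 := (dotProduct_inv_mulVec_le hc hA (Pi.single j 1)).2
  rw [single_dotProduct, single_dotProduct, one_mul, one_mul, ← hw, Pi.single_eq_same, hwi,
    ← le_div_iff₀' hc, one_div_div] at h1
  refine ⟨?_, h1⟩
  have h2 : w ⬝ᵥ A *ᵥ w = A⁻¹ j j := by
    rw [hw, mulVec_inv_of_coercive hc hA, ← hw, dotProduct_single, mul_one, hwi]
  have h3 := hΛ.inv.dotProduct_mulVec_nonneg w
  rw [star_trivial] at h3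
  rw [hAdef, add_mulVec, dotProduct_add, dotProduct_gram] at h2
  have h4 : ∀ i, (B * A⁻¹) i j = (B *ᵥ w) i := fun i => by
    simp only [mul_apply, mulVec, dotProduct]
    exact Finset.sum_congr rfl fun k _ => by rw [← hwi]
  simp only [h4]
  rw [← hAdef] at h2
  linarith

theorem noise_eq (hΛ : Λ.PosSemidef) (e : I → ℝ) (j : 𝒥) :
    ((Bᵀ * B + Λ⁻¹)⁻¹ *ᵥ (Bᵀ *ᵥ e)) j = ∑ i, (B * (Bᵀ * B + Λ⁻¹)⁻¹) i j * e i := by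
  have hsymm : ((Bᵀ * B + Λ⁻¹)⁻¹)ᵀ = (Bᵀ * B + Λ⁻¹)⁻¹ := by
    rw [transpose_nonsing_inv, transpose_add, transpose_mul, transpose_transpose,
      transpose_nonsing_inv]
    have := hΛ.isHermitian
    rw [IsHermitian, conjTranspose_eq_transpose_of_trivial] at this
    rw [this]
  have : (Bᵀ * B + Λ⁻¹)⁻¹ * Bᵀ = (B * (Bᵀ * B + Λ⁻¹)⁻¹)ᵀ := by rw [transpose_mul, hsymm]
  rw [mulVec_mulVec, this]
  rfl

theorem posSemidef_postCov (hΛ : Λ.PosSemidef) : (Bᵀ * B + Λ⁻¹)⁻¹.PosSemidef := by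
  have := posSemidef_conjTranspose_mul_self B
  rw [conjTranspose_eq_transpose_of_trivial] at this
  exact (this.add hΛ.inv).inv

/-- The matrix `B Λ Bᵀ + 1` is at least the identity, so its inverse is at most the identity. -/
theorem quadratic_form_inv_bound [DecidableEq I] (hΛ : Λ.PosSemidef) (v : I → ℝ) :
    0 ≤ v ⬝ᵥ (B * Λ * Bᵀ + 1)⁻¹ *ᵥ v ∧ v ⬝ᵥ (B * Λ * Bᵀ + 1)⁻¹ *ᵥ v ≤ ∑ i, v i ^ 2 := by
  have hM : ∀ w, 1 * (w ⬝ᵥ w) ≤ w ⬝ᵥ (B * Λ * Bᵀ + 1) *ᵥ w := fun w => by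
    have := (hΛ.mul_mul_conjTranspose_same B).dotProduct_mulVec_nonneg w
    rw [conjTranspose_eq_transpose_of_trivial, star_trivial] at this
    rw [add_mulVec, dotProduct_add, one_mulVec, one_mul]
    linarith
  have := dotProduct_inv_mulVec_le one_pos hM v
  rw [one_mul] at this
  refine ⟨this.1, this.2.trans (le_of_eq ?_)⟩
  rw [dotProduct]
  exact Finset.sum_congr rfl fun i _ => (sq _).symm

end Coercive

/-! ### Regular designs -/

section RegularDesign

/-- The box of points with `a k < x k ≤ b k`. -/
def halfOpenBox (a b : Fin 2 → ℝ) : Set Plane := {x | ∀ k, a k < x k ∧ x k ≤ b k}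

/-- A half-open interval is covered by its `R` half-open subintervals of equal length. -/
theorem exists_subinterval {a b x : ℝ} (hab : a < b) {R : ℕ} (hR : 0 < R) (hx : x ∈ Ioc a b) :
    ∃ p < R, a + p * ((b - a) / R) < x ∧ x ≤ a + (p + 1) * ((b - a) / R) := by
  have hR' : (0 : ℝ) < R := by exact_mod_cast hR
  set h := (b - a) / R with hh
  have hh0 : 0 < h := div_pos (by linarith) hR'
  have hRh : R * h = b - a := by rw [hh]; field_simp
  have hex : ∃ p : ℕ, x ≤ a + (p + 1) * h := ⟨R, by nlinarith [hx.2]⟩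
  classical
  refine ⟨Nat.find hex, ?_, ?_, Nat.find_spec hex⟩
  · have : Nat.find hex ≤ R - 1 := Nat.find_min' hex (by
      rw [Nat.cast_sub hR, Nat.cast_one, sub_add_cancel, hRh]; linarith [hx.2])
    omega
  · rcases Nat.eq_zero_or_pos (Nat.find hex) with h0 | h0
    · rw [h0]; simpa using hx.1
    · have := Nat.find_min hex (Nat.sub_one_lt h0.ne')
      rw [Nat.cast_sub h0, Nat.cast_one, sub_add_cancel, not_le] at this
      exact this

namespace SplineSpace

variable {S : SplineSpace} {w κ : ℝ}

/-- The side lengths of the parts when a knot rectangle is split into `R` parts per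
coordinate. -/
def partLength (S : SplineSpace) (R : ℕ) (μ : Fin 2 → ℕ) (k : Fin 2) : ℝ :=
  (S.knot k (μ k + 1) - S.knot k (μ k)) / R

/-- The lower corner of the part with index `p` of the knot rectangle `μ`; at the boundary of the
square it is moved out of the square, so that half-open parts cover the closed square. -/
def partLower (S : SplineSpace) (R : ℕ) (μ p : Fin 2 → ℕ) (k : Fin 2) : ℝ :=
  if μ k = S.q k - 1 ∧ p k = 0 then -1 else S.knot k (μ k) + p k * S.partLength R μ k

/-- The upper corner of the part with index `p` of the knot rectangle `μ`. -/
def partUpper (S : SplineSpace) (R : ℕ) (μ p : Fin 2 → ℕ) (k : Fin 2) : ℝ :=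
  S.knot k (μ k) + (p k + 1) * S.partLength R μ k

/-- The half-open part with index `p` of the knot rectangle `μ`. -/
def part (S : SplineSpace) (R : ℕ) (μ p : Fin 2 → ℕ) : Set Plane :=
  halfOpenBox (S.partLower R μ p) (S.partUpper R μ p)

open Classical in
/-- The design points lie in the square, and their number in each part of a knot rectangle is of
the order `m`. -/
structure IsRegularDesign (S : SplineSpace) (R : ℕ) (m C : ℝ) {n : ℕ} (X : Fin n → Plane) :
    Prop where
  mem : ∀ i, X i ∈ unitSquare
  lower : ∀ μ, S.IsCell μ → ∀ p : Fin 2 → ℕ, (∀ k, p k < R) →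
    m ≤ C * (Finset.univ.filter fun i => X i ∈ S.part R μ p).card
  upper : ∀ μ, S.IsCell μ → ∀ p : Fin 2 → ℕ, (∀ k, p k < R) →
    ((Finset.univ.filter fun i => X i ∈ S.part R μ p).card : ℝ) ≤ C * m

theorem IsMesh.partLength_le (h : S.IsMesh w κ) (R : ℕ) (μ : Fin 2 → ℕ) (k : Fin 2) :
    S.partLength R μ k ≤ κ * w / R :=
  div_le_div_of_nonneg_right (h.le_mul k _) (Nat.cast_nonneg _)

theorem IsMesh.le_partLength (h : S.IsMesh w κ) (R : ℕ) {μ : Fin 2 → ℕ} (hμ : S.IsCell μ)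
    (k : Fin 2) : w / R ≤ S.partLength R μ k :=
  div_le_div_of_nonneg_right (h.le k _ (hμ k).1 (hμ k).2) (Nat.cast_nonneg _)

theorem IsMesh.partUpper_le (h : S.IsMesh w κ) {R : ℕ} {μ : Fin 2 → ℕ} (hμ : S.IsCell μ)
    {p : Fin 2 → ℕ} {k : Fin 2} (hp : p k < R) :
    S.partUpper R μ p k ≤ S.knot k (μ k + 1) := by
  have hR : (0 : ℝ) < R := by exact_mod_cast (Nat.zero_le _).trans_lt hp
  have h1 : ((p k : ℝ) + 1) ≤ R := by exact_mod_cast hp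
  have h2 : (0 : ℝ) ≤ S.partLength R μ k :=
    (div_nonneg h.pos.le hR.le).trans (h.le_partLength R hμ k)
  have h3 : R * S.partLength R μ k = S.knot k (μ k + 1) - S.knot k (μ k) := by
    rw [partLength]; field_simp
  rw [partUpper]
  nlinarith

theorem IsMesh.part_subset_rect (h : S.IsMesh w κ) {R : ℕ} {μ : Fin 2 → ℕ} (hμ : S.IsCell μ)
    {p : Fin 2 → ℕ} (hp : ∀ k, p k < R) {x : Plane} (hxQ : x ∈ unitSquare)
    (hx : x ∈ S.part R μ p) : x ∈ S.rect μ ∧ (∀ k, μ k = S.q k - 1 ∨ S.knot k (μ k) < x k) ∧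
      ∀ k, S.knot k (μ k) + p k * S.partLength R μ k ≤ x k ∧ x k ≤ S.partUpper R μ p k := by
  have key : ∀ k, (μ k = S.q k - 1 ∨ S.knot k (μ k) < x k) ∧
      S.knot k (μ k) + p k * S.partLength R μ k ≤ x k := by
    intro k
    have hR : (0 : ℝ) < R := by exact_mod_cast (Nat.zero_le _).trans_lt (hp k)
    have h2 : (0 : ℝ) ≤ S.partLength R μ k :=
      (div_nonneg h.pos.le hR.le).trans (h.le_partLength R hμ k)
    have h1 := (hx k).1
    rw [partLower] at h1
    split_ifs at h1 with hc
    · refine ⟨Or.inl hc.1, ?_⟩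
      rw [hc.2, hc.1, (h.knots k).zero _ le_rfl]
      simpa using (hxQ k).1
    · have h3 : (0 : ℝ) ≤ p k * S.partLength R μ k := by positivity
      exact ⟨Or.inr (by linarith), h1.le⟩
  refine ⟨fun k => ⟨?_, (hx k).2.trans (h.partUpper_le hμ (hp k))⟩, fun k => (key k).1,
    fun k => ⟨(key k).2, (hx k).2⟩⟩
  rcases (key k).1 with h1 | h1
  · rw [h1, (h.knots k).zero _ le_rfl]; exact (hxQ k).1
  · exact h1.le

theorem IsMesh.exists_part (h : S.IsMesh w κ) {R : ℕ} (hR : 0 < R) {μ : Fin 2 → ℕ}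
    (hμ : S.IsCell μ) {x : Plane} (hx : x ∈ S.rect μ)
    (hx' : ∀ k, μ k = S.q k - 1 ∨ S.knot k (μ k) < x k) :
    ∃ p : Fin 2 → ℕ, (∀ k, p k < R) ∧ x ∈ S.part R μ p := by
  have key : ∀ k, ∃ p < R, ((μ k = S.q k - 1 ∧ p = 0 ∧ -1 < x k) ∨
      S.knot k (μ k) + p * S.partLength R μ k < x k) ∧
      x k ≤ S.knot k (μ k) + (p + 1) * S.partLength R μ k := by
    intro k
    rcases (hx k).1.lt_or_eq with h1 | h1
    · obtain ⟨p, hp, h2, h3⟩ := exists_subinterval (h.cell_lt hμ k) hR ⟨h1, (hx k).2⟩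
      exact ⟨p, hp, Or.inr h2, h3⟩
    · have h4 : μ k = S.q k - 1 := (hx' k).resolve_right (by rw [h1]; exact lt_irrefl _)
      have h5 := (h.knots k).nonneg (μ k)
      have h6 : 0 ≤ S.partLength R μ k :=
        (div_nonneg h.pos.le (Nat.cast_nonneg _)).trans (h.le_partLength R hμ k)
      exact ⟨0, hR, Or.inl ⟨h4, rfl, by linarith⟩, by push_cast; linarith⟩
  choose p hp h1 h2 using key
  refine ⟨p, hp, fun k => ⟨?_, h2 k⟩⟩
  rw [partLower]
  split_ifs with hc
  · have h5 := (h.knots k).nonneg (μ k)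
    linarith [(hx k).1]
  · rcases h1 k with h3 | h3
    · exact absurd ⟨h3.1, h3.2.1⟩ hc
    · exact h3

/-- A cell is determined by a point of its half-open rectangle. -/
theorem IsMesh.cell_unique (h : S.IsMesh w κ) {μ ν : Fin 2 → ℕ} (hμ : S.IsCell μ) (hν : S.IsCell ν)
    {x : Plane} (h1 : x ∈ S.rect μ) (h2 : ∀ k, μ k = S.q k - 1 ∨ S.knot k (μ k) < x k)
    (h3 : x ∈ S.rect ν) (h4 : ∀ k, ν k = S.q k - 1 ∨ S.knot k (ν k) < x k) : μ = ν := by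
  have key : ∀ {μ ν : Fin 2 → ℕ}, S.IsCell μ → x ∈ S.rect μ →
      (∀ k, ν k = S.q k - 1 ∨ S.knot k (ν k) < x k) → ∀ k, ν k ≤ μ k := by
    intro μ ν hμ h1 h4 k
    rcases h4 k with h5 | h5
    · rw [h5]; exact (hμ k).1
    · by_contra hlt
      have := (h.knots k).mono (show μ k + 1 ≤ ν k by omega)
      linarith [(h1 k).2]
  funext k
  exact le_antisymm (key hν h3 h2 k) (key hμ h1 h4 k)

theorem IsMesh.basis_nonneg (h : S.IsMesh w κ) {x : Plane} (hx : x ∈ unitSquare) (j : S.Idx) :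
    0 ≤ S.basis j x := by
  obtain ⟨μ, hμ, hxμ, -⟩ := h.exists_cell hx
  have q0 := h.four_le 0
  have q1 := h.four_le 1
  rw [basis_eq, basisDeriv,
    bsplineDeriv_eq (h.knots 0) (hμ 0).1 (hμ 0).2 (hxμ 0) 0 _ _ (by omega),
    bsplineDeriv_eq (h.knots 1) (hμ 1).1 (hμ 1).2 (hxμ 1) 0 _ _ (by omega)]
  exact mul_nonneg (cellPoly_nonneg (h.knots 0).mono (hxμ 0) _ _)
    (cellPoly_nonneg (h.knots 1).mono (hxμ 1) _ _)

theorem IsMesh.sum_basis (h : S.IsMesh w κ) {x : Plane} (hx : x ∈ unitSquare) :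
    ∑ j, S.basis j x = 1 := by
  obtain ⟨μ, hμ, hxμ, -⟩ := h.exists_cell hx
  have q0 := h.four_le 0
  have q1 := h.four_le 1
  have key : ∀ k, ∑ a : Fin (S.J k), bsplineDeriv (S.knot k) 0 (S.q k - 1) a (x k) = 1 := by
    intro k
    have qk := h.four_le k
    have hk := hμ k
    rw [Fin.sum_univ_eq_sum_range (fun a => bsplineDeriv (S.knot k) 0 (S.q k - 1) a (x k))]
    have := congrArg (Polynomial.eval (x k)) (sum_cellPoly (h.knots k).mono
      ((h.knots k).lt _ hk.1 hk.2) (n := S.J k) (by rw [SplineSpace.J]; omega) _ hk.1)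
    rw [Polynomial.eval_finsetSum, Polynomial.eval_one] at this
    rw [← this]
    exact Finset.sum_congr rfl fun a _ =>
      bsplineDeriv_eq (h.knots k) hk.1 hk.2 (hxμ k) 0 _ _ (by omega)
  simp only [basis_eq, basisDeriv]
  rw [Fintype.sum_prod_type]
  simp only
  rw [← Finset.sum_mul_sum, key 0, key 1, one_mul]

open Classical in
/-- The design matrix of a regular design is stable. The data points active for a coefficient are
those in the support of its basis function; in each knot rectangle, a whole part (around the peak of
the spline) contributes fitted values of the order of the coefficient. -/
theorem exists_isStableDesign (q : Fin 2 → ℕ) {κ : ℝ} (hκ : 0 < κ) : ∃ R : ℕ, 0 < R ∧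
    ∀ C : ℝ, 1 ≤ C → ∃ C' : ℝ, ∃ d : ℕ, ∀ (S : SplineSpace) (w : ℝ), S.q = q → S.IsMesh w κ →
    ∀ {n : ℕ} (X : Fin n → Plane) (m : ℝ), 0 < m → S.IsRegularDesign R m C X →
    ∃ (act : Fin n → S.Idx → Prop) (l : Fin n → ℕ × ℕ), IsStableDesign (S.design X) act m C' ∧
      ∀ i j, act i j → |((l i).1 : ℝ) - j.1| ≤ d ∧ |((l i).2 : ℝ) - j.2| ≤ d := by
  obtain ⟨K, hK, hpeak⟩ := exists_peak q hκ
  -- the parts have side length at most `w / K`, the width of the peak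
  set R : ℕ := ⌈κ * K⌉₊ + 1 with hR
  have hR0 : 0 < R := Nat.succ_pos _
  have hRR : (0 : ℝ) < R := by exact_mod_cast hR0
  have hRK : κ * K ≤ R := by
    have := Nat.le_ceil (κ * K)
    rw [hR]; push_cast; linarith
  refine ⟨R, hR0, fun C hC => ?_⟩
  set Q : ℕ := (q 0 - 1 + 1) * (q 1 - 1 + 1) with hQ
  have hQ1 : (1 : ℝ) ≤ Q := by
    have : 1 ≤ Q := Nat.mul_pos (Nat.succ_pos _) (Nat.succ_pos _)
    exact_mod_cast this
  have hRR1 : (1 : ℝ) ≤ (R * R : ℕ) := by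
    have : 1 ≤ R * R := Nat.mul_pos hR0 hR0
    exact_mod_cast this
  have hC0 : 0 < C := zero_lt_one.trans_le hC
  have hC'1 : 1 ≤ Q * ((R * R : ℕ) * C) + C * K ^ 2 := by
    have h1 : (1 : ℝ) ≤ (R * R : ℕ) * C := one_le_mul_of_one_le_of_one_le hRR1 hC
    have h2 : (1 : ℝ) ≤ Q * ((R * R : ℕ) * C) := one_le_mul_of_one_le_of_one_le hQ1 h1
    have h3 : 0 ≤ C * K ^ 2 := by positivity
    linarith
  refine ⟨Q * ((R * R : ℕ) * C) + C * K ^ 2, q 0 + q 1, ?_⟩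
  rintro S w rfl h n X m hm hX
  choose cell hcell hrect hleft using fun i => h.exists_cell (hX.mem i)
  have q0 := h.four_le 0
  have q1 := h.four_le 1
  refine ⟨fun i j => S.IsActive (cell i) j, fun i => (cell i 0, cell i 1),
    ⟨hm, hC'1, fun i j => h.basis_nonneg (hX.mem i) j, fun i => h.sum_basis (hX.mem i),
      fun i j hij => ?_, fun j => ?_, fun i => ?_, fun u j => ?_⟩, fun i j hij => ?_⟩
  · exact h.basisDeriv_eq_zero (hcell i) (hrect i) (r := 0) (s := 0) (by omega) (by omega) hij
  · -- the number of data points in a cell, and then in the support of a basis function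
    have hcount : ∀ μ, S.IsCell μ →
        ((Finset.univ.filter fun i => cell i = μ).card : ℝ) ≤ (R * R : ℕ) * (C * m) := by
      intro μ hμ
      have hsub : (Finset.univ.filter fun i => cell i = μ) ⊆
          (Finset.range R ×ˢ Finset.range R).biUnion fun p =>
            Finset.univ.filter fun i => X i ∈ S.part R μ ![p.1, p.2] := by
        intro i hi
        have hi := (Finset.mem_filter.1 hi).2
        obtain ⟨p, hp, hxp⟩ := h.exists_part hR0 hμ (hi ▸ hrect i) (hi ▸ hleft i)
        have hpe : ![p 0, p 1] = p := by ext k; fin_cases k <;> rfl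
        simp only [Finset.mem_biUnion, Finset.mem_product, Finset.mem_range, Finset.mem_filter,
          Finset.mem_univ, true_and]
        exact ⟨(p 0, p 1), ⟨hp 0, hp 1⟩, by rw [hpe]; exact hxp⟩
      calc ((Finset.univ.filter fun i => cell i = μ).card : ℝ)
          ≤ ∑ p ∈ Finset.range R ×ˢ Finset.range R,
            ((Finset.univ.filter fun i => X i ∈ S.part R μ ![p.1, p.2]).card : ℝ) := by
            exact_mod_cast (Finset.card_le_card hsub).trans Finset.card_biUnion_le
        _ ≤ ∑ _p ∈ Finset.range R ×ˢ Finset.range R, C * m := by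
            refine Finset.sum_le_sum fun p hp => hX.upper μ hμ _ fun k => ?_
            simp only [Finset.mem_product, Finset.mem_range] at hp
            fin_cases k
            · exact hp.1
            · exact hp.2
        _ = _ := by simp
    have hle1 : ∀ i, S.design X i j ≤ 1 := fun i => by
      rw [← h.sum_basis (hX.mem i)]
      exact Finset.single_le_sum (f := fun j => S.basis j (X i))
        (fun j _ => h.basis_nonneg (hX.mem i) j) (Finset.mem_univ j)
    set T := (Finset.Icc (j.1 : ℕ) (j.1 + (S.q 0 - 1))) ×ˢ
      (Finset.Icc (j.2 : ℕ) (j.2 + (S.q 1 - 1))) with hT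
    have hsub : (Finset.univ.filter fun i => S.IsActive (cell i) j) ⊆
        (T.filter fun a => S.IsCell ![a.1, a.2]).biUnion fun a =>
          Finset.univ.filter fun i => cell i = ![a.1, a.2] := by
      intro i hi
      obtain ⟨⟨a1, a2⟩, ⟨a3, a4⟩⟩ := (Finset.mem_filter.1 hi).2
      have hpe : ![cell i 0, cell i 1] = cell i := by ext k; fin_cases k <;> rfl
      simp only [hT, Finset.mem_biUnion, Finset.mem_product, Finset.mem_Icc, Finset.mem_filter,
        Finset.mem_univ, true_and]
      exact ⟨(cell i 0, cell i 1), ⟨⟨⟨a1, a2⟩, a3, a4⟩, by rw [hpe]; exact hcell i⟩, hpe.symm⟩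
    have hTc : ((T.filter fun a => S.IsCell ![a.1, a.2]).card : ℝ) ≤ Q := by
      have h1 : (T.filter fun a => S.IsCell ![a.1, a.2]).card ≤ T.card := Finset.card_filter_le _ _
      have h2 : T.card = Q := by
        rw [hT, Finset.card_product, Nat.card_Icc, Nat.card_Icc, hQ]
        congr 1 <;> omega
      rw [h2] at h1
      exact_mod_cast h1
    calc ∑ i, S.design X i j = ∑ i with S.IsActive (cell i) j, S.design X i j := by
          refine (Finset.sum_subset (Finset.filter_subset _ _) fun i _ hi => ?_).symm
          exact h.basisDeriv_eq_zero (hcell i) (hrect i) (r := 0) (s := 0) (by omega) (by omega)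
            (by simpa using hi)
      _ ≤ ∑ i with S.IsActive (cell i) j, (1 : ℝ) := Finset.sum_le_sum fun i _ => hle1 i
      _ = ((Finset.univ.filter fun i => S.IsActive (cell i) j).card : ℝ) := by simp
      _ ≤ ∑ a ∈ T.filter (fun a => S.IsCell ![a.1, a.2]),
          ((Finset.univ.filter fun i => cell i = ![a.1, a.2]).card : ℝ) := by
          exact_mod_cast (Finset.card_le_card hsub).trans Finset.card_biUnion_le
      _ ≤ ∑ a ∈ T.filter (fun a => S.IsCell ![a.1, a.2]), ((R * R : ℕ) * (C * m) : ℝ) :=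
          Finset.sum_le_sum fun a ha => hcount _ (Finset.mem_filter.1 ha).2
      _ = ((T.filter fun a => S.IsCell ![a.1, a.2]).card : ℝ) * ((R * R : ℕ) * (C * m)) := by
          rw [Finset.sum_const, nsmul_eq_mul]
      _ ≤ Q * ((R * R : ℕ) * (C * m)) := by gcongr
      _ ≤ (Q * ((R * R : ℕ) * C) + C * K ^ 2) * m := by
          have : 0 ≤ C * K ^ 2 * m := by positivity
          nlinarith
  · have h1 := card_active_le S (cell i) (Finset.univ.filter fun j => S.IsActive (cell i) j)
      (by simp)
    have h2 : ((Finset.univ.filter fun j => S.IsActive (cell i) j).card : ℝ) ≤ Q := by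
      exact_mod_cast h1
    have h3 : (Q : ℝ) * 1 ≤ Q * ((R * R : ℕ) * C) :=
      mul_le_mul_of_nonneg_left (one_le_mul_of_one_le_of_one_le hRR1 hC) (Nat.cast_nonneg _)
    have h4 : 0 ≤ C * K ^ 2 := by positivity
    linarith
  · -- the peak of the spline on a knot rectangle in the support of the `j`-th basis function
    set μ := S.homeCell j with hμdef
    have hμ : S.IsCell μ := h.isCell_homeCell j
    obtain ⟨z, hz, hpk⟩ := hpeak S w rfl h μ hμ u
    have hpart : ∀ k, ∃ p < R, S.knot k (μ k) + p * S.partLength R μ k ≤ z k ∧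
        z k ≤ S.knot k (μ k) + (p + 1) * S.partLength R μ k := by
      intro k
      rcases (hz k).1.lt_or_eq with h1 | h1
      · obtain ⟨p, hp, h2, h3⟩ := exists_subinterval (h.cell_lt hμ k) hR0 ⟨h1, (hz k).2⟩
        exact ⟨p, hp, h2.le, h3⟩
      · have h6 : 0 ≤ S.partLength R μ k :=
          (div_nonneg h.pos.le (Nat.cast_nonneg _)).trans (h.le_partLength R hμ k)
        exact ⟨0, hR0, by simp [h1], by push_cast; linarith⟩
    choose p hp hp1 hp2 using hpart
    have hlen : ∀ k, S.partLength R μ k ≤ w / K := fun k => by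
      refine (h.partLength_le R μ k).trans ?_
      rw [div_le_div_iff₀ hRR hK]
      nlinarith [h.pos]
    have hmem : ∀ i, X i ∈ S.part R μ p → S.IsActive (cell i) j ∧
        u j ^ 2 ≤ K ^ 2 * ((S.design X).mulVec u i) ^ 2 := by
      intro i hi
      obtain ⟨g1, g2, g3⟩ := h.part_subset_rect hμ hp (hX.mem i) hi
      have hci : cell i = μ := h.cell_unique (hcell i) hμ (hrect i) (hleft i) g1 g2
      refine ⟨by rw [hci]; exact isActive_homeCell j, ?_⟩
      have g4 := hpk (X i) g1 (fun k => by
        have := g3 k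
        rw [partUpper] at this
        have a1 := hp1 k
        have a2 := hp2 k
        have a3 := hlen k
        rw [abs_le]
        constructor <;> linarith) j (isActive_homeCell j)
      have g5 : (S.design X).mulVec u i = S.fnDeriv 0 0 u (X i) := rfl
      rw [g5, ← mul_pow, ← sq_abs (u j), ← sq_abs (K * _), abs_mul, abs_of_pos hK]
      exact pow_le_pow_left₀ (abs_nonneg _) g4 2
    have hlow := hX.lower μ hμ p hp
    calc m * u j ^ 2
        ≤ C * (Finset.univ.filter fun i => X i ∈ S.part R μ p).card * u j ^ 2 := by gcongr
      _ = C * ∑ i with X i ∈ S.part R μ p, u j ^ 2 := by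
          rw [Finset.sum_const, nsmul_eq_mul, mul_assoc]
      _ ≤ C * ∑ i with X i ∈ S.part R μ p, K ^ 2 * ((S.design X).mulVec u i) ^ 2 :=
          mul_le_mul_of_nonneg_left (Finset.sum_le_sum fun i hi =>
            (hmem i (Finset.mem_filter.1 hi).2).2) hC0.le
      _ ≤ C * ∑ i with S.IsActive (cell i) j, K ^ 2 * ((S.design X).mulVec u i) ^ 2 := by
          refine mul_le_mul_of_nonneg_left (Finset.sum_le_sum_of_subset_of_nonneg
            (fun i hi => ?_) fun i _ _ => by positivity) hC0.le
          exact Finset.mem_filter.2 ⟨Finset.mem_univ i, (hmem i (Finset.mem_filter.1 hi).2).1⟩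
      _ = C * K ^ 2 * ∑ i with S.IsActive (cell i) j, ((S.design X).mulVec u i) ^ 2 := by
          rw [← Finset.mul_sum]; ring
      _ ≤ _ := by
          refine mul_le_mul_of_nonneg_right ?_ (Finset.sum_nonneg fun i _ => sq_nonneg _)
          have : 0 ≤ (Q : ℝ) * ((R * R : ℕ) * C) := by positivity
          linarith
  · obtain ⟨⟨a1, a2⟩, ⟨a3, a4⟩⟩ := hij
    have b1 : ((j.1 : ℕ) : ℝ) ≤ cell i 0 := by exact_mod_cast a1
    have b2 : ((j.2 : ℕ) : ℝ) ≤ cell i 1 := by exact_mod_cast a3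
    have b3 : (cell i 0 : ℝ) ≤ (j.1 : ℕ) + (S.q 0 + S.q 1 : ℕ) := by exact_mod_cast (by omega)
    have b4 : (cell i 1 : ℝ) ≤ (j.2 : ℕ) + (S.q 0 + S.q 1 : ℕ) := by exact_mod_cast (by omega)
    constructor <;> rw [abs_le] <;> constructor <;> simp only <;> linarith

end SplineSpace

end RegularDesign

/-! ### Numbers of design points in boxes -/

section DesignCounts

/-- The points below `x` in both coordinates. -/
def lowerOrthant (x : Plane) : Set Plane := {y | ∀ k, y k ≤ x k}

theorem measurableSet_setOf_forall {s : Fin 2 → Set ℝ} (hs : ∀ k, MeasurableSet (s k)) :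
    MeasurableSet {x : Plane | ∀ k, x k ∈ s k} := by
  rw [Set.ofPred_forall]
  exact MeasurableSet.iInter fun k =>
    (EuclideanSpace.proj (𝕜 := ℝ) k : Plane →L[ℝ] ℝ).continuous.measurable (hs k)

theorem measurableSet_lowerOrthant (x : Plane) : MeasurableSet (lowerOrthant x) :=
  measurableSet_setOf_forall (s := fun k => Iic (x k)) fun _ => measurableSet_Iic

theorem measurableSet_halfOpenBox (a b : Fin 2 → ℝ) : MeasurableSet (halfOpenBox a b) :=
  measurableSet_setOf_forall (s := fun k => Ioc (a k) (b k)) fun _ => measurableSet_Ioc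

theorem measurableSet_unitSquare : MeasurableSet unitSquare :=
  measurableSet_setOf_forall (s := fun _ => Icc 0 1) fun _ => measurableSet_Icc

/-- The measure of a box, by inclusion and exclusion of the four corners. -/
theorem real_halfOpenBox (ν : Measure Plane) [IsFiniteMeasure ν] {a b : Fin 2 → ℝ}
    (hab : ∀ k, a k ≤ b k) : ν.real (halfOpenBox a b) = planeCDF ν !₂[b 0, b 1] -
      planeCDF ν !₂[a 0, b 1] - planeCDF ν !₂[b 0, a 1] + planeCDF ν !₂[a 0, a 1] := by
  have e1 : lowerOrthant !₂[b 0, b 1] =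
      halfOpenBox a b ∪ (lowerOrthant !₂[a 0, b 1] ∪ lowerOrthant !₂[b 0, a 1]) := by
    ext x
    simp only [lowerOrthant, halfOpenBox, Set.mem_ofPred_eq, Set.mem_union, Fin.forall_fin_two]
    simp
    have h0 := hab 0
    have h1 := hab 1
    constructor
    · rintro ⟨h2, h3⟩
      rcases le_or_gt (x 0) (a 0) with h4 | h4
      · exact Or.inr (Or.inl ⟨h4, h3⟩)
      rcases le_or_gt (x 1) (a 1) with h5 | h5
      · exact Or.inr (Or.inr ⟨h2, h5⟩)
      exact Or.inl ⟨⟨h4, h2⟩, h5, h3⟩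
    · rintro (⟨⟨-, h2⟩, -, h3⟩ | ⟨h2, h3⟩ | ⟨h2, h3⟩)
      · exact ⟨h2, h3⟩
      · exact ⟨h2.trans h0, h3⟩
      · exact ⟨h2, h3.trans h1⟩
  have e2 : lowerOrthant !₂[a 0, b 1] ∩ lowerOrthant !₂[b 0, a 1] =
      lowerOrthant !₂[a 0, a 1] := by
    ext x
    simp only [lowerOrthant, Set.mem_ofPred_eq, Set.mem_inter_iff, Fin.forall_fin_two]
    simp
    have h0 := hab 0
    have h1 := hab 1
    constructor
    · rintro ⟨⟨h2, -⟩, -, h3⟩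
      exact ⟨h2, h3⟩
    · rintro ⟨h2, h3⟩
      exact ⟨⟨h2, h3.trans h1⟩, h2.trans h0, h3⟩
  have hdisj : Disjoint (halfOpenBox a b)
      (lowerOrthant !₂[a 0, b 1] ∪ lowerOrthant !₂[b 0, a 1]) := by
    rw [Set.disjoint_left]
    rintro x hx (h | h)
    · exact absurd (h 0) (not_le.2 (by simpa using (hx 0).1))
    · exact absurd (h 1) (not_le.2 (by simpa using (hx 1).1))
  have m1 := measurableSet_lowerOrthant !₂[a 0, b 1]
  have m2 := measurableSet_lowerOrthant !₂[b 0, a 1]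
  have h1 := measureReal_union (μ := ν) hdisj (m1.union m2)
  have h2 := measureReal_union_add_inter (μ := ν) (s := lowerOrthant !₂[a 0, b 1]) m2
  rw [← e1] at h1
  rw [e2] at h2
  have hF : ∀ x, planeCDF ν x = ν.real (lowerOrthant x) := fun _ => rfl
  rw [hF, hF, hF, hF]
  linarith

theorem volume_setOf_forall (s : Fin 2 → Set ℝ) (hs : ∀ k, MeasurableSet (s k)) :
    (volume : Measure Plane) {x | ∀ k, x k ∈ s k} = volume (s 0) * volume (s 1) := by
  have h := (PiLp.volume_preserving_ofLp (Fin 2)).measure_preimage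
    (MeasurableSet.univ_pi hs).nullMeasurableSet
  rw [volume_pi_pi, Fin.prod_univ_two] at h
  rw [← h]
  congr 1
  ext x
  simp

/-- A measure with a positive continuous density on the square is comparable to Lebesgue measure
there. -/
theorem HasPositiveContinuousDensity.exists_bounds {μ : Measure Plane}
    (hμ : HasPositiveContinuousDensity μ) : ∃ c > 0, ∃ C > 0, ∀ A : Set Plane, MeasurableSet A →
      ENNReal.ofReal c * volume (A ∩ unitSquare) ≤ μ A ∧
      μ A ≤ ENNReal.ofReal C * volume (A ∩ unitSquare) := by
  obtain ⟨-, g, hg, hpos, rfl⟩ := hμ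
  have hne : unitSquare.Nonempty := interior_unitSquare_nonempty.mono interior_subset
  obtain ⟨x, hx, hmin⟩ := isCompact_unitSquare.exists_isMinOn hne hg
  obtain ⟨y, hy, hmax⟩ := isCompact_unitSquare.exists_isMaxOn hne hg
  refine ⟨g x, hpos x hx, g y, hpos y hy, fun A hA => ?_⟩
  rw [withDensity_apply _ hA, Measure.restrict_restrict hA, ← setLIntegral_const,
    ← setLIntegral_const]
  have hm := hA.inter measurableSet_unitSquare
  exact ⟨setLIntegral_mono' hm fun z hz => ENNReal.ofReal_le_ofReal (hmin hz.2),
    setLIntegral_mono' hm fun z hz => ENNReal.ofReal_le_ofReal (hmax hz.2)⟩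

theorem HasPositiveContinuousDensity.measure_compl {μ : Measure Plane}
    (hμ : HasPositiveContinuousDensity μ) : μ unitSquareᶜ = 0 := by
  obtain ⟨c, -, C, -, h⟩ := hμ.exists_bounds
  have := (h _ measurableSet_unitSquare.compl).2
  simpa using this

namespace SplineSpace

theorem IsMesh.partLower_le {S : SplineSpace} {w κ : ℝ} (h : S.IsMesh w κ) (R : ℕ)
    {μ : Fin 2 → ℕ} (hμ : S.IsCell μ) (p : Fin 2 → ℕ) (k : Fin 2) :
    S.partLower R μ p k ≤ S.knot k (μ k) + p k * S.partLength R μ k ∧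
    S.knot k (μ k) + p k * S.partLength R μ k ≤ S.partUpper R μ p k := by
  have h2 : (0 : ℝ) ≤ S.partLength R μ k :=
    (div_nonneg h.pos.le (Nat.cast_nonneg _)).trans (h.le_partLength R hμ k)
  have h3 := (h.knots k).nonneg (μ k)
  have h4 : (0 : ℝ) ≤ p k * S.partLength R μ k := by positivity
  rw [partLower, partUpper]
  constructor
  · split_ifs <;> linarith
  · linarith

/-- The parts of the knot rectangles have measure of the order `w²`. -/
theorem exists_part_measure_bounds {ν : Measure Plane} (hν : HasPositiveContinuousDensity ν)
    {R : ℕ} (hR : 0 < R) {κ : ℝ} (hκ : 0 < κ) : ∃ c > 0, ∃ C > 0, ∀ (S : SplineSpace) (w : ℝ),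
      S.IsMesh w κ → ∀ μ, S.IsCell μ → ∀ p : Fin 2 → ℕ, (∀ k, p k < R) →
      c * w ^ 2 ≤ ν.real (S.part R μ p) ∧ ν.real (S.part R μ p) ≤ C * w ^ 2 := by
  obtain ⟨c, hc, C, hC, h⟩ := hν.exists_bounds
  have := hν.1
  have hR' : (0 : ℝ) < R := by exact_mod_cast hR
  refine ⟨c / R ^ 2, by positivity, C * (κ / R) ^ 2, by positivity, ?_⟩
  intro S w hS μ hμ p hp
  have hw := hS.pos
  obtain ⟨h1, h2⟩ := h (S.part R μ p) (measurableSet_halfOpenBox _ _)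
  set l : Fin 2 → ℝ := fun k => S.knot k (μ k) + p k * S.partLength R μ k with hl
  have hlen : ∀ k, S.partUpper R μ p k - l k = S.partLength R μ k := fun k => by
    rw [partUpper, hl]; ring
  have hp0 : ∀ k, 0 ≤ S.partLength R μ k := fun k =>
    (div_nonneg hw.le hR'.le).trans (hS.le_partLength R hμ k)
  have hl0 : ∀ k, 0 ≤ l k := fun k => by
    have h3 := (hS.knots k).nonneg (μ k)
    have := hp0 k
    simp only [hl]; positivity
  have hu1 : ∀ k, S.partUpper R μ p k ≤ 1 := fun k =>
    (hS.partUpper_le hμ (hp k)).trans ((hS.knots k).le_one _)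
  constructor
  · have hsub : {x : Plane | ∀ k, x k ∈ Ioc (l k) (S.partUpper R μ p k)} ⊆
        S.part R μ p ∩ unitSquare := fun x hx =>
      ⟨fun k => ⟨(hS.partLower_le R hμ p k).1.trans_lt (hx k).1, (hx k).2⟩,
        fun k => ⟨(hl0 k).trans (hx k).1.le, (hx k).2.trans (hu1 k)⟩⟩
    have h3 := measure_mono (μ := (volume : Measure Plane)) hsub
    rw [volume_setOf_forall _ fun _ => measurableSet_Ioc, Real.volume_Ioc, Real.volume_Ioc,
      hlen, hlen, ← ENNReal.ofReal_mul (hp0 0)] at h3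
    have h4 := (mul_le_mul_right h3 (ENNReal.ofReal c)).trans h1
    rw [← ENNReal.ofReal_mul hc.le] at h4
    have h5 := (ENNReal.ofReal_le_iff_le_toReal (measure_ne_top _ _)).1 h4
    refine le_trans ?_ h5
    have h6 := mul_le_mul (hS.le_partLength R hμ 0) (hS.le_partLength R hμ 1) (by positivity)
      (hp0 0)
    calc c / R ^ 2 * w ^ 2 = c * (w / R * (w / R)) := by ring
      _ ≤ _ := mul_le_mul_of_nonneg_left h6 hc.le
  · have hsub : S.part R μ p ∩ unitSquare ⊆
        {x : Plane | ∀ k, x k ∈ Icc (l k) (S.partUpper R μ p k)} := fun x hx k =>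
      (hS.part_subset_rect hμ hp hx.2 hx.1).2.2 k
    have h3 := measure_mono (μ := (volume : Measure Plane)) hsub
    rw [volume_setOf_forall _ fun _ => measurableSet_Icc, Real.volume_Icc, Real.volume_Icc,
      hlen, hlen, ← ENNReal.ofReal_mul (hp0 0)] at h3
    have h4 := h2.trans (mul_le_mul_right h3 (ENNReal.ofReal C))
    rw [← ENNReal.ofReal_mul hC.le] at h4
    have hpp := mul_nonneg (hp0 0) (hp0 1)
    have h5 := ENNReal.toReal_le_of_le_ofReal (by positivity) h4
    refine h5.trans ?_
    have h6 := mul_le_mul (hS.partLength_le R μ 0) (hS.partLength_le R μ 1) (hp0 1)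
      (by positivity)
    calc C * (S.partLength R μ 0 * S.partLength R μ 1) ≤ C * (κ * w / R * (κ * w / R)) :=
          mul_le_mul_of_nonneg_left h6 hC.le
      _ = _ := by ring

end SplineSpace

open Classical in
/-- If the empirical distribution function is close to the distribution function on the square, then
the empirical frequencies of boxes are close to their probabilities. Corners outside the square,
with a negative coordinate, are harmless, since both functions vanish there. -/
theorem abs_card_sub_le_of_empiricalCDF {n : ℕ} (hn : 0 < n) {X : Fin n → Plane}
    (hX : ∀ i, X i ∈ unitSquare) {ν : Measure Plane} [IsProbabilityMeasure ν]
    (hν : ν unitSquareᶜ = 0) {r : ℝ} (hr : 0 ≤ r)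
    (hcdf : ∀ y ∈ unitSquare, |empiricalCDF X y - planeCDF ν y| ≤ r) {a b : Fin 2 → ℝ}
    (hab : ∀ k, a k ≤ b k) (ha : ∀ k, a k < 0 ∨ a k ∈ Icc (0 : ℝ) 1)
    (hb : ∀ k, b k ∈ Icc (0 : ℝ) 1) :
    |((Finset.univ.filter fun i => X i ∈ halfOpenBox a b).card : ℝ) - n * ν.real (halfOpenBox a b)|
      ≤ n * (4 * r) := by
  have hn' : (0 : ℝ) < n := by exact_mod_cast hn
  -- the counting measure `τ` of the design points has distribution function `n` times the empirical
  -- one, so both measures can be compared at the four corners of the box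
  set τ : Measure Plane := Measure.map X Measure.count with hτ
  have hreal : ∀ A : Set Plane, MeasurableSet A →
      τ.real A = ((Finset.univ.filter fun i => X i ∈ A).card : ℝ) := fun A hA => by
    rw [hτ, measureReal_def, Measure.map_apply (Measurable.of_discrete) hA]
    rw [show X ⁻¹' A = ((Finset.univ.filter fun i => X i ∈ A : Finset (Fin n)) : Set (Fin n)) by
      ext; simp, Measure.count_apply_finset]
    simp
  have : IsFiniteMeasure τ := by rw [hτ]; infer_instance
  have hemp : ∀ x, planeCDF τ x = n * empiricalCDF X x := fun x => by
    have e1 : planeCDF τ x = ((Finset.univ.filter fun i => X i ∈ lowerOrthant x).card : ℝ) :=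
      hreal _ (measurableSet_lowerOrthant x)
    rw [e1, empiricalCDF, mul_div_cancel₀ _ hn'.ne', Nat.card_eq_fintype_card,
      Fintype.card_subtype]
    simp [lowerOrthant]
  have hcorner : ∀ s t : ℝ, (s < 0 ∨ s ∈ Icc (0 : ℝ) 1) → (t < 0 ∨ t ∈ Icc (0 : ℝ) 1) →
      |planeCDF τ !₂[s, t] - n * planeCDF ν !₂[s, t]| ≤ n * r := by
    intro s t hs ht
    by_cases hQ : s ∈ Icc (0 : ℝ) 1 ∧ t ∈ Icc (0 : ℝ) 1
    · have hmem : (!₂[s, t] : Plane) ∈ unitSquare := by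
        intro k
        fin_cases k
        · exact hQ.1
        · exact hQ.2
      rw [hemp, ← mul_sub, abs_mul, abs_of_pos hn']
      exact mul_le_mul_of_nonneg_left (hcdf _ hmem) hn'.le
    · have hsub : lowerOrthant !₂[s, t] ⊆ unitSquareᶜ := by
        intro x hx hxQ
        have h0 := hx 0
        have h1 := hx 1
        simp at h0 h1
        have h2 := (hxQ 0).1
        have h3 := (hxQ 1).1
        rcases hs with hs | hs
        · linarith
        · rcases ht with ht | ht
          · linarith
          · exact hQ ⟨hs, ht⟩
      have e1 : planeCDF ν !₂[s, t] = 0 := by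
        have := measure_mono_null hsub hν
        change ν.real (lowerOrthant _) = 0
        rw [measureReal_def, this, ENNReal.toReal_zero]
      have e2 : planeCDF τ !₂[s, t] = 0 := by
        change τ.real (lowerOrthant _) = 0
        rw [hreal _ (measurableSet_lowerOrthant _), Nat.cast_eq_zero, Finset.card_eq_zero,
          Finset.filter_eq_empty_iff]
        exact fun i _ hi => hsub hi (hX i)
      rw [e1, e2, mul_zero, sub_zero, abs_zero]
      positivity
  rw [← hreal _ (measurableSet_halfOpenBox a b), real_halfOpenBox τ hab, real_halfOpenBox ν hab]
  have c1 := abs_le.1 (hcorner (b 0) (b 1) (Or.inr (hb 0)) (Or.inr (hb 1)))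
  have c2 := abs_le.1 (hcorner (a 0) (b 1) (ha 0) (Or.inr (hb 1)))
  have c3 := abs_le.1 (hcorner (b 0) (a 1) (Or.inr (hb 0)) (ha 1))
  have c4 := abs_le.1 (hcorner (a 0) (a 1) (ha 0) (ha 1))
  rw [abs_le]
  constructor <;> linarith

/-- Chebyshev's inequality for a sum of pairwise independent random variables with a common
mean. -/
theorem measure_le_abs_sum_sub_le {Ω : Type*} [MeasurableSpace Ω] {P : Measure Ω}
    [IsProbabilityMeasure P] {n : ℕ} {Z : Fin n → Ω → ℝ}
    (hind : Pairwise fun i j => IndepFun (Z i) (Z j) P) (hL : ∀ i, MemLp (Z i) 2 P) {a v : ℝ}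
    (ha : ∀ i, ∫ ω, Z i ω ∂P = a) (hv : ∀ i, variance (Z i) P ≤ v) {t : ℝ} (ht : 0 < t) :
    P {ω | t ≤ |∑ i, Z i ω - n * a|} ≤ ENNReal.ofReal (n * v / t ^ 2) := by
  have hsum : MemLp (∑ i, Z i) 2 P := memLp_finsetSum' _ fun i _ => hL i
  have h := meas_ge_le_variance_div_sq hsum ht
  have hint : ∫ ω, (∑ i, Z i) ω ∂P = n * a := by
    simp only [Finset.sum_apply]
    rw [integral_finsetSum _ fun i _ => (hL i).integrable one_le_two]
    simp [ha]
  rw [hint, IndepFun.variance_sum (fun i _ => hL i) fun i _ j _ hij => hind hij] at h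
  simp only [Finset.sum_apply] at h
  refine h.trans (ENNReal.ofReal_le_ofReal (div_le_div_of_nonneg_right ?_ (sq_nonneg t)))
  refine (Finset.sum_le_sum fun i _ => hv i).trans (le_of_eq ?_)
  simp

open Classical in
/-- Chebyshev's inequality for the number of random design points in a set; the variance of an
indicator is at most its mean. -/
theorem measure_le_abs_card_sub_le {Ω : Type*} [MeasurableSpace Ω] {P : Measure Ω}
    [IsProbabilityMeasure P] {n : ℕ} {X : Fin n → Ω → Plane} {ν : Measure Plane}
    (hX : ∀ i, Measurable (X i) ∧ P.map (X i) = ν) (hind : iIndepFun X P) {A : Set Plane}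
    (hA : MeasurableSet A) {t : ℝ} (ht : 0 < t) :
    P {ω | t ≤ |((Finset.univ.filter fun i => X i ω ∈ A).card : ℝ) - n * ν.real A|} ≤
      ENNReal.ofReal (n * ν.real A / t ^ 2) := by
  set φ : Plane → ℝ := A.indicator 1 with hφ
  have hφm : Measurable φ := measurable_const.indicator hA
  have hφ01 : ∀ x, ‖φ x‖ ≤ 1 := fun x => by
    rw [hφ]; by_cases hx : x ∈ A <;> simp [hx]
  have hφ2 : ∀ x, φ x ^ 2 = φ x := fun x => by
    rw [hφ]; by_cases hx : x ∈ A <;> simp [hx]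
  have hmean : ∀ i, ∫ ω, φ (X i ω) ∂P = ν.real A := fun i => by
    rw [← (hX i).2, ← integral_map (hX i).1.aemeasurable hφm.aestronglyMeasurable, hφ,
      integral_indicator_one hA]
  have h := measure_le_abs_sum_sub_le (P := P) (Z := fun i ω => φ (X i ω)) (a := ν.real A)
    (v := ν.real A) (fun i j hij => (hind.indepFun hij).comp hφm hφm)
    (fun i => MemLp.of_bound (hφm.comp (hX i).1).aestronglyMeasurable 1
      (ae_of_all _ fun ω => hφ01 _)) hmean
    (fun i => by
      refine (variance_le_expectation_sq (hφm.comp (hX i).1).aestronglyMeasurable).trans ?_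
      rw [← hmean i]
      refine le_of_eq (integral_congr_ae (ae_of_all _ fun ω => ?_))
      simp [hφ2]) ht
  have e1 : ∀ ω, ((Finset.univ.filter fun i => X i ω ∈ A).card : ℝ) = ∑ i, φ (X i ω) := fun ω => by
    rw [Finset.card_filter]
    push_cast
    refine Finset.sum_congr rfl fun i _ => ?_
    rw [hφ]; by_cases hx : X i ω ∈ A <;> simp [hx]
  simpa only [e1] using h

end DesignCounts

/-! ### Designs are regular with high probability -/

section DesignProbability

theorem tendsto_zero_of_eventually_le {f : ℕ → ℝ≥0∞} {g : ℕ → ℝ} (hfg : ∀ᶠ n in atTop,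
    f n ≤ ENNReal.ofReal (g n)) (hg : Tendsto g atTop (𝓝 0)) : Tendsto f atTop (𝓝 0) := by
  refine tendsto_of_tendsto_of_tendsto_of_le_of_le' tendsto_const_nhds ?_
    (Eventually.of_forall fun _ => zero_le) hfg
  simpa using ENNReal.tendsto_ofReal hg

theorem tendsto_const_div_of_atTop {g : ℕ → ℝ} (hg : Tendsto g atTop atTop) (A : ℝ) :
    Tendsto (fun n => A / g n) atTop (𝓝 0) := hg.const_div_atTop A

/-- Random variables that are bounded by a null sequence on events of probability tending to one
converge to zero in probability. -/
theorem tendstoInMeasure_zero_of_le {Ω : Type*} [MeasurableSpace Ω] {P : Measure Ω}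
    {F : ℕ → Ω → ℝ} {G : ℕ → Set Ω} {τ : ℕ → ℝ}
    (hG : Tendsto (fun n => P (G n)ᶜ) atTop (𝓝 0)) (hτ : Tendsto τ atTop (𝓝 0))
    (hF : ∀ᶠ n in atTop, ∀ ω ∈ G n, |F n ω| ≤ τ n) :
    TendstoInMeasure P F atTop fun _ => 0 := by
  rw [tendstoInMeasure_iff_norm]
  intro e he
  refine tendsto_of_tendsto_of_tendsto_of_le_of_le' tendsto_const_nhds hG
    (.of_forall fun _ => zero_le) ?_
  filter_upwards [hF, hτ.eventually_lt_const he] with n h1 h2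
  refine measure_mono fun ω hω hωG => ?_
  have h3 := h1 ω hωG
  have h4 : e ≤ ‖F n ω - 0‖ := hω
  rw [sub_zero, Real.norm_eq_abs] at h4
  linarith

open Classical in
/-- The counts of a design are of the right order if they deviate little from their expectations. -/
theorem SplineSpace.IsRegularDesign.of_abs_sub_le {S : SplineSpace} {R : ℕ} {ν : Measure Plane}
    {c C w : ℝ} (hc : 0 < c) (hw : 0 < w) {n : ℕ} {X : Fin n → Plane} (hX : ∀ i, X i ∈ unitSquare)
    (hbd : ∀ μ, S.IsCell μ → ∀ p : Fin 2 → ℕ, (∀ k, p k < R) →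
      c * w ^ 2 ≤ ν.real (S.part R μ p) ∧ ν.real (S.part R μ p) ≤ C * w ^ 2)
    (hdev : ∀ μ, S.IsCell μ → ∀ p : Fin 2 → ℕ, (∀ k, p k < R) →
      |((Finset.univ.filter fun i => X i ∈ S.part R μ p).card : ℝ) - n * ν.real (S.part R μ p)| ≤
        c / 2 * (n * w ^ 2)) :
    S.IsRegularDesign R (n * w ^ 2) (2 / c + (C + c) + 1) X := by
  have hn : (0 : ℝ) ≤ n := Nat.cast_nonneg n
  refine ⟨hX, fun μ hμ p hp => ?_, fun μ hμ p hp => ?_⟩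
  · obtain ⟨h1, h2⟩ := hbd μ hμ p hp
    have h3 := abs_le.1 (hdev μ hμ p hp)
    set N : ℝ := ((Finset.univ.filter fun i => X i ∈ S.part R μ p).card : ℝ)
    have h4 := mul_le_mul_of_nonneg_left h1 hn
    have h5 : c / 2 * (n * w ^ 2) ≤ N := by linarith [h3.1]
    have h6 : (n * w ^ 2 : ℝ) ≤ 2 / c * N := by
      rw [div_mul_eq_mul_div, le_div_iff₀ hc]; linarith
    have hN : 0 ≤ N := Nat.cast_nonneg _
    have hw2 : 0 < w ^ 2 := by positivity
    have h7 : 0 ≤ C + c := by nlinarith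
    nlinarith
  · obtain ⟨h1, h2⟩ := hbd μ hμ p hp
    have h3 := abs_le.1 (hdev μ hμ p hp)
    have h4 := mul_le_mul_of_nonneg_left h2 hn
    have h5 : 0 ≤ n * w ^ 2 := by positivity
    have h6 : 0 ≤ 2 / c * (n * w ^ 2) := by positivity
    nlinarith [h3.2]

variable {Ω : Type*} [MeasurableSpace Ω] {P : Measure Ω} [IsProbabilityMeasure P]
  {ν : Measure Plane} {S : ℕ → SplineSpace} {w : ℕ → ℝ} {κ D : ℝ} {R : ℕ}
  {X : (n : ℕ) → Fin n → Ω → Plane} {ε : (n : ℕ) → Fin n → Ω → ℝ}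

/-- The design is regular with probability tending to one. For the fixed design this is eventually
certain, because the deviation of the distribution functions is small compared with the measure of
a part; for the random design there are of the order `w⁻²` parts, and for each of them Chebyshev's
inequality bounds the probability of a large deviation by a multiple of `1 / (n w²)`. -/
theorem tendsto_measure_not_isRegularDesign (hν : HasPositiveContinuousDensity ν) (hκ : 0 < κ)
    (hR : 0 < R) (hD : 0 < D) (hmesh : ∀ᶠ n in atTop, (S n).IsMesh (w n) κ)
    (hJ : ∀ᶠ n in atTop, ∀ k, ((S n).J k : ℝ) * w n ≤ D)
    (hJ' : ∀ᶠ n in atTop, ∀ k, 1 ≤ D * (((S n).J k : ℝ) * w n))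
    (hlim : Tendsto (fun n : ℕ => n * w n ^ 4) atTop atTop)
    (hX : IsFixedDesign ν S X ∨ IsRandomDesign P ν X ε) : ∃ C : ℝ, 1 ≤ C ∧
      Tendsto (fun n : ℕ => P {ω | ¬ (S n).IsRegularDesign R (n * w n ^ 2) C (fun i => X n i ω)})
        atTop (𝓝 0) := by
  classical
  obtain ⟨c, hc, C, hC, hbd⟩ := SplineSpace.exists_part_measure_bounds hν hR hκ
  have := hν.1
  refine ⟨2 / c + (C + c) + 1, by
    have : 0 < 2 / c := by positivity
    linarith, ?_⟩
  rcases hX with ⟨x, hxX, hxQ, hcdf⟩ | hX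
  -- the deviation of a count is at most `4 r n` with `r = c / (8 D² J₀ J₁) ≤ c w² / 8`
  · have hr : 0 < c / (8 * D ^ 2) := by positivity
    refine tendsto_const_nhds.congr' ?_
    filter_upwards [hmesh, hJ', hcdf _ hr, eventually_gt_atTop 0] with n h1 h2 h3 hn
    symm
    rw [show {ω | ¬ (S n).IsRegularDesign R (n * w n ^ 2) (2 / c + (C + c) + 1)
      (fun i => X n i ω)} = ∅ from ?_, measure_empty]
    refine Set.eq_empty_iff_forall_notMem.2 fun ω hω => hω ?_
    have e1 : (fun i => X n i ω) = x n := funext fun i => hxX n i ω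
    rw [e1]
    have hw := h1.pos
    refine SplineSpace.IsRegularDesign.of_abs_sub_le hc hw (hxQ n) (hbd _ _ h1) fun μ hμ p hp => ?_
    have hJp : ∀ k, (0 : ℝ) < (S n).J k := fun k => by
      have := h1.four_le k
      have h4 : 0 < (S n).J k := by rw [SplineSpace.J]; omega
      exact_mod_cast h4
    have hJ0 := hJp 0
    have hJ1 := hJp 1
    have hl := h1.partLower_le R hμ p
    have hu0 : ∀ k, 0 ≤ (S n).knot k (μ k) + p k * (S n).partLength R μ k := fun k => by
      have h3 := (h1.knots k).nonneg (μ k)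
      have h4 : 0 ≤ (S n).partLength R μ k :=
        (div_nonneg hw.le (Nat.cast_nonneg _)).trans (h1.le_partLength R hμ k)
      positivity
    have hu1 : ∀ k, (S n).partUpper R μ p k ≤ 1 := fun k =>
      (h1.partUpper_le hμ (hp k)).trans ((h1.knots k).le_one _)
    have h5 := abs_card_sub_le_of_empiricalCDF hn (hxQ n) hν.measure_compl
      (by positivity : 0 ≤ c / (8 * D ^ 2) / ((S n).J 0 * (S n).J 1)) h3
      (a := (S n).partLower R μ p) (b := (S n).partUpper R μ p)
      (fun k => (hl k).1.trans (hl k).2) (fun k => ?_)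
      (fun k => ⟨(hu0 k).trans (hl k).2, hu1 k⟩)
    · refine h5.trans ?_
      have h6 : 1 ≤ D ^ 2 * ((S n).J 0 * (S n).J 1) * w n ^ 2 := by
        calc (1 : ℝ) ≤ (D * ((S n).J 0 * w n)) * (D * ((S n).J 1 * w n)) :=
              one_le_mul_of_one_le_of_one_le (h2 0) (h2 1)
          _ = _ := by ring
      have h7 : 4 * (c / (8 * D ^ 2) / ((S n).J 0 * (S n).J 1)) ≤ c / 2 * w n ^ 2 := by
        rw [div_div, ← mul_div_assoc, div_le_iff₀ (by positivity)]
        nlinarith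
      calc (n : ℝ) * (4 * (c / (8 * D ^ 2) / ((S n).J 0 * (S n).J 1)))
          ≤ n * (c / 2 * w n ^ 2) := mul_le_mul_of_nonneg_left h7 (Nat.cast_nonneg _)
        _ = _ := by ring
    · by_cases hcond : μ k = (S n).q k - 1 ∧ p k = 0
      · left; rw [SplineSpace.partLower, if_pos hcond]; norm_num
      · right
        rw [SplineSpace.partLower, if_neg hcond]
        exact ⟨hu0 k, (hl k).2.trans (hu1 k)⟩
  · -- a union bound over the parts of the knot rectangles
    refine tendsto_zero_of_eventually_le (g := fun n : ℕ =>
      (D ^ 2 * R ^ 2 * (4 * C / c ^ 2)) / (n * w n ^ 4)) ?_ (tendsto_const_div_of_atTop hlim _)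
    filter_upwards [hmesh, hJ, eventually_gt_atTop 0] with n h1 h2 hn
    have hn' : (0 : ℝ) < n := by exact_mod_cast hn
    have hw := h1.pos
    obtain ⟨hXn, hind, -⟩ := hX n
    set T : Finset ((Fin 2 → ℕ) × (Fin 2 → ℕ)) :=
      (Fintype.piFinset fun k => Finset.Icc ((S n).q k - 1) ((S n).q k - 1 + (S n).N k)) ×ˢ
        (Fintype.piFinset fun _ => Finset.range R) with hT
    set t : ℝ := c / 2 * (n * w n ^ 2) with ht
    have ht0 : 0 < t := by positivity
    have hsub : {ω | ¬ (S n).IsRegularDesign R (n * w n ^ 2) (2 / c + (C + c) + 1)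
        (fun i => X n i ω)} ⊆ (⋃ i, X n i ⁻¹' unitSquareᶜ) ∪ ⋃ a ∈ T,
          {ω | t ≤ |((Finset.univ.filter fun i => X n i ω ∈ (S n).part R a.1 a.2).card : ℝ) -
            n * ν.real ((S n).part R a.1 a.2)|} := by
      intro ω hω
      by_contra hcon
      simp only [Set.mem_union, not_or, Set.mem_iUnion, not_exists, Set.mem_preimage,
        Set.mem_compl_iff, not_not, Set.mem_ofPred_eq, not_le] at hcon
      refine hω (SplineSpace.IsRegularDesign.of_abs_sub_le hc hw hcon.1 (hbd _ _ h1)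
        fun μ hμ p hp => (hcon.2 (μ, p) ?_).le)
      rw [hT, Finset.mem_product, Fintype.mem_piFinset, Fintype.mem_piFinset]
      exact ⟨fun k => Finset.mem_Icc.2 (hμ k), fun k => Finset.mem_range.2 (hp k)⟩
    have hout : P (⋃ i, X n i ⁻¹' unitSquareᶜ) = 0 := by
      refine measure_iUnion_null fun i => ?_
      rw [← Measure.map_apply (hXn i).1 measurableSet_unitSquare.compl, (hXn i).2]
      exact hν.measure_compl
    have hTc : (T.card : ℝ) ≤ (D / w n) ^ 2 * R ^ 2 := by
      have e1 : T.card = ((S n).N 0 + 1) * ((S n).N 1 + 1) * (R * R) := by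
        rw [hT, Finset.card_product, Fintype.card_piFinset, Fintype.card_piFinset]
        simp only [Fin.prod_univ_two, Nat.card_Icc, Finset.card_range]
        congr 2 <;> omega
      have e2 : ∀ k, (((S n).N k + 1 : ℕ) : ℝ) ≤ D / w n := fun k => by
        rw [le_div_iff₀ hw]
        refine le_trans ?_ (h2 k)
        have := h1.four_le k
        have h4 : (S n).N k + 1 ≤ (S n).J k := by rw [SplineSpace.J]; omega
        have h5 : (((S n).N k + 1 : ℕ) : ℝ) ≤ (S n).J k := by exact_mod_cast h4
        exact mul_le_mul_of_nonneg_right h5 hw.le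
      rw [e1, Nat.cast_mul, Nat.cast_mul, Nat.cast_mul, sq, sq]
      exact mul_le_mul_of_nonneg_right
        (mul_le_mul (e2 0) (e2 1) (Nat.cast_nonneg _) (by positivity)) (by positivity)
    calc P _ ≤ P ((⋃ i, X n i ⁻¹' unitSquareᶜ) ∪ ⋃ a ∈ T,
          {ω | t ≤ |((Finset.univ.filter fun i => X n i ω ∈ (S n).part R a.1 a.2).card : ℝ) -
            n * ν.real ((S n).part R a.1 a.2)|}) := measure_mono hsub
      _ ≤ 0 + ∑ a ∈ T, P {ω | t ≤ |((Finset.univ.filter fun i =>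
            X n i ω ∈ (S n).part R a.1 a.2).card : ℝ) - n * ν.real ((S n).part R a.1 a.2)|} := by
          refine (measure_union_le _ _).trans (add_le_add hout.le (measure_biUnion_finset_le _ _))
      _ ≤ ∑ _a ∈ T, ENNReal.ofReal (n * (C * w n ^ 2) / t ^ 2) := by
          rw [zero_add]
          refine Finset.sum_le_sum fun a ha => ?_
          rw [hT, Finset.mem_product, Fintype.mem_piFinset, Fintype.mem_piFinset] at ha
          refine (measure_le_abs_card_sub_le hXn hind (measurableSet_halfOpenBox _ _) ht0).trans
            (ENNReal.ofReal_le_ofReal ?_)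
          have := (hbd _ _ h1 a.1 (fun k => Finset.mem_Icc.1 (ha.1 k)) a.2
            fun k => Finset.mem_range.1 (ha.2 k)).2
          exact div_le_div_of_nonneg_right (mul_le_mul_of_nonneg_left this hn'.le) (sq_nonneg t)
      _ = ENNReal.ofReal (T.card * (n * (C * w n ^ 2) / t ^ 2)) := by
          rw [Finset.sum_const, nsmul_eq_mul, ENNReal.ofReal_mul (Nat.cast_nonneg _),
            ENNReal.ofReal_natCast]
      _ ≤ _ := by
          refine ENNReal.ofReal_le_ofReal ?_
          refine (mul_le_mul_of_nonneg_right hTc (by positivity)).trans (le_of_eq ?_)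
          rw [ht]
          field_simp
          ring

end DesignProbability

/-! ### Noise and Gaussian tails -/

section Noise

variable {Ω : Type*} [MeasurableSpace Ω] {P : Measure Ω}

theorem hasSubgaussianMGF_mono {Z : Ω → ℝ} {c c' : ℝ≥0} (h : HasSubgaussianMGF Z c P)
    (hc : c ≤ c') : HasSubgaussianMGF Z c' P where
  integrable_exp_mul := h.integrable_exp_mul
  mgf_le t := (h.mgf_le t).trans (Real.exp_le_exp.2 (by
    have : (c : ℝ) ≤ c' := hc
    gcongr))

theorem measure_le_abs_le_of_hasSubgaussianMGF [IsProbabilityMeasure P] {Z : Ω → ℝ} {c : ℝ≥0}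
    (h : HasSubgaussianMGF Z c P) {t : ℝ} (ht : 0 ≤ t) :
    P {ω | t ≤ |Z ω|} ≤ ENNReal.ofReal (2 * Real.exp (-t ^ 2 / (2 * c))) := by
  have h1 := h.measure_ge_le ht
  have h2 := h.neg.measure_ge_le ht
  have hsub : {ω | t ≤ |Z ω|} ⊆ {ω | t ≤ Z ω} ∪ {ω | t ≤ (-Z) ω} := fun ω hω => by
    rcases le_abs.1 (show t ≤ |Z ω| from hω) with h3 | h3
    · exact Or.inl h3
    · exact Or.inr h3
  rw [← ofReal_measureReal]
  refine ENNReal.ofReal_le_ofReal ?_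
  refine (measureReal_mono hsub).trans ((measureReal_union_le _ _).trans ?_)
  linarith

theorem hasSubgaussianMGF_sum_mul {n : ℕ} {e : Fin n → Ω → ℝ} (he : iIndepFun e P) {c : ℝ≥0}
    (hsub : ∀ i, HasSubgaussianMGF (e i) c P) {V : ℝ≥0} {g : Fin n → ℝ} (hg : ∑ i, g i ^ 2 ≤ V) :
    HasSubgaussianMGF (fun ω => ∑ i, g i * e i ω) (V * c) P := by
  have h := HasSubgaussianMGF.sum_of_iIndepFun (X := fun i ω => g i * e i ω)
    (c := fun i => ⟨g i ^ 2, sq_nonneg (g i)⟩ * c) (s := Finset.univ)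
    (he.comp (fun i x => g i * x) fun i => measurable_const.mul measurable_id)
    fun i _ => (hsub i).const_mul (g i)
  refine hasSubgaussianMGF_mono h ?_
  rw [← NNReal.coe_le_coe, NNReal.coe_sum, NNReal.coe_mul]
  refine le_trans (le_of_eq ?_) (mul_le_mul_of_nonneg_right hg c.coe_nonneg)
  rw [Finset.sum_mul]
  rfl

/-- Maximal inequality for linear forms in sub-Gaussian errors whose coefficients depend on an
independent design. -/
theorem measure_exists_noise_le [IsProbabilityMeasure P] {n : ℕ} {X : Fin n → Ω → Plane}
    {e : Fin n → Ω → ℝ} (hX : ∀ i, Measurable (X i)) (hem : ∀ i, Measurable (e i))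
    (hXe : IndepFun (fun ω i => X i ω) (fun ω i => e i ω) P) (he : iIndepFun e P) {c : ℝ≥0}
    (hsub : ∀ i, HasSubgaussianMGF (e i) c P) {𝒥 : Type*} [Fintype 𝒥]
    {g : 𝒥 → Fin n → (Fin n → Plane) → ℝ} (hg : ∀ j i, Measurable (g j i)) (V : ℝ≥0) {t : ℝ}
    (ht : 0 ≤ t) :
    P {ω | ∃ j, ∑ i, g j i (fun i => X i ω) ^ 2 ≤ V ∧
        t ≤ |∑ i, g j i (fun i => X i ω) * e i ω|} ≤
      ENNReal.ofReal (Fintype.card 𝒥 * (2 * Real.exp (-t ^ 2 / (2 * (V * c : ℝ≥0))))) := by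
  have hXm : Measurable fun ω i => X i ω := measurable_pi_lambda _ hX
  have hEm : Measurable fun ω i => e i ω := measurable_pi_lambda _ hem
  have hlaw := hXe.map_prod_eq_prod_map_map hXm.aemeasurable hEm.aemeasurable
  have hP1 : IsProbabilityMeasure (P.map fun ω i => X i ω) :=
    Measure.isProbabilityMeasure_map hXm.aemeasurable
  have hP2 : IsProbabilityMeasure (P.map fun ω i => e i ω) :=
    Measure.isProbabilityMeasure_map hEm.aemeasurable
  have hone : ∀ j, P {ω | ∑ i, g j i (fun i => X i ω) ^ 2 ≤ V ∧
      t ≤ |∑ i, g j i (fun i => X i ω) * e i ω|} ≤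
        ENNReal.ofReal (2 * Real.exp (-t ^ 2 / (2 * (V * c : ℝ≥0)))) := by
    intro j
    set A : Set ((Fin n → Plane) × (Fin n → ℝ)) :=
      {p | ∑ i, g j i p.1 ^ 2 ≤ V ∧ t ≤ |∑ i, g j i p.1 * p.2 i|} with hA
    have hAm : MeasurableSet A := by
      have hm : ∀ i, Measurable fun p : (Fin n → Plane) × (Fin n → ℝ) => g j i p.1 := fun i =>
        (hg j i).comp measurable_fst
      have hm2 : ∀ i, Measurable fun p : (Fin n → Plane) × (Fin n → ℝ) => p.2 i := fun i =>
        (measurable_pi_apply i).comp measurable_snd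
      refine MeasurableSet.inter ?_ ?_
      · exact measurableSet_le (Finset.measurable_sum _ fun i _ => (hm i).pow_const 2)
          measurable_const
      · exact measurableSet_le measurable_const
          (continuous_abs.measurable.comp (Finset.measurable_sum _ fun i _ => (hm i).mul (hm2 i)))
    have h1 : P {ω | ∑ i, g j i (fun i => X i ω) ^ 2 ≤ V ∧
        t ≤ |∑ i, g j i (fun i => X i ω) * e i ω|} =
        (P.map fun ω => ((fun i => X i ω), fun i => e i ω)) A := by
      rw [Measure.map_apply (hXm.prodMk hEm) hAm]
      rfl
    -- for a fixed design the linear form is sub-Gaussian with constant at most `V c`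
    rw [h1, hlaw, Measure.prod_apply hAm]
    refine (lintegral_mono (g := fun _ => ENNReal.ofReal (2 * Real.exp (-t ^ 2 /
      (2 * (V * c : ℝ≥0))))) fun x => ?_).trans (by simp)
    rw [Measure.map_apply hEm (measurable_prodMk_left hAm)]
    by_cases hx : ∑ i, g j i x ^ 2 ≤ V
    · refine (measure_mono fun ω hω => ?_).trans (measure_le_abs_le_of_hasSubgaussianMGF
        (hasSubgaussianMGF_sum_mul he hsub hx) ht)
      exact hω.2
    · refine (measure_mono (t := ∅) fun ω hω => ?_).trans (by simp)
      exact hx hω.1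
  calc P _ ≤ P (⋃ j, {ω | ∑ i, g j i (fun i => X i ω) ^ 2 ≤ V ∧
        t ≤ |∑ i, g j i (fun i => X i ω) * e i ω|}) := measure_mono fun ω hω => by
          obtain ⟨j, hj⟩ := hω
          exact Set.mem_iUnion.2 ⟨j, hj⟩
    _ ≤ ∑ j, P {ω | ∑ i, g j i (fun i => X i ω) ^ 2 ≤ V ∧
        t ≤ |∑ i, g j i (fun i => X i ω) * e i ω|} := measure_iUnion_fintype_le _ _
    _ ≤ ∑ _j : 𝒥, ENNReal.ofReal (2 * Real.exp (-t ^ 2 / (2 * (V * c : ℝ≥0)))) :=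
        Finset.sum_le_sum fun j _ => hone j
    _ = _ := by
        rw [Finset.sum_const, nsmul_eq_mul, Finset.card_univ,
          ENNReal.ofReal_mul (p := (Fintype.card 𝒥 : ℝ)) (Nat.cast_nonneg _),
          ENNReal.ofReal_natCast]

theorem hasSubgaussianMGF_gaussianReal (v : ℝ≥0) :
    HasSubgaussianMGF id v (gaussianReal 0 v) where
  integrable_exp_mul t := integrable_exp_mul_gaussianReal t
  mgf_le t := by rw [mgf_id_gaussianReal]; simp

/-- Maximal inequality for the coordinates of a Gaussian vector. -/
theorem multivariateGaussian_exists_le {𝒥 : Type*} [Fintype 𝒥] [DecidableEq 𝒥]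
    (a : EuclideanSpace ℝ 𝒥) {Γ : Matrix 𝒥 𝒥 ℝ} (hΓ : Γ.PosSemidef) {v : ℝ≥0}
    (hv : ∀ j, Γ j j ≤ v) {t : ℝ} (ht : 0 ≤ t) :
    multivariateGaussian a Γ {θ | ∃ j, t ≤ |θ j - a j|} ≤
      ENNReal.ofReal (Fintype.card 𝒥 * (2 * Real.exp (-t ^ 2 / (2 * v)))) := by
  have hone : ∀ j, multivariateGaussian a Γ {θ | t ≤ |θ j - a j|} ≤
      ENNReal.ofReal (2 * Real.exp (-t ^ 2 / (2 * v))) := fun j => by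
    have hmp := measurePreserving_eval_multivariateGaussian (μ := a) hΓ (i := j)
    have hm : MeasurableSet {x : ℝ | t ≤ |x - a j|} :=
      measurableSet_le measurable_const
        (continuous_abs.measurable.comp (measurable_id.sub measurable_const))
    have h1 := hmp.measure_preimage hm.nullMeasurableSet
    have h2 : HasSubgaussianMGF (fun x => x - a j) (Γ j j).toNNReal
        (gaussianReal (a j) (Γ j j).toNNReal) := by
      rw [← HasSubgaussianMGF.id_map_iff (by fun_prop), gaussianReal_map_sub_const, sub_self]
      exact hasSubgaussianMGF_gaussianReal _
    have h3 := measure_le_abs_le_of_hasSubgaussianMGF (hasSubgaussianMGF_mono h2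
      (Real.toNNReal_le_iff_le_coe.2 (hv j))) ht
    rw [← h1] at h3
    exact h3
  calc _ ≤ multivariateGaussian a Γ (⋃ j, {θ | t ≤ |θ j - a j|}) := measure_mono fun θ hθ => by
          obtain ⟨j, hj⟩ := hθ
          exact Set.mem_iUnion.2 ⟨j, hj⟩
    _ ≤ ∑ j, multivariateGaussian a Γ {θ | t ≤ |θ j - a j|} := measure_iUnion_fintype_le _ _
    _ ≤ ∑ _j : 𝒥, ENNReal.ofReal (2 * Real.exp (-t ^ 2 / (2 * v))) :=
        Finset.sum_le_sum fun j _ => hone j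
    _ = _ := by
        rw [Finset.sum_const, nsmul_eq_mul, Finset.card_univ,
          ENNReal.ofReal_mul (p := (Fintype.card 𝒥 : ℝ)) (Nat.cast_nonneg _),
          ENNReal.ofReal_natCast]

theorem measurable_bsplineDeg (τ : ℕ → ℝ) : ∀ k j, Measurable (bsplineDeg τ k j)
  | 0, j => by
      rw [show bsplineDeg τ 0 j = fun x => if (τ j ≤ x ∧ x < τ (j + 1)) ∨
        (x = 1 ∧ τ j < 1 ∧ τ (j + 1) = 1) then 1 else 0 from funext fun x => by
          simp only [bsplineDeg]]
      refine Measurable.ite ?_ measurable_const measurable_const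
      have h1 : MeasurableSet {x : ℝ | τ j ≤ x ∧ x < τ (j + 1)} := measurableSet_Ico
      have h2 : MeasurableSet {x : ℝ | x = 1 ∧ τ j < 1 ∧ τ (j + 1) = 1} :=
        (measurableSet_singleton (1 : ℝ)).inter (MeasurableSet.const _)
      exact h1.union h2
  | k + 1, j => by
      rw [show bsplineDeg τ (k + 1) j = fun x =>
        (x - τ j) / (τ (j + k + 1) - τ j) * bsplineDeg τ k j x +
        (τ (j + k + 2) - x) / (τ (j + k + 2) - τ (j + 1)) * bsplineDeg τ k (j + 1) x from
          funext fun x => by simp only [bsplineDeg]]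
      exact (((measurable_id.sub_const _).div_const _).mul (measurable_bsplineDeg τ k j)).add
        (((measurable_const.sub measurable_id).div_const _).mul
          (measurable_bsplineDeg τ k (j + 1)))

theorem measurable_basis (S : SplineSpace) (j : S.Idx) : Measurable (S.basis j) := by
  have h : ∀ k : Fin 2, Measurable fun x : Plane => x k := fun k =>
    (EuclideanSpace.proj (𝕜 := ℝ) k : Plane →L[ℝ] ℝ).continuous.measurable
  exact ((measurable_bsplineDeg _ _ _).comp (h 0)).mul ((measurable_bsplineDeg _ _ _).comp (h 1))

theorem measurable_det {β 𝒥 : Type*} [MeasurableSpace β] [Fintype 𝒥] [DecidableEq 𝒥]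
    {M : β → Matrix 𝒥 𝒥 ℝ} (hM : ∀ i j, Measurable fun x => M x i j) :
    Measurable fun x => (M x).det := by
  simp only [Matrix.det_apply]
  exact Finset.measurable_sum _ fun σ _ =>
    (Finset.measurable_prod _ fun i _ => hM _ _).const_smul (Equiv.Perm.sign σ)

theorem measurable_inv_apply {β 𝒥 : Type*} [MeasurableSpace β] [Fintype 𝒥] [DecidableEq 𝒥]
    {M : β → Matrix 𝒥 𝒥 ℝ} (hM : ∀ i j, Measurable fun x => M x i j) (i j : 𝒥) :
    Measurable fun x => (M x)⁻¹ i j := by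
  simp only [Matrix.inv_def, Ring.inverse_eq_inv', Matrix.smul_apply, smul_eq_mul,
    Matrix.adjugate_apply]
  refine (measurable_det hM).inv.mul (measurable_det fun k l => ?_)
  simp only [Matrix.updateRow_apply]
  split_ifs
  · exact measurable_const
  · exact hM k l

/-- The coefficients of the noise in the posterior mean are measurable functions of the design, the
matrix inverse being a rational function of the entries (with the value zero for singular
matrices). -/
theorem measurable_noise_coefficient (S : SplineSpace) (Λ : Matrix S.Idx S.Idx ℝ) {n : ℕ}
    (i : Fin n) (j : S.Idx) :
    Measurable fun x : Fin n → Plane => (S.design x * postCov S Λ x) i j := by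
  have hB : ∀ i j, Measurable fun x : Fin n → Plane => S.design x i j := fun i j =>
    (measurable_basis S j).comp (measurable_pi_apply i)
  simp only [Matrix.mul_apply]
  refine Finset.measurable_sum _ fun k _ => (hB i k).mul (measurable_inv_apply (fun a b => ?_) k j)
  simp only [Matrix.add_apply, Matrix.mul_apply, Matrix.transpose_apply]
  exact (Finset.measurable_sum _ fun l _ => (hB l a).mul (hB l b)).add measurable_const

/-- The mean square of the errors is bounded with high probability. -/
theorem IsErrorArray.tendsto_measure_sum_sq [IsProbabilityMeasure P] {σ₀ : ℝ}
    {ε : (n : ℕ) → Fin n → Ω → ℝ} (hε : IsErrorArray P σ₀ ε) :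
    Tendsto (fun n : ℕ => P {ω | n * (σ₀ ^ 2 + 1) ≤ ∑ i, ε n i ω ^ 2}) atTop (𝓝 0) := by
  obtain ⟨c, hc⟩ := hε.subgaussian
  set v : ℝ := variance (fun ω => ε 1 0 ω ^ 2) P with hv
  refine tendsto_zero_of_eventually_le (g := fun n : ℕ => v / n) ?_
    (tendsto_const_div_of_atTop tendsto_natCast_atTop_atTop v)
  filter_upwards [eventually_gt_atTop 0] with n hn
  have hn' : (0 : ℝ) < n := by exact_mod_cast hn
  have hsq : Measurable fun x : ℝ => x ^ 2 := measurable_id.pow_const 2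
  have hL : ∀ i, MemLp (fun ω => ε n i ω ^ 2) 2 P := fun i => by
    have h4 := (hc n i).memLp 4
    have := h4.norm_rpow_div (p := (4 : ℝ≥0)) (q := 2)
    have e1 : (((4 : ℝ≥0) : ℝ≥0∞) / 2) = 2 := by
      rw [show (((4 : ℝ≥0) : ℝ≥0∞)) = 2 * 2 by norm_num,
        ENNReal.mul_div_cancel_right (by norm_num) (by norm_num)]
    rw [e1] at this
    refine this.congr_norm ((hε.measurable n i).pow_const 2).aestronglyMeasurable
      (ae_of_all _ fun ω => ?_)
    simp
  have hmean : ∀ i, ∫ ω, ε n i ω ^ 2 ∂P = σ₀ ^ 2 := fun i => by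
    rw [← hε.variance_eq n i, variance_of_integral_eq_zero (hε.measurable n i).aemeasurable
      (hε.mean_zero n i)]
  have h := measure_le_abs_sum_sub_le (P := P) (Z := fun i ω => ε n i ω ^ 2) (a := σ₀ ^ 2)
    (v := v) (fun i j hij => ((hε.indep n).indepFun hij).comp hsq hsq) hL hmean
    (fun i => ((hε.identDistrib n i 1 0).comp hsq).variance_eq.le) hn'
  refine (measure_mono fun ω hω => ?_).trans (h.trans (ENNReal.ofReal_le_ofReal (le_of_eq ?_)))
  · have hω' : n * (σ₀ ^ 2 + 1) ≤ ∑ i, ε n i ω ^ 2 := hω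
    change (n : ℝ) ≤ |∑ i, ε n i ω ^ 2 - n * σ₀ ^ 2|
    exact le_trans (by linarith) (le_abs_self _)
  · field_simp

end Noise

/-! ### Mesh widths and rates -/

section Scale

theorem IsKnots.one_le {N : ℕ} {t : ℕ → ℝ} {C : ℝ} (h : IsKnots N t C) : 1 ≤ C := by
  have h1 := h.lt_succ 0 (Nat.zero_le _)
  have h2 := h.quasiUniform 0 (Nat.zero_le _) 0 (Nat.zero_le _)
  by_contra hC
  nlinarith

/-- Quasi-uniform spacings are of the order of one over their number. -/
theorem IsKnots.spacing {N : ℕ} {t : ℕ → ℝ} {C : ℝ} (h : IsKnots N t C) {l : ℕ} (hl : l ≤ N) :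
    1 ≤ C * ((N + 1) * (t (l + 1) - t l)) ∧ (N + 1) * (t (l + 1) - t l) ≤ C := by
  have hsum : ∑ m ∈ Finset.range (N + 1), (t (m + 1) - t m) = 1 := by
    rw [Finset.sum_range_sub, h.first, h.last, sub_zero]
  constructor
  · calc (1 : ℝ) = ∑ m ∈ Finset.range (N + 1), (t (m + 1) - t m) := hsum.symm
      _ ≤ ∑ _m ∈ Finset.range (N + 1), C * (t (l + 1) - t l) :=
          Finset.sum_le_sum fun m hm =>
            h.quasiUniform m (Nat.lt_succ_iff.1 (Finset.mem_range.1 hm)) l hl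
      _ = _ := by simp; ring
  · calc (N + 1) * (t (l + 1) - t l) = ∑ _m ∈ Finset.range (N + 1), (t (l + 1) - t l) := by
          rw [Finset.sum_const, Finset.card_range, nsmul_eq_mul]; push_cast; ring
      _ ≤ ∑ m ∈ Finset.range (N + 1), C * (t (m + 1) - t m) :=
          Finset.sum_le_sum fun m hm =>
            h.quasiUniform l hl m (Nat.lt_succ_iff.1 (Finset.mem_range.1 hm))
      _ = C := by rw [← Finset.mul_sum, hsum, mul_one]

theorem IsKnots.isKnotSeq {N : ℕ} {t : ℕ → ℝ} {C : ℝ} (h : IsKnots N t C) (q : ℕ) :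
    IsKnotSeq (q - 1) N (extKnots q N t) := by
  refine ⟨monotone_nat_of_le_succ fun m => ?_, fun m hm => ?_, fun m hm => ?_, fun m h1 h2 => ?_⟩
  · simp only [extKnots]
    by_cases hm : m < q - 1
    · rw [show m + 1 - (q - 1) = 0 by omega, show m - (q - 1) = 0 by omega]
    by_cases hm' : m - (q - 1) ≤ N
    · rw [min_eq_left (by omega), min_eq_left (by omega),
        show m + 1 - (q - 1) = m - (q - 1) + 1 by omega]
      exact (h.lt_succ _ hm').le
    · rw [min_eq_right (by omega), min_eq_right (by omega)]
  · rw [extKnots, show m - (q - 1) = 0 by omega, Nat.zero_min, h.first]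
  · rw [extKnots, min_eq_right (by omega), h.last]
  · simp only [extKnots]
    rw [min_eq_left (by omega), min_eq_left (by omega),
      show m + 1 - (q - 1) = m - (q - 1) + 1 by omega]
    exact h.lt_succ _ (by omega)

/-- The mesh widths `w n` are of the order prescribed for the numbers of basis functions, up to the
constants `κ` and `D`: the consequences of `w ≍ 1 / J ≍ (n / log n) ^ (-1 / (2 (α + 1)))` that the
argument needs. The order of the number of data points per basis function is `n w ^ 2`, and
`n w ^ (2 α + 2) ≍ log n` balances the noise and the approximation error. -/
structure IsScale (α : ℝ) (S : ℕ → SplineSpace) (w : ℕ → ℝ) (κ D : ℝ) : Prop where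
  mesh : ∀ᶠ n in atTop, (S n).IsMesh (w n) κ
  le_one : ∀ᶠ n in atTop, w n ≤ 1
  J_le : ∀ᶠ n in atTop, ∀ k, ((S n).J k : ℝ) * w n ≤ D
  le_J : ∀ᶠ n in atTop, ∀ k, 1 ≤ D * (((S n).J k : ℝ) * w n)
  tendsto : Tendsto (fun n : ℕ => n * w n ^ 4) atTop atTop
  one_le : ∀ᶠ n : ℕ in atTop, 1 ≤ w n ^ α * (n * w n ^ 3)
  log_le : ∀ᶠ n : ℕ in atTop, Real.log n ≤ D * (n * w n ^ (2 * α + 2))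
  le_rate : ∀ᶠ n in atTop, w n ^ (α - 2) ≤ D * rate α n

theorem tendsto_div_log : Tendsto (fun n : ℕ => (n : ℝ) / Real.log n) atTop atTop := by
  have h1 : Tendsto (fun x : ℝ => Real.log x / x) atTop (𝓝[>] 0) := by
    refine tendsto_nhdsWithin_iff.2 ⟨Real.isLittleO_log_id_atTop.tendsto_div_nhds_zero, ?_⟩
    filter_upwards [eventually_gt_atTop 1] with x hx
    exact div_pos (Real.log_pos hx) (by linarith)
  have h2 := h1.inv_tendsto_nhdsGT_zero.comp tendsto_natCast_atTop_atTop
  refine h2.congr fun n => ?_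
  simp

theorem tendsto_rate {α : ℝ} (hα : 4 ≤ α) : Tendsto (rate α) atTop (𝓝[>] 0) := by
  refine tendsto_nhdsWithin_iff.2 ⟨?_, ?_⟩
  · have h := (tendsto_rpow_neg_atTop (y := (α - 2) / (2 * (α + 1)))
      (div_pos (by linarith) (by linarith))).comp tendsto_div_log
    refine h.congr fun n => ?_
    simp only [Function.comp, rate]
    congr 1
    ring
  · filter_upwards [tendsto_div_log.eventually_gt_atTop 0] with n hn
    exact Real.rpow_pos_of_pos hn _

/-- Quasi-uniform knots in the prescribed numbers have mesh widths of the right order: the width is a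
small multiple of `1 / ρ`, for the common order `ρ` of the numbers of basis functions. -/
theorem exists_isScale {α : ℝ} (hα : 4 ≤ α) {q : Fin 2 → ℕ} (hq : ∀ k, α ≤ q k)
    {S : ℕ → SplineSpace} (hSq : ∀ n, (S n).q = q) {C : ℝ}
    (hknots : ∀ n k, IsKnots ((S n).N k) ((S n).t k) C)
    (hJ : ∀ k, (fun n => ((S n).J k : ℝ)) =Θ[atTop]
      (fun n : ℕ => ((n : ℝ) / Real.log n) ^ (1 / (2 * (α + 1))))) :
    ∃ (w : ℕ → ℝ) (κ D : ℝ), 0 < κ ∧ 0 < D ∧ IsScale α S w κ D := by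
  have hC := (hknots 0 0).one_le
  have hC0 : 0 < C := zero_lt_one.trans_le hC
  have hα1 : 0 < 2 * (α + 1) := by linarith
  set ρ : ℕ → ℝ := fun n => ((n : ℝ) / Real.log n) ^ (1 / (2 * (α + 1))) with hρ
  have hρlim : Tendsto ρ atTop atTop :=
    (tendsto_rpow_atTop (one_div_pos.2 hα1)).comp tendsto_div_log
  choose B hB using fun k => (hJ k).1.exists_pos
  choose A hA using fun k => (hJ k).2.exists_pos
  set b := B 0 + B 1 with hb
  set a := A 0 + A 1 with ha
  have hb0 : 0 < b := add_pos (hB 0).1 (hB 1).1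
  have ha0 : 0 < a := add_pos (hA 0).1 (hA 1).1
  have hBb : ∀ k, B k ≤ b := fun k => by
    fin_cases k
    · exact le_add_of_nonneg_right (hB 1).1.le
    · exact le_add_of_nonneg_left (hB 0).1.le
  have hAa : ∀ k, A k ≤ a := fun k => by
    fin_cases k
    · exact le_add_of_nonneg_right (hA 1).1.le
    · exact le_add_of_nonneg_left (hA 0).1.le
  have hJb : ∀ᶠ n in atTop, ∀ k, ((S n).J k : ℝ) ≤ b * ρ n := by
    rw [eventually_all]
    intro k
    filter_upwards [(hB k).2.bound, hρlim.eventually_gt_atTop 0] with n h1 h2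
    rw [Real.norm_of_nonneg (Nat.cast_nonneg _), Real.norm_of_nonneg h2.le] at h1
    exact h1.trans (mul_le_mul_of_nonneg_right (hBb k) h2.le)
  have hJa : ∀ᶠ n in atTop, ∀ k, ρ n ≤ a * (S n).J k := by
    rw [eventually_all]
    intro k
    filter_upwards [(hA k).2.bound, hρlim.eventually_gt_atTop 0] with n h1 h2
    rw [Real.norm_of_nonneg (Nat.cast_nonneg _), Real.norm_of_nonneg h2.le] at h1
    exact h1.trans (mul_le_mul_of_nonneg_right (hAa k) (Nat.cast_nonneg _))
  -- the mesh width, and the quantities it determines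
  set c : ℝ := 1 / (C * b) with hc
  have hc0 : 0 < c := by positivity
  set w : ℕ → ℝ := fun n => c / ρ n with hw
  set Q : ℝ := q 0 + q 1 with hQ
  have hqQ : ∀ k, (q k : ℝ) ≤ Q := fun k => by
    fin_cases k
    · exact le_add_of_nonneg_right (Nat.cast_nonneg _)
    · exact le_add_of_nonneg_left (Nat.cast_nonneg _)
  have hQ0 : 0 < Q := lt_of_lt_of_le (by linarith) ((hq 0).trans (hqQ 0))
  have hq4 : ∀ k, 4 ≤ q k := fun k => by
    have := hα.trans (hq k)
    exact_mod_cast this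
  set κ : ℝ := C * Q * a / c with hκ
  have hκ0 : 0 < κ := by positivity
  set D : ℝ := b * c + a / c + c ^ (-(2 * α + 2)) + c ^ (α - 2) with hD
  have hD1 : 0 < c ^ (-(2 * α + 2)) := Real.rpow_pos_of_pos hc0 _
  have hD2 : 0 < c ^ (α - 2) := Real.rpow_pos_of_pos hc0 _
  have hD3 : 0 < b * c := by positivity
  have hD4 : 0 < a / c := by positivity
  have hlogn : Tendsto (fun n : ℕ => Real.log n) atTop atTop :=
    Real.tendsto_log_atTop.comp tendsto_natCast_atTop_atTop
  have hwpos : ∀ᶠ n in atTop, 0 < w n := by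
    filter_upwards [hρlim.eventually_gt_atTop 0] with n hn
    exact div_pos hc0 hn
  have hw1 : ∀ᶠ n in atTop, w n ≤ 1 := by
    filter_upwards [hρlim.eventually_ge_atTop c, hρlim.eventually_gt_atTop 0] with n h1 h2
    exact (div_le_one h2).2 h1
  have hu : ∀ᶠ n : ℕ in atTop, 0 < (n : ℝ) / Real.log n := tendsto_div_log.eventually_gt_atTop 0
  have hpow : ∀ᶠ n : ℕ in atTop, n * w n ^ (2 * α + 2) = c ^ (2 * α + 2) * Real.log n := by
    filter_upwards [hu, hρlim.eventually_gt_atTop 0, hlogn.eventually_gt_atTop 0] with n h1 h2 h3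
    rw [hw, Real.div_rpow hc0.le h2.le]
    have : ρ n ^ (2 * α + 2) = n / Real.log n := by
      rw [hρ, ← Real.rpow_mul h1.le, show 1 / (2 * (α + 1)) * (2 * α + 2) = 1 by
        field_simp, Real.rpow_one]
    have hn : (n : ℝ) ≠ 0 := by
      rintro h0
      rw [h0, zero_div] at h1
      exact lt_irrefl _ h1
    rw [this]
    field_simp
  have hlow : ∀ s : ℝ, s ≤ 2 * α + 2 → ∀ᶠ n : ℕ in atTop,
      c ^ (2 * α + 2) * Real.log n ≤ n * w n ^ s := by
    intro s hs
    filter_upwards [hpow, hwpos, hw1] with n h1 h2 h3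
    rw [← h1]
    exact mul_le_mul_of_nonneg_left (Real.rpow_le_rpow_of_exponent_ge h2 h3 hs)
      (Nat.cast_nonneg _)
  have hclog : Tendsto (fun n : ℕ => c ^ (2 * α + 2) * Real.log n) atTop atTop :=
    hlogn.const_mul_atTop (Real.rpow_pos_of_pos hc0 _)
  refine ⟨w, κ, D, hκ0, by positivity, ⟨?_, hw1, ?_, ?_, ?_, ?_, ?_, ?_⟩⟩
  · filter_upwards [hJa, hJb, hρlim.eventually_gt_atTop 0, hwpos] with n h1 h2 h3 h4
    have hNJ : ∀ k, ((S n).N k + 1 : ℝ) ≤ (S n).J k := fun k => by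
      have := hq4 k
      have h5 : (S n).N k + 1 ≤ (S n).J k := by rw [SplineSpace.J, hSq]; omega
      exact_mod_cast h5
    have hJN : ∀ k, ((S n).J k : ℝ) ≤ Q * ((S n).N k + 1) := fun k => by
      have := hqQ k
      have h6 : (4 : ℝ) ≤ q k := by exact_mod_cast hq4 k
      rw [SplineSpace.J, hSq]
      push_cast
      have h7 : (0 : ℝ) ≤ (S n).N k := Nat.cast_nonneg _
      nlinarith
    have hspace : ∀ k l, l ≤ (S n).N k → w n ≤ (S n).t k (l + 1) - (S n).t k l ∧
        (S n).t k (l + 1) - (S n).t k l ≤ κ * w n := by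
      intro k l hl
      obtain ⟨g1, g2⟩ := (hknots n k).spacing hl
      have g3 := (hknots n k).lt_succ l hl
      set s := (S n).t k (l + 1) - (S n).t k l with hs
      have hs0 : 0 < s := by rw [hs]; linarith
      have hN0 : (0 : ℝ) < (S n).N k + 1 := by positivity
      constructor
      · have g4 : 1 ≤ C * (b * ρ n * s) := g1.trans (by
          have := (hNJ k).trans (h2 k)
          gcongr)
        have e1 : w n = 1 / (C * b * ρ n) := by
          simp only [hw, hc]; field_simp
        rw [e1, div_le_iff₀ (by positivity)]
        linarith
      · have e1 : κ * w n = C * Q * a / ρ n := by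
          simp only [hw, hκ]; field_simp
        rw [e1, le_div_iff₀ h3]
        calc s * ρ n ≤ s * (a * (Q * ((S n).N k + 1))) := by
              have := (h1 k).trans (mul_le_mul_of_nonneg_left (hJN k) ha0.le)
              gcongr
          _ = Q * a * (((S n).N k + 1) * s) := by ring
          _ ≤ Q * a * C := by gcongr
          _ = _ := by ring
    refine ⟨fun k => by rw [hSq]; exact hq4 k, fun k => (hknots n k).isKnotSeq _, h4,
      fun k m g1 g2 => ?_, fun k m => ?_⟩
    · simp only [SplineSpace.knot, extKnots]
      rw [min_eq_left (by omega), min_eq_left (by omega),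
        show m + 1 - ((S n).q k - 1) = m - ((S n).q k - 1) + 1 by omega]
      exact (hspace k _ (by omega)).1
    · have hnn : 0 ≤ κ * w n := by positivity
      simp only [SplineSpace.knot, extKnots]
      by_cases hm : m < (S n).q k - 1
      · rw [show m + 1 - ((S n).q k - 1) = 0 by omega, show m - ((S n).q k - 1) = 0 by omega,
          sub_self]
        exact hnn
      by_cases hm' : m - ((S n).q k - 1) ≤ (S n).N k
      · rw [min_eq_left (by omega), min_eq_left (by omega),
          show m + 1 - ((S n).q k - 1) = m - ((S n).q k - 1) + 1 by omega]
        exact (hspace k _ hm').2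
      · rw [min_eq_right (by omega), min_eq_right (by omega), sub_self]
        exact hnn
  · filter_upwards [hJb, hρlim.eventually_gt_atTop 0, hwpos] with n h1 h2 h3 k
    have : ((S n).J k : ℝ) * w n ≤ b * c := by
      refine (mul_le_mul_of_nonneg_right (h1 k) h3.le).trans (le_of_eq ?_)
      simp only [hw]; field_simp
    linarith
  · filter_upwards [hJa, hρlim.eventually_gt_atTop 0, hwpos] with n h1 h2 h3 k
    have e1 : (1 : ℝ) ≤ a / c * ((S n).J k * w n) := by
      have : a / c * ((S n).J k * w n) = a * (S n).J k / ρ n := by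
        simp only [hw]; field_simp
      rw [this, le_div_iff₀ h2, one_mul]
      exact h1 k
    refine e1.trans (mul_le_mul_of_nonneg_right (by linarith) (by positivity))
  · refine tendsto_atTop_mono' _ ?_ hclog
    filter_upwards [hlow 4 (by linarith)] with n hn
    exact_mod_cast hn
  · filter_upwards [hlow (α + 3) (by linarith), hclog.eventually_ge_atTop 1, hwpos] with n h1 h2 h3
    refine h2.trans (h1.trans (le_of_eq ?_))
    rw [Real.rpow_add h3, show (3 : ℝ) = (3 : ℕ) by norm_num, Real.rpow_natCast]
    ring
  · filter_upwards [hpow, hlogn.eventually_ge_atTop 0] with n h1 h2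
    rw [h1, ← mul_assoc]
    have h3 : 1 ≤ D * c ^ (2 * α + 2) := by
      have : c ^ (-(2 * α + 2)) * c ^ (2 * α + 2) = 1 := by
        rw [← Real.rpow_add hc0, neg_add_cancel, Real.rpow_zero]
      rw [← this]
      exact mul_le_mul_of_nonneg_right (by linarith) (Real.rpow_nonneg hc0.le _)
    nlinarith
  · filter_upwards [hu, hρlim.eventually_gt_atTop 0] with n h1 h2
    have e1 : w n ^ (α - 2) = c ^ (α - 2) * rate α n := by
      rw [hw, Real.div_rpow hc0.le h2.le, div_eq_mul_inv, ← Real.rpow_neg h2.le, hρ,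
        ← Real.rpow_mul h1.le, rate]
      congr 2
      field_simp
      ring
    rw [e1]
    exact mul_le_mul_of_nonneg_right (by linarith) (Real.rpow_nonneg h1.le _)

end Scale

/-! ### Concentration of the posterior -/

section Concentration

theorem IsC2Close.trans {f g h : Plane → ℝ} {a b c : ℝ} (h1 : IsC2Close f g a)
    (h2 : IsC2Close g h b) (hc : a + b ≤ c) : IsC2Close f h c := fun x hx =>
  ⟨fun i => (abs_sub_le _ _ _).trans ((add_le_add ((h1 x hx).1 i) ((h2 x hx).1 i)).trans hc),
    fun i j => (abs_sub_le _ _ _).trans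
      ((add_le_add ((h1 x hx).2 i j) ((h2 x hx).2 i j)).trans hc)⟩

/-- Splines with close coefficients are close together with their derivatives. -/
theorem SplineSpace.exists_isC2Close (q : Fin 2 → ℕ) : ∃ K : ℝ, 0 < K ∧
    ∀ (S : SplineSpace) (w κ : ℝ), S.q = q → S.IsMesh w κ → w ≤ 1 →
    ∀ (θ ζ : EuclideanSpace ℝ S.Idx) (A : ℝ), 0 ≤ A → (∀ j, |θ j - ζ j| ≤ A) →
      IsC2Close (S.fn θ) (S.fn ζ) (K * (w ^ 2)⁻¹ * A) := by
  obtain ⟨K, hK, h⟩ := exists_abs_fnDeriv_le q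
  refine ⟨K, hK, fun S w κ hq hS hw θ ζ A hA hθ x hx => ?_⟩
  obtain ⟨μ, hμ, hxμ, -⟩ := hS.exists_cell hx
  have key : ∀ r s : ℕ, r + s ≤ 2 →
      |S.fnDeriv r s θ x - S.fnDeriv r s ζ x| ≤ K * (w ^ 2)⁻¹ * A := fun r s hrs => by
    rw [← fnDeriv_sub]
    exact (h S w κ hq hS hw μ hμ x hxμ r s hrs _ A hA fun j _ => hθ j).1
  obtain ⟨a1, a2, a3, a4, a5, a6⟩ := hS.pderiv_fn θ hx
  obtain ⟨b1, b2, b3, b4, b5, b6⟩ := hS.pderiv_fn ζ hx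
  constructor
  · intro i
    fin_cases i
    · simp only [Fin.zero_eta]; rw [a1, b1]; exact key 1 0 (by norm_num)
    · simp only [Fin.mk_one]; rw [a2, b2]; exact key 0 1 (by norm_num)
  · intro i j
    fin_cases i <;> fin_cases j <;> simp only [Fin.zero_eta, Fin.mk_one]
    · rw [a3, b3]; exact key 2 0 (by norm_num)
    · rw [a4, b4]; exact key 1 1 (by norm_num)
    · rw [a5, b5]; exact key 1 1 (by norm_num)
    · rw [a6, b6]; exact key 0 2 (by norm_num)

variable {f : Plane → ℝ} {α : ℝ} {q : Fin 2 → ℕ} {S : ℕ → SplineSpace} {w : ℕ → ℝ} {κ D : ℝ}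

/-- Coefficient vectors within `O(w ^ α)` of those of a good approximation have a filament close to
that of the true function. -/
theorem exists_hausdorffEDist_le_of_coefficients (hα : 4 ≤ α) (hSq : ∀ n, (S n).q = q)
    (hD : 0 < D) (hscale : IsScale α S w κ D) {Cf : ℝ} (hCf : 0 < Cf)
    (hstab : ∀ᶠ ε in 𝓝[>] (0 : ℝ), ∀ g : Plane → ℝ, IsRegular g → IsC2Close g f ε →
      Metric.hausdorffEDist (filament g) (filament f) ≤ ENNReal.ofReal (Cf * ε))
    {ζ : (n : ℕ) → (S n).Idx → ℝ} {K : ℝ} (hK : 0 < K)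
    (hζ : ∀ᶠ n in atTop, IsC2Close ((S n).fnDeriv 0 0 (ζ n)) f (K * w n ^ (α - 2))) {A : ℝ}
    (hA : 0 < A) : ∃ C > 0, ∀ᶠ n in atTop, ∀ θ : EuclideanSpace ℝ (S n).Idx,
      (∀ j, |θ j - ζ n j| ≤ A * w n ^ α) →
      Metric.hausdorffEDist (filament ((S n).fn θ)) (filament f) ≤
        ENNReal.ofReal (C * rate α n) := by
  obtain ⟨K', hK', hclose⟩ := SplineSpace.exists_isC2Close q
  set E : ℝ := (K' * A + K) * D with hE
  have hE0 : 0 < E := by positivity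
  have hlim : Tendsto (fun n => E * rate α n) atTop (𝓝[>] 0) := by
    have h := tendsto_nhdsWithin_iff.1 (tendsto_rate hα)
    refine tendsto_nhdsWithin_iff.2 ⟨by simpa using h.1.const_mul E, ?_⟩
    filter_upwards [h.2] with n hn
    exact mul_pos hE0 hn
  refine ⟨Cf * E, by positivity, ?_⟩
  filter_upwards [hlim.eventually hstab, hscale.mesh, hscale.le_one, hscale.le_rate, hζ]
    with n h1 h2 h3 h4 h5 θ hθ
  have hw := h2.pos
  have h6 := hclose (S n) (w n) κ (hSq n) h2 h3 θ (WithLp.toLp 2 (ζ n)) (A * w n ^ α)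
    (by positivity) hθ
  have h7 : IsC2Close ((S n).fn θ) f (E * rate α n) := by
    refine h6.trans h5 ?_
    have e1 : K' * (w n ^ 2)⁻¹ * (A * w n ^ α) = K' * A * w n ^ (α - 2) := by
      rw [Real.rpow_sub hw, Real.rpow_two]; ring
    rw [e1, ← add_mul, hE, mul_assoc]
    exact mul_le_mul_of_nonneg_left h4 (by positivity)
  rw [mul_assoc]
  exact h1 _ (h2.isRegular_fn θ) h7

variable {Ω : Type*} [MeasurableSpace Ω] {P : Measure Ω} [IsProbabilityMeasure P]

theorem measurable_and_indepFun_of_design {ν : Measure Plane}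
    {X : (n : ℕ) → Fin n → Ω → Plane} {ε : (n : ℕ) → Fin n → Ω → ℝ}
    (hX : IsFixedDesign ν S X ∨ IsRandomDesign P ν X ε) (n : ℕ) : (∀ i, Measurable (X n i)) ∧
      IndepFun (fun ω i => X n i ω) (fun ω i => ε n i ω) P := by
  rcases hX with ⟨x, hx, -, -⟩ | h
  · have e1 : ∀ i, X n i = fun _ => x n i := fun i => funext fun ω => hx n i ω
    refine ⟨fun i => by rw [e1]; exact measurable_const, ?_⟩
    have e2 : (fun ω i => X n i ω) = fun _ : Ω => x n := funext fun ω => funext fun i => hx n i ω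
    rw [e2]
    exact indepFun_const_left _ _
  · exact ⟨fun i => ((h n).1 i).1, (h n).2.2⟩

open Classical in
/-- The value of `σ̂²` is at most the mean square of the residuals of the prior mean. -/
theorem sigmaHatSq_bound {S : SplineSpace} {Λ : Matrix S.Idx S.Idx ℝ} (hΛ : Λ.PosSemidef)
    (θ₀ : S.Idx → ℝ) {n : ℕ} (X : Fin n → Plane) (Y : Fin n → ℝ) :
    0 ≤ sigmaHatSq S θ₀ Λ X Y ∧
      sigmaHatSq S θ₀ Λ X Y ≤ (n : ℝ)⁻¹ * ∑ i, (Y i - (S.design X).mulVec θ₀ i) ^ 2 := by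
  have h := quadratic_form_inv_bound (B := S.design X) hΛ (Y - (S.design X).mulVec θ₀)
  have hn : (0 : ℝ) ≤ (n : ℝ)⁻¹ := by positivity
  exact ⟨mul_nonneg hn h.1, mul_le_mul_of_nonneg_left h.2 hn⟩

instance (S : SplineSpace) (θ₀ : S.Idx → ℝ) (Λ₀ : Matrix S.Idx S.Idx ℝ) {n : ℕ}
    (X : Fin n → Plane) (Y : Fin n → ℝ) : IsProbabilityMeasure (posterior S θ₀ Λ₀ X Y) := by
  unfold posterior
  infer_instance

/-- Deviations of a draw from the posterior from the posterior mean. -/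
theorem posterior_exists_le {S : SplineSpace} {Λ : Matrix S.Idx S.Idx ℝ} (hΛ : Λ.PosSemidef)
    (θ₀ : S.Idx → ℝ) {n : ℕ} {X : Fin n → Plane} {act : Fin n → S.Idx → Prop} {m C : ℝ}
    (h : IsStableDesign (S.design X) act m C) (Y : Fin n → ℝ) {s : ℝ}
    (hs : sigmaHatSq S θ₀ Λ X Y ≤ s) {v : ℝ≥0} (hv : s * (2 * C ^ 2 / m) ≤ v) {t : ℝ}
    (ht : 0 ≤ t) :
    posterior S θ₀ Λ X Y {θ | ∃ j, t ≤ |θ j - postMean S θ₀ Λ X Y j|} ≤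
      ENNReal.ofReal (Fintype.card S.Idx * (2 * Real.exp (-t ^ 2 / (2 * v)))) := by
  have hσ := (sigmaHatSq_bound hΛ θ₀ X Y).1
  have hΓ : (postCov S Λ X).PosSemidef := posSemidef_postCov hΛ
  refine multivariateGaussian_exists_le _ (hΓ.smul hσ) (fun j => ?_) ht
  rw [Matrix.smul_apply, smul_eq_mul]
  exact (mul_le_mul hs (h.noise_bound hΛ j).2 hΓ.diag_nonneg (hσ.trans hs)).trans hv

/-- With `t` a large multiple of `w ^ α`, Gaussian tails with the variance of the coefficients are
so small that they can be summed over all coefficients. -/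
theorem IsScale.eventually_tail_le (hD : 0 < D) (hscale : IsScale α S w κ D) {b : ℝ}
    (hb : 0 ≤ b) : ∀ᶠ n : ℕ in atTop, ∀ v : ℝ≥0, 0 < v → 2 * (v : ℝ) ≤ b / (n * w n ^ 2) →
      Fintype.card (S n).Idx * (2 * Real.exp (-((√(2 * D * b) + 1) * w n ^ α) ^ 2 / (2 * v))) ≤
        2 * D ^ 2 / (n * w n ^ 4) := by
  set A₀ : ℝ := √(2 * D * b) + 1 with hA₀
  filter_upwards [hscale.mesh, eventually_gt_atTop 0, hscale.J_le, hscale.log_le, hscale.le_one]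
    with n hmesh hn h2 h3 h4 v hv0 hv
  have hw := hmesh.pos
  have hn1 : (1 : ℝ) ≤ n := by exact_mod_cast hn
  replace hn : (0 : ℝ) < n := by linarith
  have hv0' : (0 : ℝ) < v := hv0
  have hexp : Real.exp (-(A₀ * w n ^ α) ^ 2 / (2 * v)) ≤ ((n : ℝ) ^ 2)⁻¹ := by
    have e0 : ((n : ℝ) ^ 2)⁻¹ = Real.exp (-(Real.log n * 2)) := by
      rw [Real.exp_neg, mul_two, Real.exp_add, Real.exp_log hn, sq]
    rw [e0]
    refine Real.exp_le_exp.2 ?_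
    rw [neg_div]
    have hA2 : 2 * D * b ≤ A₀ ^ 2 := by
      have hb0 : 0 ≤ 2 * D * b := by positivity
      have := Real.sq_sqrt hb0
      rw [hA₀]
      nlinarith [Real.sqrt_nonneg (2 * D * b)]
    have e1 : (A₀ * w n ^ α) ^ 2 * (n * w n ^ 2) = A₀ ^ 2 * (n * w n ^ (2 * α + 2)) := by
      rw [Real.rpow_add hw, Real.rpow_two, mul_comm 2 α, Real.rpow_mul hw.le, Real.rpow_two]
      ring
    have hq0 : 0 ≤ (n * w n ^ (2 * α + 2) : ℝ) := by positivity
    have h5 : Real.log n * 2 ≤ (A₀ * w n ^ α) ^ 2 / (2 * v) := by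
      rw [le_div_iff₀ (by positivity)]
      have hl : 0 ≤ Real.log n := Real.log_nonneg hn1
      have hm0 : 0 < n * w n ^ 2 := by positivity
      refine le_of_mul_le_mul_right ?_ hm0
      rw [e1]
      rw [le_div_iff₀ hm0] at hv
      calc Real.log n * 2 * (2 * v) * (n * w n ^ 2)
          = Real.log n * 2 * (2 * v * (n * w n ^ 2)) := by ring
        _ ≤ Real.log n * 2 * b := by gcongr
        _ ≤ D * (n * w n ^ (2 * α + 2)) * 2 * b := by gcongr
        _ = 2 * D * b * (n * w n ^ (2 * α + 2)) := by ring
        _ ≤ A₀ ^ 2 * (n * w n ^ (2 * α + 2)) := by gcongr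
    linarith
  have hcd : (Fintype.card (S n).Idx : ℝ) ≤ (D / w n) ^ 2 := by
    have h3 : ∀ k, ((S n).J k : ℝ) ≤ D / w n := fun k => (le_div_iff₀ hw).2 (h2 k)
    rw [Fintype.card_prod, Fintype.card_fin, Fintype.card_fin, sq]
    push_cast
    exact mul_le_mul (h3 0) (h3 1) (Nat.cast_nonneg _) (by positivity)
  calc Fintype.card (S n).Idx * (2 * Real.exp (-(A₀ * w n ^ α) ^ 2 / (2 * v)))
      ≤ (D / w n) ^ 2 * (2 * ((n : ℝ) ^ 2)⁻¹) := by gcongr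
    _ = 2 * D ^ 2 / (n * (n * w n ^ 2)) := by field_simp
    _ ≤ 2 * D ^ 2 / (n * w n ^ 4) := by
        refine div_le_div_of_nonneg_left (by positivity) (by positivity) ?_
        have h6 : w n ^ 2 ≤ 1 := pow_le_one₀ hw.le h4
        have h7 : w n ^ 4 ≤ n * w n ^ 2 := by
          have : w n ^ 4 = w n ^ 2 * w n ^ 2 := by ring
          rw [this]
          exact mul_le_mul_of_nonneg_right (h6.trans hn1) (sq_nonneg _)
        gcongr

/-- With high probability the posterior mean is within `O(w ^ α)` of the coefficients of a good
approximation, and so is a draw from the posterior. On the event `G n` the design is regular, the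
mean square of the errors is bounded, and the noise in the posterior mean is small; `τ n` bounds the
posterior probability of a large deviation on this event. -/
theorem exists_concentration (hα : 4 ≤ α) (hf : IsHolder α f) (hq : ∀ k, α ≤ q k)
    (hSq : ∀ n, (S n).q = q) (hκ : 0 < κ) (hD : 0 < D) (hscale : IsScale α S w κ D)
    {θ₀ : (n : ℕ) → (S n).Idx → ℝ} {K : ℝ} (hθ₀ : ∀ n j, |θ₀ n j| ≤ K)
    {Λ₀ : (n : ℕ) → Matrix (S n).Idx (S n).Idx ℝ} {c₁ : ℝ} (hc₁ : 0 < c₁)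
    (hΛ : ∀ n, (Λ₀ n - c₁ • (1 : Matrix (S n).Idx (S n).Idx ℝ)).PosSemidef)
    {ν : Measure Plane} (hν : HasPositiveContinuousDensity ν) {X : (n : ℕ) → Fin n → Ω → Plane}
    {σ₀ : ℝ} {ε : (n : ℕ) → Fin n → Ω → ℝ} (hε : IsErrorArray P σ₀ ε)
    (hX : IsFixedDesign ν S X ∨ IsRandomDesign P ν X ε) :
    ∃ (ζ : (n : ℕ) → (S n).Idx → ℝ) (K' A : ℝ) (G : ℕ → Set Ω) (τ : ℕ → ℝ), 0 < K' ∧ 0 < A ∧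
      (∀ᶠ n in atTop, IsC2Close ((S n).fnDeriv 0 0 (ζ n)) f (K' * w n ^ (α - 2))) ∧
      Tendsto (fun n => P (G n)ᶜ) atTop (𝓝 0) ∧ Tendsto τ atTop (𝓝 0) ∧
      ∀ᶠ n in atTop, ∀ ω ∈ G n,
        (∀ j, |postMean (S n) (θ₀ n) (Λ₀ n) (fun i => X n i ω) (response f X ε n ω) j - ζ n j| ≤
          A * w n ^ α) ∧
        (posterior (S n) (θ₀ n) (Λ₀ n) (fun i => X n i ω) (response f X ε n ω)).real
          {θ | ¬ ∀ j, |θ j - ζ n j| ≤ A * w n ^ α} ≤ τ n := by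
  classical
  obtain ⟨R, hR, hstable⟩ := SplineSpace.exists_isStableDesign q hκ
  obtain ⟨C, hC, hreg⟩ := tendsto_measure_not_isRegularDesign (w := w) hν hκ hR hD hscale.mesh
    hscale.J_le hscale.le_J hscale.tendsto hX
  obtain ⟨C', d, hstable⟩ := hstable C hC
  obtain ⟨Km, hKm, hmean⟩ := exists_abs_posterior_mean_sub_le C' d hc₁
  obtain ⟨Ka, hKa, happ⟩ := SplineSpace.exists_approximation hα hf q hq hκ
  obtain ⟨Kf, hKf, hfb⟩ := hf.exists_bound
  obtain ⟨c, hc⟩ := hε.subgaussian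
  have happ' : ∀ n, ∃ θ : (S n).Idx → ℝ, ((S n).IsMesh (w n) κ ∧ w n ≤ 1) →
      (∀ j, |θ j| ≤ Ka) ∧ (∀ x ∈ unitSquare, |(S n).fnDeriv 0 0 θ x - f x| ≤ Ka * w n ^ α) ∧
        IsC2Close ((S n).fnDeriv 0 0 θ) f (Ka * w n ^ (α - 2)) := fun n => by
    by_cases h : (S n).IsMesh (w n) κ ∧ w n ≤ 1
    · obtain ⟨θ, hθ⟩ := happ (S n) (w n) (hSq n) h.1 h.2
      exact ⟨θ, fun _ => hθ⟩
    · exact ⟨0, fun h' => absurd h' h⟩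
  choose ζ hζ using happ'
  -- sub-Gaussian constants of the noise and of the posterior; `W` bounds the diagonal of the
  -- posterior covariance, up to the order of the number of data points per basis function
  set W : ℝ := 2 * C' ^ 2 + 1 with hW
  have hW0 : 0 < W := by positivity
  set s₀ : ℝ := 2 * (Kf + |K|) ^ 2 + 2 * (σ₀ ^ 2 + 1) with hs₀
  have hs₀0 : 0 < s₀ := by positivity
  set V : ℕ → ℝ≥0 := fun n => Real.toNNReal (W / (n * w n ^ 2)) with hV
  set U : ℕ → ℝ≥0 := fun n => Real.toNNReal (s₀ * (W / (n * w n ^ 2))) with hU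
  set b : ℝ := 2 * W * (s₀ + (c + 1)) with hb
  set A₀ : ℝ := √(2 * D * b) + 1 with hA₀
  have hA₀0 : 0 < A₀ := by positivity
  set A₁ : ℝ := Km * Ka + Km * D * (|K| + Ka + Ka) + A₀ with hA₁
  have hA₁0 : 0 < A₁ := by positivity
  set noise : (n : ℕ) → (S n).Idx → Fin n → (Fin n → Plane) → ℝ := fun n j i x =>
    ((S n).design x * postCov (S n) (Λ₀ n) x) i j with hnoise
  set G₁ : ℕ → Set Ω := fun n =>
    {ω | ¬ (S n).IsRegularDesign R (n * w n ^ 2) C (fun i => X n i ω)} with hG₁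
  set G₂ : ℕ → Set Ω := fun n => {ω | n * (σ₀ ^ 2 + 1) ≤ ∑ i, ε n i ω ^ 2} with hG₂
  set G₃ : ℕ → Set Ω := fun n => {ω | ∃ j, ∑ i, noise n j i (fun i => X n i ω) ^ 2 ≤ V n ∧
    A₀ * w n ^ α ≤ |∑ i, noise n j i (fun i => X n i ω) * ε n i ω|} with hG₃
  set τ : ℕ → ℝ := fun n => 2 * D ^ 2 / (n * w n ^ 4) with hτ
  have hτlim : Tendsto τ atTop (𝓝 0) := tendsto_const_div_of_atTop hscale.tendsto _
  have hbasic : ∀ᶠ n : ℕ in atTop, 0 < w n ∧ (0 : ℝ) < n ∧ (V n : ℝ) = W / (n * w n ^ 2) ∧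
      (U n : ℝ) = s₀ * (W / (n * w n ^ 2)) := by
    filter_upwards [hscale.mesh, eventually_gt_atTop 0] with n h1 h2
    have hw := h1.pos
    have hn : (0 : ℝ) < n := by exact_mod_cast h2
    exact ⟨hw, hn, Real.coe_toNNReal _ (by positivity), Real.coe_toNNReal _ (by positivity)⟩
  have hb0 : 0 ≤ b := by positivity
  have htail := hscale.eventually_tail_le hD hb0
  refine ⟨ζ, Ka, A₁ + A₀, fun n => (G₁ n ∪ (G₂ n ∪ G₃ n))ᶜ, τ, hKa, by positivity, ?_, ?_, hτlim,
    ?_⟩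
  · filter_upwards [hscale.mesh, hscale.le_one] with n h1 h2
    exact (hζ n ⟨h1, h2⟩).2.2
  · -- the exceptional events have small probability
    have h3 : Tendsto (fun n => P (G₃ n)) atTop (𝓝 0) := by
      refine tendsto_zero_of_eventually_le ?_ hτlim
      filter_upwards [htail, hbasic] with n h1 h2
      obtain ⟨hw, hn, hVn, -⟩ := h2
      obtain ⟨hXm, hXe⟩ := measurable_and_indepFun_of_design hX n
      refine (measure_exists_noise_le hXm (hε.measurable n) hXe (hε.indep n) (c := c + 1)
        (fun i => hasSubgaussianMGF_mono (hc n i) (by simp)) (g := noise n)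
        (fun j i => measurable_noise_coefficient (S n) (Λ₀ n) i j) (V n)
        (t := A₀ * w n ^ α) (by positivity)).trans (ENNReal.ofReal_le_ofReal ?_)
      have hV0 : 0 < V n := by
        have : (0 : ℝ) < V n := by rw [hVn]; positivity
        exact this
      refine h1 _ (by positivity) ?_
      push_cast
      rw [hVn, hb]
      rw [show 2 * (W / (n * w n ^ 2) * (c + 1)) = 2 * W * (c + 1) / (n * w n ^ 2) by ring]
      exact div_le_div_of_nonneg_right
        (mul_le_mul_of_nonneg_left (by linarith) (by positivity)) (by positivity)
    have hsum := (hreg.add (hε.tendsto_measure_sum_sq.add h3))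
    simp only [add_zero] at hsum
    refine tendsto_of_tendsto_of_tendsto_of_le_of_le tendsto_const_nhds hsum
      (fun _ => zero_le) fun n => ?_
    simp only [compl_compl]
    exact (measure_union_le _ _).trans (add_le_add le_rfl (measure_union_le _ _))
  · filter_upwards [htail, hbasic, hscale.mesh, hscale.le_one, hscale.J_le, hscale.one_le]
      with n htail hbasic hmesh hw1 hJ hone ω hω
    obtain ⟨hw, hn, hVn, hUn⟩ := hbasic
    obtain ⟨hω1, hω2, hω3⟩ : ω ∉ G₁ n ∧ ω ∉ G₂ n ∧ ω ∉ G₃ n := by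
      simpa [not_or] using hω
    have hω1 : (S n).IsRegularDesign R (n * w n ^ 2) C (fun i => X n i ω) := not_not.1 hω1
    have hω2 : ∑ i, ε n i ω ^ 2 < n * (σ₀ ^ 2 + 1) := not_le.1 hω2
    obtain ⟨hζb, hζf, -⟩ := hζ n ⟨hmesh, hw1⟩
    have hm0 : 0 < n * w n ^ 2 := by positivity
    have hwα : w n ^ α ≤ 1 := Real.rpow_le_one hw.le hw1 (by linarith)
    have hwα0 : 0 < w n ^ α := Real.rpow_pos_of_pos hw _
    have hΛn := posSemidef_of_sub_posSemidef hc₁ (hΛ n)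
    obtain ⟨act, l, hst, hact⟩ := hstable (S n) (w n) (hSq n) hmesh (fun i => X n i ω)
      (n * w n ^ 2) hm0 hω1
    have hnb := hst.noise_bound hΛn
    have hWle : 2 * C' ^ 2 / (n * w n ^ 2) ≤ W / (n * w n ^ 2) := by
      gcongr; rw [hW]; linarith
    -- the posterior mean: the approximation error is at most `Ka w ^ α`, the influence of the prior of
    -- the order `w⁻¹ / (n w²) ≤ w ^ α`, and the noise less than `A₀ w ^ α` off `G₃`
    have hmeanω : ∀ j, |postMean (S n) (θ₀ n) (Λ₀ n) (fun i => X n i ω) (response f X ε n ω) j -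
        ζ n j| ≤ A₁ * w n ^ α := fun j => by
      have hcard : ((S n).J 0 : ℝ) * (S n).J 1 ≤ (D / w n) ^ 2 := by
        have h3 : ∀ k, ((S n).J k : ℝ) ≤ D / w n := fun k => (le_div_iff₀ hw).2 (hJ k)
        rw [sq]
        exact mul_le_mul (h3 0) (h3 1) (Nat.cast_nonneg _) (by positivity)
      have h1 := hmean hst l hact (hΛ n) (θ₀ := θ₀ n) (θ := ζ n)
        (r := fun i => f (X n i ω) - (S n).fnDeriv 0 0 (ζ n) (X n i ω)) (e := fun i => ε n i ω)
        (R := Ka * w n ^ α) (L := |K| + Ka) (D := D / w n)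
        (fun i => by rw [abs_sub_comm]; exact hζf _ (hω1.mem i)) (by positivity)
        (fun j => (abs_sub _ _).trans (add_le_add ((hθ₀ n j).trans (le_abs_self K)) (hζb j)))
        (by positivity) hcard (by positivity) j
      have hdata : ((S n).design fun i => X n i ω).mulVec (ζ n) +
          (fun i => f (X n i ω) - (S n).fnDeriv 0 0 (ζ n) (X n i ω)) + (fun i => ε n i ω) =
          response f X ε n ω := by
        funext i
        have : ((S n).design fun i => X n i ω).mulVec (ζ n) i =
          (S n).fnDeriv 0 0 (ζ n) (X n i ω) := rfl
        simp only [Pi.add_apply, this, response]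
        ring
      rw [hdata] at h1
      have hnoise_le : |(((((S n).design fun i => X n i ω).transpose *
          (S n).design fun i => X n i ω) + (Λ₀ n)⁻¹)⁻¹.mulVec
          (((S n).design fun i => X n i ω).transpose.mulVec fun i => ε n i ω)) j| ≤
          A₀ * w n ^ α := by
        rw [noise_eq hΛn]
        by_contra hcon
        refine hω3 ⟨j, ?_, (not_le.1 hcon).le⟩
        rw [hVn]
        exact (hnb j).1.trans hWle
      refine h1.trans ((add_le_add le_rfl hnoise_le).trans ?_)
      have h4 : D / w n / (n * w n ^ 2) ≤ D * w n ^ α := by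
        rw [div_div, div_le_iff₀ (by positivity)]
        calc D = D * 1 := (mul_one D).symm
          _ ≤ D * (w n ^ α * (n * w n ^ 3)) := by gcongr
          _ = D * w n ^ α * (w n * (n * w n ^ 2)) := by ring
      calc Km * (Ka * w n ^ α) + Km * (D / w n) / (n * w n ^ 2) *
            (|K| + Ka + Ka * w n ^ α) + A₀ * w n ^ α
          = Km * (Ka * w n ^ α) + Km * (D / w n / (n * w n ^ 2)) *
            (|K| + Ka + Ka * w n ^ α) + A₀ * w n ^ α := by ring
        _ ≤ Km * (Ka * w n ^ α) + Km * (D * w n ^ α) * (|K| + Ka + Ka * 1) +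
            A₀ * w n ^ α := by gcongr
        _ = A₁ * w n ^ α := by rw [hA₁]; ring
    refine ⟨fun j => (hmeanω j).trans (by gcongr; linarith), ?_⟩
    -- a draw from the posterior: `σ̂²` is bounded off `G₂`, so the coordinates have variances of the
    -- order `1 / (n w²)`
    have hσ : sigmaHatSq (S n) (θ₀ n) (Λ₀ n) (fun i => X n i ω) (response f X ε n ω) ≤ s₀ := by
      refine (sigmaHatSq_bound hΛn _ _ _).2.trans ?_
      rw [inv_mul_le_iff₀ hn]
      have hprior : ∀ i, |((S n).design fun i => X n i ω).mulVec (θ₀ n) i| ≤ |K| := fun i => by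
        calc |((S n).design fun i => X n i ω).mulVec (θ₀ n) i|
            ≤ ∑ j, |((S n).design fun i => X n i ω) i j * θ₀ n j| :=
              Finset.abs_sum_le_sum_abs _ _
          _ ≤ ∑ j, ((S n).design fun i => X n i ω) i j * |K| :=
              Finset.sum_le_sum fun j _ => by
                rw [abs_mul, abs_of_nonneg (hst.nonneg i j)]
                exact mul_le_mul_of_nonneg_left ((hθ₀ n j).trans (le_abs_self K))
                  (hst.nonneg i j)
          _ = |K| := by rw [← Finset.sum_mul, hst.row_sum, one_mul]
      calc ∑ i, (response f X ε n ω i - ((S n).design fun i => X n i ω).mulVec (θ₀ n) i) ^ 2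
          ≤ ∑ i, (2 * (Kf + |K|) ^ 2 + 2 * ε n i ω ^ 2) := by
            refine Finset.sum_le_sum fun i _ => ?_
            have h1 : |f (X n i ω) - ((S n).design fun i => X n i ω).mulVec (θ₀ n) i| ≤
                Kf + |K| :=
              (abs_sub _ _).trans (add_le_add (hfb _ (hω1.mem i)) (hprior i))
            have h2 := sq_le_sq' (abs_le.1 h1).1 (abs_le.1 h1).2
            simp only [response]
            nlinarith [sq_nonneg (f (X n i ω) -
              ((S n).design fun i => X n i ω).mulVec (θ₀ n) i - ε n i ω)]
        _ = n * (2 * (Kf + |K|) ^ 2) + 2 * ∑ i, ε n i ω ^ 2 := by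
            rw [Finset.sum_add_distrib, Finset.mul_sum, Finset.sum_const, Finset.card_univ,
              Fintype.card_fin, nsmul_eq_mul]
        _ ≤ n * (2 * (Kf + |K|) ^ 2) + 2 * (n * (σ₀ ^ 2 + 1)) := by gcongr
        _ = n * s₀ := by rw [hs₀]; ring
    have hU0 : 0 < U n := by
      have : (0 : ℝ) < U n := by rw [hUn]; positivity
      exact this
    have hpost := posterior_exists_le hΛn (θ₀ n) hst (response f X ε n ω) hσ (v := U n)
      (by rw [hUn]; gcongr) (t := A₀ * w n ^ α) (by positivity)
    refine ENNReal.toReal_le_of_le_ofReal (by positivity) ((measure_mono fun θ hθ => ?_).trans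
      (hpost.trans (ENNReal.ofReal_le_ofReal (htail _ hU0 ?_))))
    · obtain ⟨j, hj⟩ := not_forall.1 hθ
      refine ⟨j, ?_⟩
      have := abs_sub_le (θ j)
        (postMean (S n) (θ₀ n) (Λ₀ n) (fun i => X n i ω) (response f X ε n ω) j) (ζ n j)
      have := hmeanω j
      linarith [not_le.1 hj]
    · rw [hUn, hb]
      rw [show 2 * (s₀ * (W / (n * w n ^ 2))) = 2 * W * s₀ / (n * w n ^ 2) by ring]
      have : (0 : ℝ) ≤ c := c.2
      exact div_le_div_of_nonneg_right
        (mul_le_mul_of_nonneg_left (by linarith) (by positivity)) (by positivity)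

end Concentration

end FilamentPosterior

end

theorem theorem5p8
    {Ω : Type*} [MeasurableSpace Ω] (P₀ : MeasureTheory.Measure Ω)
    [MeasureTheory.IsProbabilityMeasure P₀]
    -- the true function and its assumptions
    (α : ℝ) (hα : 4 ≤ α) (fstar : FilamentPosterior.Plane → ℝ)
    (hholder : FilamentPosterior.IsHolder α fstar)
    (δ η : ℝ) (hδ : 0 < δ) (hη : 0 < η)
    (V : FilamentPosterior.Plane → FilamentPosterior.Plane)
    (hV : FilamentPosterior.IsEigenfield fstar (FilamentPosterior.filamentNhd fstar δ) V)
    (a : ℝ) (Υ : FilamentPosterior.Plane → ℝ → FilamentPosterior.Plane)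
    (T : FilamentPosterior.Plane → ℝ)
    (hcurves : FilamentPosterior.IsCurveSystem fstar V a Υ T)
    (hsep : FilamentPosterior.HasSeparatedEigenvalues fstar δ η)
    (htrans : FilamentPosterior.IsTransversal fstar V δ η)
    (hcompact : FilamentPosterior.IsCompactHittingSet fstar a Υ T)
    (hchord : FilamentPosterior.HasChordBound fstar a Υ T)
    (hnondeg : FilamentPosterior.IsNondegenerate fstar)
    -- the spline spaces: fixed orders at least `α`, quasi-uniform knots
    (q : Fin 2 → ℕ) (hq : ∀ k, α ≤ q k)
    (S : ℕ → FilamentPosterior.SplineSpace) (hSq : ∀ n, (S n).q = q)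
    (Cknot : ℝ) (hknots : ∀ n k, FilamentPosterior.IsKnots ((S n).N k) ((S n).t k) Cknot)
    (hJ : ∀ k, (fun n => ((S n).J k : ℝ)) =Θ[Filter.atTop]
      (fun n : ℕ => ((n : ℝ) / Real.log n) ^ (1 / (2 * (α + 1)))))
    -- the prior
    (θ₀ : (n : ℕ) → (S n).Idx → ℝ) (K : ℝ) (hθ₀ : ∀ n j, |θ₀ n j| ≤ K)
    (Λ₀ : (n : ℕ) → Matrix (S n).Idx (S n).Idx ℝ)
    (c₁ c₂ : ℝ) (hc₁ : 0 < c₁)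
    (hΛ₁ : ∀ n, (Λ₀ n - c₁ • (1 : Matrix (S n).Idx (S n).Idx ℝ)).PosSemidef)
    (hΛ₂ : ∀ n, (c₂ • (1 : Matrix (S n).Idx (S n).Idx ℝ) - Λ₀ n).PosSemidef)
    -- the data
    (μ : MeasureTheory.Measure FilamentPosterior.Plane)
    (hμ : FilamentPosterior.HasPositiveContinuousDensity μ)
    (X : (n : ℕ) → Fin n → Ω → FilamentPosterior.Plane)
    (σ₀ : ℝ) (ε : (n : ℕ) → Fin n → Ω → ℝ)
    (hε : FilamentPosterior.IsErrorArray P₀ σ₀ ε)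
    (hX : FilamentPosterior.IsFixedDesign μ S X ∨ FilamentPosterior.IsRandomDesign P₀ μ X ε) :
    -- posterior contraction around the true filament
    (∀ M : ℕ → ℝ, Filter.Tendsto M Filter.atTop Filter.atTop →
      MeasureTheory.TendstoInMeasure P₀
        (fun n ω => (FilamentPosterior.posterior (S n) (θ₀ n) (Λ₀ n) (fun i => X n i ω)
            (FilamentPosterior.response fstar X ε n ω)).real
          {θ | ENNReal.ofReal (M n * FilamentPosterior.rate α n) <
            Metric.hausdorffEDist (FilamentPosterior.filament ((S n).fn θ))
              (FilamentPosterior.filament fstar)})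
        Filter.atTop (fun _ => 0)) ∧
    -- posterior contraction around the filament of the posterior mean
    (∀ M : ℕ → ℝ, Filter.Tendsto M Filter.atTop Filter.atTop →
      MeasureTheory.TendstoInMeasure P₀
        (fun n ω => (FilamentPosterior.posterior (S n) (θ₀ n) (Λ₀ n) (fun i => X n i ω)
            (FilamentPosterior.response fstar X ε n ω)).real
          {θ | ENNReal.ofReal (M n * FilamentPosterior.rate α n) <
            Metric.hausdorffEDist (FilamentPosterior.filament ((S n).fn θ))
              (FilamentPosterior.filament (FilamentPosterior.postMeanFn (S n) (θ₀ n) (Λ₀ n)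
                (fun i => X n i ω) (FilamentPosterior.response fstar X ε n ω)))})
        Filter.atTop (fun _ => 0)) ∧
    -- convergence of the filament of the posterior mean
    (∃ C : ℝ, 0 < C ∧
      Filter.Tendsto
        (fun n => P₀ {ω | ENNReal.ofReal (C * FilamentPosterior.rate α n) <
          Metric.hausdorffEDist
            (FilamentPosterior.filament (FilamentPosterior.postMeanFn (S n) (θ₀ n) (Λ₀ n)
              (fun i => X n i ω) (FilamentPosterior.response fstar X ε n ω)))
            (FilamentPosterior.filament fstar)})
        Filter.atTop (nhds 0)) := by
  classical
  obtain ⟨w, κ, D, hκ, hD, hscale⟩ := FilamentPosterior.exists_isScale hα hq hSq hknots hJ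
  obtain ⟨Cf, hCf, hstab⟩ := FilamentPosterior.exists_hausdorffEDist_filament_le
    (FilamentPosterior.IsHolder.contDiffOn_three hα hholder) hδ hη hV hcurves hsep htrans
    hcompact.1 hnondeg
  obtain ⟨ζ, K', A, G, τ, hK', hA, hζ, hG, hτ, hconc⟩ :=
    FilamentPosterior.exists_concentration hα hholder hq hSq hκ hD hscale hθ₀ hc₁ hΛ₁ hμ hε hX
  obtain ⟨C, hC, hclose⟩ := FilamentPosterior.exists_hausdorffEDist_le_of_coefficients hα hSq hD
    hscale hCf hstab hK' hζ hA
  have hrate : ∀ᶠ n in Filter.atTop, 0 < FilamentPosterior.rate α n :=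
    (tendsto_nhdsWithin_iff.1 (FilamentPosterior.tendsto_rate hα)).2
  refine ⟨fun M hM => ?_, fun M hM => ?_, C, hC, ?_⟩
  · refine FilamentPosterior.tendstoInMeasure_zero_of_le hG hτ ?_
    filter_upwards [hconc, hclose, hM.eventually_ge_atTop C, hrate] with n h1 h2 h3 h4 ω hω
    rw [abs_of_nonneg MeasureTheory.measureReal_nonneg]
    refine le_trans (MeasureTheory.measureReal_mono ?_) (h1 ω hω).2
    intro θ hθ hθ'
    exact absurd ((h2 θ hθ').trans (ENNReal.ofReal_le_ofReal (by gcongr))) (not_le.2 hθ)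
  · refine FilamentPosterior.tendstoInMeasure_zero_of_le hG hτ ?_
    filter_upwards [hconc, hclose, hM.eventually_ge_atTop (C + C), hrate] with n h1 h2 h3 h4 ω hω
    rw [abs_of_nonneg MeasureTheory.measureReal_nonneg]
    refine le_trans (MeasureTheory.measureReal_mono ?_) (h1 ω hω).2
    intro θ hθ hθ'
    refine absurd (Metric.hausdorffEDist_triangle.trans ((add_le_add (h2 θ hθ')
      (Metric.hausdorffEDist_comm.trans_le (h2 _ (h1 ω hω).1))).trans ?_)) (not_le.2 hθ)
    rw [← ENNReal.ofReal_add (by positivity) (by positivity), ← add_mul]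
    exact ENNReal.ofReal_le_ofReal (by gcongr)
  · refine tendsto_of_tendsto_of_tendsto_of_le_of_le' tendsto_const_nhds hG
      (.of_forall fun _ => zero_le) ?_
    filter_upwards [hconc, hclose] with n h1 h2
    exact MeasureTheory.measure_mono fun ω hω hωG => not_le.2 hω (h2 _ (h1 ω hωG).1)
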